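/- **The polyhedral surface.** Let $e_1,e_2,e_3$ be the standard basis of $\mathbb{R}^3$ and let $\Lambda=\{8w : w\in\mathbb{Z}^3,\ w_1+w_2+w_3 \text{ even}\}$. Around every point $g\in\Lambda\cup(\Lambda+(4,4,4))$ put the regular octahedron with vertices $g\pm 3e_i$. Its faces are indexed by signs $s\in\{\pm1\}^3$ (corners $g+3s_ie_i$). Remove the four pairwise non-adjacent faces with $s_1s_2s_3=1$ if $g\in\Lambda$, and those with $s_1s_2s_3=-1$ if $g\in\Lambda+(4,4,4)$ (Type 2 octahedra). On every missing face attach the mirror image of the octahedron in that face, with this face and its opposite face removed (Type 1 octahedra); the opposite face is then a missing face of another Type 2 octahedron. Let $\Pi$ be the union of all remaining closed triangular faces. Let $X=\Pi/T$, where $T$ is the group of all translations mapping $\Pi$ to itself (faces to faces). Let the fundamental piece $X_0$ consist of the faces of the Type 2 octahedron at $0$, the four Type 1 octahedra attached to it, and the Type 2 octahedron at $(4,4,4)$. $X$ carries the triangulation induced by $\Pi$ and the conformal structure induced by its Euclidean cone metric, with the outward orientation. **The hyperbolic $16$-gon.** In the Poincaré disk consider the tessellation by equilateral triangles with angles $\left(\frac\pi4,\frac\pi4,\frac\pi4\right)$,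 eight at each vertex, having the center $0$ as a vertex. Let $v_0,\dots,v_7$ be the neighbours of $0$ in counterclockwise order (indices mod $8$), let $w_j$ be the mirror image of $0$ in the edge $v_jv_{j+1}$, and let $u_j$ be the vertex reached from $0$ by following the edge $0v_j$ straight on through $v_j$ along one more edge. Let $P$ be the geodesic $16$-gon with consecutive corners $u_0,w_0,u_1,w_1,\dots,u_7,w_7$, with sides $A_j=u_jw_j$ and $B_j=u_{j+1}w_j$. (It consists of $16$ triangles of the tessellation and $32$ halves of triangles.) A Petrie polygon is a piecewise geodesic joining midpoints of consecutive edges of a strip of triangles so that the clipped vertices lie alternately to the left and to the right. Let $\tau_j$ be the hyperbolic translation by six steps along the Petrie polygon through the midpoint of $0v_{j+1}$ and then the midpoint of $0v_{j+2}$. **Theorem.** 1. All triangles of the tessellation have all angles $\pi/4$, and the boundary of $P$ is the union of the sides $A_j,B_j$. 2. For every $j$, $\tau_j(A_j)=B_{j+2}$. There is a Petrie polygon on which $\tau_j$ acts as the shift by six steps and which meets $A_j$ in a point $z$ and $B_{j+2}$ in $\tau_j(z)$. 3. Let $Y$ be the quotient space of $P$ by the identifications $z\sim\tau_j(z)$,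 $z\in A_j$, with its induced hyperbolic triangulation and conformal structure. Then $Y$ has exactly $32$ triangles (halves cut off by paired sides being put together again), and there is a homeomorphism $\Phi:Y\to X$ that is conformal (biholomorphic) and maps the vertices, edges and faces of $Y$ onto those of $X$. 4. The $16$-gon represents the fundamental piece: under $\Phi$ the triangles of $Y$ correspond one-to-one to the triangular faces of $X_0$. That is, for every triangle $F$ of $Y$ there is exactly one face of $X_0$ whose image in $X$ is $\Phi(F)$, and conversely for every face of $X_0$ there is exactly one such triangle. -/

import Mathlib

namespace OctaSurface

/-! ### Holomorphic charts determined by a family of local parametrizations -/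

/-- Let `S` carry a family `𝓕` of local parametrizations `φ : U → S` by plane domains
(each pair is `(U, φ)`), any two of which differ by holomorphic maps and whose images cover `S` up to
a discrete set.  These are the charts of the resulting Riemann surface: the local homeomorphisms
`e : S → ℂ` which are holomorphic when read in the given parametrizations.  (At a point of the
exceptional discrete set, a chart is a homeomorphism that is holomorphic off that point; this is the
usual conformal structure of a cone metric.) -/
def holomorphicCharts {S : Type} [TopologicalSpace S] (𝓕 : Set (Set ℂ × (ℂ → S))) :
    Set (OpenPartialHomeomorph S ℂ) :=
  {e | ∀ P ∈ 𝓕, DifferentiableOn ℂ (fun z => e (P.2 z)) (P.1 ∩ P.2 ⁻¹' e.source)}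

/-- A homeomorphism is conformal (biholomorphic) if it matches the holomorphic charts. -/
def IsConformal {S T : Type} [TopologicalSpace S] [TopologicalSpace T]
    (𝓕 : Set (Set ℂ × (ℂ → S))) (𝓖 : Set (Set ℂ × (ℂ → T))) (Φ : S ≃ₜ T) : Prop :=
  ∀ e : OpenPartialHomeomorph T ℂ,
    e ∈ holomorphicCharts 𝓖 ↔ Φ.toOpenPartialHomeomorph.trans e ∈ holomorphicCharts 𝓕

/-! ### The polyhedral surface `Π` and its quotient `X` -/

/-- Euclidean space. -/
abbrev E3 : Type := EuclideanSpace ℝ (Fin 3)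

/-- An integer vector as a point of Euclidean space. -/
noncomputable def pt (v : Fin 3 → ℤ) : E3 := WithLp.toLp 2 fun i => (v i : ℝ)

/-- The regular octahedron with vertices `center ± axis i`; in all uses below the three axes are
pairwise orthogonal of length `3`. -/
structure Octahedron where
  center : Fin 3 → ℤ
  axis : Fin 3 → Fin 3 → ℤ

/-- The `i`-th corner of the face of an octahedron which corresponds to the signs `s`. -/
def Octahedron.corner (O : Octahedron) (s : Fin 3 → ℤˣ) (i : Fin 3) : Fin 3 → ℤ :=
  fun k => O.center k + (s i : ℤ) * O.axis i k

/-- `a`, `b`, `c` are the corners of the face with signs `s`, in counterclockwise order as seen from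
outside of the octahedron. -/
def Octahedron.IsFace (O : Octahedron) (s : Fin 3 → ℤˣ) (a b c : Fin 3 → ℤ) : Prop :=
  (∃ σ : Equiv.Perm (Fin 3),
    a = O.corner s (σ 0) ∧ b = O.corner s (σ 1) ∧ c = O.corner s (σ 2)) ∧
  0 < (Matrix.of ![a - O.center, b - O.center, c - O.center]).det

/-- The octahedron with vertices `c ± 3 eᵢ`. All Type 2 octahedra are of this shape. -/
def typeTwo (c : Fin 3 → ℤ) : Octahedron where
  center := c
  axis := fun i k => if k = i then 3 else 0

/-- The mirror image of `typeTwo c` in the plane of its face with signs `n`. It shares with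
`typeTwo c` the face with corners `c + 3 nᵢ eᵢ` (its own face with signs `1`), and it shares the
opposite face (signs `-1`) with the octahedron `typeTwo (c + 4 n)`. -/
def typeOne (c : Fin 3 → ℤ) (n : Fin 3 → ℤˣ) : Octahedron where
  center := fun k => c k + 2 * (n k : ℤ)
  axis := fun i k => (if k = i then 3 * (n i : ℤ) else 0) - 2 * (n k : ℤ)

/-- The (ordered, outward oriented) faces of one cell: a Type 2 octahedron around `g`, from which
the four pairwise non-adjacent faces with sign product `1` are removed; the four Type 1 octahedra
attached to it there, each without its two parallel gluing faces; and the Type 2 octahedron around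
`g + (4,4,4)`, attached to one of these, from which the four non-adjacent faces with sign product
`-1` are removed. -/
inductive IsCellFace (g : Fin 3 → ℤ) : (Fin 3 → ℤ) → (Fin 3 → ℤ) → (Fin 3 → ℤ) → Prop
  | typeTwo_even (s : Fin 3 → ℤˣ) (a b c : Fin 3 → ℤ) (hs : ∏ i, s i = -1)
      (h : (typeTwo g).IsFace s a b c) : IsCellFace g a b c
  | typeTwo_odd (s : Fin 3 → ℤˣ) (a b c : Fin 3 → ℤ) (hs : ∏ i, s i = 1)
      (h : (typeTwo (fun k => g k + 4)).IsFace s a b c) : IsCellFace g a b c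
  | typeOne (n s : Fin 3 → ℤˣ) (a b c : Fin 3 → ℤ) (hn : ∏ i, n i = 1)
      (hs : s ≠ 1) (hs' : s ≠ -1) (h : (typeOne g n).IsFace s a b c) : IsCellFace g a b c

/-- The positions of the cells: gluing Type 1 and Type 2 octahedra alternately, with a Type 1
octahedron on each missing face of a Type 2 octahedron and conversely, produces the Type 2
octahedra around these points and around their translates by `(4,4,4)`. -/
def IsCellPosition (g : Fin 3 → ℤ) : Prop :=
  ∃ w : Fin 3 → ℤ, Even (∑ i, w i) ∧ g = fun i => 8 * w i

/-- The oriented faces of the triply periodic polyhedral surface `Π`. -/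
def polyFaces : Set (E3 × E3 × E3) :=
  {t | ∃ g a b c, IsCellPosition g ∧ IsCellFace g a b c ∧ t = (pt a, pt b, pt c)}

/-- The oriented faces of the fundamental piece `X₀`: two Type 2 and four Type 1 octahedra. -/
def pieceFaces : Set (E3 × E3 × E3) :=
  {t | ∃ a b c, IsCellFace 0 a b c ∧ t = (pt a, pt b, pt c)}

/-- The closed triangle spanned by three points. -/
def solidTriangle (t : E3 × E3 × E3) : Set E3 := convexHull ℝ {t.1, t.2.1, t.2.2}

/-- The triply periodic polyhedral surface `Π`. -/
def polySurface : Set E3 := ⋃ t ∈ polyFaces, solidTriangle t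

/-- The group of all translations which map `Π` to itself (faces to faces). -/
def translations : AddSubgroup E3 where
  carrier := {v | ∀ a b c : E3, (a, b, c) ∈ polyFaces ↔ (a + v, b + v, c + v) ∈ polyFaces}
  zero_mem' := by
    intro a b c
    simp
  add_mem' := by
    intro v w hv hw a b c
    rw [hv a b c, hw (a + v) (b + v) (c + v)]
    simp only [add_assoc]
  neg_mem' := by
    intro v hv a b c
    have h := hv (a + -v) (b + -v) (c + -v)
    simp only [neg_add_cancel_right] at h
    exact h.symm

/-- Points of `Π` that differ by a translation symmetry of `Π`. -/
def translationSetoid : Setoid polySurface :=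
  Setoid.comap (Subtype.val : polySurface → E3) (QuotientAddGroup.leftRel translations)

/-- The surface `X = Π / translations`, with the quotient topology. -/
abbrev X : Type := Quotient translationSetoid

/-- The projection `Π → X`. -/
def projX (p : polySurface) : X := Quotient.mk translationSetoid p

/-- The image in `X` of (the part in `Π` of) a subset of space. -/
def imageX (A : Set E3) : Set X := projX '' (Subtype.val ⁻¹' A)

/-- The vertices of `X`. -/
def verticesX : Set X := imageX {a | ∃ b c, (a, b, c) ∈ polyFaces}

/-- The edges of `X`. -/
def edgesX : Set (Set X) :=
  {F | ∃ a b c, (a, b, c) ∈ polyFaces ∧ F = imageX (segment ℝ a b)}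

/-- The faces of `X`. -/
def facesX : Set (Set X) := {F | ∃ t ∈ polyFaces, F = imageX (solidTriangle t)}

/-- The sixth root of unity `exp (π i / 3)`. -/
noncomputable def omega : ℂ := Complex.exp (Real.pi / 3 * Complex.I)

/-- The open rhombus with corners `0`, `conj ω`, `1`, `ω`: two equilateral triangles of side `1`
joined along the segment `[0, 1]`. -/
noncomputable def rhombus : Set ℂ :=
  interior (convexHull ℝ {0, 1, omega, (starRingEnd ℂ) omega})

/-- The map from the rhombus onto the two triangles `abc` and `bad`: it is real affine on each of the
two halves of the rhombus and sends `0, 1, ω, conj ω` to `a, b, c, d`. Explicitly, with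
`x + y i = s + t ω`, it is `a + s (b - a) + t (c - a)` if `0 ≤ t`, and
`a + (s + t) (b - a) - t (d - a)` otherwise. -/
noncomputable def fold (a b c d : E3) (z : ℂ) : E3 :=
  let t : ℝ := 2 / Real.sqrt 3 * z.im
  let s : ℝ := z.re - t / 2
  if 0 ≤ t then a + s • (b - a) + t • (c - a) else a + (s + t) • (b - a) - t • (d - a)

/-- The flat parametrizations of `X` off the vertices (isometric up to the constant factor given by
the edge length): unfoldings of two adjacent faces `abc`, `bad` of `Π` into the plane. They are
compatible with the outward orientation of `Π`, and they define the conformal structure of `X`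
induced by its Euclidean cone metric. -/
def flatParams : Set (Set ℂ × (ℂ → X)) :=
  {P | P.1 = rhombus ∧ ∃ a b c d : E3, (a, b, c) ∈ polyFaces ∧ (b, a, d) ∈ polyFaces ∧
    ∀ z ∈ rhombus, ∃ h : fold a b c d z ∈ polySurface, P.2 z = projX ⟨fold a b c d z, h⟩}

/-! ### The hyperbolic disk and its tessellation by `(π/4, π/4, π/4)` triangles -/

/-- The isometry from the Poincaré disk model to the Klein disk model. -/
noncomputable def toKlein (z : ℂ) : ℂ := (2 / (1 + ‖z‖ ^ 2) : ℝ) • z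

/-- The hyperbolic convex hull of a set in the Poincaré disk (geodesics are straight in the Klein
model). -/
def hypHull (A : Set ℂ) : Set ℂ := {z | ‖z‖ < 1 ∧ toKlein z ∈ convexHull ℝ (toKlein '' A)}

/-- The geodesic segment between two points of the Poincaré disk. -/
def hypSegment (a b : ℂ) : Set ℂ := hypHull {a, b}

/-- The hyperbolic angle at `a` from the geodesic ray towards `b` to the one towards `c`: the
disk automorphism `z ↦ (z - a) / (1 - conj a * z)` moves `a` to the center. -/
noncomputable def hypAngle (a b c : ℂ) : ℝ :=
  Complex.arg (((c - a) / (1 - (starRingEnd ℂ) a * c)) / ((b - a) / (1 - (starRingEnd ℂ) a * b)))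

/-- The pseudo-hyperbolic distance `tanh (d / 2)`, where `d` is the hyperbolic distance. -/
noncomputable def pseudoDist (a b : ℂ) : ℝ := ‖(a - b) / (1 - (starRingEnd ℂ) a * b)‖

/-- `m` is the midpoint of the geodesic segment from `a` to `b`. -/
def IsHypMidpoint (m a b : ℂ) : Prop := m ∈ hypSegment a b ∧ pseudoDist a m = pseudoDist m b

/-- The primitive eighth root of unity `exp (π i / 4)`. -/
noncomputable def zeta : ℂ := Complex.exp (Real.pi / 4 * Complex.I)

/-- The eight neighbours of the center in the tessellation. The equilateral hyperbolic triangle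
with one corner at `0` and angles `π / 4` has its other corners at Euclidean distance
`√(√2 - 1)` from `0`. -/
noncomputable def v (j : ℕ) : ℂ := (Real.sqrt (Real.sqrt 2 - 1) : ℝ) * zeta ^ j

/-- The hyperbolic half-turn which exchanges `0` and `c`, for `c` in the disk. -/
noncomputable def halfTurn (c z : ℂ) : ℂ := (c - z) / (1 - (starRingEnd ℂ) c * z)

/-- The triangles of the tessellation of the disk by equilateral triangles with angles `π / 4`, given
by their corners in counterclockwise order: all images of the triangle `0, v 0, v 1` under the group
generated by the rotation by `π / 4` about the vertex `0` and the half-turn about the midpoint of the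
edge from `0` to `v 0`. -/
inductive IsTile : ℂ → ℂ → ℂ → Prop
  | base : IsTile 0 (v 0) (v 1)
  | rotate {a b c : ℂ} : IsTile a b c → IsTile (zeta * a) (zeta * b) (zeta * c)
  | turn {a b c : ℂ} : IsTile a b c →
      IsTile (halfTurn (v 0) a) (halfTurn (v 0) b) (halfTurn (v 0) c)

/-- A Petrie strip of the tessellation: consecutive points span triangles
`p k, p (k+1), p (k+2)`, each adjacent to the next one, of alternating orientation. -/
def IsPetrieStrip (p : ℤ → ℂ) : Prop :=
  ∀ k : ℤ, IsTile (p (2 * k)) (p (2 * k + 1)) (p (2 * k + 2)) ∧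
    IsTile (p (2 * k + 2)) (p (2 * k + 1)) (p (2 * k + 3))

/-- The Petrie polygon of a strip: geodesic segments which join the midpoints of consecutive edges
`p k, p (k+1)` and `p (k+1), p (k+2)`, so that the clipped vertices `p (k+1)` lie alternately to the
left and to the right. -/
def petriePolygon (p : ℤ → ℂ) : Set ℂ :=
  {z | ∃ (k : ℤ) (m m' : ℂ), IsHypMidpoint m (p k) (p (k + 1)) ∧
    IsHypMidpoint m' (p (k + 1)) (p (k + 2)) ∧ z ∈ hypSegment m m'}

/-! ### The `16`-gon and its side pairings -/

/-- The vertex of the tessellation reached from the center by following the edge from `0` to `v j`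
straight on through `v j` along one more edge. -/
noncomputable def u (j : ℕ) : ℂ := halfTurn (v j) (v (j + 4))

/-- The mirror image of the center in the edge from `v j` to `v (j + 1)`. -/
noncomputable def w (j : ℕ) : ℂ := halfTurn (v j) (v (j + 6))

/-- The hyperbolic `16`-gon with corners `u 0, w 0, u 1, w 1, …, u 7, w 7`. It consists of the
`16` triangles `0, v j, v (j+1)` and `w j, v (j+1), v j`, and of `32` halves of triangles, cut off by
its sides along altitudes. -/
def polygon : Set ℂ := hypHull (Set.range u ∪ Set.range w)

/-- The side of the `16`-gon from `u j` to `w j`. -/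
def sideA (j : ℕ) : Set ℂ := hypSegment (u j) (w j)

/-- The side of the `16`-gon from `w j` to `u (j + 1)`. -/
def sideB (j : ℕ) : Set ℂ := hypSegment (u (j + 1)) (w j)

/-- The translation by six steps along the Petrie polygon through the midpoints of the edges from
`0` to `v (j+1)` and from `0` to `v (j+2)`. The half-turns about these two consecutive midpoints
compose to the translation by two steps. -/
noncomputable def sidePairing (j : ℕ) : ℂ → ℂ :=
  (fun z => halfTurn (v (j + 2)) (halfTurn (v (j + 1)) z))^[3]

/-- The identification of the sides of the `16`-gon along the Petrie polygons. -/
def polygonSetoid : Setoid polygon :=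
  Relation.EqvGen.setoid fun p q : polygon =>
    ∃ j : ℕ, (p : ℂ) ∈ sideA j ∧ (q : ℂ) = sidePairing j p

/-- The closed surface obtained from the `16`-gon, with the quotient topology. -/
abbrev Y : Type := Quotient polygonSetoid

/-- The projection from the `16`-gon to the surface. -/
def projY (p : polygon) : Y := Quotient.mk polygonSetoid p

/-- The `16`-gon together with its neighbouring copy across the side `sideA j`. -/
noncomputable def doublePolygon (j : ℕ) : Set ℂ :=
  polygon ∪ {z | ‖z‖ < 1 ∧ sidePairing j z ∈ polygon}

/-- `p` is the point of the `16`-gon which corresponds to the point `z` of `doublePolygon j`. -/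
def Represents (j : ℕ) (z : ℂ) (p : polygon) : Prop :=
  (p : ℂ) = z ∨ (p : ℂ) = sidePairing j z

/-- The image in `Y` of a subset of `doublePolygon j`. -/
def imageY (j : ℕ) (A : Set ℂ) : Set Y := {y | ∃ z ∈ A, ∃ p : polygon, Represents j z p ∧ y = projY p}

/-- The vertices of `Y`. -/
def verticesY : Set Y := {y | ∃ (p : polygon) (b c : ℂ), IsTile p b c ∧ y = projY p}

/-- The edges of `Y`: images of edges of the tessellation. -/
def edgesY : Set (Set Y) :=
  {F | ∃ (j : ℕ) (a b c : ℂ), IsTile a b c ∧ hypSegment a b ⊆ doublePolygon j ∧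
    F = imageY j (hypSegment a b)}

/-- The faces of `Y`: images of triangles of the tessellation. Triangles which are cut into halves by
a side of the `16`-gon are put together again by the side pairings. -/
def facesY : Set (Set Y) :=
  {F | ∃ (j : ℕ) (a b c : ℂ), IsTile a b c ∧ hypHull {a, b, c} ⊆ doublePolygon j ∧
    F = imageY j (hypHull {a, b, c})}

/-- The hyperbolic parametrizations of `Y` off the corners of the `16`-gon: local isometries from the
interior of the `16`-gon and its copy across a side. They define the conformal structure of `Y`. -/
def hypParams : Set (Set ℂ × (ℂ → Y)) :=
  {P | ∃ j : ℕ, P.1 = interior (doublePolygon j) ∧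
    ∀ z ∈ interior (doublePolygon j), ∃ p : polygon, Represents j z p ∧ P.2 z = projY p}

end OctaSurface

noncomputable section
open Complex Metric Set Filter Topology
open scoped ComplexConjugate Interval

namespace TriangleMap

/-- Painlevé's theorem for the real line: a continuous function which is holomorphic off the real
line is holomorphic. -/
lemma differentiableOn_of_off_real {f : ℂ → ℂ} {U : Set ℂ} (hU : IsOpen U)
    (hc : ContinuousOn f U) (hd : ∀ z ∈ U, z.im ≠ 0 → DifferentiableAt ℂ f z) :
    DifferentiableOn ℂ f U := by
  refine (isConservativeOn_and_continuousOn_iff_isDifferentiableOn hU).1 ⟨?_, hc⟩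
  intro z w hzw
  rw [← add_eq_zero_iff_eq_neg, wedgeIntegral_add_wedgeIntegral_eq]
  have key : ∀ c d : ℝ, [[c, d]] ⊆ [[z.im, w.im]] → (c ≤ 0 ∧ d ≤ 0 ∨ 0 ≤ c ∧ 0 ≤ d) →
      (∫ x : ℝ in z.re..w.re, f (x + c * I)) - (∫ x : ℝ in z.re..w.re, f (x + d * I)) +
        I • (∫ y : ℝ in c..d, f (w.re + y * I)) - I • (∫ y : ℝ in c..d, f (z.re + y * I)) = 0 := by
    intro c d hcd hs; have := integral_boundary_rect_eq_zero_of_continuousOn_of_differentiableOn f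
      (⟨z.re, c⟩ : ℂ) ⟨w.re, d⟩ (hc.mono fun x hx => hzw ⟨hx.1, hcd hx.2⟩) ?_
    · simpa using this
    · intro x hx; refine (hd x (hzw ⟨Ioo_subset_Icc_self hx.1, hcd (Ioo_subset_Icc_self hx.2)⟩)
        ?_).differentiableWithinAt
      have h2 := hx.2; simp only [mem_preimage, mem_Ioo] at h2
      rcases hs with ⟨h, h'⟩ | ⟨h, h'⟩
      · exact (h2.2.trans_le (max_le h h')).ne
      · exact ((le_min h h').trans_lt h2.1).ne'
  by_cases h0 : (0 : ℝ) ∈ [[z.im, w.im]]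
  · have e1 := key z.im 0 (uIcc_subset_uIcc left_mem_uIcc h0)
      (by rcases le_total z.im 0 with h | h <;> simp [h])
    have e2 := key 0 w.im (uIcc_subset_uIcc h0 right_mem_uIcc)
      (by rcases le_total w.im 0 with h | h <;> simp [h])
    have hint : ∀ a : ℝ, a ∈ [[z.re, w.re]] → ∀ c d : ℝ, [[c, d]] ⊆ [[z.im, w.im]] →
        IntervalIntegrable (fun y : ℝ => f (a + y * I)) MeasureTheory.volume c d := by
      intro a ha c d hcd; refine ContinuousOn.intervalIntegrable ?_
      refine hc.comp (by fun_prop) fun y hy => hzw ⟨?_, ?_⟩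
      · simpa using ha
      · simpa using hcd hy
    have hl := uIcc_subset_uIcc (left_mem_uIcc (a := z.im) (b := w.im)) h0
    have hr := uIcc_subset_uIcc h0 (right_mem_uIcc (a := z.im) (b := w.im))
    rw [← intervalIntegral.integral_add_adjacent_intervals
        (hint w.re right_mem_uIcc z.im 0 hl) (hint w.re right_mem_uIcc 0 w.im hr),
      ← intervalIntegral.integral_add_adjacent_intervals
        (hint z.re left_mem_uIcc z.im 0 hl) (hint z.re left_mem_uIcc 0 w.im hr)]
    linear_combination (norm := skip) e1 + e2; simp only [smul_eq_mul]; ring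
  · refine key z.im w.im subset_rfl ?_; rw [mem_uIcc] at h0
    push Not at h0
    rcases le_total z.im 0 with h | h
    · exact Or.inl ⟨h, (h0.1 h).le⟩
    · rcases le_total w.im 0 with h' | h'
      · exact absurd (h0.2 h') (not_lt.2 h)
      · exact Or.inr ⟨h, h'⟩

/-- The maximum modulus principle with an upper limit at the boundary. -/
lemma norm_le_of_eventually_le_frontier {F : ℂ → ℂ} {U : Set ℂ} {C : ℝ} (hU : IsOpen U)
    (hb : Bornology.IsBounded U) (hF : DifferentiableOn ℂ F U)
    (h : ∀ x ∈ frontier U, ∀ η > 0, ∀ᶠ z in 𝓝[U] x, ‖F z‖ ≤ C + η) {z : ℂ} (hz : z ∈ U) :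
    ‖F z‖ ≤ C := by
  refine le_of_forall_pos_le_add fun η hη => ?_
  by_contra! hlt
  set V : Set ℂ := U ∩ {x | C + η < ‖F x‖} with hV
  have hVo : IsOpen V := hF.continuousOn.norm.isOpen_inter_preimage hU isOpen_Ioi
  have hcl : closure V ⊆ U := by
    intro x hx
    by_contra hxU
    have hxf : x ∈ frontier U := ⟨closure_mono inter_subset_left hx, by rwa [hU.interior_eq]⟩
    have h1 := h x hxf η hη; rw [eventually_nhdsWithin_iff] at h1
    obtain ⟨y, hy, hy'⟩ := (mem_closure_iff_frequently.1 hx).and_eventually h1 |>.exists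
    exact (hy' hy.1).not_gt hy.2
  refine hlt.not_ge (norm_le_of_forall_mem_frontier_norm_le (hb.subset inter_subset_left)
    (DifferentiableOn.diffContOnCl (hF.mono hcl)) (fun x hx => ?_)
    (subset_closure (⟨hz, hlt⟩ : z ∈ V)))
  by_contra! h2
  have : x ∈ V := ⟨hcl hx.1, h2⟩
  exact hx.2 (by rwa [hVo.interior_eq])

def mob (a z : ℂ) : ℂ := (z - a) / (1 - conj a * z)

lemma one_sub_conj_mul_ne_zero {a z : ℂ} (ha : ‖a‖ < 1) (hz : ‖z‖ < 1) : 1 - conj a * z ≠ 0 := by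
  intro h
  have : ‖conj a * z‖ = 1 := by rw [← sub_eq_zero.1 h]; simp
  rw [norm_mul, RCLike.norm_conj] at this
  nlinarith [norm_nonneg a, norm_nonneg z]

lemma norm_sq_sub_norm_sq (a z : ℂ) : ‖1 - conj a * z‖ ^ 2 - ‖z - a‖ ^ 2 = (1 - ‖a‖ ^ 2) * (1 - ‖z‖ ^ 2) := by
  simp only [← normSq_eq_norm_sq, normSq_apply, sub_re, sub_im, mul_re, mul_im, conj_re, conj_im,
    one_re, one_im]
  ring

lemma norm_mob_lt_one {a z : ℂ} (ha : ‖a‖ < 1) (hz : ‖z‖ < 1) : ‖mob a z‖ < 1 := by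
  have h0 := norm_pos_iff.2 (one_sub_conj_mul_ne_zero ha hz)
  rw [mob, norm_div, div_lt_one h0]
  have h := norm_sq_sub_norm_sq a z
  have h1 : 0 < (1 - ‖a‖ ^ 2) * (1 - ‖z‖ ^ 2) :=
    mul_pos (by nlinarith [norm_nonneg a]) (by nlinarith [norm_nonneg z])
  nlinarith [norm_nonneg (z - a)]

lemma mob_self (a : ℂ) : mob a a = 0 := by simp [mob]

lemma mob_injOn {a : ℂ} (ha : ‖a‖ < 1) : InjOn (mob a) (ball 0 1) := by
  intro z hz w hw h
  rw [mem_ball_zero_iff] at hz hw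
  have h1 := one_sub_conj_mul_ne_zero ha hz
  have h2 := one_sub_conj_mul_ne_zero ha hw
  rw [mob, mob, div_eq_div_iff h1 h2] at h
  have h3 := one_sub_conj_mul_ne_zero ha ha
  have : (z - w) * (1 - conj a * a) = 0 := by linear_combination h
  rcases mul_eq_zero.1 this with h | h
  · exact sub_eq_zero.1 h
  · exact absurd h h3

lemma hasDerivAt_mob {a z : ℂ} (ha : ‖a‖ < 1) (hz : ‖z‖ < 1) :
    HasDerivAt (mob a) ((1 - conj a * a) / (1 - conj a * z) ^ 2) z := by
  have h := ((hasDerivAt_id z).sub_const a).div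
    (((hasDerivAt_id z).const_mul (conj a)).const_sub 1) (one_sub_conj_mul_ne_zero ha hz)
  refine h.congr_deriv ?_
  simp only [id]
  congr 1
  ring

lemma differentiableOn_mob {a : ℂ} (ha : ‖a‖ < 1) : DifferentiableOn ℂ (mob a) (ball 0 1) :=
  fun _ hz => (hasDerivAt_mob ha (by simpa using hz)).differentiableAt.differentiableWithinAt

lemma one_sub_conj_mul_self (a : ℂ) : 1 - conj a * a = ((1 - ‖a‖ ^ 2 : ℝ) : ℂ) := by
  rw [mul_comm, mul_conj, normSq_eq_norm_sq]; push_cast; rfl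

lemma norm_deriv_mul_le {f : ℂ → ℂ} {z : ℂ} {d : ℝ} (hd : 0 < d)
    (hf : DifferentiableOn ℂ f (ball z d)) (hm : MapsTo f (ball z d) (ball 0 1)) :
    ‖deriv f z‖ * d ≤ 1 - ‖f z‖ ^ 2 := by
  have hz : ‖f z‖ < 1 := by simpa using hm (mem_ball_self hd)
  have h1 : DifferentiableOn ℂ (mob (f z) ∘ f) (ball z d) := (differentiableOn_mob hz).comp hf hm
  have h2 : MapsTo (mob (f z) ∘ f) (ball z d) (ball ((mob (f z) ∘ f) z) 1) := by
    intro x hx; simpa [mob_self] using norm_mob_lt_one hz (by simpa using hm hx)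
  have h3 := norm_deriv_le_div_of_mapsTo_ball h1 (h2.mono_right ball_subset_closedBall) hd
  have h4 : HasDerivAt (mob (f z) ∘ f) ((1 - conj (f z) * f z) / (1 - conj (f z) * f z) ^ 2 * deriv f z) z :=
    (hasDerivAt_mob hz hz).comp z (hf.differentiableAt (ball_mem_nhds z hd)).hasDerivAt
  have hpos : 0 < 1 - ‖f z‖ ^ 2 := by nlinarith [norm_nonneg (f z)]
  rw [h4.deriv, one_sub_conj_mul_self, norm_mul, norm_div, norm_pow, norm_real,
    Real.norm_of_nonneg hpos.le] at h3
  have : (1 - ‖f z‖ ^ 2) / (1 - ‖f z‖ ^ 2) ^ 2 = 1 / (1 - ‖f z‖ ^ 2) := by field_simp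
  rw [this, div_mul_eq_mul_div, one_mul, div_le_div_iff₀ hpos hd] at h3
  linarith

/-- An injective holomorphic function has open image and a holomorphic inverse; its derivative does
not vanish. -/
lemma injOn_holomorphic {f : ℂ → ℂ} {U : Set ℂ} (hU : IsOpen U) (hf : DifferentiableOn ℂ f U)
    (hinj : InjOn f U) :
    IsOpen (f '' U) ∧ DifferentiableOn ℂ (Function.invFunOn f U) (f '' U) ∧ ∀ z ∈ U, deriv f z ≠ 0 := by
  have han : AnalyticOnNhd ℂ f U := hf.analyticOnNhd hU
  have hmap : ∀ z ∈ U, 𝓝 (f z) ≤ map f (𝓝 z) := by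
    intro z hz; refine (han z hz).eventually_constant_or_nhds_le_map_nhds.resolve_left fun h => ?_
    have h1 : ∀ᶠ w in 𝓝[≠] z, w = z := by
      filter_upwards [h.filter_mono nhdsWithin_le_nhds,
        mem_nhdsWithin_of_mem_nhds (hU.mem_nhds hz)] with w hw hwU
      exact hinj hwU hz hw
    obtain ⟨w, hw, hw'⟩ := (h1.and self_mem_nhdsWithin).exists; exact hw' hw
  have hopen : ∀ V ⊆ U, IsOpen V → IsOpen (f '' V) := by
    intro V hV hVo; rw [isOpen_iff_mem_nhds]; rintro _ ⟨z, hz, rfl⟩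
    exact hmap z (hV hz) (image_mem_map (hVo.mem_nhds hz))
  set F := Function.invFunOn f U with hF
  have hl : ∀ z ∈ U, F (f z) = z := fun z hz => hinj.leftInvOn_invFunOn hz
  have hr : ∀ w ∈ f '' U, f (F w) = w := fun w hw => Function.invFunOn_eq hw
  have hFm : ∀ w ∈ f '' U, F w ∈ U := fun w hw => Function.invFunOn_mem hw
  have hFc : ∀ z ∈ U, ContinuousAt F (f z) := by
    intro z hz; rw [ContinuousAt, hl z hz]; intro V hV; have h1 : f '' (interior V ∩ U) ∈ 𝓝 (f z) :=
      hmap z hz (image_mem_map (inter_mem (interior_mem_nhds.2 hV) (hU.mem_nhds hz)))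
    refine mem_map.2 (mem_of_superset h1 ?_); rintro _ ⟨y, hy, rfl⟩; rw [mem_preimage, hl y hy.2]
    exact interior_subset hy.1
  have hinv : ∀ z ∈ U, deriv f z ≠ 0 → DifferentiableAt ℂ F (f z) := by
    intro z hz h0; have h1 : HasDerivAt f (deriv f z) (F (f z)) := by
      rw [hl z hz]; exact (hf.differentiableAt (hU.mem_nhds hz)).hasDerivAt
    refine (HasDerivAt.of_local_left_inverse (hFc z hz) h1 h0 ?_).differentiableAt
    filter_upwards [(hopen U subset_rfl hU).mem_nhds (mem_image_of_mem f hz)] with w hw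
    exact hr w hw
  have hdiff : ∀ z ∈ U, DifferentiableAt ℂ F (f z) := by
    intro a ha; refine (analyticAt_of_differentiable_on_punctured_nhds_of_continuousAt ?_
      (hFc a ha)).differentiableAt
    have h1 : ∀ᶠ z in 𝓝[≠] a, deriv f z ≠ 0 := by
      refine ((han a ha).deriv.eventually_eq_zero_or_eventually_ne_zero).resolve_left fun h => ?_
      obtain ⟨r, hr0, hr1⟩ := Metric.eventually_nhds_iff_ball.1 (h.and (hU.mem_nhds ha))
      have hb : a + (r / 2 : ℝ) ∈ ball a r := by simp [abs_of_pos hr0, hr0]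
      have h2 := (convex_ball a r).is_const_of_fderivWithin_eq_zero (𝕜 := ℂ)
        (hf.mono fun x hx => (hr1 x hx).2) (fun x hx => by
          rw [fderivWithin_of_isOpen isOpen_ball hx]; ext
          simp [(hr1 x hx).1]) hb (mem_ball_self hr0)
      have h3 := hinj (hr1 _ hb).2 ha h2; simp [hr0.ne'] at h3
    have h2 : ∀ᶠ w in 𝓝[≠] f a, w ∈ f '' U ∧ (F w ≠ a → deriv f (F w) ≠ 0) := by
      have h3 : ∀ᶠ w in 𝓝 (f a), w ∈ f '' U := (hopen U subset_rfl hU).mem_nhds (mem_image_of_mem f ha)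
      have h4 : ∀ᶠ z in 𝓝 a, z ≠ a → deriv f z ≠ 0 := eventually_nhdsWithin_iff.1 h1
      have h5 : Tendsto F (𝓝 (f a)) (𝓝 a) := by simpa [ContinuousAt, hl a ha] using hFc a ha
      exact (h3.and (h5.eventually h4)).filter_mono nhdsWithin_le_nhds
    filter_upwards [h2, self_mem_nhdsWithin] with w hw hwa; obtain ⟨z, hz, rfl⟩ := hw.1
    refine hinv z hz ?_; have := hw.2; rw [hl z hz] at this
    exact this fun h => hwa (by rw [h]; rfl)
  refine ⟨hopen U subset_rfl hU, ?_, fun z hz h0 => ?_⟩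
  · rintro _ ⟨z, hz, rfl⟩; exact (hdiff z hz).differentiableWithinAt
  · have h1 : HasDerivAt (F ∘ f) (deriv F (f z) * deriv f z) z :=
      (hdiff z hz).hasDerivAt.comp z (hf.differentiableAt (hU.mem_nhds hz)).hasDerivAt
    have h2 : HasDerivAt (F ∘ f) 1 z := by
      refine (hasDerivAt_id z).congr_of_eventuallyEq ?_; filter_upwards [hU.mem_nhds hz] with y hy
      exact hl y hy
    have := h1.unique h2; simp [h0] at this

/-- A barrier estimate: near a real boundary point where a holomorphic function of modulus less
than `1` attains modulus `1`, its modulus is at least `1` minus a multiple of the height. -/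
lemma one_sub_norm_le_of_half_disk {f : ℂ → ℂ} {x ρ : ℝ} (hρ : 0 < ρ)
    (hd : DifferentiableOn ℂ f (ball (x : ℂ) ρ ∩ {z | 0 < z.im}))
    (h2 : ∀ z ∈ ball (x : ℂ) ρ ∩ {z | 0 < z.im}, 1 / 2 < ‖f z‖)
    (h1 : ∀ t : ℝ, |t - x| ≤ ρ → ∀ s < 1, ∀ᶠ z in 𝓝[ball (x : ℂ) ρ ∩ {z | 0 < z.im}] (t : ℂ), s < ‖f z‖)
    {y : ℝ} (hy : 0 < y) (hyρ : y < ρ) :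
    1 - ‖f (x + y * I)‖ ≤ 2 * Real.log 2 / ρ * y := by
  set V := ball (x : ℂ) ρ ∩ {z : ℂ | 0 < z.im} with hV
  have hVo : IsOpen V := isOpen_ball.inter (isOpen_lt continuous_const continuous_im)
  set K : ℝ := Real.log 2 / ρ ^ 2 with hK
  have hK0 : 0 < K := div_pos (Real.log_pos one_lt_two) (by positivity)
  set B : ℂ → ℂ := fun z => (z - x) ^ 2 - I * (2 * ρ) * (z - x) with hB
  have hBre : ∀ z : ℂ, (B z).re = (z.re - x) ^ 2 - z.im ^ 2 + 2 * ρ * z.im := by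
    intro z
    simp only [hB, pow_two, sub_re, mul_re, sub_im, ofReal_re, ofReal_im, I_re, I_im, mul_im]
    norm_num
  have hBc : Continuous fun z => ‖exp (-K * B z)‖ := by fun_prop
  have hBn : ∀ z, ‖exp (-K * B z)‖ = Real.exp (-K * (B z).re) := by
    intro z; rw [norm_exp, ← ofReal_neg, re_ofReal_mul]
  have hf0 : ∀ z ∈ V, f z ≠ 0 := fun z hz h => by
    have := h2 z hz; rw [h, norm_zero] at this; linarith
  have hF : DifferentiableOn ℂ (fun z => exp (-K * B z) / f z) V := by
    refine DifferentiableOn.div ?_ hd hf0; simp only [hB]; fun_prop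
  have hz : (x + y * I : ℂ) ∈ V := by refine ⟨?_, by simpa using hy⟩; simp [abs_of_pos hy, hyρ]
  have main : ‖exp (-K * B (x + y * I)) / f (x + y * I)‖ ≤ 1 := by
    refine norm_le_of_eventually_le_frontier (F := fun z => exp (-K * B z) / f z) hVo
      (isBounded_ball.subset inter_subset_left) hF (fun ξ hξ η hη => ?_) hz
    have hξV : ξ ∉ V := by rw [hVo.frontier_eq] at hξ; exact hξ.2
    have hξρ : dist ξ x ≤ ρ := by
      have := closure_mono inter_subset_left hξ.1
      exact mem_closedBall.1 (closure_ball_subset_closedBall this)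
    have hξi : 0 ≤ ξ.im := by
      have : V ⊆ {z : ℂ | 0 ≤ z.im} := fun z hz => le_of_lt (show (0 : ℝ) < z.im from hz.2)
      exact closure_minimal this (isClosed_le continuous_const continuous_im) hξ.1
    rcases hξi.eq_or_lt with h0 | h0
    · have hreal : ξ = (ξ.re : ℂ) := by apply Complex.ext <;> simp [← h0]
      have hle : ‖exp (-K * B ξ)‖ ≤ 1 := by
        rw [hBn, hBre, ← h0, Real.exp_le_one_iff]; nlinarith [sq_nonneg (ξ.re - x)]
      have hs : 1 / (1 + η / 2) < 1 := by rw [div_lt_one (by linarith)]; linarith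
      have e1 := h1 ξ.re (by rw [hreal, dist_eq, ← ofReal_sub, norm_real] at hξρ; exact hξρ) (1 / (1 + η / 2)) hs
      rw [← hreal] at e1; have hc2 : (1 : ℝ) < (1 + η) / (1 + η / 2) := by
        rw [lt_div_iff₀ (by linarith)]; linarith
      have e2 : ∀ᶠ z in 𝓝 ξ, ‖exp (-K * B z)‖ < (1 + η) / (1 + η / 2) :=
        hBc.continuousAt.eventually (Iio_mem_nhds (hle.trans_lt hc2))
      filter_upwards [e1, e2.filter_mono nhdsWithin_le_nhds] with z hz1 hz2
      have hz0 : 0 < ‖f z‖ := lt_trans (by positivity) hz1; rw [norm_div, div_le_iff₀ hz0]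
      calc ‖exp (-K * B z)‖ ≤ (1 + η) / (1 + η / 2) := hz2.le
        _ = (1 + η) * (1 / (1 + η / 2)) := by ring
        _ ≤ (1 + η) * ‖f z‖ := by gcongr
    · have hdist : dist ξ x = ρ := by refine le_antisymm hξρ (not_lt.1 fun h => hξV ⟨h, h0⟩)
      have hsq : (ξ.re - x) ^ 2 + ξ.im ^ 2 = ρ ^ 2 := by
        rw [← hdist, dist_eq, ← normSq_eq_norm_sq, normSq_apply]; simp; ring
      have him : ξ.im ≤ ρ := by nlinarith [sq_nonneg (ξ.re - x)]
      have hle : ‖exp (-K * B ξ)‖ ≤ 1 / 2 := by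
        rw [hBn, hBre]; have : -K * ((ξ.re - x) ^ 2 - ξ.im ^ 2 + 2 * ρ * ξ.im) ≤ - Real.log 2 := by
          have h3 : ρ ^ 2 ≤ (ξ.re - x) ^ 2 - ξ.im ^ 2 + 2 * ρ * ξ.im := by nlinarith
          have h4 : Real.log 2 = K * ρ ^ 2 := by rw [hK]; field_simp
          rw [h4]; nlinarith
        calc _ ≤ Real.exp (-Real.log 2) := Real.exp_le_exp.2 this
          _ = 1 / 2 := by rw [Real.exp_neg, Real.exp_log two_pos, one_div]
      have e2 : ∀ᶠ z in 𝓝 ξ, ‖exp (-K * B z)‖ < (1 + η) / 2 :=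
        hBc.continuousAt.eventually (Iio_mem_nhds (by linarith))
      filter_upwards [e2.filter_mono nhdsWithin_le_nhds, self_mem_nhdsWithin] with z hz1 hz2
      have h3 := h2 z hz2; rw [norm_div, div_le_iff₀ (by linarith)]; nlinarith
  have hfz : 0 < ‖f (x + y * I)‖ := norm_pos_iff.2 (hf0 _ hz)
  rw [norm_div, div_le_one hfz, hBn, hBre] at main
  have h5 := Real.add_one_le_exp (-K * (((x + y * I : ℂ).re - x) ^ 2 - (x + y * I : ℂ).im ^ 2 + 2 * ρ * (x + y * I : ℂ).im))
  have h6 : (x + y * I : ℂ).re = x := by simp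
  have h7 : (x + y * I : ℂ).im = y := by simp
  rw [h6, h7] at main h5
  have h8 : 2 * Real.log 2 / ρ * y = K * (2 * ρ * y) := by rw [hK]; field_simp
  rw [h8]
  nlinarith [mul_nonneg hK0.le (sq_nonneg y)]

/-- A bounded holomorphic function on a half disk whose modulus tends to `1` at the diameter has a
limit at the center. -/
lemma exists_tendsto_of_half_disk {f : ℂ → ℂ} {b r : ℝ} (hr : 0 < r)
    (hd : DifferentiableOn ℂ f (ball (b : ℂ) r ∩ {z | 0 < z.im}))
    (hm : MapsTo f (ball (b : ℂ) r ∩ {z | 0 < z.im}) (ball 0 1))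
    (h1 : ∀ t : ℝ, |t - b| < r → ∀ s < 1, ∀ᶠ z in 𝓝[ball (b : ℂ) r ∩ {z | 0 < z.im}] (t : ℂ), s < ‖f z‖) :
    ∃ y, Tendsto f (𝓝[ball (b : ℂ) r ∩ {z | 0 < z.im}] (b : ℂ)) (𝓝 y) := by
  set U := ball (b : ℂ) r ∩ {z : ℂ | 0 < z.im} with hU
  obtain ⟨ρ₀, hρ₀, hρ₁⟩ := Metric.eventually_nhds_iff_ball.1
    (eventually_nhdsWithin_iff.1 (h1 b (by simpa using hr) (1 / 2) (by norm_num)))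
  obtain ⟨ρ, hρ, hρr, hρρ₀⟩ : ∃ ρ > 0, 2 * ρ < r ∧ 2 * ρ ≤ ρ₀ :=
    ⟨min r ρ₀ / 3, by positivity, by linarith [min_le_left r ρ₀], by linarith [min_le_right r ρ₀]⟩
  have hsub : ∀ x : ℝ, |x - b| < ρ → ball (x : ℂ) ρ ∩ {z : ℂ | 0 < z.im} ⊆ U ∩ ball b ρ₀ := by
    intro x hx z hz; have h2 : dist (x : ℂ) b < ρ := by rwa [dist_eq, ← ofReal_sub, norm_real]
    have h3 : dist z x < ρ := hz.1; have h4 := dist_triangle z x b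
    exact ⟨⟨by rw [mem_ball]; linarith, hz.2⟩, by rw [mem_ball]; linarith⟩
  have key : ∀ x : ℝ, |x - b| < ρ → ∀ y : ℝ, 0 < y → y < ρ →
      1 - ‖f (x + y * I)‖ ≤ 2 * Real.log 2 / ρ * y := by
    intro x hx y hy hyρ; have hs := hsub x hx
    refine one_sub_norm_le_of_half_disk hρ (hd.mono fun z hz => (hs hz).1) (fun z hz => ?_)
      (fun t ht s hs1 => ?_) hy hyρ
    · exact hρ₁ z (hs hz).2 (hs hz).1
    · refine (h1 t ?_ s hs1).filter_mono (nhdsWithin_mono _ fun z hz => (hs hz).1)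
      have := abs_sub_le t x b; linarith
  set W := ball (b : ℂ) (ρ / 2) ∩ {z : ℂ | 0 < z.im} with hW
  have hWo : IsOpen W := isOpen_ball.inter (isOpen_lt continuous_const continuous_im)
  have hWU : W ⊆ U := fun z hz => ⟨ball_subset_ball (by linarith) hz.1, hz.2⟩
  have hWc : Convex ℝ W := (convex_ball _ _).inter (convex_halfSpace_im_gt 0)
  set M : ℝ := 2 * (2 * Real.log 2 / ρ) with hM
  have hM0 : 0 ≤ M := by have := Real.log_pos one_lt_two; positivity
  have hder : ∀ z ∈ W, ‖deriv f z‖₊ ≤ M.toNNReal := by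
    intro z hz; have hzi : 0 < z.im := hz.2; have hzb : dist z b < ρ / 2 := hz.1
    have hzi' : z.im < ρ / 2 := by
      have := abs_im_le_norm (z - b); rw [← dist_eq] at this
      simp only [sub_im, ofReal_im, sub_zero] at this; linarith [le_abs_self z.im]
    have hzr : |z.re - b| < ρ := by
      have := abs_re_le_norm (z - b); rw [← dist_eq] at this; simp only [sub_re, ofReal_re] at this
      linarith
    have hb : ball z z.im ⊆ U := by
      intro w hw; refine ⟨?_, ?_⟩
      · have := dist_triangle w z b; have h3 : dist w z < z.im := hw; rw [mem_ball]; linarith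
      · have h3 : dist w z < z.im := hw; have := abs_im_le_norm (w - z)
        rw [← dist_eq, sub_im] at this; have := neg_abs_le (w.im - z.im)
        simp only [mem_ofPred_eq]; linarith
    have h3 := norm_deriv_mul_le hzi (hd.mono hb) (hm.mono_left hb)
    have h4 := key z.re hzr z.im hzi (by linarith); rw [re_add_im] at h4
    have h5 : ‖f z‖ < 1 := by simpa using hm (hWU hz)
    have h6 : ‖deriv f z‖ * z.im ≤ M * z.im := by
      refine h3.trans ?_; have : 1 - ‖f z‖ ^ 2 ≤ 2 * (1 - ‖f z‖) := by nlinarith [norm_nonneg (f z)]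
      rw [hM]; linarith
    rw [← NNReal.coe_le_coe, coe_nnnorm, Real.coe_toNNReal _ hM0]
    exact le_of_mul_le_mul_right h6 hzi
  have hlip := hWc.lipschitzOnWith_of_nnnorm_deriv_le (f := f)
    (fun z hz => (hd.mono hWU).differentiableAt (hWo.mem_nhds hz)) hder
  obtain ⟨g, hg, hfg⟩ := hlip.extend_finite_dimension
  refine ⟨g b, ?_⟩
  have e1 : 𝓝[U] (b : ℂ) = 𝓝[W] (b : ℂ) := by
    have : W = ball (b : ℂ) (ρ / 2) ∩ U := by
      ext z; constructor
      · intro hz; exact ⟨hz.1, hWU hz⟩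
      · intro hz; exact ⟨hz.1, hz.2.2⟩
    rw [this]
    exact (nhdsWithin_inter_of_mem (mem_nhdsWithin_of_mem_nhds (ball_mem_nhds _ (by linarith)))).symm
  rw [e1]
  refine (hg.continuous.continuousAt.tendsto.mono_left nhdsWithin_le_nhds).congr' ?_
  filter_upwards [self_mem_nhdsWithin] with z hz
  exact (hfg hz).symm

/-- A holomorphic function of positive imaginary part on an upper neighborhood of a real interval,
which is continuous and real on the interval, is strictly increasing there. -/
lemma strictMonoOn_re_of_im_pos {g : ℂ → ℂ} {a b : ℝ} {N : Set ℂ} (hN : IsOpen N)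
    (hsym : ∀ z ∈ N, conj z ∈ N) (hNr : ∀ x ∈ Ioo a b, (x : ℂ) ∈ N)
    (hd : DifferentiableOn ℂ g (N ∩ {z | 0 < z.im})) (hc : ContinuousOn g (N ∩ {z | 0 ≤ z.im}))
    (hpos : ∀ z ∈ N, 0 < z.im → 0 < (g z).im) (hreal : ∀ z ∈ N, z.im = 0 → (g z).im = 0) :
    StrictMonoOn (fun x : ℝ => (g x).re) (Ioo a b) := by
  set G : ℂ → ℂ := fun z => if 0 ≤ z.im then g z else conj (g (conj z)) with hG
  have hGc : ContinuousOn G N := by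
    refine ContinuousOn.if ?_ ?_ ?_
    · intro z hz; have h0 : z.im = 0 := by
        have := frontier_le_subset_eq continuous_const continuous_im hz.2
        exact (this : (0 : ℝ) = z.im).symm
      have h1 : conj z = z := by apply Complex.ext <;> simp [h0]
      rw [h1]; exact (conj_eq_iff_im.2 (hreal z hz.1 h0)).symm
    · have : closure {z : ℂ | 0 ≤ z.im} = {z : ℂ | 0 ≤ z.im} :=
        (isClosed_le continuous_const continuous_im).closure_eq
      rw [this]; exact hc
    · refine continuous_conj.comp_continuousOn (hc.comp continuous_conj.continuousOn ?_); intro z hz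
      refine ⟨hsym z hz.1, ?_⟩
      have : z ∈ {z : ℂ | z.im ≤ 0} :=
        closure_minimal (fun w hw => (not_le.1 hw).le) (isClosed_le continuous_im continuous_const) hz.2
      simpa using this
  have hGd : DifferentiableOn ℂ G N := by
    refine differentiableOn_of_off_real hN hGc fun z hz h0 => ?_
    rcases lt_or_gt_of_ne h0 with h | h
    · have h1 : DifferentiableAt ℂ g (conj z) := hd.differentiableAt
        ((hN.inter (isOpen_lt continuous_const continuous_im)).mem_nhds
          ⟨hsym z hz, by simpa using h⟩)
      refine (differentiableAt_conj_conj_iff.2 h1 : DifferentiableAt ℂ (conj ∘ g ∘ conj) z).congr_of_eventuallyEq ?_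
      filter_upwards [(isOpen_lt continuous_im continuous_const).mem_nhds h] with w hw
      have : ¬ (0 ≤ w.im) := not_le.2 hw; simp [hG, this]
    · have h1 : DifferentiableAt ℂ g z := hd.differentiableAt
        ((hN.inter (isOpen_lt continuous_const continuous_im)).mem_nhds ⟨hz, h⟩)
      refine h1.congr_of_eventuallyEq ?_
      filter_upwards [(isOpen_lt continuous_const continuous_im).mem_nhds h] with w hw
      have : 0 ≤ w.im := le_of_lt hw; simp [hG, this]
  have hGr : ∀ x : ℝ, G x = g x := fun x => by simp [hG]
  have hderiv : ∀ x ∈ Ioo a b, HasDerivAt (fun t : ℝ => (g t).re) (deriv G x).re x ∧ 0 ≤ (deriv G x).re := by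
    intro x hx
    have h1 : HasDerivAt G (deriv G x) x := (hGd.differentiableAt (hN.mem_nhds (hNr x hx))).hasDerivAt
    refine ⟨?_, ?_⟩
    · have := h1.real_of_complex; simpa only [hGr] using this
    · have h2 : HasDerivAt (fun t : ℝ => ((x : ℂ) + t * I)) I 0 := by
        have := ((hasDerivAt_id (0 : ℝ)).ofReal_comp.mul_const I).const_add (x : ℂ)
        simpa using this
      have h3 : HasDerivAt (fun t : ℝ => G (x + t * I)) (deriv G x * I) 0 := by
        have h1' : HasDerivAt G (deriv G x) ((x : ℂ) + (0 : ℝ) * I) := by simpa using h1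
        exact h1'.comp (0 : ℝ) h2
      have h4 : HasDerivAt (fun t : ℝ => (G (x + t * I)).im) (deriv G x).re 0 := by
        have := (imCLM.hasFDerivAt.comp_hasDerivAt (0 : ℝ) h3)
        have e : imCLM (deriv G x * I) = (deriv G x).re := by simp
        rw [e] at this; exact this
      have h5 : Tendsto (fun t : ℝ => (x : ℂ) + t * I) (𝓝[>] 0) (𝓝 (x : ℂ)) := by
        have : Continuous fun t : ℝ => (x : ℂ) + t * I := by fun_prop
        simpa using (this.tendsto 0).mono_left (nhdsWithin_le_nhds (s := Ioi 0))
      have h6 := (hasDerivAt_iff_tendsto_slope.1 h4).mono_left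
        (nhdsWithin_mono 0 (fun t ht => (ne_of_gt ht : t ≠ 0) : Ioi (0 : ℝ) ⊆ {0}ᶜ))
      refine ge_of_tendsto h6 ?_
      filter_upwards [h5.eventually (hN.mem_nhds (hNr x hx)), self_mem_nhdsWithin] with t ht ht0
      have ht0' : 0 < t := ht0; have h7 := hpos _ ht (by simpa using ht0')
      have h8 : G (x + t * I) = g (x + t * I) := by simp [hG, ht0'.le]
      have h9 := hreal x (hNr x hx) (ofReal_im x); rw [slope_def_field]
      simp only [h8, ofReal_zero, zero_mul, add_zero, hGr, h9, sub_zero]; positivity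
  have hmono : MonotoneOn (fun x : ℝ => (g x).re) (Ioo a b) := monotoneOn_of_deriv_nonneg (convex_Ioo a b)
      (fun x hx => (hderiv x hx).1.continuousAt.continuousWithinAt)
      (fun x hx => (hderiv x (interior_subset hx)).1.differentiableAt.differentiableWithinAt)
      (fun x hx => by have h := hderiv x (interior_subset hx); rw [h.1.deriv]; exact h.2)
  intro x hx y hy hxy
  refine (hmono hx hy hxy.le).lt_of_ne fun heq => ?_
  obtain ⟨c, hxc, hcy⟩ := exists_between hxy
  have hcI : c ∈ Ioo a b := ⟨hx.1.trans hxc, hcy.trans hy.2⟩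
  have hconst : ∀ t ∈ Ioo x y, G t = G c := by
    intro t ht; have htI : t ∈ Ioo a b := ⟨hx.1.trans ht.1, ht.2.trans hy.2⟩
    have h1 : ∀ t ∈ Ioo x y, (g t).re = (g x).re := fun t ht => by
      have htI : t ∈ Ioo a b := ⟨hx.1.trans ht.1, ht.2.trans hy.2⟩
      exact le_antisymm ((hmono htI hy ht.2.le).trans heq.ge) (hmono hx htI ht.1.le)
    rw [hGr, hGr]; apply Complex.ext
    · rw [h1 t ht, h1 c ⟨hxc, hcy⟩]
    · rw [hreal _ (hNr t htI) (ofReal_im _), hreal _ (hNr c hcI) (ofReal_im _)]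
  obtain ⟨ε, hε, hεN⟩ := Metric.isOpen_iff.1 hN c (hNr c hcI)
  have han : AnalyticOnNhd ℂ G (ball (c : ℂ) ε) := (hGd.mono hεN).analyticOnNhd isOpen_ball
  have hfreq : ∃ᶠ z in 𝓝[≠] (c : ℂ), G z = G c := by
    have h2 : Tendsto (fun t : ℝ => (t : ℂ)) (𝓝[>] c) (𝓝[≠] (c : ℂ)) := by
      refine tendsto_nhdsWithin_iff.2 ⟨?_, ?_⟩
      · exact (continuous_ofReal.tendsto c).mono_left nhdsWithin_le_nhds
      · filter_upwards [self_mem_nhdsWithin] with t ht; simpa using (ne_of_gt ht : t ≠ c)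
    refine h2.frequently (Eventually.frequently ?_); filter_upwards [Ioo_mem_nhdsGT hcy] with t ht
    exact hconst t ⟨hxc.trans ht.1, ht.2⟩
  have heqon := han.eqOn_of_preconnected_of_frequently_eq analyticOnNhd_const
    (convex_ball (c : ℂ) ε).isPreconnected (mem_ball_self hε) hfreq
  have hz : (c + (ε / 2 : ℝ) * I : ℂ) ∈ ball (c : ℂ) ε := by simp [abs_of_pos hε, hε]
  have h3 := heqon hz
  have h4 := hpos _ (hεN hz) (by simp [hε])
  have h5 : G (c + (ε / 2 : ℝ) * I) = g (c + (ε / 2 : ℝ) * I) := by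
    have : 0 ≤ (c + (ε / 2 : ℝ) * I : ℂ).im := by
      rw [add_im, ofReal_im, im_ofReal_mul, I_im]; linarith
    exact if_pos this
  rw [← h5, h3, hGr, hreal _ (hNr c hcI) (ofReal_im _)] at h4
  exact lt_irrefl _ h4

lemma hasDerivAt_of_sq {s G : ℂ → ℂ} {z G' : ℂ} (hc : ContinuousAt s z)
    (hs : ∀ w, s w ^ 2 = G w) (hG : HasDerivAt G G' z) (h0 : G z ≠ 0) :
    HasDerivAt s (G' / (2 * s z)) z := by
  have hsz : s z ≠ 0 := fun h => h0 (by rw [← hs, h]; simp)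
  rw [hasDerivAt_iff_tendsto_slope] at hG ⊢
  have h1 : Tendsto (fun w => s w + s z) (𝓝[≠] z) (𝓝 (2 * s z)) := by
    rw [two_mul]; exact (hc.tendsto.mono_left nhdsWithin_le_nhds).add_const _
  have h2 := hG.div h1 (mul_ne_zero two_ne_zero hsz)
  refine h2.congr' ?_
  filter_upwards [self_mem_nhdsWithin, h1.eventually_ne (mul_ne_zero two_ne_zero hsz)] with w hw hw2
  have hwz : w - z ≠ 0 := sub_ne_zero.2 hw
  rw [Pi.div_apply, slope_def_field, slope_def_field, ← hs, ← hs]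
  field_simp
  ring

/-- Hurwitz' theorem for pointwise limits: locally uniform limits of injective holomorphic functions
are injective or constant. -/
lemma injOn_of_tendstoLocallyUniformlyOn {l : Filter ℕ} [l.NeBot] {F : ℕ → ℂ → ℂ} {g : ℂ → ℂ}
    {U : Set ℂ} (hU : IsOpen U) (hUc : IsPreconnected U) (hF : ∀ n, DifferentiableOn ℂ (F n) U)
    (hinj : ∀ n, InjOn (F n) U) (hlim : TendstoLocallyUniformlyOn F g l U)
    {z₀ : ℂ} (hz₀ : z₀ ∈ U) (hne : deriv g z₀ ≠ 0) : InjOn g U := by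
  have hg : DifferentiableOn ℂ g U := hlim.differentiableOn (Eventually.of_forall hF) hU
  have han : AnalyticOnNhd ℂ g U := hg.analyticOnNhd hU
  intro a ha b hb hab
  by_contra hne'
  have h1 : ∀ᶠ z in 𝓝[≠] b, g z ≠ g b := by
    rcases (han b hb).eventually_eq_or_eventually_ne (analyticAt_const (v := g b)) with h | h
    · exfalso
      have h2 := han.eqOn_of_preconnected_of_eventuallyEq analyticOnNhd_const hUc hb h
      have h3 : g =ᶠ[𝓝 z₀] fun _ => g b := h2.eventuallyEq_of_mem (hU.mem_nhds hz₀)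
      exact hne (by rw [h3.deriv_eq, deriv_const])
    · exact h
  obtain ⟨ε, hε, hε1⟩ := Metric.eventually_nhds_iff_ball.1
    ((eventually_nhdsWithin_iff.1 h1).and
      ((show ∀ᶠ z in 𝓝 b, z ∈ U from hU.mem_nhds hb).and
        (show ∀ᶠ z in 𝓝 b, z ≠ a from isOpen_ne.mem_nhds (Ne.symm hne'))))
  set r := ε / 2 with hr
  have hr0 : 0 < r := by positivity
  have hball : ∀ z ∈ closedBall b r, z ∈ ball b ε := closedBall_subset_ball (by linarith)
  have hsph : ∀ z ∈ sphere b r, g z ≠ g a := by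
    intro z hz; rw [hab]
    exact (hε1 z (hball z (sphere_subset_closedBall hz))).1 (ne_of_mem_sphere hz hr0.ne')
  obtain ⟨ζ, hζ, hmin⟩ := (isCompact_sphere b r).exists_isMinOn
    ((NormedSpace.sphere_nonempty (E := ℂ)).2 hr0.le)
    (f := fun z => ‖g z - g a‖) ((hg.continuousOn.mono fun z hz =>
      (hε1 z (hball z (sphere_subset_closedBall hz))).2.1).sub continuousOn_const).norm
  set m := ‖g ζ - g a‖ with hm
  have hm0 : 0 < m := norm_pos_iff.2 (sub_ne_zero.2 (hsph ζ hζ))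
  have hu : TendstoUniformlyOn F g l (sphere b r ∪ {a, b}) := by
    refine (tendstoLocallyUniformlyOn_iff_forall_isCompact hU).1 hlim _ ?_ ?_
    · rintro z (hz | rfl | rfl)
      · exact (hε1 z (hball z (sphere_subset_closedBall hz))).2.1
      · exact ha
      · exact hb
    · exact (isCompact_sphere b r).union (Set.toFinite {a, b}).isCompact
  obtain ⟨n, hn⟩ := (Metric.tendstoUniformlyOn_iff.1 hu (m / 8) (by positivity)).exists
  have hna := hn a (by simp)
  have hnb := hn b (by simp)
  rw [dist_eq_norm] at hna hnb
  set q : ℂ → ℂ := fun z => (F n z - F n a)⁻¹ with hq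
  have hq0 : ∀ z ∈ closedBall b r, F n z - F n a ≠ 0 := by
    intro z hz h; have h2 := hε1 z (hball z hz); exact h2.2.2 (hinj n h2.2.1 ha (sub_eq_zero.1 h))
  have hqd : DifferentiableOn ℂ q (closedBall b r) :=
    (((hF n).mono fun z hz => (hε1 z (hball z hz)).2.1).sub_const _).inv hq0
  have hqb := norm_le_of_forall_mem_frontier_norm_le (C := 2 / m) (isBounded_ball (x := b) (r := r))
    (DifferentiableOn.diffContOnCl (by rwa [closure_ball b hr0.ne'])) (fun z hz => by
      rw [frontier_ball b hr0.ne'] at hz; have h3 := hn z (Or.inl hz); rw [dist_eq_norm] at h3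
      have h4 : m ≤ ‖g z - g a‖ := hmin hz; have h5 : m / 2 ≤ ‖F n z - F n a‖ := by
        have : g z - g a = (g z - F n z) + (F n z - F n a) - (g a - F n a) := by ring
        have h6 : ‖g z - g a‖ ≤ ‖g z - F n z‖ + ‖F n z - F n a‖ + ‖g a - F n a‖ := by
          rw [this]; exact (norm_sub_le _ _).trans (by gcongr; exact norm_add_le _ _)
        linarith
      rw [hq, norm_inv, inv_le_comm₀ (by linarith) (by positivity), inv_div]
      exact h5) (subset_closure (mem_ball_self hr0))
  have hb0 := hq0 b (mem_closedBall_self hr0.le)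
  rw [hq, norm_inv, inv_le_comm₀ (norm_pos_iff.2 hb0) (by positivity), inv_div] at hqb
  have : F n b - F n a = -(g b - F n b) + (g a - F n a) := by rw [hab]; ring
  have h6 : ‖F n b - F n a‖ ≤ ‖g b - F n b‖ + ‖g a - F n a‖ := by
    rw [this]; exact (norm_add_le _ _).trans (by rw [norm_neg])
  linarith

/-- Normalized injective holomorphic maps into the unit disk. -/
def diskMaps (U : Set ℂ) (z₀ : ℂ) : Set (ℂ → ℂ) :=
  {f | DifferentiableOn ℂ f U ∧ InjOn f U ∧ MapsTo f U (ball 0 1) ∧ f z₀ = 0}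

lemma exists_diskMap_deriv_maximal {U : Set ℂ} (hU : IsOpen U) (hUc : IsPreconnected U)
    (hb : Bornology.IsBounded U) {z₀ : ℂ} (hz₀ : z₀ ∈ U) :
    ∃ g ∈ diskMaps U z₀, ∀ f ∈ diskMaps U z₀, ‖deriv f z₀‖ ≤ ‖deriv g z₀‖ := by
  set S : Set ℝ := (fun f : ℂ → ℂ => ‖deriv f z₀‖) '' diskMaps U z₀ with hS
  obtain ⟨M, hM, hUM⟩ := hb.subset_ball_lt 0 z₀
  set f₀ : ℂ → ℂ := fun z => (z - z₀) / M with hf₀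
  have hf₀' : HasDerivAt f₀ (1 / M) z₀ := ((hasDerivAt_id z₀).sub_const z₀).div_const _
  have hf₀m : f₀ ∈ diskMaps U z₀ := by
    refine ⟨by simp only [hf₀]; fun_prop, fun z _ w _ h => ?_, fun z hz => ?_, by simp [hf₀]⟩
    · have hM' : (M : ℂ) ≠ 0 := ofReal_ne_zero.2 hM.ne'; simpa [hf₀, div_left_inj' hM'] using h
    · rw [mem_ball_zero_iff, norm_div, norm_real, Real.norm_of_nonneg hM.le, div_lt_one hM]
      simpa [dist_eq] using hUM hz
  obtain ⟨d, hd, hdU⟩ := Metric.isOpen_iff.1 hU z₀ hz₀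
  have hbdd : BddAbove S := by
    refine ⟨1 / d, ?_⟩; rintro _ ⟨f, hf, rfl⟩
    have := norm_deriv_mul_le hd (hf.1.mono hdU) (hf.2.2.1.mono_left hdU); rw [le_div_iff₀ hd]
    exact this.trans (by nlinarith [norm_nonneg (f z₀)])
  have hpos : 0 < sSup S := by
    refine lt_of_lt_of_le ?_ (le_csSup hbdd (mem_image_of_mem _ hf₀m)); simp [hf₀'.deriv, hM.ne']
  obtain ⟨x, -, hx, hxS⟩ := exists_seq_tendsto_sSup (Set.Nonempty.image _ ⟨f₀, hf₀m⟩) hbdd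
  choose F hF hFx using hxS
  set l : Ultrafilter ℕ := hyperfilter ℕ
  have hlim : ∀ z ∈ U, ∃ y, Tendsto (fun n => F n z) l (𝓝 y) := by
    intro z hz
    obtain ⟨y, -, hy⟩ := (isCompact_closedBall (0 : ℂ) 1).ultrafilter_le_nhds (l.map fun n => F n z)
      (by
        rw [Ultrafilter.coe_map, le_principal_iff, mem_map]
        exact univ_mem' fun n => ball_subset_closedBall ((hF n).2.2.1 hz))
    exact ⟨y, hy⟩
  choose! g hg using hlim
  have hlu : TendstoLocallyUniformlyOn F g l U := by
    rw [Metric.tendstoLocallyUniformlyOn_iff]; intro ε hε z hz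
    obtain ⟨δ, hδ, hδU⟩ := Metric.isOpen_iff.1 hU z hz
    have hL : ∀ n, ∀ w ∈ ball z δ, dist (F n w) (F n z) ≤ 2 / δ * dist w z := by
      intro n w hw
      refine dist_le_div_mul_dist_of_mapsTo_ball ((hF n).1.mono hδU) (fun y hy => ?_) hw
      have h1 := (hF n).2.2.1 (hδU hy); have h2 := (hF n).2.2.1 hz; rw [mem_ball_zero_iff] at h1 h2
      rw [mem_closedBall, dist_eq_norm]; exact (norm_sub_le _ _).trans (by linarith)
    have hLg : ∀ w ∈ ball z δ, dist (g w) (g z) ≤ 2 / δ * dist w z := by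
      intro w hw
      exact le_of_tendsto ((hg w (hδU hw)).dist (hg z hz)) (Eventually.of_forall fun n => hL n w hw)
    set ρ := min δ (ε * δ / 8) with hρ; have hρ0 : 0 < ρ := by positivity
    refine ⟨ball z ρ, mem_nhdsWithin_of_mem_nhds (ball_mem_nhds z hρ0), ?_⟩
    filter_upwards [Metric.tendsto_nhds.1 (hg z hz) (ε / 4) (by positivity)] with n hn w hw
    have hwδ : w ∈ ball z δ := ball_subset_ball (min_le_left _ _) hw
    have h3 : 2 / δ * dist w z ≤ ε / 4 := by
      have : dist w z ≤ ε * δ / 8 := (mem_ball.1 hw).le.trans (min_le_right _ _)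
      calc 2 / δ * dist w z ≤ 2 / δ * (ε * δ / 8) := by gcongr
        _ = ε / 4 := by field_simp; ring
    have h4 := hL n w hwδ; have h5 := hLg w hwδ
    have h6 : dist (g w) (F n w) ≤ dist (g w) (g z) + dist (F n z) (g z) + dist (F n w) (F n z) := by
      have := dist_triangle4 (g w) (g z) (F n z) (F n w)
      rw [dist_comm (g z), dist_comm (F n z) (F n w)] at this; exact this
    linarith
  have hgd : DifferentiableOn ℂ g U := hlu.differentiableOn (Eventually.of_forall fun n => (hF n).1) hU
  have hder := (hlu.deriv (Eventually.of_forall fun n => (hF n).1) hU).tendsto_at hz₀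
  have hval : ‖deriv g z₀‖ = sSup S := by
    refine tendsto_nhds_unique hder.norm ((hx.mono_left (Nat.hyperfilter_le_atTop)).congr fun n => ?_)
    exact (hFx n).symm
  have hne : deriv g z₀ ≠ 0 := norm_pos_iff.1 (by rw [hval]; exact hpos)
  have hginj := injOn_of_tendstoLocallyUniformlyOn hU hUc (fun n => (hF n).1) (fun n => (hF n).2.1)
    hlu hz₀ hne
  refine ⟨g, ⟨hgd, hginj, ?_, ?_⟩, fun f hf => ?_⟩
  · have h1 : g '' U ⊆ closedBall 0 1 := by
      rintro _ ⟨z, hz, rfl⟩; exact isClosed_closedBall.mem_of_tendsto (hg z hz)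
        (Eventually.of_forall fun n => ball_subset_closedBall ((hF n).2.2.1 hz))
    have h2 := interior_mono h1
    rw [(injOn_holomorphic hU hgd hginj).1.interior_eq, interior_closedBall _ one_ne_zero] at h2
    exact fun z hz => h2 (mem_image_of_mem g hz)
  · refine tendsto_nhds_unique (hg z₀ hz₀) (tendsto_const_nhds.congr fun n => ?_)
    exact ((hF n).2.2.2).symm
  · rw [hval]; exact le_csSup hbdd (mem_image_of_mem _ hf)

/-- The Riemann mapping theorem for bounded simply connected domains. -/
lemma exists_riemann_map {U : Set ℂ} (hU : IsOpen U) (hUc : IsSimplyConnected U)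
    (hb : Bornology.IsBounded U) {z₀ : ℂ} (hz₀ : z₀ ∈ U) :
    ∃ f : ℂ → ℂ, DifferentiableOn ℂ f U ∧ InjOn f U ∧ f '' U = ball 0 1 ∧ f z₀ = 0 := by
  obtain ⟨g, ⟨hgd, hgi, hgm, hg0⟩, hmax⟩ :=
    exists_diskMap_deriv_maximal hU hUc.isPathConnected.isConnected.isPreconnected hb hz₀
  refine ⟨g, hgd, hgi, subset_antisymm (image_subset_iff.2 hgm) fun w hw => ?_, hg0⟩
  by_contra hwg
  have hw1 : ‖w‖ < 1 := by simpa using hw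
  set G := fun z => mob w (g z) with hG
  have hGd : ∀ z ∈ U, HasDerivAt G ((1 - conj w * w) / (1 - conj w * g z) ^ 2 * deriv g z) z := by
    intro z hz; exact (hasDerivAt_mob hw1 (by simpa using hgm hz)).comp z
      (hgd.differentiableAt (hU.mem_nhds hz)).hasDerivAt
  have hGlt : ∀ z ∈ U, ‖G z‖ < 1 := fun z hz => norm_mob_lt_one hw1 (by simpa using hgm hz)
  have hG0 : ∀ z ∈ U, G z ≠ 0 := by
    intro z hz h; have h1 : mob w (g z) = mob w w := by rw [mob_self]; exact h
    exact hwg ⟨z, hz, mob_injOn hw1 (hgm hz) hw h1⟩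
  obtain ⟨s, hsc, hs⟩ := exists_continuousOn_pow_eq hUc hU
    (g := G) (fun z hz => (hGd z hz).continuousAt.continuousWithinAt)
    (by rintro ⟨z, hz, h⟩; exact hG0 z hz h) two_ne_zero
  have hsd : ∀ z ∈ U, HasDerivAt s (((1 - conj w * w) / (1 - conj w * g z) ^ 2 * deriv g z) / (2 * s z)) z :=
    fun z hz => hasDerivAt_of_sq (hsc.continuousAt (hU.mem_nhds hz)) hs (hGd z hz) (hG0 z hz)
  have hslt : ∀ z ∈ U, ‖s z‖ < 1 := by
    intro z hz; have := hGlt z hz; rw [← hs, norm_pow] at this; nlinarith [norm_nonneg (s z)]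
  set c := s z₀ with hc
  have hc1 := hslt z₀ hz₀
  have hk : (fun z => mob c (s z)) ∈ diskMaps U z₀ := by
    refine ⟨fun z hz => ?_, fun z hz z' hz' h => ?_, fun z hz => ?_, mob_self c⟩
    · exact ((hasDerivAt_mob hc1 (hslt z hz)).comp z (hsd z hz)).differentiableAt.differentiableWithinAt
    · have h1 := mob_injOn hc1 (by simpa using hslt z hz) (by simpa using hslt z' hz') h
      refine hgi hz hz' (mob_injOn hw1 (hgm hz) (hgm hz') ?_); change G z = G z'
      rw [← hs, ← hs, h1]
    · simpa using norm_mob_lt_one hc1 (hslt z hz)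
  have h1 := hmax _ hk
  have h2 : HasDerivAt (fun z => mob c (s z)) _ z₀ := (hasDerivAt_mob hc1 hc1).comp z₀ (hsd z₀ hz₀)
  have hcw : ‖c‖ ^ 2 = ‖w‖ := by rw [← norm_pow, hc, hs, hG]; simp [hg0, mob]
  have hcpos : 0 < ‖c‖ := by
    rw [norm_pos_iff]; intro h; exact hG0 z₀ hz₀ (by rw [← hs, ← hc, h]; simp)
  have h3 : 0 < 1 - ‖c‖ ^ 2 := by nlinarith
  have h4 : 0 < 1 - ‖w‖ ^ 2 := by nlinarith [norm_nonneg w]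
  rw [h2.deriv, hg0, one_sub_conj_mul_self, one_sub_conj_mul_self, ← hc] at h1
  simp only [mul_zero, sub_zero, one_pow, div_one, norm_mul, norm_div, norm_pow, norm_real,
    Real.norm_of_nonneg h3.le, Real.norm_of_nonneg h4.le, norm_ofNat] at h1
  have h5 : 0 < ‖deriv g z₀‖ := norm_pos_iff.2 ((injOn_holomorphic hU hgd hgi).2.2 z₀ hz₀)
  have h6 : (1 - ‖c‖ ^ 2) / (1 - ‖c‖ ^ 2) ^ 2 * ((1 - ‖w‖ ^ 2) * ‖deriv g z₀‖ / (2 * ‖c‖)) =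
      ‖deriv g z₀‖ * ((1 + ‖c‖ ^ 2) / (2 * ‖c‖)) := by
    rw [← hcw]; field_simp; ring
  rw [h6] at h1
  have h7 : 1 < (1 + ‖c‖ ^ 2) / (2 * ‖c‖) := by
    rw [lt_div_iff₀ (by positivity)]
    nlinarith [sq_nonneg (1 - ‖c‖), mul_self_pos.2 (sub_ne_zero.2 hc1.ne')]
  nlinarith

/-- Two Riemann maps with the same center differ by a rotation. -/
lemma exists_unimodular_of_riemann_maps {f g : ℂ → ℂ} {U : Set ℂ} (hU : IsOpen U)
    (hf : DifferentiableOn ℂ f U) (hfi : InjOn f U) (hfU : f '' U = ball 0 1)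
    (hg : DifferentiableOn ℂ g U) (hgi : InjOn g U) (hgU : g '' U = ball 0 1)
    {z₀ : ℂ} (hz₀ : z₀ ∈ U) (hf0 : f z₀ = 0) (hg0 : g z₀ = 0) :
    ∃ μ : ℂ, ‖μ‖ = 1 ∧ ∀ z ∈ U, g z = μ * f z := by
  have key : ∀ f g : ℂ → ℂ, DifferentiableOn ℂ f U → InjOn f U → f '' U = ball 0 1 →
      DifferentiableOn ℂ g U → g '' U = ball 0 1 → f z₀ = 0 → g z₀ = 0 →
      DifferentiableOn ℂ (g ∘ Function.invFunOn f U) (ball 0 1) ∧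
      MapsTo (g ∘ Function.invFunOn f U) (ball 0 1) (ball 0 1) ∧
      (g ∘ Function.invFunOn f U) 0 = 0 ∧ ∀ z ∈ U, (g ∘ Function.invFunOn f U) (f z) = g z := by
    intro f g hf hfi hfU hg hgU hf0 hg0; obtain ⟨-, h2, -⟩ := injOn_holomorphic hU hf hfi
    rw [hfU] at h2; have hm : MapsTo (Function.invFunOn f U) (ball 0 1) U := fun w hw => by
      rw [← hfU] at hw; exact Function.invFunOn_mem hw
    have hl : ∀ z ∈ U, (g ∘ Function.invFunOn f U) (f z) = g z := fun z hz => by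
      rw [Function.comp_apply, hfi.leftInvOn_invFunOn hz]
    refine ⟨hg.comp h2 hm, fun w hw => ?_, ?_, hl⟩
    · rw [← hgU]; exact mem_image_of_mem g (hm hw)
    · have := hl z₀ hz₀; rwa [hf0, hg0] at this
  obtain ⟨d1, m1, z1, l1⟩ := key f g hf hfi hfU hg hgU hf0 hg0
  obtain ⟨d2, m2, z2, l2⟩ := key g f hg hgi hgU hf hfU hg0 hf0
  set k := g ∘ Function.invFunOn f U with hk
  set k' := f ∘ Function.invFunOn g U with hk'
  have hkk : ∀ w ∈ ball (0 : ℂ) 1, k' (k w) = w := by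
    intro w hw; rw [← hfU] at hw; obtain ⟨z, hz, rfl⟩ := hw; rw [l1 z hz, l2 z hz]
  have hn : ∀ w ∈ ball (0 : ℂ) 1, ‖k w‖ = ‖w‖ := by
    intro w hw
    refine le_antisymm (norm_le_norm_of_mapsTo_ball d1 (m1.mono_right ball_subset_closedBall) z1 (by simpa using hw)) ?_
    have := norm_le_norm_of_mapsTo_ball d2 (m2.mono_right ball_subset_closedBall) z2 (by simpa using m1 hw)
    rwa [hkk w hw] at this
  have hhalf : (1 / 2 : ℂ) ∈ ball (0 : ℂ) 1 := by simp; norm_num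
  have hds : ‖dslope k 0 (1 / 2)‖ = 1 / 1 := by
    rw [dslope_of_ne _ (by norm_num), slope_def_field, z1, sub_zero, sub_zero, norm_div, hn _ hhalf]
    norm_num
  have haff := affine_of_mapsTo_ball_of_norm_dslope_eq_div d1
    (by rw [z1]; exact m1.mono_right ball_subset_closedBall) hhalf hds
  refine ⟨dslope k 0 (1 / 2), by simpa using hds, fun z hz => ?_⟩
  have h3 := haff (hfU ▸ mem_image_of_mem f hz : f z ∈ ball (0 : ℂ) 1)
  rw [l1 z hz, z1] at h3
  simpa [mul_comm] using h3

/-- The shape of an equilateral triangle with corners `0`, `p`, `p * exp (π i / n)` and angles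
`π / n` in the flat plane (`k = 0`) or in the Poincaré disk (`k = 1`). -/
structure Shape where
  n : ℕ
  p : ℝ
  k : ℝ
  three_le : 3 ≤ n
  p_pos : 0 < p
  k_nonneg : 0 ≤ k
  rel : k * p ^ 2 = 2 * Real.cos (Real.pi / n) - 1

namespace Shape

variable (S : Shape)

def c : ℝ := Real.cos (Real.pi / S.n)
def s : ℝ := Real.sin (Real.pi / S.n)
def c2 : ℝ := Real.cos (Real.pi / S.n / 2)
def s2 : ℝ := Real.sin (Real.pi / S.n / 2)
def κ : ℂ := ⟨S.c, S.s⟩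

lemma angle_pos : 0 < Real.pi / S.n := by
  have := S.three_le
  have : (0 : ℝ) < S.n := by exact_mod_cast (by omega : 0 < S.n)
  have := Real.pi_pos
  positivity

lemma angle_le : Real.pi / S.n ≤ Real.pi / 3 := by
  have := S.three_le
  have : (3 : ℝ) ≤ S.n := by exact_mod_cast this
  have := Real.pi_pos
  gcongr

lemma c_half : S.c = 1 - 2 * S.s2 ^ 2 := by
  have h := Real.cos_two_mul (Real.pi / S.n / 2)
  rw [show 2 * (Real.pi / S.n / 2) = Real.pi / S.n by ring] at h
  have h2 := Real.sin_sq_add_cos_sq (Real.pi / S.n / 2)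
  simp only [c, s2]; linarith

lemma s_half : S.s = 2 * S.s2 * S.c2 := by
  have h := Real.sin_two_mul (Real.pi / S.n / 2)
  rwa [show 2 * (Real.pi / S.n / 2) = Real.pi / S.n by ring] at h

lemma sq_half : S.s2 ^ 2 + S.c2 ^ 2 = 1 := Real.sin_sq_add_cos_sq _

lemma s2_pos : 0 < S.s2 := Real.sin_pos_of_pos_of_lt_pi (by have := S.angle_pos; linarith)
    (by have := S.angle_le; linarith [Real.pi_pos])

lemma c2_pos : 0 < S.c2 := Real.cos_pos_of_mem_Ioo ⟨by have := S.angle_pos; linarith [Real.pi_pos], by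
    have := S.angle_le; linarith [Real.pi_pos]⟩

lemma s_pos : 0 < S.s := by
  rw [s_half]; have := S.s2_pos; have := S.c2_pos; positivity

lemma c_lt_one : S.c < 1 := by
  rw [c_half]; have := S.s2_pos; nlinarith

lemma half_le_c : 1 / 2 ≤ S.c := by
  rw [← Real.cos_pi_div_three]
  exact Real.cos_le_cos_of_nonneg_of_le_pi S.angle_pos.le (by linarith [Real.pi_pos]) S.angle_le

lemma c_sq_add : S.c ^ 2 + S.s ^ 2 = 1 := Real.cos_sq_add_sin_sq _

lemma rel' : S.k * S.p ^ 2 = 2 * S.c - 1 := S.rel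

lemma kp_lt_one : S.k * S.p ^ 2 < 1 := by rw [rel']; have := S.c_lt_one; linarith

lemma norm_κ : ‖S.κ‖ = 1 := by
  have : ‖S.κ‖ ^ 2 = 1 := by
    rw [← normSq_eq_norm_sq, normSq_apply]; simp only [κ]; linarith [S.c_sq_add]
  nlinarith [norm_nonneg S.κ]

lemma κ_mul_conj : S.κ * conj S.κ = 1 := by
  rw [mul_conj, normSq_eq_norm_sq, norm_κ]; simp

lemma κ_ne_zero : S.κ ≠ 0 := fun h => by have := S.norm_κ; simp [h] at this

/-- The geodesic half-turn about the midpoint of the side from `0` to `p`. -/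
def turn (z : ℂ) : ℂ := (S.p - z) / (1 - S.k * S.p * z)
/-- The rotation of order three which permutes the corners. -/
def ρ (z : ℂ) : ℂ := S.κ * S.turn z
def ρ' (z : ℂ) : ℂ := (S.κ * S.p - z) / (S.κ - S.k * S.p * z)
/-- The reflection in the altitude through `0`. -/
def σ (z : ℂ) : ℂ := S.κ * conj z

def f2 (z : ℂ) : ℝ := S.s * z.re - S.c * z.im
def f3 (z : ℂ) : ℝ := S.s * S.p * (1 + S.k * normSq z) - 2 * S.c * S.s * z.re - 2 * S.c * (1 - S.c) * z.im
/-- Negative on the side of `p` of the altitude through `0`. -/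
def alt (z : ℂ) : ℝ := S.c2 * z.im - S.s2 * z.re

def T : Set ℂ := {z | 0 ≤ z.im ∧ 0 ≤ S.f2 z ∧ 0 ≤ S.f3 z ∧ S.k * normSq z < 1}
def Ω : Set ℂ := {z | 0 < z.im ∧ 0 < S.f2 z ∧ 0 < S.f3 z ∧ S.k * normSq z < 1}

lemma Ω_subset_T : S.Ω ⊆ S.T := fun _ h => ⟨h.1.le, h.2.1.le, h.2.2.1.le, h.2.2.2⟩

lemma continuous_f2 : Continuous S.f2 := by unfold f2; fun_prop
lemma continuous_f3 : Continuous S.f3 := by unfold f3; fun_prop (disch := exact continuous_normSq)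
lemma isOpen_Ω : IsOpen S.Ω :=
  (isOpen_lt continuous_const continuous_im).inter ((isOpen_lt continuous_const S.continuous_f2).inter
    ((isOpen_lt continuous_const S.continuous_f3).inter
      (isOpen_lt (continuous_const.mul continuous_normSq) continuous_const)))

lemma norm_le {z : ℂ} (hz : z ∈ S.T) : ‖z‖ ≤ S.p := by
  obtain ⟨h1, h2, h3, h4⟩ := hz
  have hs := S.s_pos
  have hp := S.p_pos
  have hc := S.half_le_c
  have hc1 := S.c_lt_one
  have hcs := S.c_sq_add
  have hr := norm_nonneg z
  have hsq : normSq z = ‖z‖ ^ 2 := normSq_eq_norm_sq z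
  have hsq' : z.re * z.re + z.im * z.im = ‖z‖ ^ 2 := by rw [← hsq, normSq_apply]
  have hx : 0 ≤ z.re := by
    have : 0 ≤ S.s * z.re := by unfold f2 at h2; nlinarith
    nlinarith
  have hB : S.s * ‖z‖ ≤ S.s * z.re + (1 - S.c) * z.im := by
    refine abs_le_of_sq_le_sq' ?_ (by nlinarith) |>.2
    have e : (S.s * z.re + (1 - S.c) * z.im) ^ 2 - (S.s * ‖z‖) ^ 2 = 2 * (1 - S.c) * z.im * S.f2 z := by
      rw [mul_pow, ← hsq']; unfold f2; linear_combination (- z.im ^ 2) * hcs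
    have : 0 ≤ 2 * (1 - S.c) * z.im * S.f2 z := by
      have : 0 ≤ 1 - S.c := by linarith
      positivity
    linarith
  have h5 : 0 ≤ S.s * ((S.p - ‖z‖) * (1 - S.k * S.p * ‖z‖)) := by
    have e : S.s * ((S.p - ‖z‖) * (1 - S.k * S.p * ‖z‖)) =
        S.s * S.p * (1 + S.k * ‖z‖ ^ 2) - 2 * S.c * (S.s * ‖z‖) := by
      linear_combination (-S.s * ‖z‖) * S.rel'
    rw [e]; unfold f3 at h3; rw [hsq] at h3; nlinarith
  by_contra! hlt
  have h6 : 0 < 1 - S.k * S.p * ‖z‖ := by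
    have : S.k * S.p * ‖z‖ ≤ S.k * ‖z‖ ^ 2 := by
      have := mul_le_mul_of_nonneg_left hlt.le (mul_nonneg S.k_nonneg hr); nlinarith
    rw [hsq] at h4; linarith
  have : 0 < S.s * ((‖z‖ - S.p) * (1 - S.k * S.p * ‖z‖)) := mul_pos hs (mul_pos (by linarith) h6)
  nlinarith

lemma T_eq : S.T = {z | 0 ≤ z.im ∧ 0 ≤ S.f2 z ∧ 0 ≤ S.f3 z} ∩ closedBall 0 S.p := by
  ext z
  constructor
  · intro h; exact ⟨⟨h.1, h.2.1, h.2.2.1⟩, by simpa using S.norm_le h⟩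
  · rintro ⟨h, hz⟩; refine ⟨h.1, h.2.1, h.2.2, ?_⟩; rw [mem_closedBall_zero_iff] at hz
    have := S.kp_lt_one; rw [normSq_eq_norm_sq]; have : S.k * ‖z‖ ^ 2 ≤ S.k * S.p ^ 2 := by
      have := S.k_nonneg; gcongr
    linarith

lemma isCompact_T : IsCompact S.T := by
  rw [T_eq]
  refine (isCompact_closedBall 0 S.p).inter_left ?_
  exact (isClosed_le continuous_const continuous_im).inter
    ((isClosed_le continuous_const S.continuous_f2).inter
    (isClosed_le continuous_const S.continuous_f3))

lemma isBounded_Ω : Bornology.IsBounded S.Ω := S.isCompact_T.isBounded.subset S.Ω_subset_T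

lemma normSq_one_sub {z : ℂ} : normSq (1 - S.k * S.p * z) - S.k * normSq (S.p - z) =
    (1 - S.k * S.p ^ 2) * (1 - S.k * normSq z) := by
  simp only [normSq_apply, sub_re, sub_im, mul_re, mul_im, ofReal_re, ofReal_im, one_re, one_im]
  ring

lemma den_pos {z : ℂ} (hz : S.k * normSq z < 1) : 0 < normSq (1 - S.k * S.p * z) := by
  have h := S.normSq_one_sub (z := z)
  have h1 : 0 < (1 - S.k * S.p ^ 2) * (1 - S.k * normSq z) :=
    mul_pos (by linarith [S.kp_lt_one]) (by linarith)
  have := mul_nonneg S.k_nonneg (normSq_nonneg (S.p - z))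
  linarith

lemma den_ne_zero {z : ℂ} (hz : S.k * normSq z < 1) : 1 - S.k * S.p * z ≠ 0 := normSq_pos.1 (S.den_pos hz)

lemma κ_sub_ne_zero {z : ℂ} (hz : S.k * normSq z < 1) : S.κ - S.k * S.p * z ≠ 0 := by
  intro h
  have h1 : normSq (S.k * S.p * z) = 1 := by
    rw [← sub_eq_zero.1 h, normSq_eq_norm_sq, norm_κ]; norm_num
  rw [normSq_mul, normSq_mul, normSq_ofReal, normSq_ofReal] at h1
  have e : S.k * S.k * (S.p * S.p) * normSq z = (S.k * S.p ^ 2) * (S.k * normSq z) := by ring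
  rw [e] at h1
  have h2 := mul_nonneg S.k_nonneg (normSq_nonneg z)
  have h3 := S.kp_lt_one
  nlinarith

lemma turn_re_im {z : ℂ} (hz : S.k * normSq z < 1) :
    (S.turn z).re * normSq (1 - S.k * S.p * z) = (S.p - z.re) * (1 - S.k * S.p * z.re) + S.k * S.p * z.im ^ 2 ∧
    (S.turn z).im * normSq (1 - S.k * S.p * z) = -(1 - S.k * S.p ^ 2) * z.im := by
  have h0 := (S.den_pos hz).ne'
  constructor
  · rw [turn, div_re, add_mul, div_mul_cancel₀ _ h0, div_mul_cancel₀ _ h0]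
    simp only [sub_re, sub_im, mul_re, mul_im, ofReal_re, ofReal_im, one_re, one_im]; ring
  · rw [turn, div_im, sub_mul, div_mul_cancel₀ _ h0, div_mul_cancel₀ _ h0]
    simp only [sub_re, sub_im, mul_re, mul_im, ofReal_re, ofReal_im, one_re, one_im]; ring

lemma k_normSq_turn {z : ℂ} (hz : S.k * normSq z < 1) : S.k * normSq (S.turn z) < 1 := by
  have h0 := S.den_pos hz
  rw [turn, normSq_div, ← mul_div_assoc, div_lt_one h0]
  have h := S.normSq_one_sub (z := z)
  have h1 : 0 < (1 - S.k * S.p ^ 2) * (1 - S.k * normSq z) :=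
    mul_pos (by linarith [S.kp_lt_one]) (by linarith)
  linarith

lemma k_normSq_ρ {z : ℂ} (hz : S.k * normSq z < 1) : S.k * normSq (S.ρ z) < 1 := by
  rw [ρ, normSq_mul, normSq_eq_norm_sq S.κ, norm_κ]
  simpa using S.k_normSq_turn hz

lemma ρ_im {z : ℂ} (hz : S.k * normSq z < 1) : (S.ρ z).im * normSq (1 - S.k * S.p * z) = S.f3 z := by
  obtain ⟨h1, h2⟩ := S.turn_re_im hz
  have : (S.ρ z).im = S.c * (S.turn z).im + S.s * (S.turn z).re := by simp [ρ, κ, mul_im]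
  rw [this, f3, normSq_apply z]
  linear_combination (-(S.s * z.re) + S.c * z.im) * S.rel' + S.s * h1 + S.c * h2

lemma f2_ρ {z : ℂ} (hz : S.k * normSq z < 1) :
    S.f2 (S.ρ z) * normSq (1 - S.k * S.p * z) = (1 - S.k * S.p ^ 2) * z.im := by
  obtain ⟨h1, h2⟩ := S.turn_re_im hz
  have e1 : (S.ρ z).im = S.c * (S.turn z).im + S.s * (S.turn z).re := by simp [ρ, κ, mul_im]
  have e2 : (S.ρ z).re = S.c * (S.turn z).re - S.s * (S.turn z).im := by simp [ρ, κ, mul_re]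
  rw [f2, e1, e2]
  linear_combination (-1 : ℝ) * h2 - (S.turn z).im * normSq (1 - S.k * S.p * z) * S.c_sq_add

lemma kp_complex : (S.k : ℂ) * S.p ^ 2 = S.κ + conj S.κ - 1 := by
  rw [add_conj, ← ofReal_pow, ← ofReal_mul, rel']
  push_cast [κ]; ring

lemma κ_mul_sub : S.κ * (S.κ - S.k * S.p ^ 2) = S.κ - 1 := by
  rw [S.kp_complex]; linear_combination -S.κ_mul_conj

lemma one_sub_κ_mul : 1 - S.κ * (S.k * S.p ^ 2) = S.κ - S.κ ^ 2 := by
  rw [S.kp_complex]; linear_combination -S.κ_mul_conj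

lemma ρ_ρ {z : ℂ} (hz : S.k * normSq z < 1) : S.ρ (S.ρ z) = S.ρ' z := by
  have h1 := S.den_ne_zero hz
  have h2 := S.den_ne_zero (S.k_normSq_ρ hz)
  have h3 := S.κ_sub_ne_zero hz
  have e : S.ρ z * (1 - S.k * S.p * z) = S.κ * (S.p - z) := by
    rw [ρ, turn, mul_assoc, div_mul_cancel₀ _ h1]
  rw [ρ, turn, mul_div_assoc', ρ', div_eq_div_iff h2 h3]
  refine mul_right_cancel₀ h1 ?_
  linear_combination (-S.κ * (S.κ - S.k * S.p * z) + (S.κ * S.p - z) * (S.k * S.p)) * e +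
    (z * (S.κ - S.k * S.p * z)) * S.κ_mul_sub - (S.κ * S.p - z) * S.one_sub_κ_mul

lemma ρ_ρ' {z : ℂ} (hz : S.k * normSq z < 1) : S.ρ (S.ρ' z) = z := by
  have h3 := S.κ_sub_ne_zero hz
  have h1 : 1 - S.k * S.p * S.ρ' z ≠ 0 := by
    rw [← S.ρ_ρ hz]; exact S.den_ne_zero (S.k_normSq_ρ (S.k_normSq_ρ hz))
  have e : S.ρ' z * (S.κ - S.k * S.p * z) = S.κ * S.p - z := by rw [ρ', div_mul_cancel₀ _ h3]
  rw [ρ, turn, mul_div_assoc', div_eq_iff h1]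
  refine mul_right_cancel₀ h3 ?_
  linear_combination (-S.κ + z * S.k * S.p) * e

lemma ρ'_ρ {z : ℂ} (hz : S.k * normSq z < 1) : S.ρ' (S.ρ z) = z := by
  rw [← S.ρ_ρ (S.k_normSq_ρ hz), S.ρ_ρ hz, S.ρ_ρ' hz]

lemma σ_σ (z : ℂ) : S.σ (S.σ z) = z := by
  simp only [σ, map_mul, conj_conj]
  linear_combination z * S.κ_mul_conj

lemma normSq_σ (z : ℂ) : normSq (S.σ z) = normSq z := by
  rw [σ, normSq_mul, normSq_conj, normSq_eq_norm_sq S.κ, norm_κ]; ring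

lemma σ_re_im (z : ℂ) : (S.σ z).re = S.c * z.re + S.s * z.im ∧ (S.σ z).im = S.f2 z := by
  constructor
  · simp only [σ, mul_re, conj_re, conj_im, κ]; ring
  · simp only [σ, mul_im, conj_re, conj_im, κ, f2]; ring

lemma f2_σ (z : ℂ) : S.f2 (S.σ z) = z.im := by
  rw [← (S.σ_re_im _).2, σ_σ]

lemma f3_σ (z : ℂ) : S.f3 (S.σ z) = S.f3 z := by
  obtain ⟨h1, h2⟩ := S.σ_re_im z
  rw [f3, f3, normSq_σ, h1, h2, f2]
  linear_combination (-2 * S.c * z.im) * S.c_sq_add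

lemma alt_σ (z : ℂ) : S.alt (S.σ z) = -S.alt z := by
  obtain ⟨h1, h2⟩ := S.σ_re_im z
  rw [alt, alt, h1, h2, f2, s_half, c_half]
  linear_combination (2 * S.s2 * z.re - 2 * S.s2 ^ 2 * S.c2 * 0 * z.im) * S.sq_half

lemma σ_ρ_eq {z : ℂ} : S.σ (S.ρ z) = conj (S.turn z) := by
  simp only [σ, ρ, map_mul]
  linear_combination (conj (S.turn z)) * S.κ_mul_conj

lemma σ_ρ_σ_ρ {z : ℂ} (hz : S.k * normSq z < 1) : S.σ (S.ρ (S.σ (S.ρ z))) = z := by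
  have h1 := S.den_ne_zero hz
  have h2 := S.den_ne_zero (S.k_normSq_turn hz)
  have e : S.turn z * (1 - S.k * S.p * z) = S.p - z := by rw [turn, div_mul_cancel₀ _ h1]
  rw [σ_ρ_eq, σ_ρ_eq]
  have h3 : S.turn (conj (S.turn z)) = conj (S.turn (S.turn z)) := by simp [turn]
  rw [h3, conj_conj]
  rw [turn, div_eq_iff h2]
  refine mul_right_cancel₀ h1 ?_
  linear_combination (-1 + z * S.k * S.p) * e

lemma σ_mem_T {z : ℂ} (hz : z ∈ S.T) : S.σ z ∈ S.T := by
  obtain ⟨h1, h2, h3, h4⟩ := hz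
  exact ⟨by rwa [(S.σ_re_im z).2], by rwa [f2_σ], by rwa [f3_σ], by rwa [normSq_σ]⟩

lemma σ_mem_Ω {z : ℂ} (hz : z ∈ S.Ω) : S.σ z ∈ S.Ω := by
  obtain ⟨h1, h2, h3, h4⟩ := hz
  exact ⟨by rwa [(S.σ_re_im z).2], by rwa [f2_σ], by rwa [f3_σ], by rwa [normSq_σ]⟩

lemma ρ'_im {z : ℂ} (hz : S.k * normSq z < 1) :
    (S.ρ' z).im * normSq (S.κ - S.k * S.p * z) = (1 - S.k * S.p ^ 2) * S.f2 z := by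
  have h0 : normSq (S.κ - S.k * S.p * z) ≠ 0 := (normSq_pos.2 (S.κ_sub_ne_zero hz)).ne'
  rw [ρ', div_im, sub_mul, div_mul_cancel₀ _ h0, div_mul_cancel₀ _ h0, f2]
  simp only [sub_re, sub_im, mul_re, mul_im, ofReal_re, ofReal_im, κ]
  ring

lemma f3_ρ {z : ℂ} (hz : S.k * normSq z < 1) : ∃ r > 0, S.f3 (S.ρ z) = r * S.f2 z := by
  have h1 := S.ρ_im (S.k_normSq_ρ hz)
  have h2 := S.den_pos (S.k_normSq_ρ hz)
  have h3 := S.ρ'_im hz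
  have h4 := normSq_pos.2 (S.κ_sub_ne_zero hz)
  rw [S.ρ_ρ hz] at h1
  refine ⟨normSq (1 - S.k * S.p * S.ρ z) * (1 - S.k * S.p ^ 2) / normSq (S.κ - S.k * S.p * z),
    div_pos (mul_pos h2 (by linarith [S.kp_lt_one])) h4, ?_⟩
  rw [← h1, div_mul_eq_mul_div, eq_div_iff h4.ne', mul_assoc _ (1 - _) _, ← h3]
  ring

lemma ρ_mem_T {z : ℂ} (hz : z ∈ S.T) : S.ρ z ∈ S.T := by
  obtain ⟨h1, h2, h3, h4⟩ := hz
  have hd := S.den_pos h4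
  have hk : 0 < 1 - S.k * S.p ^ 2 := by linarith [S.kp_lt_one]
  refine ⟨?_, ?_, ?_, S.k_normSq_ρ h4⟩
  · rw [← S.ρ_im h4] at h3; exact nonneg_of_mul_nonneg_left h3 hd
  · have := S.f2_ρ h4; exact nonneg_of_mul_nonneg_left (by rw [this]; positivity) hd
  · obtain ⟨r, hr, e⟩ := S.f3_ρ h4; rw [e]; positivity

lemma ρ_mem_Ω {z : ℂ} (hz : z ∈ S.Ω) : S.ρ z ∈ S.Ω := by
  obtain ⟨h1, h2, h3, h4⟩ := hz
  have hd := S.den_pos h4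
  have hk : 0 < 1 - S.k * S.p ^ 2 := by linarith [S.kp_lt_one]
  refine ⟨?_, ?_, ?_, S.k_normSq_ρ h4⟩
  · rw [← S.ρ_im h4] at h3; exact pos_of_mul_pos_left h3 hd.le
  · have := S.f2_ρ h4; exact pos_of_mul_pos_left (by rw [this]; positivity) hd.le
  · obtain ⟨r, hr, e⟩ := S.f3_ρ h4; rw [e]; positivity

lemma ρ'_mem_T {z : ℂ} (hz : z ∈ S.T) : S.ρ' z ∈ S.T := by
  rw [← S.ρ_ρ hz.2.2.2]; exact S.ρ_mem_T (S.ρ_mem_T hz)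

lemma ρ'_mem_Ω {z : ℂ} (hz : z ∈ S.Ω) : S.ρ' z ∈ S.Ω := by
  rw [← S.ρ_ρ hz.2.2.2]; exact S.ρ_mem_Ω (S.ρ_mem_Ω hz)

lemma differentiableAt_ρ {z : ℂ} (hz : S.k * normSq z < 1) : DifferentiableAt ℂ S.ρ z := by
  have := S.den_ne_zero hz
  unfold ρ turn
  fun_prop (disch := assumption)

lemma continuousOn_ρ : ContinuousOn S.ρ S.T :=
  fun _ hz => (S.differentiableAt_ρ hz.2.2.2).continuousAt.continuousWithinAt

lemma continuous_σ : Continuous S.σ := continuous_const.mul continuous_conj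

lemma real_mem_T {x : ℝ} : (x : ℂ) ∈ S.T ↔ 0 ≤ x ∧ x ≤ S.p := by
  have hs := S.s_pos
  have e3 : S.f3 x = S.s * ((S.p - x) * (1 - S.k * S.p * x)) := by
    simp only [f3, normSq_ofReal, ofReal_re, ofReal_im]; linear_combination (S.s * x) * S.rel'
  have e2 : S.f2 x = S.s * x := by simp [f2]
  constructor
  · intro h; have h2 := h.2.1; rw [e2] at h2; have h4 := S.norm_le h; rw [norm_real] at h4
    exact ⟨nonneg_of_mul_nonneg_right h2 hs, (le_abs_self x).trans h4⟩
  · rintro ⟨h0, h1⟩; have hk := S.k_nonneg; have hkp := S.kp_lt_one; have hp := S.p_pos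
    have h5 : S.k * S.p * x ≤ S.k * S.p ^ 2 := by rw [pow_two, ← mul_assoc]; gcongr
    have h6 : S.k * (x * x) ≤ S.k * S.p ^ 2 := by rw [pow_two]; gcongr
    refine ⟨by simp, by rw [e2]; positivity, ?_, by rw [normSq_ofReal]; linarith⟩; rw [e3]
    exact mul_nonneg hs.le (mul_nonneg (by linarith) (by linarith))

lemma exists_eq_ofReal {z : ℂ} (h : z.im = 0) : ∃ t : ℝ, z = t := ⟨z.re, Complex.ext rfl h⟩

lemma eq_ofReal {z : ℂ} (h : z.im = 0) : z = (z.re : ℂ) := by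
  apply Complex.ext <;> simp [h]

/-- The sides of the triangle are the images of the side from `0` to `p`. -/
lemma exists_side {z : ℂ} (hz : z ∈ S.T) (hzΩ : z ∉ S.Ω) : z.im = 0 ∨ (S.ρ z).im = 0 ∨ (S.ρ' z).im = 0 := by
  by_contra! h
  obtain ⟨h1, h2, h3⟩ := h
  refine hzΩ ⟨lt_of_le_of_ne hz.1 (Ne.symm h1), ?_, ?_, hz.2.2.2⟩
  · refine lt_of_le_of_ne hz.2.1 fun h => h3 ?_; have := S.ρ'_im hz.2.2.2
    rw [← h, mul_zero, mul_eq_zero] at this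
    exact this.resolve_right (normSq_pos.2 (S.κ_sub_ne_zero hz.2.2.2)).ne'
  · refine lt_of_le_of_ne hz.2.2.1 fun h => h2 ?_; have := S.ρ_im hz.2.2.2
    rw [← h, mul_eq_zero] at this; exact this.resolve_right (S.den_pos hz.2.2.2).ne'

lemma ρ_notMem_Ω {z : ℂ} (hz : z ∈ S.T) (h : z ∉ S.Ω) : S.ρ z ∉ S.Ω := fun h' =>
  h (by rw [← S.ρ'_ρ hz.2.2.2]; exact S.ρ'_mem_Ω h')

lemma ρ'_notMem_Ω {z : ℂ} (hz : z ∈ S.T) (h : z ∉ S.Ω) : S.ρ' z ∉ S.Ω := fun h' =>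
  h (by rw [← S.ρ_ρ' hz.2.2.2]; exact S.ρ_mem_Ω h')

lemma ofReal_notMem_Ω (x : ℝ) : (x : ℂ) ∉ S.Ω := fun h => by simpa using h.1

lemma ρ_zero : S.ρ 0 = S.κ * S.p := by simp [ρ, turn]
lemma ρ_p : S.ρ S.p = 0 := by simp [ρ, turn]

lemma f2_smul (t : ℝ) (z : ℂ) : S.f2 (t * z) = t * S.f2 z := by
  simp only [f2, re_ofReal_mul, im_ofReal_mul]; ring

lemma alt_smul (t : ℝ) (z : ℂ) : S.alt (t * z) = t * S.alt z := by
  simp only [alt, re_ofReal_mul, im_ofReal_mul]; ring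

lemma f2_add (z w : ℂ) : S.f2 (z + w) = S.f2 z + S.f2 w := by
  simp only [f2, add_re, add_im]; ring

lemma alt_add (z w : ℂ) : S.alt (z + w) = S.alt z + S.alt w := by
  simp only [alt, add_re, add_im]; ring

lemma normSq_smul (t : ℝ) (z : ℂ) : normSq (t * z) = t ^ 2 * normSq z := by
  rw [normSq_mul, normSq_ofReal]; ring

lemma k_normSq_smul {t : ℝ} (ht0 : 0 ≤ t) (ht : t ≤ 1) {z : ℂ} (hz : S.k * normSq z < 1) :
    S.k * normSq (t * z) < 1 := by
  rw [normSq_smul]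
  have h1 : t ^ 2 ≤ 1 := pow_le_one₀ ht0 ht
  have h2 : t ^ 2 * (S.k * normSq z) ≤ S.k * normSq z :=
    mul_le_of_le_one_left (mul_nonneg S.k_nonneg (normSq_nonneg z)) h1
  linarith

lemma f3_smul_pos {t : ℝ} (ht0 : 0 ≤ t) (ht : t < 1) {z : ℂ} (h3 : 0 ≤ S.f3 z) (hz : S.k * normSq z < 1) :
    0 < S.f3 (t * z) := by
  have e : S.f3 (t * z) = t * S.f3 z + S.s * S.p * ((1 - t) * (1 - t * (S.k * normSq z))) := by
    simp only [f3, normSq_smul, re_ofReal_mul, im_ofReal_mul]; ring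
  have h1 : t * (S.k * normSq z) < 1 := by
    have := mul_nonneg S.k_nonneg (normSq_nonneg z); nlinarith
  have := S.s_pos
  have := S.p_pos
  have : 0 < 1 - t := by linarith
  have : 0 < 1 - t * (S.k * normSq z) := by linarith
  rw [e]; positivity

lemma smul_mem_Ω {t : ℝ} (ht0 : 0 < t) (ht : t ≤ 1) {z : ℂ} (hz : z ∈ S.Ω) : (t * z : ℂ) ∈ S.Ω := by
  obtain ⟨h1, h2, h3, h4⟩ := hz
  rcases ht.lt_or_eq with h | rfl
  · exact ⟨by rw [im_ofReal_mul]; positivity, by rw [f2_smul]; positivity,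
      S.f3_smul_pos ht0.le h h3.le h4, S.k_normSq_smul ht0.le ht h4⟩
  · simpa using ⟨h1, h2, h3, h4⟩

/-- Near the corner `0` the triangle is a sector. -/
lemma exists_sector : ∃ δ > 0, ∀ z : ℂ, ‖z‖ < δ → 0 < S.f3 z ∧ S.k * normSq z < 1 := by
  have h : ∀ᶠ z in 𝓝 (0 : ℂ), 0 < S.f3 z ∧ S.k * normSq z < 1 := by
    refine (IsOpen.eventually_mem (isOpen_lt continuous_const S.continuous_f3) ?_).and
      (IsOpen.eventually_mem (isOpen_lt (continuous_const.mul continuous_normSq) continuous_const) ?_)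
    · have := S.s_pos; have := S.p_pos; rw [mem_ofPred_eq]
      simp only [f3, map_zero, zero_re, zero_im]; ring_nf; positivity
    · change S.k * normSq 0 < 1; rw [map_zero, mul_zero]; exact one_pos
  obtain ⟨δ, hδ, h⟩ := Metric.eventually_nhds_iff_ball.1 h
  exact ⟨δ, hδ, fun z hz => h z (by simpa using hz)⟩

lemma convex_sector (δ : ℝ) : Convex ℝ ({z : ℂ | 0 < z.im ∧ 0 < S.f2 z} ∩ ball 0 δ) := by
  refine Convex.inter ?_ (convex_ball _ _)
  intro x hx y hy a b ha hb hab
  rw [mem_ofPred_eq, real_smul, real_smul]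
  refine ⟨?_, ?_⟩
  · rw [add_im, im_ofReal_mul, im_ofReal_mul]
    rcases ha.eq_or_lt with rfl | ha'
    · have : b = 1 := by linarith
      subst this; simpa using hy.1
    · have := mul_pos ha' hx.1; have := mul_nonneg hb hy.1.le; linarith
  · rw [f2_add, f2_smul, f2_smul]
    rcases ha.eq_or_lt with rfl | ha'
    · have : b = 1 := by linarith
      subst this; simpa using hy.2
    · have := mul_pos ha' hx.2; have := mul_nonneg hb hy.2.le; linarith

lemma exists_smul_norm_lt {z : ℂ} {δ : ℝ} (hδ : 0 < δ) : ∃ t : ℝ, 0 < t ∧ t ≤ 1 ∧ ‖(t * z : ℂ)‖ < δ := by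
  refine ⟨min 1 (δ / (2 * (‖z‖ + 1))), by positivity, min_le_left _ _, ?_⟩
  rw [norm_mul, norm_real, Real.norm_of_nonneg (by positivity)]
  have h := norm_nonneg z
  calc min 1 (δ / (2 * (‖z‖ + 1))) * ‖z‖ ≤ δ / (2 * (‖z‖ + 1)) * (‖z‖ + 1) := by
        gcongr
        · exact min_le_right _ _
        · linarith
    _ = δ / 2 := by field_simp
    _ < δ := by linarith

/-- A direction into the half of the triangle on the side of `p`. -/
def dir : ℂ := ⟨1 + S.c2, S.s2⟩

lemma dir_im : S.dir.im = S.s2 := rfl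
lemma f2_dir : S.f2 S.dir = S.s + S.s2 := by
  have := S.sq_half
  simp only [f2, dir]
  rw [s_half, c_half]
  linear_combination (2 * S.s2) * this
lemma alt_dir : S.alt S.dir = -S.s2 := by simp only [alt, dir]; ring

lemma isSimplyConnected_Ω : IsSimplyConnected S.Ω := by
  obtain ⟨δ, hδ, hsec⟩ := S.exists_sector
  obtain ⟨r, hr0, hr1, hr⟩ : ∃ r : ℝ, 0 < r ∧ r ≤ 1 ∧ r * S.p < δ := by
    obtain ⟨r, h1, h2, h3⟩ := exists_smul_norm_lt (z := (S.p : ℂ)) hδ; refine ⟨r, h1, h2, ?_⟩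
    rwa [norm_mul, norm_real, norm_real, Real.norm_of_nonneg h1.le, Real.norm_of_nonneg S.p_pos.le] at h3
  obtain ⟨q, hq0, hq1, hq⟩ := exists_smul_norm_lt (z := S.dir) hδ
  have hsmall : ∀ z ∈ S.Ω, (r * z : ℂ) ∈ {z : ℂ | 0 < z.im ∧ 0 < S.f2 z} ∩ ball 0 δ := by
    intro z hz; have h := S.smul_mem_Ω hr0 hr1 hz; refine ⟨⟨h.1, h.2.1⟩, ?_⟩
    rw [mem_ball_zero_iff, norm_mul, norm_real, Real.norm_of_nonneg hr0.le]
    have := S.norm_le (S.Ω_subset_T hz); nlinarith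
  have hbase : (q * S.dir : ℂ) ∈ {z : ℂ | 0 < z.im ∧ 0 < S.f2 z} ∩ ball 0 δ := by
    have := S.s2_pos; have := S.s_pos; refine ⟨⟨?_, ?_⟩, by simpa using hq⟩
    · rw [im_ofReal_mul, dir_im]; positivity
    · rw [f2_smul, f2_dir]; positivity
  have hsub : {z : ℂ | 0 < z.im ∧ 0 < S.f2 z} ∩ ball 0 δ ⊆ S.Ω := fun z hz =>
    ⟨hz.1.1, hz.1.2, hsec z (by simpa using hz.2)⟩
  let mid : C(S.Ω, S.Ω) := ⟨fun z => ⟨r * z, S.smul_mem_Ω hr0 hr1 z.2⟩, by fun_prop⟩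
  let bp : S.Ω := ⟨q * S.dir, hsub hbase⟩
  have H1 : (ContinuousMap.id S.Ω).Homotopic mid := by
    refine ⟨⟨⟨fun x => ⟨((1 - x.1 * (1 - r) : ℝ) : ℂ) * x.2, S.smul_mem_Ω ?_ ?_ x.2.2⟩, by fun_prop⟩, ?_, ?_⟩⟩
    · have := x.1.2.1; have := x.1.2.2; nlinarith
    · have := x.1.2.1; nlinarith
    · intro x; ext1; simp
    · intro x; ext1; simp [mid]
  have H2 : mid.Homotopic (ContinuousMap.const S.Ω bp) := by
    refine ⟨⟨⟨fun x => ⟨(1 - x.1 : ℝ) • (r * x.2 : ℂ) + (x.1 : ℝ) • (q * S.dir : ℂ), hsub ?_⟩, by fun_prop⟩, ?_, ?_⟩⟩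
    · exact S.convex_sector δ (hsmall _ x.2.2) hbase (by have := x.1.2.2; linarith) x.1.2.1 (by ring)
    · intro x; ext1; simp [mid]
    · intro x; ext1; simp [bp]
  have : ContractibleSpace S.Ω := (contractible_iff_id_nullhomotopic _).2 ⟨bp, H1.trans H2⟩
  exact SimplyConnectedSpace.ofContractible _

/-- The half of the open triangle on the side of `p`. -/
def half : Set ℂ := {z ∈ S.Ω | S.alt z < 0}

lemma smul_mem_half {t : ℝ} (ht0 : 0 < t) (ht : t ≤ 1) {z : ℂ} (hz : z ∈ S.half) : (t * z : ℂ) ∈ S.half :=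
  ⟨S.smul_mem_Ω ht0 ht hz.1, by rw [alt_smul]; exact mul_neg_of_pos_of_neg ht0 hz.2⟩

lemma isPreconnected_half : IsPreconnected S.half := by
  obtain ⟨δ, hδ, hsec⟩ := S.exists_sector
  set K := {z : ℂ | 0 < z.im ∧ 0 < S.f2 z} ∩ ball 0 δ ∩ {z | S.alt z < 0} with hK
  have hKc : Convex ℝ K := by
    refine (S.convex_sector δ).inter ?_; intro x hx y hy a b ha hb hab
    simp only [real_smul, mem_ofPred_eq] at *
    rw [alt_add, alt_smul, alt_smul]
    rcases ha.eq_or_lt with rfl | ha'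
    · have : b = 1 := by linarith
      subst this; simpa using hy
    · have := mul_neg_of_pos_of_neg ha' hx; have := mul_nonpos_of_nonneg_of_nonpos hb hy.le
      linarith
  have hKs : K ⊆ S.half := fun z hz => ⟨⟨hz.1.1.1, hz.1.1.2, hsec z (by simpa using hz.1.2)⟩, hz.2⟩
  have hray : ∀ z ∈ S.half, ∃ t : ℝ, 0 < t ∧ t ≤ 1 ∧ (t * z : ℂ) ∈ K := by
    intro z hz; obtain ⟨t, h0, h1, h2⟩ := exists_smul_norm_lt (z := z) hδ
    have h := S.smul_mem_half h0 h1 hz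
    exact ⟨t, h0, h1, ⟨⟨h.1.1, h.1.2.1⟩, by simpa using h2⟩, h.2⟩
  have hrc : ∀ z ∈ S.half, IsPreconnected ((fun t : ℝ => (t * z : ℂ)) '' Ioc 0 1 ∪ K) := by
    intro z hz; obtain ⟨t, h0, h1, h2⟩ := hray z hz
    exact IsPreconnected.union (t * z : ℂ) ⟨t, ⟨h0, h1⟩, rfl⟩ h2
      (isPreconnected_Ioc.image _ (by fun_prop)) hKc.isPreconnected
  refine isPreconnected_of_forall_pair fun x hx y hy =>
    ⟨((fun t : ℝ => (t * x : ℂ)) '' Ioc 0 1 ∪ K) ∪ ((fun t : ℝ => (t * y : ℂ)) '' Ioc 0 1 ∪ K), ?_,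
      Or.inl (Or.inl ⟨1, by simp, by simp⟩), Or.inr (Or.inl ⟨1, by simp, by simp⟩), ?_⟩
  · have : ∀ z ∈ S.half, (fun t : ℝ => (t * z : ℂ)) '' Ioc 0 1 ∪ K ⊆ S.half := by
      rintro z hz w (⟨t, ht, rfl⟩ | hw)
      · exact S.smul_mem_half ht.1 ht.2 hz
      · exact hKs hw
    exact union_subset (this x hx) (this y hy)
  · obtain ⟨t, -, -, h⟩ := hray x hx
    exact IsPreconnected.union _ (Or.inr h) (Or.inr h) (hrc x hx) (hrc y hy)

lemma mem_closure_half {z : ℂ} (hz : z ∈ S.T) (ha : S.alt z ≤ 0) : z ∈ closure S.half := by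
  have key : ∀ t : ℝ, t ∈ Ioo (0 : ℝ) 1 → (t * z : ℂ) ∈ closure S.half := by
    intro t ht
    have hlim : Tendsto (fun ε : ℝ => (t * z + ε * S.dir : ℂ)) (𝓝[>] 0) (𝓝 (t * z)) := by
      have : Continuous fun ε : ℝ => (t * z + ε * S.dir : ℂ) := by fun_prop
      simpa using (this.tendsto 0).mono_left nhdsWithin_le_nhds
    refine mem_closure_of_tendsto hlim ?_
    have h3 := hlim.eventually ((isOpen_lt continuous_const S.continuous_f3).mem_nhds
      (S.f3_smul_pos ht.1.le ht.2 hz.2.2.1 hz.2.2.2))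
    have h4 := hlim.eventually ((isOpen_lt (continuous_const.mul continuous_normSq) continuous_const).mem_nhds
      (S.k_normSq_smul ht.1.le ht.2.le hz.2.2.2))
    filter_upwards [h3, h4, self_mem_nhdsWithin] with ε h3 h4 hε; have hε : 0 < ε := hε
    have h1 := mul_nonneg ht.1.le hz.1; have h2 := mul_nonneg ht.1.le hz.2.1
    have h5 := mul_nonpos_of_nonneg_of_nonpos ht.1.le ha; have hs2 := mul_pos hε S.s2_pos
    have hs := mul_pos hε S.s_pos; refine ⟨⟨?_, ?_, h3, h4⟩, ?_⟩
    · rw [add_im, im_ofReal_mul, im_ofReal_mul, dir_im]; linarith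
    · rw [f2_add, f2_smul, f2_smul, f2_dir]; linarith
    · rw [alt_add, alt_smul, alt_smul, alt_dir]; linarith
  have hlim : Tendsto (fun t : ℝ => (t * z : ℂ)) (𝓝[<] 1) (𝓝 z) := by
    have : Continuous fun t : ℝ => (t * z : ℂ) := by fun_prop
    simpa using (this.tendsto 1).mono_left nhdsWithin_le_nhds
  rw [← closure_closure]
  refine mem_closure_of_tendsto hlim ?_
  filter_upwards [Ioo_mem_nhdsLT (show (0 : ℝ) < 1 by norm_num)] with t ht using key t ht

lemma closure_Ω : closure S.Ω = S.T := by
  refine subset_antisymm (closure_minimal S.Ω_subset_T S.isCompact_T.isClosed) fun z hz => ?_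
  rcases le_total (S.alt z) 0 with h | h
  · exact closure_mono (fun z hz => hz.1) (S.mem_closure_half hz h)
  · have h1 := S.mem_closure_half (S.σ_mem_T hz) (by rw [alt_σ]; linarith); rw [← S.σ_σ z]
    exact closure_mono (by rintro _ ⟨w, hw, rfl⟩; exact S.σ_mem_Ω hw.1)
      (image_closure_subset_closure_image S.continuous_σ ⟨_, h1, rfl⟩)

lemma exists_centre : ∃ z ∈ S.Ω, S.σ z = z ∧ S.ρ z = z := by
  have hc2 := S.c2_pos
  have hs2 := S.s2_pos
  have hp := S.p_pos
  have hq := S.sq_half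
  have hcc : S.c < S.c2 := by
    have h1 : S.c2 < 1 := by nlinarith
    rw [c_half]; nlinarith
  obtain ⟨t, ht, h0⟩ : ∃ t ∈ Ioo 0 S.p, S.k * S.p * t ^ 2 - 2 * S.c2 * t + S.p = 0 := by
    have h := intermediate_value_Ioo' hp.le
      (f := fun t => S.k * S.p * t ^ 2 - 2 * S.c2 * t + S.p) (by fun_prop)
    refine h ⟨?_, ?_⟩
    · have := S.rel'
      have : S.k * S.p * S.p ^ 2 - 2 * S.c2 * S.p + S.p = 2 * S.p * (S.c - S.c2) := by
        linear_combination S.p * this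
      rw [this]; nlinarith
    · simpa using hp
  set e : ℂ := ⟨S.c2, S.s2⟩ with he
  have hee : e * conj e = 1 := by rw [mul_conj, normSq_mk]; norm_cast; linarith
  have hκ : S.κ = e ^ 2 := by
    have h1 := S.c_half; have h2 := S.s_half; rw [pow_two]; apply Complex.ext
    · simp only [κ, mul_re, he]; rw [h1]; linear_combination -hq
    · simp only [κ, mul_im, he]; rw [h2]; ring
  have hsum : e + conj e = (2 * S.c2 : ℝ) := by rw [add_conj]
  have hk : S.k * normSq (t * e) < 1 := by
    have : normSq e = 1 := by rw [normSq_mk]; linarith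
    rw [normSq_smul, this, mul_one]; have := S.kp_lt_one; have : S.k * t ^ 2 ≤ S.k * S.p ^ 2 := by
      have := S.k_nonneg; have := ht.2; have := ht.1
      gcongr
    linarith
  have h0' : (S.k * S.p * t ^ 2 - (e + conj e) * t + S.p : ℂ) = 0 := by rw [hsum]; exact_mod_cast h0
  have hρ : S.ρ (t * e) = t * e := by
    rw [ρ, turn, mul_div_assoc', div_eq_iff (S.den_ne_zero hk), hκ]
    linear_combination e ^ 2 * h0' + t * e * hee
  refine ⟨t * e, ⟨?_, ?_, ?_, hk⟩, ?_, hρ⟩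
  · rw [im_ofReal_mul]; exact mul_pos ht.1 hs2
  · rw [f2_smul]; refine mul_pos ht.1 ?_; simp only [f2, he, S.s_half, S.c_half]; nlinarith
  · have := S.ρ_im hk; rw [hρ, im_ofReal_mul] at this; rw [← this]
    exact mul_pos (mul_pos ht.1 hs2) (S.den_pos hk)
  · rw [σ, map_mul, conj_ofReal, hκ]; linear_combination (t * e) * hee

lemma exists_midpoint : ∃ m : ℝ, 0 < m ∧ m < S.p ∧ S.k * S.p * m ^ 2 - 2 * m + S.p = 0 := by
  have hp := S.p_pos
  have h := intermediate_value_Ioo' hp.le (f := fun t => S.k * S.p * t ^ 2 - 2 * t + S.p) (by fun_prop)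
  obtain ⟨m, hm, h0⟩ := h (show (0 : ℝ) ∈ _ from by
    refine ⟨?_, ?_⟩
    · have := S.kp_lt_one
      have e : S.k * S.p * S.p ^ 2 - 2 * S.p + S.p = S.p * (S.k * S.p ^ 2 - 1) := by ring
      rw [e]; nlinarith
    · simpa using hp)
  exact ⟨m, hm.1, hm.2, h0⟩

lemma n_pos : (0 : ℝ) < S.n := by
  have := S.three_le
  exact_mod_cast (by omega : 0 < S.n)

lemma f2_exp (z : ℂ) : S.f2 (exp z) = Real.exp z.re * Real.sin (Real.pi / S.n - z.im) := by
  rw [f2, exp_re, exp_im, Real.sin_sub, s, c]; ring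

def root (w : ℂ) : ℂ := exp (log w / S.n)

lemma root_pow {w : ℂ} (hw : w ≠ 0) : S.root w ^ S.n = w := by
  have := S.n_pos.ne'
  rw [root, ← exp_nat_mul, mul_div_cancel₀ _ (by exact_mod_cast this), exp_log hw]

lemma arg_pos_of_im_pos {w : ℂ} (hw : 0 < w.im) : 0 < w.arg ∧ w.arg < Real.pi := by
  refine ⟨lt_of_le_of_ne (arg_nonneg_iff.2 hw.le) fun h => ?_, lt_of_le_of_ne (arg_le_pi w) fun h => ?_⟩
  · rw [eq_comm, arg_eq_zero_iff] at h; exact hw.ne' h.2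
  · rw [arg_eq_pi_iff] at h; exact hw.ne' h.2

lemma log_div_re_im (w : ℂ) : (log w / S.n).im = w.arg / S.n ∧ (log w / S.n).re = Real.log ‖w‖ / S.n := by
  rw [div_natCast_im, div_natCast_re, log_im, log_re]; exact ⟨rfl, rfl⟩

lemma root_mem_sector {w : ℂ} (hw : 0 < w.im) : 0 < (S.root w).im ∧ 0 < S.f2 (S.root w) := by
  obtain ⟨h1, h2⟩ := arg_pos_of_im_pos hw
  have hn := S.n_pos
  have h3 : w.arg / S.n < Real.pi / S.n := by gcongr
  have h4 : 0 < w.arg / S.n := by positivity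
  have h5 := S.angle_le
  have := Real.pi_pos
  rw [root, f2_exp, exp_im, (S.log_div_re_im w).1]
  exact ⟨mul_pos (Real.exp_pos _) (Real.sin_pos_of_pos_of_lt_pi h4 (by linarith)),
    mul_pos (Real.exp_pos _) (Real.sin_pos_of_pos_of_lt_pi (by linarith) (by linarith))⟩

lemma norm_root_pow {w : ℂ} (hw : w ≠ 0) : ‖S.root w‖ ^ S.n = ‖w‖ := by
  rw [← norm_pow, S.root_pow hw]

lemma arg_lt_of_sector {z : ℂ} (h1 : 0 < z.im) (h2 : 0 < S.f2 z) : 0 < z.arg ∧ z.arg < Real.pi / S.n := by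
  obtain ⟨h3, h4⟩ := arg_pos_of_im_pos h1
  refine ⟨h3, ?_⟩
  by_contra! h
  have h0 : z ≠ 0 := by rintro rfl; simp at h1
  rw [← exp_log h0, f2_exp, log_im] at h2
  have := Real.sin_nonneg_of_nonneg_of_le_pi (x := z.arg - Real.pi / S.n) (by linarith)
    (by linarith [S.angle_pos])
  rw [← neg_sub, Real.sin_neg] at h2
  have := mul_nonneg (Real.exp_pos (log z).re).le this
  linarith

lemma root_pow_self {z : ℂ} (h1 : 0 < z.im) (h2 : 0 < S.f2 z) : S.root (z ^ S.n) = z ∧ 0 < (z ^ S.n).im := by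
  obtain ⟨h3, h4⟩ := S.arg_lt_of_sector h1 h2
  have h0 : z ≠ 0 := by rintro rfl; simp at h1
  have hn := S.n_pos
  have h5 : S.n * z.arg < Real.pi := by rwa [lt_div_iff₀' hn] at h4
  have e : z ^ S.n = exp (S.n * log z) := by rw [exp_nat_mul, exp_log h0]
  have him : (S.n * log z : ℂ).im = S.n * z.arg := by rw [← ofReal_natCast, im_ofReal_mul, log_im]
  have h6 : 0 < S.n * z.arg := by positivity
  constructor
  · rw [e, root, log_exp (by rw [him]; linarith [Real.pi_pos]) (by rw [him]; exact h5.le),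
      mul_div_cancel_left₀ _ (by exact_mod_cast hn.ne'), exp_log h0]
  · rw [e, exp_im, him]; exact mul_pos (Real.exp_pos _) (Real.sin_pos_of_pos_of_lt_pi h6 h5)

lemma f3_ofReal (x : ℝ) : S.f3 x = S.s * ((S.p - x) * (1 - S.k * S.p * x)) := by
  simp only [f3, normSq_ofReal, ofReal_re, ofReal_im]
  linear_combination (S.s * x) * S.rel'

lemma f2_ofReal (x : ℝ) : S.f2 x = S.s * x := by simp [f2]

lemma one_sub_kpx_pos {x : ℝ} (hx : x ≤ S.p) : 0 < 1 - S.k * S.p * x := by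
  have := S.kp_lt_one
  have h5 : S.k * S.p * x ≤ S.k * S.p ^ 2 := by
    have := S.k_nonneg; have := S.p_pos; rw [pow_two, ← mul_assoc]; gcongr
  linarith

section Extension

variable {S}
lemma exists_tendsto_edge {φ : ℂ → ℂ} (hd : DifferentiableOn ℂ φ S.Ω) (hm : MapsTo φ S.Ω (ball 0 1))
    (hp : ∀ y ∉ S.Ω, ∀ s < 1, ∀ᶠ z in 𝓝[S.Ω] y, s < ‖φ z‖) {x : ℝ}
    (h0 : 0 < x) (h1 : x < S.p) : ∃ y, Tendsto φ (𝓝[S.Ω] x) (𝓝 y) := by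
  have hs := S.s_pos
  have hk := (S.real_mem_T.2 ⟨h0.le, h1.le⟩).2.2.2
  have hev : ∀ᶠ z in 𝓝 (x : ℂ), 0 < S.f2 z ∧ 0 < S.f3 z ∧ S.k * normSq z < 1 := by
    refine (IsOpen.eventually_mem (isOpen_lt continuous_const S.continuous_f2) ?_).and
      ((IsOpen.eventually_mem (isOpen_lt continuous_const S.continuous_f3) ?_).and
      (IsOpen.eventually_mem (isOpen_lt (continuous_const.mul continuous_normSq) continuous_const) hk))
    · rw [mem_ofPred_eq, f2_ofReal]; positivity
    · rw [mem_ofPred_eq, f3_ofReal]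
      exact mul_pos hs (mul_pos (by linarith) (S.one_sub_kpx_pos h1.le))
  obtain ⟨r, hr, hball⟩ := Metric.eventually_nhds_iff_ball.1 hev
  have hU : ball (x : ℂ) r ∩ {z | 0 < z.im} ⊆ S.Ω := fun z hz =>
    ⟨hz.2, (hball z hz.1).1, (hball z hz.1).2.1, (hball z hz.1).2.2⟩
  obtain ⟨y, hy⟩ := exists_tendsto_of_half_disk hr (hd.mono hU) (hm.mono_left hU)
    (fun t _ s hs => nhdsWithin_mono _ hU (hp t (S.ofReal_notMem_Ω t) s hs))
  refine ⟨y, ?_⟩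
  rwa [nhdsWithin_eq_nhdsWithin (u := S.Ω) (mem_ball_self hr) isOpen_ball] at hy
  ext z
  exact ⟨fun h => ⟨hU h.1, h.2⟩, fun h => ⟨⟨h.2, h.1.1⟩, h.2⟩⟩

lemma exists_tendsto_corner {φ : ℂ → ℂ} (hd : DifferentiableOn ℂ φ S.Ω) (hm : MapsTo φ S.Ω (ball 0 1))
    (hp : ∀ y ∉ S.Ω, ∀ s < 1, ∀ᶠ z in 𝓝[S.Ω] y, s < ‖φ z‖) : ∃ y, Tendsto φ (𝓝[S.Ω] 0) (𝓝 y) := by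
  obtain ⟨δ, hδ, hsec⟩ := S.exists_sector
  have hn := S.n_pos
  have hn0 : S.n ≠ 0 := by exact_mod_cast hn.ne'
  set U := ball ((0 : ℝ) : ℂ) (δ ^ S.n) ∩ {z : ℂ | 0 < z.im} with hU
  have hroot : MapsTo S.root U S.Ω := by
    intro w hw; have hw0 : w ≠ 0 := by rintro rfl; simpa using hw.2
    obtain ⟨h1, h2⟩ := S.root_mem_sector hw.2; have h3 : ‖S.root w‖ < δ := by
      refine lt_of_pow_lt_pow_left₀ S.n hδ.le ?_; rw [S.norm_root_pow hw0]; simpa using hw.1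
    exact ⟨h1, h2, (hsec _ h3).1, (hsec _ h3).2⟩
  have hrd : DifferentiableOn ℂ S.root U := by
    intro w hw; have : w ∈ slitPlane := mem_slitPlane_iff.2 (Or.inr (ne_of_gt hw.2)); unfold root
    exact (((differentiableAt_id.clog this).div_const _).cexp).differentiableWithinAt
  have hev : ∀ t : ℝ, |t - 0| < δ ^ S.n → ∀ s < 1, ∀ᶠ w in 𝓝[U] (t : ℂ), s < ‖(φ ∘ S.root) w‖ := by
    intro t _ s hs
    set K := {z ∈ S.Ω | ‖φ z‖ ≤ s} with hK
    have hKc : IsCompact K := by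
      refine S.isCompact_T.of_isClosed_subset ?_ fun z hz => S.Ω_subset_T hz.1
      refine isClosed_of_closure_subset fun z hz => ?_; have hf : ∃ᶠ w in 𝓝[S.Ω] z, ‖φ w‖ ≤ s := by
        rw [frequently_nhdsWithin_iff]
        exact (mem_closure_iff_frequently.1 hz).mono fun w hw => ⟨hw.2, hw.1⟩
      by_cases hzΩ : z ∈ S.Ω
      · refine ⟨hzΩ, ?_⟩
        have hc : ContinuousWithinAt (fun z => ‖φ z‖) S.Ω z := (hd.continuousOn z hzΩ).norm
        by_contra! hlt
        obtain ⟨w, h1, h2⟩ := (hf.and_eventually (hc.eventually_const_lt hlt)).exists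
        exact absurd h1 (not_le.2 h2)
      · obtain ⟨w, h1, h2⟩ := (hf.and_eventually (hp z hzΩ s hs)).exists
        exact absurd h1 (not_le.2 h2)
    have hKn : IsClosed ((fun z : ℂ => z ^ S.n) '' K) := (hKc.image (by fun_prop)).isClosed
    have ht : (t : ℂ) ∉ (fun z : ℂ => z ^ S.n) '' K := by
      rintro ⟨z, hz, he⟩; have := (S.root_pow_self hz.1.1 hz.1.2.1).2
      rw [show z ^ S.n = (t : ℂ) from he] at this; simp at this
    have h1 : _ ∈ 𝓝[U] (t : ℂ) := mem_nhdsWithin_of_mem_nhds (hKn.isOpen_compl.mem_nhds ht)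
    filter_upwards [h1, self_mem_nhdsWithin] with w hw hwU
    have hw0 : w ≠ 0 := by rintro rfl; simpa using hwU.2
    by_contra! hle
    exact hw ⟨S.root w, ⟨hroot hwU, hle⟩, S.root_pow hw0⟩
  obtain ⟨y, hy⟩ := exists_tendsto_of_half_disk (f := φ ∘ S.root) (pow_pos hδ S.n) (hd.comp hrd hroot)
    (hm.comp hroot) hev
  refine ⟨y, ?_⟩
  have hlim : Tendsto (fun z : ℂ => z ^ S.n) (𝓝[S.Ω] 0) (𝓝[U] ((0 : ℝ) : ℂ)) := by
    refine tendsto_nhdsWithin_iff.2 ⟨?_, ?_⟩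
    · have : Continuous fun z : ℂ => z ^ S.n := by fun_prop
      simpa [hn0] using (this.tendsto 0).mono_left nhdsWithin_le_nhds
    · filter_upwards [self_mem_nhdsWithin, mem_nhdsWithin_of_mem_nhds (ball_mem_nhds (0 : ℂ) hδ)] with z hz hzb
      refine ⟨?_, (S.root_pow_self hz.1 hz.2.1).2⟩; rw [ofReal_zero, mem_ball_zero_iff, norm_pow]
      exact pow_lt_pow_left₀ (by simpa using hzb) (norm_nonneg z) hn0
  refine (hy.comp hlim).congr' ?_
  filter_upwards [self_mem_nhdsWithin] with z hz
  simp only [Function.comp]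
  rw [(S.root_pow_self hz.1 hz.2.1).1]

/-- Boundary limits of a proper holomorphic map from the triangle to the disk which intertwines `ρ`
with a rotation. -/
lemma exists_tendsto_of_proper {φ : ℂ → ℂ} (hd : DifferentiableOn ℂ φ S.Ω) (hm : MapsTo φ S.Ω (ball 0 1))
    (hp : ∀ y ∉ S.Ω, ∀ s < 1, ∀ᶠ z in 𝓝[S.Ω] y, s < ‖φ z‖)
    {μ : ℂ} (hμ : μ ≠ 0) (hρ : ∀ z ∈ S.Ω, φ (S.ρ z) = μ * φ z) {z : ℂ} (hz : z ∈ S.T) :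
    ∃ y, Tendsto φ (𝓝[S.Ω] z) (𝓝 y) := by
  have hmove : ∀ z ∈ S.T, (∃ y, Tendsto φ (𝓝[S.Ω] (S.ρ z)) (𝓝 y)) → ∃ y, Tendsto φ (𝓝[S.Ω] z) (𝓝 y) := by
    rintro z hz ⟨y, hy⟩; refine ⟨μ⁻¹ * y, ?_⟩
    have h1 : Tendsto S.ρ (𝓝[S.Ω] z) (𝓝[S.Ω] (S.ρ z)) := by
      refine tendsto_nhdsWithin_iff.2 ⟨?_, ?_⟩
      · exact (S.differentiableAt_ρ hz.2.2.2).continuousAt.tendsto.mono_left nhdsWithin_le_nhds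
      · filter_upwards [self_mem_nhdsWithin] with w hw using S.ρ_mem_Ω hw
    refine ((hy.comp h1).const_mul μ⁻¹).congr' ?_; filter_upwards [self_mem_nhdsWithin] with w hw
    simp only [Function.comp]; rw [hρ w hw, inv_mul_cancel_left₀ hμ]
  have hreal : ∀ z ∈ S.T, z.im = 0 → ∃ y, Tendsto φ (𝓝[S.Ω] z) (𝓝 y) := by
    intro z hz hi; obtain ⟨x, rfl⟩ : ∃ x : ℝ, z = x := ⟨z.re, eq_ofReal hi⟩
    obtain ⟨h0, h1⟩ := S.real_mem_T.1 hz
    rcases h0.eq_or_lt with rfl | h0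
    · simpa using exists_tendsto_corner hd hm hp
    rcases h1.eq_or_lt with rfl | h1
    · refine hmove _ hz ?_; rw [ρ_p]; exact exists_tendsto_corner hd hm hp
    · exact exists_tendsto_edge hd hm hp h0 h1
  by_cases hzΩ : z ∈ S.Ω
  · exact ⟨_, hd.continuousOn z hzΩ⟩
  rcases S.exists_side hz hzΩ with h | h | h
  · exact hreal z hz h
  · exact hmove z hz (hreal _ (S.ρ_mem_T hz) h)
  · refine hmove z hz (hmove _ (S.ρ_mem_T hz) ?_); rw [S.ρ_ρ hz.2.2.2]
    exact hreal _ (S.ρ'_mem_T hz) h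

end Extension

/-- The Riemann map of the triangle with its boundary values, up to the position on the boundary. -/
lemma exists_extended_riemann_map : ∃ (φ : ℂ → ℂ) (μ : ℂ), ContinuousOn φ S.T ∧
    DifferentiableOn ℂ φ S.Ω ∧ InjOn φ S.Ω ∧ φ '' S.Ω = ball 0 1 ∧ (∀ z ∈ S.T, z ∉ S.Ω → ‖φ z‖ = 1) ∧
    (∀ z ∈ S.T, φ (S.ρ z) = μ * φ z) ∧ (∀ z ∈ S.T, φ (S.σ z) = conj (φ z)) ∧ φ 0 = 1 ∧
    μ ^ 3 = 1 ∧ μ ≠ 1 := by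
  obtain ⟨c₀, hc₀, hσc, hρc⟩ := S.exists_centre
  obtain ⟨φ, hd, hi, hU, h0⟩ := exists_riemann_map S.isOpen_Ω S.isSimplyConnected_Ω S.isBounded_Ω hc₀
  have hm : MapsTo φ S.Ω (ball 0 1) := fun z hz => hU ▸ mem_image_of_mem φ hz
  have hρd : DifferentiableOn ℂ S.ρ S.Ω := fun z hz =>
    (S.differentiableAt_ρ hz.2.2.2).differentiableWithinAt
  have hρi : InjOn S.ρ S.Ω := fun a ha b hb h => by rw [← S.ρ'_ρ ha.2.2.2, h, S.ρ'_ρ hb.2.2.2]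
  have hρU : S.ρ '' S.Ω = S.Ω := subset_antisymm (by rintro _ ⟨z, hz, rfl⟩; exact S.ρ_mem_Ω hz)
    fun z hz => ⟨S.ρ' z, S.ρ'_mem_Ω hz, S.ρ_ρ' hz.2.2.2⟩
  have hσU : S.σ '' S.Ω = S.Ω := subset_antisymm (by rintro _ ⟨z, hz, rfl⟩; exact S.σ_mem_Ω hz)
    fun z hz => ⟨S.σ z, S.σ_mem_Ω hz, S.σ_σ z⟩
  obtain ⟨μ, hμ, hμe⟩ := exists_unimodular_of_riemann_maps S.isOpen_Ω hd hi hU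
    (hd.comp hρd (fun z hz => S.ρ_mem_Ω hz)) (hi.comp hρi fun z hz => S.ρ_mem_Ω hz)
    (by rw [image_comp, hρU, hU]) hc₀ h0 (by simp only [Function.comp]; rw [hρc, h0])
  have hgd : DifferentiableOn ℂ (fun z => conj (φ (S.σ z))) S.Ω := by
    intro z hz; have h1 : DifferentiableAt ℂ (fun w => φ (S.κ * w)) (conj z) := by
      have : DifferentiableAt ℂ φ (S.κ * conj z) := hd.differentiableAt (S.isOpen_Ω.mem_nhds (S.σ_mem_Ω hz))
      exact this.comp (conj z) (by fun_prop)
    have h2 := differentiableAt_conj_conj_iff.2 h1; exact h2.differentiableWithinAt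
  obtain ⟨ν, hν, hνe⟩ := exists_unimodular_of_riemann_maps S.isOpen_Ω hd hi hU hgd
    (fun a ha b hb h => by
      have h1 := hi (S.σ_mem_Ω ha) (S.σ_mem_Ω hb) (star_injective h); rw [← S.σ_σ a, h1, S.σ_σ])
    (by
      have : (fun z => conj (φ (S.σ z))) = conj ∘ φ ∘ S.σ := rfl
      rw [this, image_comp, image_comp, hσU, hU]; ext z
      refine ⟨?_, fun hz => ⟨conj z, by simpa using hz, conj_conj z⟩⟩; rintro ⟨w, hw, rfl⟩
      simpa using hw) hc₀ h0 (by simp [hσc, h0])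
  have hμ0 : μ ≠ 0 := by rintro rfl; simp at hμ
  have hμ3 : μ ^ 3 = 1 := by
    obtain ⟨z, hz, he⟩ : (1 / 2 : ℂ) ∈ φ '' S.Ω := by rw [hU]; simp; norm_num
    have h1 := hμe _ (S.ρ_mem_Ω (S.ρ_mem_Ω hz)); have h2 := hμe _ (S.ρ_mem_Ω hz)
    have h3 := hμe _ hz; simp only [Function.comp] at h1 h2 h3
    rw [h2, h3, S.ρ_ρ hz.2.2.2, S.ρ_ρ' hz.2.2.2, he] at h1; linear_combination -2 * h1
  have hμ1 : μ ≠ 1 := by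
    rintro rfl
    have h1 : EqOn S.ρ id S.Ω := fun z hz => hi (S.ρ_mem_Ω hz) hz (by simpa using hμe z hz)
    have h2 := h1.of_subset_closure S.continuousOn_ρ continuousOn_id S.Ω_subset_T S.closure_Ω.ge
      (show ((0 : ℝ) : ℂ) ∈ S.T from S.real_mem_T.2 ⟨le_rfl, S.p_pos.le⟩)
    rw [ofReal_zero, ρ_zero] at h2; have := S.p_pos.ne'; simp [S.κ_ne_zero, this] at h2
  obtain ⟨-, hginv, -⟩ := injOn_holomorphic S.isOpen_Ω hd hi
  have hp : ∀ y ∉ S.Ω, ∀ s < 1, ∀ᶠ z in 𝓝[S.Ω] y, s < ‖φ z‖ := by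
    intro y hy s hs; rw [hU] at hginv
    have hK : IsCompact (Function.invFunOn φ S.Ω '' closedBall 0 s) :=
      (isCompact_closedBall 0 s).image_of_continuousOn
        (hginv.continuousOn.mono (closedBall_subset_ball hs))
    have hyK : y ∉ Function.invFunOn φ S.Ω '' closedBall 0 s := by
      rintro ⟨w, hw, rfl⟩; refine hy (Function.invFunOn_mem ?_)
      have : w ∈ φ '' S.Ω := by rw [hU]; exact closedBall_subset_ball hs hw
      exact this
    filter_upwards [mem_nhdsWithin_of_mem_nhds (hK.isClosed.isOpen_compl.mem_nhds hyK),
      self_mem_nhdsWithin] with z hz hzΩ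
    by_contra! hle
    exact hz ⟨φ z, by simpa using hle, hi.leftInvOn_invFunOn hzΩ⟩
  set φ₁ := extendFrom S.Ω φ with hφ₁
  have hlim : ∀ z ∈ S.T, ∃ y, Tendsto φ (𝓝[S.Ω] z) (𝓝 y) := fun z hz =>
    exists_tendsto_of_proper hd hm hp hμ0 hμe hz
  have hc₁ : ContinuousOn φ₁ S.T := continuousOn_extendFrom S.closure_Ω.ge hlim
  have he₁ : ∀ z ∈ S.Ω, φ₁ z = φ z := extendFrom_extends hd.continuousOn
  have hb₁ : ∀ z ∈ S.T, z ∉ S.Ω → ‖φ₁ z‖ = 1 := by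
    intro z hz hzΩ; have ht := (tendsto_extendFrom (hlim z hz)).norm
    have hne : (𝓝[S.Ω] z).NeBot := mem_closure_iff_nhdsWithin_neBot.1 (S.closure_Ω.ge hz)
    refine le_antisymm (le_of_tendsto ht ?_) (le_of_forall_lt fun s hs => ?_)
    · filter_upwards [self_mem_nhdsWithin] with w hw; have := hm hw; rw [mem_ball_zero_iff] at this
      exact this.le
    · obtain ⟨s', h1, h2⟩ := exists_between hs; refine h1.trans_le (ge_of_tendsto ht ?_)
      filter_upwards [hp z hzΩ s' h2] with w hw using hw.le
  have hρ₁ : ∀ z ∈ S.T, φ₁ (S.ρ z) = μ * φ₁ z := by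
    refine EqOn.of_subset_closure (s := S.Ω) (fun z hz => ?_)
      (hc₁.comp S.continuousOn_ρ fun z hz => S.ρ_mem_T hz) (continuousOn_const.mul hc₁) S.Ω_subset_T S.closure_Ω.ge
    rw [he₁ z hz, he₁ _ (S.ρ_mem_Ω hz)]; exact hμe z hz
  have hσ₁ : ∀ z ∈ S.T, conj (φ₁ (S.σ z)) = ν * φ₁ z := by
    refine EqOn.of_subset_closure (s := S.Ω) (fun z hz => ?_)
      (continuous_conj.comp_continuousOn (hc₁.comp S.continuous_σ.continuousOn fun z hz => S.σ_mem_T hz))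
      (continuousOn_const.mul hc₁) S.Ω_subset_T S.closure_Ω.ge
    rw [he₁ z hz, he₁ _ (S.σ_mem_Ω hz)]; exact hνe z hz
  have h0T : (0 : ℂ) ∈ S.T := by simpa using S.real_mem_T.2 ⟨le_rfl, S.p_pos.le⟩
  have h0Ω : (0 : ℂ) ∉ S.Ω := by simpa using S.ofReal_notMem_Ω 0
  set a := φ₁ 0 with ha
  have ha1 : ‖a‖ = 1 := hb₁ 0 h0T h0Ω
  have haa : conj a * a = 1 := by rw [conj_mul', ha1]; simp
  have ha0 : conj a ≠ 0 := by intro h; rw [h] at haa; simp at haa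
  have haν : conj a = ν * a := by have := hσ₁ 0 h0T; rwa [show S.σ 0 = 0 by simp [σ] ] at this
  have haΩ : ∀ z ∈ S.Ω, conj a * φ₁ z = conj a * φ z := fun z hz => by rw [he₁ z hz]
  refine ⟨fun z => conj a * φ₁ z, μ, continuousOn_const.mul hc₁,
    (hd.const_mul (conj a)).congr haΩ, ?_, ?_, ?_, ?_, ?_, haa, hμ3, hμ1⟩
  · intro x hx y hy h; simp only [haΩ x hx, haΩ y hy] at h; exact hi hx hy (mul_left_cancel₀ ha0 h)
  · rw [image_congr haΩ]; ext w; constructor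
    · rintro ⟨z, hz, rfl⟩; have := hm hz; simpa [ha1] using this
    · intro hw; have : a * w ∈ φ '' S.Ω := by rw [hU]; simpa [ha1] using hw
      obtain ⟨z, hz, h⟩ := this; refine ⟨z, hz, ?_⟩; simp only [h]; rw [← mul_assoc, haa, one_mul]
  · intro z hz hzΩ; rw [norm_mul, norm_conj, hb₁ z hz hzΩ, ha1, one_mul]
  · intro z hz; change conj a * φ₁ (S.ρ z) = _; rw [hρ₁ z hz]; ring
  · intro z hz; have h1 : φ₁ (S.σ z) = conj (ν * φ₁ z) := by rw [← hσ₁ z hz, conj_conj]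
    have h2 : conj a * conj ν = a := by rw [← map_mul, mul_comm, ← haν, conj_conj]
    change conj a * φ₁ (S.σ z) = conj (conj a * φ₁ z); simp only [h1, map_mul, conj_conj]
    rw [← mul_assoc, h2]

end Shape

lemma strictMonoOn_Icc_of_Ioo {f : ℝ → ℝ} {a b : ℝ} (hab : a < b) (hc : ContinuousOn f (Icc a b))
    (hf : StrictMonoOn f (Ioo a b)) : StrictMonoOn f (Icc a b) := by
  have hcl : ∀ x ∈ Icc a b, (𝓝[Ioo a b] x).NeBot := fun x hx => by
    rw [← mem_closure_iff_nhdsWithin_neBot, closure_Ioo hab.ne]; exact hx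
  have hlim : ∀ x ∈ Icc a b, Tendsto f (𝓝[Ioo a b] x) (𝓝 (f x)) := fun x hx =>
    (hc x hx).mono Ioo_subset_Icc_self
  intro x hx y hy hxy
  obtain ⟨x', h1, h2⟩ := exists_between hxy
  obtain ⟨y', h3, h4⟩ := exists_between h2
  have hx' : x' ∈ Ioo a b := ⟨hx.1.trans_lt h1, (h3.trans h4).trans_le hy.2⟩
  have hy' : y' ∈ Ioo a b := ⟨hx'.1.trans h3, h4.trans_le hy.2⟩
  have := hcl x hx
  have := hcl y hy
  have e1 : f x ≤ f x' := by
    refine le_of_tendsto (hlim x hx) ?_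
    filter_upwards [self_mem_nhdsWithin, mem_nhdsWithin_of_mem_nhds (Iio_mem_nhds h1)] with t ht htx
    exact (hf ht hx' htx).le
  have e2 : f y' ≤ f y := by
    refine ge_of_tendsto (hlim y hy) ?_
    filter_upwards [self_mem_nhdsWithin, mem_nhdsWithin_of_mem_nhds (Ioi_mem_nhds h4)] with t ht htx
    exact (hf hy' ht htx).le
  exact e1.trans_lt ((hf hx' hy' h3).trans_le e2)

namespace Shape

variable (S : Shape)

lemma alt_ρ'_ofReal {x m : ℝ} (hx : (x : ℂ) ∈ S.T) (hmp : m < S.p)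
    (hm : S.k * S.p * m ^ 2 - 2 * m + S.p = 0) (hxm : x ≤ m) : S.alt (S.ρ' x) ≤ 0 := by
  have h0 : 0 < normSq (S.κ - S.k * S.p * x) := normSq_pos.2 (S.κ_sub_ne_zero hx.2.2.2)
  have e : S.alt (S.ρ' x) * normSq (S.κ - S.k * S.p * x) = -S.s2 * (S.k * S.p * x ^ 2 - 2 * x + S.p) := by
    have h1 : (S.ρ' x).re * normSq (S.κ - S.k * S.p * x) =
        S.p * (1 + S.k * x ^ 2) - S.c * x * (S.k * S.p ^ 2 + 1) := by
      rw [ρ', div_re, add_mul, div_mul_cancel₀ _ h0.ne', div_mul_cancel₀ _ h0.ne']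
      simp only [sub_re, sub_im, mul_re, mul_im, ofReal_re, ofReal_im, κ]
      linear_combination (S.p + S.k * S.p * x ^ 2 * 0) * S.c_sq_add
    have h2 : (S.ρ' x).im * normSq (S.κ - S.k * S.p * x) = S.s * x * (1 - S.k * S.p ^ 2) := by
      rw [S.ρ'_im hx.2.2.2, f2_ofReal]; ring
    rw [alt]
    have h3 : S.c2 * (S.s * x * (1 - S.k * S.p ^ 2)) - S.s2 * (S.p * (1 + S.k * x ^ 2) - S.c * x * (S.k * S.p ^ 2 + 1)) =
        -S.s2 * (S.k * S.p * x ^ 2 - 2 * x + S.p) := by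
      have h4 : S.c2 ^ 2 = 1 - S.s2 ^ 2 := by linarith [S.sq_half]
      rw [S.rel', s_half, c_half]; linear_combination (2 * S.s2 * x * (4 * S.s2 ^ 2)) * h4
    rw [← h3, ← h1, ← h2]; ring
  have h1 : 0 ≤ S.k * S.p * x ^ 2 - 2 * x + S.p := by
    have e2 : S.k * S.p * x ^ 2 - 2 * x + S.p = (m - x) * (2 - S.k * S.p * (x + m)) := by
      linear_combination hm
    have h2 := S.one_sub_kpx_pos hmp.le; have h3 := S.one_sub_kpx_pos (hxm.trans hmp.le); rw [e2]
    exact mul_nonneg (by linarith) (by linarith)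
  have h2 : S.alt (S.ρ' x) * normSq (S.κ - S.k * S.p * x) ≤ 0 := by
    rw [e]; nlinarith [mul_nonneg S.s2_pos.le h1]
  by_contra! h
  have := mul_pos h h0
  linarith

lemma turn_ofReal (x : ℝ) : S.turn x = ((S.p - x) / (1 - S.k * S.p * x) : ℝ) := by
  rw [turn]; push_cast; rfl

lemma turn_turn {z : ℂ} (hz : S.k * normSq z < 1) : S.turn (S.turn z) = z := by
  have h := congrArg conj (S.σ_ρ_σ_ρ (z := conj z) (by rwa [normSq_conj]))
  have h3 : ∀ z, S.turn (conj z) = conj (S.turn z) := fun z => by simp [turn]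
  rw [σ_ρ_eq, σ_ρ_eq, h3, h3, h3, conj_conj, conj_conj, conj_conj] at h
  exact h

lemma turn_ofReal_mem_T {x : ℝ} (hx : (x : ℂ) ∈ S.T) : S.turn x ∈ S.T := by
  have h := S.σ_mem_T (S.ρ_mem_T hx)
  rwa [σ_ρ_eq, turn_ofReal, conj_ofReal, ← turn_ofReal] at h

lemma turn_ofReal_le {x m : ℝ} (hx : (x : ℂ) ∈ S.T) (hm0 : 0 < m) (hmp : m < S.p)
    (hm : S.k * S.p * m ^ 2 - 2 * m + S.p = 0) (hxm : m ≤ x) :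
    (S.p - x) / (1 - S.k * S.p * x) ≤ m := by
  have hd := S.one_sub_kpx_pos (S.real_mem_T.1 hx).2
  have hdm := S.one_sub_kpx_pos hmp.le
  rw [div_le_iff₀ hd]
  nlinarith

/-- The multiplier of the rotation by `-2 π / 3`. -/
def μ₃ : ℂ := ⟨-1 / 2, -(√3 / 2)⟩

lemma sqrt_three_sq : √3 ^ 2 = 3 := Real.sq_sqrt (by norm_num)

/-- The arc of the unit circle from `1` to `conj μ₃`. -/
def arc : Set ℂ := {ζ | ‖ζ‖ = 1 ∧ 0 ≤ ζ.im ∧ (μ₃ * ζ).im ≤ 0}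

lemma μ₃_mul_eq_one {ζ : ℂ} (h : ζ ∈ arc) (h' : μ₃ * ζ ∈ arc) : μ₃ * ζ = 1 := by
  obtain ⟨h1, h2, h3⟩ := h
  obtain ⟨h4, h5, h6⟩ := h'
  have h7 : (μ₃ * ζ).im = 0 := le_antisymm h3 h5
  have h8 := eq_ofReal h7
  rw [h8, im_mul_ofReal, μ₃] at h6
  have h9 : 0 < √3 := by positivity
  simp only at h6
  rw [h8, norm_real] at h4
  rw [h8]
  have h10 : 0 ≤ (μ₃ * ζ).re := by rw [μ₃]; by_contra! h; nlinarith
  rw [Real.norm_of_nonneg h10] at h4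
  rw [h4]; rfl

lemma exists_disk_map : ∃ φ : ℂ → ℂ, ContinuousOn φ S.T ∧ BijOn φ S.T (closedBall 0 1) ∧
    DifferentiableOn ℂ φ S.Ω ∧ φ '' S.Ω = ball 0 1 ∧ (∀ z ∈ S.T, φ (S.ρ z) = μ₃ * φ z) ∧
    (∀ z ∈ S.T, φ (S.σ z) = conj (φ z)) ∧ φ 0 = 1 ∧ (∀ z ∈ S.T, z.im = 0 ↔ φ z ∈ arc) := by
  obtain ⟨φ, μ, hc, hd, hi, hU, hb, hρ, hσ, h0, hμ3, hμ1⟩ := S.exists_extended_riemann_map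
  obtain ⟨m, hm0, hmp, hm⟩ := S.exists_midpoint
  have h3 := sqrt_three_sq
  have h3p : 0 < √3 := by positivity
  have hμn : ‖μ‖ = 1 := by
    have : ‖μ‖ ^ 3 = 1 := by rw [← norm_pow, hμ3, norm_one]
    exact (pow_eq_one_iff_of_nonneg (norm_nonneg _) (by norm_num)).1 this
  have hμc : μ * conj μ = 1 := by rw [mul_conj']; simp [hμn]
  have hμ2 : μ ^ 2 = conj μ := by
    have hne : μ ≠ 0 := by rintro rfl; simp at hμn
    refine mul_left_cancel₀ hne ?_; rw [hμc]; linear_combination hμ3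
  have hμs : μ ^ 2 + μ + 1 = 0 := by
    have : (μ - 1) * (μ ^ 2 + μ + 1) = 0 := by linear_combination hμ3
    exact (mul_eq_zero.1 this).resolve_left (sub_ne_zero.2 hμ1)
  have hμre : μ.re = -1 / 2 := by have := congrArg re hμs; rw [hμ2] at this; simp at this; linarith
  have hρ' : ∀ z ∈ S.T, φ (S.ρ' z) = conj μ * φ z := fun z hz => by
    rw [← S.ρ_ρ hz.2.2.2, hρ _ (S.ρ_mem_T hz), hρ z hz, ← hμ2]; ring
  have hhalfT : S.half ⊆ S.T := fun z hz => S.Ω_subset_T hz.1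
  have him0 : ∀ z ∈ S.half, (φ z).im ≠ 0 := by
    intro z hz h; have h1 : φ (S.σ z) = φ z := by rw [hσ z (hhalfT hz), conj_eq_iff_im.2 h]
    have h2 := hi (S.σ_mem_Ω hz.1) hz.1 h1; have h4 := S.alt_σ z; rw [h2] at h4; have := hz.2
    linarith
  obtain ⟨ε, hε, hεpos⟩ : ∃ ε : ℝ, (ε = 1 ∨ ε = -1) ∧ ∀ z ∈ S.half, 0 < ε * (φ z).im := by
    have hcim : ContinuousOn (fun z => (φ z).im) S.half := continuous_im.comp_continuousOn (hc.mono hhalfT)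
    by_cases hex : ∃ z ∈ S.half, 0 < (φ z).im
    · obtain ⟨z, hz, hzp⟩ := hex; refine ⟨1, Or.inl rfl, fun w hw => ?_⟩; rw [one_mul]
      by_contra! hle
      obtain ⟨y, hy, hy0⟩ := S.isPreconnected_half.intermediate_value hw hz hcim ⟨hle, hzp.le⟩
      exact him0 y hy hy0
    · push Not at hex
      exact ⟨-1, Or.inr rfl, fun w hw => by have := (hex w hw).lt_of_ne (him0 w hw); linarith⟩
  have hεε : ε * ε = 1 := by rcases hε with rfl | rfl <;> norm_num
  have hnn : ∀ z ∈ S.T, S.alt z ≤ 0 → 0 ≤ ε * (φ z).im := by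
    intro z hz ha
    have h1 := ContinuousWithinAt.mem_closure (t := {r : ℝ | 0 ≤ r}) (f := fun z => ε * (φ z).im)
      ((continuousOn_const.mul (continuous_im.comp_continuousOn (hc.mono Subset.rfl))) z hz |>.mono hhalfT)
      (S.mem_closure_half hz ha) (fun w hw => (hεpos w hw).le)
    have h2 : IsClosed {r : ℝ | 0 ≤ r} := isClosed_Ici
    rwa [h2.closure_eq] at h1
  have hbr : ∀ x : ℝ, (x : ℂ) ∈ S.T → (φ x).re ^ 2 + (φ x).im ^ 2 = 1 := by
    intro x hx; have := hb x hx (S.ofReal_notMem_Ω x)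
    have h2 : normSq (φ x) = 1 := by rw [normSq_eq_norm_sq, this]; norm_num
    rw [normSq_apply] at h2; linarith
  have hE : ∀ x : ℝ, (x : ℂ) ∈ S.T → x ≤ m → 0 ≤ ε * (φ x).im ∧
      0 ≤ μ.re * (ε * (φ x).im) - (ε * μ.im) * (φ x).re := by
    intro x hx hxm; have hx0 := (S.real_mem_T.1 hx).1; refine ⟨hnn x hx ?_, ?_⟩
    · have := mul_nonneg S.s2_pos.le hx0; simp only [alt, ofReal_im, ofReal_re]; linarith
    · have h1 := hnn _ (S.ρ'_mem_T hx) (S.alt_ρ'_ofReal hx hmp hm hxm)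
      rw [hρ' x hx, mul_im, conj_re, conj_im] at h1; linarith
  have h0T : ((0 : ℝ) : ℂ) ∈ S.T := S.real_mem_T.2 ⟨le_rfl, S.p_pos.le⟩
  have hpT : ((S.p : ℝ) : ℂ) ∈ S.T := S.real_mem_T.2 ⟨S.p_pos.le, le_rfl⟩
  have hμim : ε * μ.im = -(√3 / 2) := by
    have h1 := (hE 0 h0T hm0.le).2; rw [ofReal_zero, h0, one_re, one_im] at h1
    have h2 : μ.im ^ 2 = 3 / 4 := by
      have : normSq μ = 1 := by rw [normSq_eq_norm_sq, hμn]; norm_num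
      rw [normSq_apply, hμre] at this; linarith
    have h4 : (ε * μ.im - √3 / 2) * (ε * μ.im + √3 / 2) = 0 := by
      linear_combination (ε * ε) * h2 + (3 / 4) * hεε - h3 / 4
    rcases mul_eq_zero.1 h4 with h | h
    · linarith
    · linarith
  have hturn : ∀ x : ℝ, (x : ℂ) ∈ S.T → φ (S.turn x) = conj (μ * φ x) := by
    intro x hx; rw [← hρ x hx, ← hσ _ (S.ρ_mem_T hx), σ_ρ_eq, turn_ofReal, conj_ofReal]
  have hE2 : ∀ x : ℝ, (x : ℂ) ∈ S.T → m ≤ x → ∃ a : ℂ, φ x = conj (μ * a) ∧ 0 ≤ ε * a.im ∧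
      0 ≤ μ.re * (ε * a.im) - (ε * μ.im) * a.re ∧ a.re ^ 2 + a.im ^ 2 = 1 := by
    intro x hx hxm; have hT := S.turn_ofReal_mem_T hx
    have h1 := hturn _ (by rw [← turn_ofReal]; exact hT)
    rw [← turn_ofReal, S.turn_turn hx.2.2.2] at h1; rw [turn_ofReal] at hT h1
    obtain ⟨h2, h4⟩ := hE _ hT (S.turn_ofReal_le hx hm0 hmp hm hxm); exact ⟨_, h1, h2, h4, hbr _ hT⟩
  have hre : ∀ a : ℂ, 0 ≤ ε * a.im → 0 ≤ μ.re * (ε * a.im) - (ε * μ.im) * a.re →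
      a.re ^ 2 + a.im ^ 2 = 1 → 0 < a.re := by
    intro a h1 h2 h4; rw [hμre, hμim] at h2
    by_contra! h
    have h5 : ε * a.im = 0 := by nlinarith
    have h6 : a.im = 0 := by
      have : ε * (ε * a.im) = 0 := by rw [h5, mul_zero]
      rwa [← mul_assoc, hεε, one_mul] at this
    rw [h5] at h2; have : a.re = 0 := by nlinarith
    rw [this, h6] at h4; norm_num at h4
  have hall : ∀ x : ℝ, (x : ℂ) ∈ S.T → φ x ∈ slitPlane ∧ 0 ≤ ε * (φ x).im ∧ ε * (μ * φ x).im ≤ 0 := by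
    intro x hx
    rcases le_total x m with hxm | hxm
    · obtain ⟨h1, h2⟩ := hE x hx hxm; have h4 := hre _ h1 h2 (hbr x hx); refine ⟨Or.inl h4, h1, ?_⟩
      rw [mul_im]; rw [hμre] at *
      have := mul_pos h3p h4
      have e : ε * (-1 / 2 * (φ x).im + μ.im * (φ x).re) = -1 / 2 * (ε * (φ x).im) + (ε * μ.im) * (φ x).re := by ring
      rw [e, hμim]; linarith
    · obtain ⟨a, ha, h1, h2, h4⟩ := hE2 x hx hxm; have h5 := hre _ h1 h2 h4; have := mul_pos h3p h5
      have e : ε * (φ x).im = 1 / 2 * (ε * a.im) + √3 / 2 * a.re := by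
        rw [ha, conj_im, mul_im, hμre]; linear_combination (-a.re) * hμim
      have h6 : 0 < ε * (φ x).im := by rw [e]; linarith
      refine ⟨Or.inr fun h => ?_, h6.le, ?_⟩
      · rw [h, mul_zero] at h6; exact h6.false
      · have : μ * φ x = conj a := by rw [ha, map_mul, ← mul_assoc, hμc, one_mul]
        rw [this, conj_im]; linarith
  have hargc : ContinuousOn (fun x : ℝ => (φ x).arg) (Icc 0 S.p) := by
    intro x hx; have hxT : (x : ℂ) ∈ S.T := S.real_mem_T.2 hx
    have h1 : ContinuousWithinAt (fun x : ℝ => φ x) (Icc 0 S.p) x :=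
      (hc x hxT).comp continuous_ofReal.continuousWithinAt fun y hy => S.real_mem_T.2 hy
    exact ContinuousAt.comp_continuousWithinAt (f := fun x : ℝ => φ x) (continuousAt_arg (hall x hxT).1) h1
  have hmono : StrictMonoOn (fun x : ℝ => (φ x).arg) (Icc 0 S.p) := by
    refine strictMonoOn_Icc_of_Ioo S.p_pos hargc ?_
    let up : ℂ → ℂ := fun z => ⟨z.re, |z.im|⟩
    have hup : Continuous up := by
      have : up = fun z : ℂ => (z.re : ℂ) + (|z.im| : ℝ) * I := by
        ext z; exact (re_add_im (up z)).symm
      rw [this]; fun_prop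
    have hup1 : ∀ z, 0 ≤ z.im → up z = z := fun z hz => by
      apply Complex.ext <;> simp [up, abs_of_nonneg hz]
    set N₀ : Set ℂ := up ⁻¹' ({z | 0 < S.f2 z} ∩ ({z | 0 < S.f3 z} ∩ {z | S.k * normSq z < 1})) with hN₀
    have hN₀o : IsOpen N₀ := ((isOpen_lt continuous_const S.continuous_f2).inter
      ((isOpen_lt continuous_const S.continuous_f3).inter
        (isOpen_lt (continuous_const.mul continuous_normSq) continuous_const))).preimage hup
    have hN₀T : MapsTo up N₀ S.T := fun z hz => ⟨abs_nonneg _, le_of_lt hz.1, le_of_lt hz.2.1, hz.2.2⟩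
    have hcu : ContinuousOn (fun z => φ (up z)) N₀ := hc.comp hup.continuousOn hN₀T
    set N := N₀ ∩ (fun z => φ (up z)) ⁻¹' slitPlane with hN
    have hNΩ : ∀ z ∈ N, 0 < z.im → z ∈ S.Ω := by
      intro z hz hz0; have h1 := hz.1; rw [hN₀, mem_preimage, hup1 z hz0.le] at h1
      exact ⟨hz0, h1.1, h1.2.1, h1.2.2⟩
    have hNs : ∀ z ∈ N, 0 ≤ z.im → φ z ∈ slitPlane := by
      intro z hz hz0; have := hz.2; rwa [mem_preimage, hup1 z hz0] at this
    have key := strictMonoOn_re_of_im_pos (g := fun z => -I * log (φ z)) (a := 0) (b := S.p) (N := N)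
      (hcu.isOpen_inter_preimage hN₀o isOpen_slitPlane) ?_ ?_ ?_ ?_ ?_ ?_
    · refine key.congr fun x hx => ?_; simp [log_im]
    · intro z hz; have : up (conj z) = up z := by simp [up]
      exact ⟨by rw [hN₀, mem_preimage, this]; exact hz.1, by rw [mem_preimage, this]; exact hz.2⟩
    · intro x hx; have hxT : (x : ℂ) ∈ S.T := S.real_mem_T.2 ⟨hx.1.le, hx.2.le⟩
      have hux : up x = x := hup1 x (by simp)
      refine ⟨?_, by rw [mem_preimage, hux]; exact (hall x hxT).1⟩; rw [hN₀, mem_preimage, hux]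
      refine ⟨?_, ?_, hxT.2.2.2⟩
      · rw [mem_ofPred_eq, f2_ofReal]; exact mul_pos S.s_pos hx.1
      · rw [mem_ofPred_eq, f3_ofReal]
        exact mul_pos S.s_pos (mul_pos (by linarith [hx.2]) (S.one_sub_kpx_pos hx.2.le))
    · intro z hz; have h1 := hNΩ z hz.1 hz.2
      have h2 := hd.differentiableAt (S.isOpen_Ω.mem_nhds h1)
      exact ((h2.clog (hNs z hz.1 (le_of_lt hz.2))).const_mul _).differentiableWithinAt
    · intro z hz; refine ContinuousWithinAt.mul continuousWithinAt_const ?_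
      have hsub : N ∩ {z | 0 ≤ z.im} ⊆ S.T := fun w hw => by
        have := hN₀T hw.1.1; rwa [hup1 w hw.2] at this
      exact ((hc z (hsub hz)).mono hsub).clog (hNs z hz.1 hz.2)
    · intro z hz hz0; have h1 := hNΩ z hz hz0
      have h2 : φ z ∈ ball (0 : ℂ) 1 := hU ▸ mem_image_of_mem φ h1
      have h4 : φ z ≠ 0 := slitPlane_ne_zero (hNs z hz hz0.le)
      have h5 := Real.log_neg (norm_pos_iff.2 h4) (by simpa using h2); simp [log_re]; simpa using h5
    · intro z hz hz0; have h1 : z ∈ S.T := by have := hN₀T hz.1; rwa [hup1 z hz0.ge] at this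
      have h2 := hb z h1 (fun h => by have := h.1; linarith); simp [log_re, h2]
  have hφp : φ S.p = conj μ := by
    have := hturn 0 h0T; rwa [ofReal_zero, h0, mul_one, show S.turn 0 = S.p by simp [turn] ] at this
  have hε1 : ε = 1 := by
    have h1 := hmono ⟨le_rfl, S.p_pos.le⟩ ⟨S.p_pos.le, le_rfl⟩ S.p_pos
    simp only [ofReal_zero, h0, arg_one, hφp] at h1; have h2 := arg_nonneg_iff.1 h1.le
    rw [conj_im] at h2
    rcases hε with h | rfl
    · exact h
    · nlinarith
  rw [hε1, one_mul] at hμim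
  have hμ : μ = μ₃ := Complex.ext hμre hμim
  have hinjE : ∀ x y : ℝ, (x : ℂ) ∈ S.T → (y : ℂ) ∈ S.T → φ x = φ y → x = y := fun x y hx hy h =>
    hmono.injOn (S.real_mem_T.1 hx) (S.real_mem_T.1 hy) (by simp only [h])
  have harc : ∀ x : ℝ, (x : ℂ) ∈ S.T → φ x ∈ arc := fun x hx => by
    obtain ⟨-, h1, h2⟩ := hall x hx; rw [hε1, one_mul] at h1 h2
    exact ⟨hb x hx (S.ofReal_notMem_Ω x), h1, by rw [← hμ]; exact h2⟩
  have hone : ∀ x : ℝ, (x : ℂ) ∈ S.T → φ x = 1 → x = 0 := fun x hx h =>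
    hinjE x 0 hx h0T (by rw [h, ofReal_zero, h0])
  have hconj : ∀ x : ℝ, (x : ℂ) ∈ S.T → μ * φ x = 1 → x = S.p := fun x hx h =>
    hinjE x S.p hx hpT (by
      rw [hφp, ← mul_one (conj μ), ← h, ← mul_assoc, mul_comm (conj μ), hμc, one_mul])
  have harg3 : ∀ ζ, conj μ * ζ ∈ arc → ζ ∈ arc → ζ = 1 := fun ζ h1 h2 => by
    have e : μ₃ * (conj μ * ζ) = ζ := by rw [← hμ, ← mul_assoc, hμc, one_mul]
    have := μ₃_mul_eq_one h1 (by rwa [e]); rwa [e] at this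
  have hbinj0 : ∀ (x : ℝ) (y : ℂ), (x : ℂ) ∈ S.T → y ∈ S.T → y ∉ S.Ω → φ x = φ y → (x : ℂ) = y := by
    intro x y hx hy hyΩ h; have hxa := harc x hx
    rcases S.exists_side hy hyΩ with h1 | h1 | h1
    · obtain ⟨y, rfl⟩ := exists_eq_ofReal h1; rw [hinjE x y hx hy h]
    · obtain ⟨t, ht⟩ := exists_eq_ofReal h1; have htT : (t : ℂ) ∈ S.T := ht ▸ S.ρ_mem_T hy
      have h2 : φ t = μ₃ * φ x := by rw [← ht, hρ y hy, h, hμ]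
      have h4 := μ₃_mul_eq_one hxa (h2 ▸ harc t htT); have h5 := hone t htT (h2.trans h4)
      have h6 := hconj x hx (by rw [hμ]; exact h4)
      rw [h6, ← S.ρ'_ρ hy.2.2.2, ht, h5, ofReal_zero, ← S.ρ_p, S.ρ'_ρ hpT.2.2.2]
    · obtain ⟨t, ht⟩ := exists_eq_ofReal h1; have htT : (t : ℂ) ∈ S.T := ht ▸ S.ρ'_mem_T hy
      have h2 : φ t = conj μ * φ x := by rw [← ht, hρ' y hy, h]
      have h4 := harg3 (φ x) (h2 ▸ harc t htT) hxa; have h5 := hone x hx h4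
      have h6 := hconj t htT (by rw [h2, h4, mul_one, hμc])
      rw [h5, ← S.ρ_ρ' hy.2.2.2, ht, h6, ρ_p, ofReal_zero]
  have hbinj : ∀ x y : ℂ, x ∈ S.T → y ∈ S.T → x ∉ S.Ω → y ∉ S.Ω → φ x = φ y → x = y := by
    intro x y hx hy hxΩ hyΩ h
    rcases S.exists_side hx hxΩ with h1 | h1 | h1
    · rw [eq_ofReal h1] at hx h ⊢; exact hbinj0 _ y hx hy hyΩ h
    · have h2 := hbinj0 (S.ρ x).re (S.ρ y) (by rw [← eq_ofReal h1]; exact S.ρ_mem_T hx)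
        (S.ρ_mem_T hy) (S.ρ_notMem_Ω hy hyΩ) (by rw [← eq_ofReal h1, hρ x hx, hρ y hy, h])
      rw [← eq_ofReal h1] at h2; rw [← S.ρ'_ρ hx.2.2.2, h2, S.ρ'_ρ hy.2.2.2]
    · have h2 := hbinj0 (S.ρ' x).re (S.ρ' y) (by rw [← eq_ofReal h1]; exact S.ρ'_mem_T hx)
        (S.ρ'_mem_T hy) (S.ρ'_notMem_Ω hy hyΩ) (by rw [← eq_ofReal h1, hρ' x hx, hρ' y hy, h])
      rw [← eq_ofReal h1] at h2; rw [← S.ρ_ρ' hx.2.2.2, h2, S.ρ_ρ' hy.2.2.2]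
  have hnorm : ∀ z ∈ S.Ω, ‖φ z‖ < 1 := fun z hz => by
    have : φ z ∈ ball (0 : ℂ) 1 := hU ▸ mem_image_of_mem φ hz; simpa using this
  have hinjT : InjOn φ S.T := by
    intro x hx y hy h
    by_cases hxΩ : x ∈ S.Ω <;> by_cases hyΩ : y ∈ S.Ω
    · exact hi hxΩ hyΩ h
    · exact absurd (hb y hy hyΩ) (by rw [← h]; exact (hnorm x hxΩ).ne)
    · exact absurd (hb x hx hxΩ) (by rw [h]; exact (hnorm y hyΩ).ne)
    · exact hbinj x y hx hy hxΩ hyΩ h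
  have himg : φ '' S.T = closedBall 0 1 := by
    refine subset_antisymm ?_ ?_
    · rintro _ ⟨z, hz, rfl⟩; rw [mem_closedBall_zero_iff]
      by_cases hzΩ : z ∈ S.Ω
      · exact (hnorm z hzΩ).le
      · exact (hb z hz hzΩ).le
    · rw [← closure_ball (0 : ℂ) one_ne_zero]
      refine closure_minimal ?_ (S.isCompact_T.image_of_continuousOn hc).isClosed
      rw [← hU]; exact image_mono S.Ω_subset_T
  refine ⟨φ, hc, ⟨mapsTo_iff_image_subset.2 himg.le, hinjT, himg.ge⟩, hd, hU, fun z hz => by rw [hρ z hz, hμ], hσ, h0, fun z hz => ⟨fun h => ?_, fun h => ?_⟩⟩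
  · rw [eq_ofReal h] at hz ⊢; exact harc _ hz
  · have hzΩ : z ∉ S.Ω := fun h' => (hnorm z h').ne h.1
    rcases S.exists_side hz hzΩ with h1 | h1 | h1
    · exact h1
    · obtain ⟨t, ht⟩ := exists_eq_ofReal h1; have htT : (t : ℂ) ∈ S.T := ht ▸ S.ρ_mem_T hz
      have h2 : φ t = μ₃ * φ z := by rw [← ht, hρ z hz, hμ]
      have h4 := μ₃_mul_eq_one h (h2 ▸ harc t htT); have h5 := hone t htT (h2.trans h4)
      rw [← S.ρ'_ρ hz.2.2.2, ht, h5, ofReal_zero, ← S.ρ_p, S.ρ'_ρ hpT.2.2.2, ofReal_im]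
    · obtain ⟨t, ht⟩ := exists_eq_ofReal h1; have htT : (t : ℂ) ∈ S.T := ht ▸ S.ρ'_mem_T hz
      have h2 : φ t = conj μ * φ z := by rw [← ht, hρ' z hz]
      have h4 := harg3 (φ z) (h2 ▸ harc t htT) h
      have h6 := hconj t htT (by rw [h2, h4, mul_one, hμc])
      rw [← S.ρ_ρ' hz.2.2.2, ht, h6, ρ_p, zero_im]

end Shape

lemma continuousOn_invFunOn_of_isCompact {X Y : Type*} [TopologicalSpace X] [Nonempty X] [TopologicalSpace Y]
    [T2Space Y] {f : X → Y} {K : Set X} (hK : IsCompact K) (hf : ContinuousOn f K) (hi : InjOn f K) :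
    ContinuousOn (Function.invFunOn f K) (f '' K) := by
  rw [continuousOn_iff_isClosed]
  intro t ht
  refine ⟨f '' (K ∩ t), ((hK.inter_right ht).image_of_continuousOn (hf.mono inter_subset_left)).isClosed, ?_⟩
  ext y
  constructor
  · rintro ⟨h1, x, hx, rfl⟩; rw [mem_preimage, hi.leftInvOn_invFunOn hx] at h1
    exact ⟨⟨x, ⟨hx, h1⟩, rfl⟩, x, hx, rfl⟩
  · rintro ⟨⟨x, ⟨hx, hxt⟩, rfl⟩, -⟩; refine ⟨?_, x, hx, rfl⟩
    rw [mem_preimage, hi.leftInvOn_invFunOn hx]; exact hxt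

namespace Shape

lemma exists_triangle_map (S S' : Shape) : ∃ h : ℂ → ℂ, ContinuousOn h S.T ∧ BijOn h S.T S'.T ∧
    DifferentiableOn ℂ h S.Ω ∧ (∀ z ∈ S.T, h z ∈ S'.Ω ↔ z ∈ S.Ω) ∧
    (∀ z ∈ S.T, h (S.ρ z) = S'.ρ (h z)) ∧ (∀ z ∈ S.T, h (S.σ z) = S'.σ (h z)) ∧ h 0 = 0 ∧
    (∀ z ∈ S.T, (h z).im = 0 ↔ z.im = 0) := by
  obtain ⟨φ, hc, hb, hd, hU, hρ, hσ, h0, ha⟩ := S.exists_disk_map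
  obtain ⟨φ', hc', hb', hd', hU', hρ', hσ', h0', ha'⟩ := S'.exists_disk_map
  set ψ := Function.invFunOn φ' S'.T with hψ
  have hψc : ContinuousOn ψ (closedBall 0 1) := by
    rw [← hb'.image_eq]; exact continuousOn_invFunOn_of_isCompact S'.isCompact_T hc' hb'.injOn
  have hinv : InvOn ψ φ' S'.T (closedBall 0 1) := hb'.invOn_invFunOn
  have hψb : BijOn ψ (closedBall 0 1) S'.T := hinv.symm.bijOn (hb'.surjOn.mapsTo_invFunOn) hb'.mapsTo
  have hcancel : ∀ z ∈ S.T, φ' (ψ (φ z)) = φ z := fun z hz => hinv.2 (hb.mapsTo hz)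
  have hmem : ∀ z ∈ S.T, ψ (φ z) ∈ S'.T := fun z hz => hψb.mapsTo (hb.mapsTo hz)
  have hΩ : ∀ z ∈ S.T, φ z ∈ ball (0 : ℂ) 1 → z ∈ S.Ω := by
    intro z hz h; rw [← hU] at h; obtain ⟨w, hw, he⟩ := h; rwa [← hb.injOn (S.Ω_subset_T hw) hz he]
  have hΩ' : ∀ z ∈ S'.T, φ' z ∈ ball (0 : ℂ) 1 → z ∈ S'.Ω := by
    intro z hz h; rw [← hU'] at h; obtain ⟨w, hw, he⟩ := h
    rwa [← hb'.injOn (S'.Ω_subset_T hw) hz he]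
  refine ⟨ψ ∘ φ, hψc.comp hc hb.mapsTo, hψb.comp hb, ?_, fun z hz => ⟨fun h => ?_, fun h => ?_⟩,
    fun z hz => ?_, fun z hz => ?_, ?_, fun z hz => ?_⟩
  · obtain ⟨-, h1, -⟩ := injOn_holomorphic S'.isOpen_Ω hd' (hb'.injOn.mono S'.Ω_subset_T)
    rw [hU'] at h1; have h2 : DifferentiableOn ℂ ψ (ball 0 1) := by
      refine h1.congr fun w hw => ?_; rw [← hU'] at hw; obtain ⟨z, hz, rfl⟩ := hw
      rw [hinv.1 (S'.Ω_subset_T hz), (hb'.injOn.mono S'.Ω_subset_T).leftInvOn_invFunOn hz]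
    exact h2.comp hd fun z hz => hU ▸ mem_image_of_mem φ hz
  · refine hΩ z hz ?_; rw [← hcancel z hz, ← hU']; exact mem_image_of_mem φ' h
  · refine hΩ' _ (hmem z hz) ?_; simp only [Function.comp]; rw [hcancel z hz, ← hU]
    exact mem_image_of_mem φ h
  · refine hb'.injOn (hmem _ (S.ρ_mem_T hz)) (S'.ρ_mem_T (hmem z hz)) ?_; simp only [Function.comp]
    rw [hcancel _ (S.ρ_mem_T hz), hρ' _ (hmem z hz), hcancel z hz, hρ z hz]
  · refine hb'.injOn (hmem _ (S.σ_mem_T hz)) (S'.σ_mem_T (hmem z hz)) ?_; simp only [Function.comp]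
    rw [hcancel _ (S.σ_mem_T hz), hσ' _ (hmem z hz), hcancel z hz, hσ z hz]
  · have h1 : (0 : ℂ) ∈ S'.T := by simpa using S'.real_mem_T.2 ⟨le_rfl, S'.p_pos.le⟩
    simp only [Function.comp]; rw [h0, ← h0', hinv.1 h1]
  · simp only [Function.comp]; rw [ha z hz, ha' _ (hmem z hz), hcancel z hz]

/-- The point of the closed upper half plane which is equal to `z` or to its mirror image. -/
def up (z : ℂ) : ℂ := ⟨z.re, |z.im|⟩

lemma continuous_up : Continuous up := by
  have : up = fun z : ℂ => (z.re : ℂ) + (|z.im| : ℝ) * I := by ext z; exact (re_add_im (up z)).symm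
  rw [this]; fun_prop

lemma up_of_nonneg {z : ℂ} (hz : 0 ≤ z.im) : up z = z := by
  apply Complex.ext <;> simp [up, abs_of_nonneg hz]

lemma up_conj (z : ℂ) : up (conj z) = up z := by simp [up]

lemma up_of_nonpos {z : ℂ} (hz : z.im ≤ 0) : up z = conj z := by
  rw [← up_conj, up_of_nonneg (by simpa using hz)]

/-- The union of the triangle and its mirror image in the side from `0` to `p`, without the other
four sides. -/
def kite (S : Shape) : Set ℂ := {z | 0 < S.f2 (up z) ∧ 0 < S.f3 (up z) ∧ S.k * normSq (up z) < 1}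

lemma isOpen_kite (S : Shape) : IsOpen S.kite := ((isOpen_lt continuous_const S.continuous_f2).inter
      ((isOpen_lt continuous_const S.continuous_f3).inter
        (isOpen_lt (continuous_const.mul continuous_normSq) continuous_const))).preimage continuous_up

lemma up_mem_T {S : Shape} {z : ℂ} (hz : z ∈ S.kite) : up z ∈ S.T :=
  ⟨abs_nonneg _, hz.1.le, hz.2.1.le, hz.2.2⟩

lemma conj_mem_kite {S : Shape} {z : ℂ} : conj z ∈ S.kite ↔ z ∈ S.kite := by
  change up (conj z) ∈ {z | 0 < S.f2 z ∧ 0 < S.f3 z ∧ S.k * normSq z < 1} ↔ _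
  rw [up_conj]; rfl

lemma mem_kite_iff {S : Shape} {z : ℂ} (hz : z ∈ S.T) : z ∈ S.kite ↔ (S.ρ z).im ≠ 0 ∧ (S.ρ' z).im ≠ 0 := by
  have h1 := S.ρ'_im hz.2.2.2
  have h2 := S.ρ_im hz.2.2.2
  have h3 := S.den_pos hz.2.2.2
  have h4 := normSq_pos.2 (S.κ_sub_ne_zero hz.2.2.2)
  have hk : 0 < 1 - S.k * S.p ^ 2 := by linarith [S.kp_lt_one]
  have e : z ∈ S.kite ↔ 0 < S.f2 z ∧ 0 < S.f3 z := by
    change 0 < S.f2 (up z) ∧ 0 < S.f3 (up z) ∧ S.k * normSq (up z) < 1 ↔ _; rw [up_of_nonneg hz.1]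
    simp [hz.2.2.2]
  rw [e, hz.2.1.lt_iff_ne', hz.2.2.1.lt_iff_ne', ← h2]
  have e2 : (S.ρ' z).im ≠ 0 ↔ S.f2 z ≠ 0 := by
    rw [← mul_ne_zero_iff_right h4.ne', h1, mul_ne_zero_iff_left hk.ne']
  rw [e2, mul_ne_zero_iff_right h3.ne', and_comm]

/-- The extension by reflection of a map of the triangle. -/
def reflectExt (h : ℂ → ℂ) (z : ℂ) : ℂ := if 0 ≤ z.im then h z else conj (h (conj z))

lemma exists_kite_map (S S' : Shape) : ∃ h : ℂ → ℂ, ContinuousOn h S.T ∧ BijOn h S.T S'.T ∧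
    (∀ z ∈ S.T, h z ∈ S'.Ω ↔ z ∈ S.Ω) ∧
    (∀ z ∈ S.T, h (S.ρ z) = S'.ρ (h z)) ∧ (∀ z ∈ S.T, h (S.σ z) = S'.σ (h z)) ∧ h 0 = 0 ∧
    (∀ z ∈ S.T, (h z).im = 0 ↔ z.im = 0) ∧
    BijOn (reflectExt h) S.kite S'.kite ∧ DifferentiableOn ℂ (reflectExt h) S.kite := by
  obtain ⟨h, hc, hb, hd, hΩ, hρ, hσ, h0, him⟩ := exists_triangle_map S S'
  refine ⟨h, hc, hb, hΩ, hρ, hσ, h0, him, ?_⟩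
  have hρ' : ∀ z ∈ S.T, h (S.ρ' z) = S'.ρ' (h z) := fun z hz => by
    rw [← S.ρ_ρ hz.2.2.2, hρ _ (S.ρ_mem_T hz), hρ z hz, S'.ρ_ρ (hb.mapsTo hz).2.2.2]
  have hkite : ∀ z ∈ S.T, h z ∈ S'.kite ↔ z ∈ S.kite := fun z hz => by
    rw [mem_kite_iff hz, mem_kite_iff (hb.mapsTo hz), ← hρ z hz, ← hρ' z hz,
      Ne, Ne, him _ (S.ρ_mem_T hz), him _ (S.ρ'_mem_T hz)]
  have hTu : ∀ {S : Shape}, ∀ z ∈ S.kite, 0 ≤ z.im → z ∈ S.T := fun z hz h => by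
    rw [← up_of_nonneg h]; exact up_mem_T hz
  have hTl : ∀ {S : Shape}, ∀ z ∈ S.kite, z.im ≤ 0 → conj z ∈ S.T := fun z hz h => by
    rw [← up_of_nonpos h]; exact up_mem_T hz
  have hu : ∀ z : ℂ, 0 ≤ z.im → reflectExt h z = h z := fun z hz => if_pos hz
  have hl : ∀ z : ℂ, z ∈ S.kite → z.im ≤ 0 → reflectExt h z = conj (h (conj z)) := by
    intro z hz h1
    rcases h1.lt_or_eq with h1 | h1
    · exact if_neg (not_le.2 h1)
    · have h2 : conj z = z := conj_eq_iff_im.2 h1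
      rw [hu z h1.ge, h2, eq_comm, conj_eq_iff_im, him z (hTu z hz h1.ge)]; exact h1
  have himu : ∀ z ∈ S.kite, 0 ≤ z.im → 0 ≤ (reflectExt h z).im := fun z hz h1 => by
    rw [hu z h1]; exact (hb.mapsTo (hTu z hz h1)).1
  have himl : ∀ z ∈ S.kite, z.im < 0 → (reflectExt h z).im < 0 := fun z hz h1 => by
    have h2 := hTl z hz h1.le; rw [hl z hz h1.le, conj_im, neg_lt_zero]
    refine lt_of_le_of_ne (hb.mapsTo h2).1 fun h3 => ?_; have := (him _ h2).1 h3.symm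
    rw [conj_im, neg_eq_zero] at this; exact h1.ne this
  have hmaps : MapsTo (reflectExt h) S.kite S'.kite := by
    intro z hz
    rcases le_total 0 z.im with h1 | h1
    · rw [hu z h1, hkite z (hTu z hz h1)]; exact hz
    · rw [hl z hz h1, conj_mem_kite, hkite _ (hTl z hz h1), conj_mem_kite]; exact hz
  refine ⟨⟨hmaps, ?_, ?_⟩, ?_⟩
  · intro z hz w hw he
    rcases le_or_gt 0 z.im with h1 | h1 <;> rcases le_or_gt 0 w.im with h2 | h2
    · rw [hu z h1, hu w h2] at he; exact hb.injOn (hTu z hz h1) (hTu w hw h2) he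
    · have := himu z hz h1; rw [he] at this; exact absurd this (not_le.2 (himl w hw h2))
    · have := himu w hw h2; rw [← he] at this; exact absurd this (not_le.2 (himl z hz h1))
    · rw [hl z hz h1.le, hl w hw h2.le] at he
      exact star_injective (hb.injOn (hTl z hz h1.le) (hTl w hw h2.le) (star_injective he))
  · intro w hw
    rcases le_total 0 w.im with h1 | h1
    · obtain ⟨z, hz, rfl⟩ := hb.surjOn (hTu w hw h1); exact ⟨z, (hkite z hz).1 hw, hu z hz.1⟩
    · obtain ⟨z, hz, he⟩ := hb.surjOn (hTl w hw h1); have hzk : conj z ∈ S.kite := by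
        rw [conj_mem_kite, ← hkite z hz, he, conj_mem_kite]; exact hw
      refine ⟨conj z, hzk, ?_⟩
      rw [hl _ hzk (by rw [conj_im]; linarith [hz.1]), conj_conj, he, conj_conj]
  · have hcont : ContinuousOn (reflectExt h) S.kite := by
      have e : S.kite = S.kite ∩ {z | 0 ≤ z.im} ∪ S.kite ∩ {z | z.im ≤ 0} := by
        rw [← inter_union_distrib_left]; refine (inter_eq_left.2 fun z _ => ?_).symm
        exact le_total 0 z.im
      rw [e]
      have hA : ∀ z, z ∉ S.kite ∩ {z : ℂ | 0 ≤ z.im} → z ∈ S.kite →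
          ContinuousWithinAt (reflectExt h) (S.kite ∩ {z : ℂ | 0 ≤ z.im}) z := by
        intro z h1 h2; refine continuousWithinAt_of_notMem_closure fun h3 => h1 ⟨h2, ?_⟩
        have h4 : IsClosed {z : ℂ | 0 ≤ z.im} := isClosed_le continuous_const continuous_im
        exact h4.closure_eq ▸ closure_mono inter_subset_right h3
      have hB : ∀ z, z ∉ S.kite ∩ {z : ℂ | z.im ≤ 0} → z ∈ S.kite →
          ContinuousWithinAt (reflectExt h) (S.kite ∩ {z : ℂ | z.im ≤ 0}) z := by
        intro z h1 h2; refine continuousWithinAt_of_notMem_closure fun h3 => h1 ⟨h2, ?_⟩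
        have h4 : IsClosed {z : ℂ | z.im ≤ 0} := isClosed_le continuous_im continuous_const
        exact h4.closure_eq ▸ closure_mono inter_subset_right h3
      have h1 : ContinuousOn (reflectExt h) (S.kite ∩ {z | 0 ≤ z.im}) :=
        (hc.mono fun z hz => hTu z hz.1 hz.2).congr fun z hz => hu z hz.2
      have h2 : ContinuousOn (reflectExt h) (S.kite ∩ {z | z.im ≤ 0}) :=
        (continuous_conj.comp_continuousOn (hc.comp continuous_conj.continuousOn fun z hz => hTl z hz.1 hz.2)).congr
          fun z hz => hl z hz.1 hz.2
      intro z hz; have hzk : z ∈ S.kite := by rwa [e]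
      refine ContinuousWithinAt.union ?_ ?_
      · by_cases hz1 : z ∈ S.kite ∩ {z : ℂ | 0 ≤ z.im}
        · exact h1 z hz1
        · exact hA z hz1 hzk
      · by_cases hz1 : z ∈ S.kite ∩ {z : ℂ | z.im ≤ 0}
        · exact h2 z hz1
        · exact hB z hz1 hzk
    have hΩk : ∀ z ∈ S.kite, 0 < z.im → z ∈ S.Ω := fun z hz h1 => by
      have := hz; change 0 < S.f2 (up z) ∧ 0 < S.f3 (up z) ∧ S.k * normSq (up z) < 1 at this
      rw [up_of_nonneg h1.le] at this; exact ⟨h1, this⟩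
    refine differentiableOn_of_off_real S.isOpen_kite hcont fun z hz hz0 => ?_
    rcases lt_or_gt_of_ne hz0 with h1 | h1
    · have h2 : conj z ∈ S.Ω := hΩk _ (conj_mem_kite.2 hz) (by rw [conj_im]; linarith)
      have h3 : DifferentiableAt ℂ (conj ∘ h ∘ conj) z :=
        differentiableAt_conj_conj_iff.2 (hd.differentiableAt (S.isOpen_Ω.mem_nhds h2))
      refine h3.congr_of_eventuallyEq ?_
      filter_upwards [(isOpen_lt continuous_im continuous_const).mem_nhds h1] with w hw
      exact if_neg (not_le.2 hw)
    · refine (hd.differentiableAt (S.isOpen_Ω.mem_nhds (hΩk z hz h1))).congr_of_eventuallyEq ?_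
      filter_upwards [(isOpen_lt continuous_const continuous_im).mem_nhds h1] with w hw
      exact hu w (le_of_lt hw)

end Shape

end TriangleMap
end

noncomputable section
open Set Complex Function TriangleMap
open Matrix (cons_val_zero cons_val_one cons_val)
open Fin (sum_univ_three)
open scoped ComplexConjugate Topology

namespace OctaSurface

abbrev Z3 : Type := ℤ × ℤ × ℤ

/-- The corners of the faces of the cell at the origin, one cyclic order of each face. -/
def faceTable : List (Z3 × Z3 × Z3) :=
  [((3, 0, 0), (0, 0, -3), (0, 3, 0)), ((0, 0, -3), (3, 0, 0), (4, -1, -4)),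
    ((0, 3, 0), (0, 0, -3), (-1, 4, -4)), ((3, 0, 0), (0, 3, 0), (4, 4, 1)),
    ((4, -1, -4), (3, 0, 0), (4, -4, -1)), ((0, 0, -3), (4, -1, -4), (1, -4, -4)),
    ((-1, 4, -4), (0, 0, -3), (-4, 1, -4)), ((0, 3, 0), (-1, 4, -4), (-4, 4, -1)),
    ((4, 4, 1), (0, 3, 0), (1, 4, 4)), ((3, 0, 0), (4, 4, 1), (4, 1, 4)),
    ((4, -4, -1), (3, 0, 0), (0, -3, 0)), ((4, 7, 4), (4, 4, 7), (7, 4, 4)),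
    ((1, 4, 4), (4, 7, 4), (4, 4, 1)), ((0, 0, -3), (1, -4, -4), (0, -3, 0)),
    ((-4, 1, -4), (0, 0, -3), (-3, 0, 0)), ((7, 4, 4), (4, 1, 4), (4, 4, 1)),
    ((0, 3, 0), (-4, 4, -1), (-3, 0, 0)), ((1, 4, 4), (0, 3, 0), (0, 0, 3)),
    ((3, 0, 0), (4, 1, 4), (0, 0, 3)), ((0, -3, 0), (3, 0, 0), (0, 0, 3)),
    ((4, -4, -1), (0, -3, 0), (1, -4, -4)), ((-4, -1, 4), (-1, -4, 4), (0, 0, 3)),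
    ((-4, -4, 1), (-4, -1, 4), (-3, 0, 0)), ((0, 0, -3), (0, -3, 0), (-3, 0, 0)),
    ((-4, 1, -4), (-3, 0, 0), (-4, 4, -1)), ((-1, -4, 4), (-4, -4, 1), (0, -3, 0)),
    ((0, 3, 0), (-3, 0, 0), (0, 0, 3)), ((1, 4, 4), (0, 0, 3), (4, 1, 4)),
    ((0, -3, 0), (0, 0, 3), (-1, -4, 4)), ((4, 4, 7), (1, 4, 4), (4, 1, 4)),
    ((-4, -1, 4), (0, 0, 3), (-3, 0, 0)), ((-4, -4, 1), (-3, 0, 0), (0, -3, 0))]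

/-- The flag obtained by turning about the first corner to the next face. -/
def rotTable : List ℕ :=
  [9, 3, 6, 15, 0, 12, 21, 1, 18, 27, 2, 24, 33, 4, 30, 39, 5, 36, 45, 7, 42, 48, 8, 34, 38,
    10, 51, 54, 11, 46, 60, 13, 57, 63, 14, 22, 26, 16, 66, 69, 17, 61, 72, 19, 71, 75, 20,
    28, 78, 23, 73, 81, 25, 80, 58, 29, 82, 84, 31, 56, 87, 32, 40, 90, 35, 85, 93, 37, 92,
    43, 41, 94, 89, 44, 49, 86, 47, 95, 52, 50, 91, 88, 53, 55, 77, 59, 64, 74, 62, 83, 67,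
    65, 79, 76, 68, 70]

/-- The flag on the other side of the first edge. -/
def flipTable : List ℕ :=
  [3, 6, 9, 0, 12, 15, 1, 18, 21, 2, 24, 27, 4, 30, 33, 5, 36, 39, 7, 42, 45, 8, 34, 48, 10,
    51, 38, 11, 46, 54, 13, 57, 60, 14, 22, 63, 16, 66, 26, 17, 61, 69, 19, 71, 72, 20, 28,
    75, 23, 73, 78, 25, 80, 81, 29, 82, 58, 31, 56, 84, 32, 40, 87, 35, 85, 90, 37, 92, 93,
    41, 94, 43, 44, 49, 89, 47, 95, 86, 50, 91, 52, 53, 55, 88, 59, 64, 77, 62, 83, 74, 65,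
    79, 67, 68, 70, 76]

def toVec (p : Z3) : Fin 3 → ℤ := ![p.1, p.2.1, p.2.2]

/-- A flag is a face with a cyclic order of its corners: the flags `3 f`, `3 f + 1`, `3 f + 2` belong to the same face. -/
abbrev Flag := Fin 96

def corners (k : Flag) : Z3 × Z3 × Z3 := let t := faceTable.getD (k.1 / 3) default
  if k.1 % 3 = 0 then t else if k.1 % 3 = 1 then (t.2.1, t.2.2, t.1) else (t.2.2, t.1, t.2.1)

def rot (k : Flag) : Flag := Fin.ofNat 96 (rotTable.getD k.1 0)
def flip (k : Flag) : Flag := Fin.ofNat 96 (flipTable.getD k.1 0)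

lemma exists_perm_fin_three {P : Fin 3 → Fin 3 → Fin 3 → Prop} :
    (∃ σ : Equiv.Perm (Fin 3), P (σ 0) (σ 1) (σ 2)) ↔
      P 0 1 2 ∨ P 1 2 0 ∨ P 2 0 1 ∨ P 0 2 1 ∨ P 2 1 0 ∨ P 1 0 2 := by
  constructor
  · rintro ⟨σ, h⟩; have h01 : σ 0 ≠ σ 1 := σ.injective.ne (by decide)
    have h02 : σ 0 ≠ σ 2 := σ.injective.ne (by decide)
    have h12 : σ 1 ≠ σ 2 := σ.injective.ne (by decide)
    revert h h01 h02 h12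
    generalize σ 0 = i; generalize σ 1 = j; generalize σ 2 = k
    revert i j k
    have : ∀ i j k : Fin 3, i ≠ j → i ≠ k → j ≠ k → (i = 0 ∧ j = 1 ∧ k = 2) ∨ (i = 1 ∧ j = 2 ∧ k = 0) ∨
        (i = 2 ∧ j = 0 ∧ k = 1) ∨ (i = 0 ∧ j = 2 ∧ k = 1) ∨ (i = 2 ∧ j = 1 ∧ k = 0) ∨ (i = 1 ∧ j = 0 ∧ k = 2) := by
      decide
    intro i j k h h1 h2 h3
    rcases this i j k h1 h2 h3 with ⟨rfl, rfl, rfl⟩ | ⟨rfl, rfl, rfl⟩ | ⟨rfl, rfl, rfl⟩ | ⟨rfl, rfl, rfl⟩ |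
      ⟨rfl, rfl, rfl⟩ | ⟨rfl, rfl, rfl⟩ <;> simp [h]
  · rintro (h | h | h | h | h | h)
    · exact ⟨1, h⟩
    · exact ⟨c[0, 1, 2], h⟩
    · exact ⟨c[0, 2, 1], h⟩
    · exact ⟨Equiv.swap 1 2, h⟩
    · exact ⟨Equiv.swap 0 2, h⟩
    · exact ⟨Equiv.swap 0 1, h⟩

/-- The test that three corners of a face are in counterclockwise order as seen from outside. -/
def posDet (o a b c : Z3) : Bool :=
  decide (0 < (a.1 - o.1) * ((b.2.1 - o.2.1) * (c.2.2 - o.2.2) - (b.2.2 - o.2.2) * (c.2.1 - o.2.1)) -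
    (a.2.1 - o.2.1) * ((b.1 - o.1) * (c.2.2 - o.2.2) - (b.2.2 - o.2.2) * (c.1 - o.1)) +
    (a.2.2 - o.2.2) * ((b.1 - o.1) * (c.2.1 - o.2.1) - (b.2.1 - o.2.1) * (c.1 - o.1)))

lemma toVec_eq (a : Fin 3 → ℤ) : toVec (a 0, a 1, a 2) = a := by
  ext i; fin_cases i <;> rfl

lemma toVec_injective : Injective toVec := fun p q h => by
  have h0 := congrFun h 0
  have h1 := congrFun h 1
  have h2 := congrFun h 2
  simp only [toVec, cons_val_zero, cons_val_one, cons_val] at h0 h1 h2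
  ext <;> simp [*]

def tcorner (O : Octahedron) (s : Fin 3 → ℤˣ) (i : Fin 3) : Z3 :=
  (O.corner s i 0, O.corner s i 1, O.corner s i 2)

def IsTFace (O : Octahedron) (s : Fin 3 → ℤˣ) (a b c : Z3) (i j k : Fin 3) : Prop :=
  a = tcorner O s i ∧ b = tcorner O s j ∧ c = tcorner O s k ∧
    posDet (O.center 0, O.center 1, O.center 2) a b c = true

instance (O : Octahedron) (s : Fin 3 → ℤˣ) (a b c : Z3) (i j k : Fin 3) :
    Decidable (IsTFace O s a b c i j k) := by unfold IsTFace; infer_instance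

lemma isFace_iff (O : Octahedron) (s : Fin 3 → ℤˣ) (a b c : Z3) : O.IsFace s (toVec a) (toVec b) (toVec c) ↔
      IsTFace O s a b c 0 1 2 ∨ IsTFace O s a b c 1 2 0 ∨ IsTFace O s a b c 2 0 1 ∨
      IsTFace O s a b c 0 2 1 ∨ IsTFace O s a b c 2 1 0 ∨ IsTFace O s a b c 1 0 2 := by
  rw [← exists_perm_fin_three (P := IsTFace O s a b c), Octahedron.IsFace, ← exists_and_right]
  refine exists_congr fun σ => ?_
  have key : ∀ (a : Z3) (i : Fin 3), toVec a = O.corner s i ↔ a = tcorner O s i := fun a i => by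
    rw [← toVec_eq (O.corner s i)]; exact toVec_injective.eq_iff
  rw [key, key, key, IsTFace, Matrix.det_fin_three, and_assoc, and_assoc]
  refine and_congr_right fun _ => and_congr_right fun _ => and_congr_right fun _ => ?_
  rw [posDet, decide_eq_true_iff]
  simp only [Matrix.of_apply, cons_val_zero, cons_val_one, cons_val, Pi.sub_apply, toVec]
  ring_nf

/-- The listed flags contain all flags of a given face of an octahedron. -/
def FaceListed (O : Octahedron) (s : Fin 3 → ℤˣ) : Prop := ∀ i j k : Fin 3,
  posDet (O.center 0, O.center 1, O.center 2) (tcorner O s i) (tcorner O s j) (tcorner O s k) = true →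
    ∃ l : Flag, corners l = (tcorner O s i, tcorner O s j, tcorner O s k)

instance (O : Octahedron) (s : Fin 3 → ℤˣ) : Decidable (FaceListed O s) := by
  unfold FaceListed; infer_instance

lemma FaceListed.exists_flag {O : Octahedron} {s : Fin 3 → ℤˣ} {a b c : Z3} (hO : FaceListed O s)
    (h : O.IsFace s (toVec a) (toVec b) (toVec c)) : ∃ l : Flag, corners l = (a, b, c) := by
  rw [isFace_iff] at h
  rcases h with ⟨rfl, rfl, rfl, h⟩ | ⟨rfl, rfl, rfl, h⟩ | ⟨rfl, rfl, rfl, h⟩ | ⟨rfl, rfl, rfl, h⟩ |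
    ⟨rfl, rfl, rfl, h⟩ | ⟨rfl, rfl, rfl, h⟩ <;> exact hO _ _ _ h

lemma typeTwo_even_listed : ∀ s : Fin 3 → ℤˣ, ∏ i, s i = -1 → FaceListed (typeTwo 0) s := by
  decide +kernel

lemma typeTwo_odd_listed : ∀ s : Fin 3 → ℤˣ, ∏ i, s i = 1 → FaceListed (typeTwo fun _ => 4) s := by
  decide +kernel

lemma typeOne_listed : ∀ n : Fin 3 → ℤˣ, ∏ i, n i = 1 → ∀ s : Fin 3 → ℤˣ, s ≠ 1 → s ≠ -1 →
    FaceListed (typeOne 0 n) s := by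
  decide +kernel

/-- The flag belongs to the given face of an octahedron. -/
def IsTFlag (O : Octahedron) (s : Fin 3 → ℤˣ) (l : Flag) : Prop :=
  IsTFace O s (corners l).1 (corners l).2.1 (corners l).2.2 0 1 2 ∨
    IsTFace O s (corners l).1 (corners l).2.1 (corners l).2.2 1 2 0 ∨
    IsTFace O s (corners l).1 (corners l).2.1 (corners l).2.2 2 0 1 ∨
    IsTFace O s (corners l).1 (corners l).2.1 (corners l).2.2 0 2 1 ∨
    IsTFace O s (corners l).1 (corners l).2.1 (corners l).2.2 2 1 0 ∨
    IsTFace O s (corners l).1 (corners l).2.1 (corners l).2.2 1 0 2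

instance (O : Octahedron) (s : Fin 3 → ℤˣ) (l : Flag) : Decidable (IsTFlag O s l) := by
  unfold IsTFlag; infer_instance

lemma exists_face : ∀ l : Flag, (∃ s : Fin 3 → ℤˣ, ∏ i, s i = -1 ∧ IsTFlag (typeTwo 0) s l) ∨
    (∃ s : Fin 3 → ℤˣ, ∏ i, s i = 1 ∧ IsTFlag (typeTwo fun _ => 4) s l) ∨
    (∃ n : Fin 3 → ℤˣ, ∏ i, n i = 1 ∧ ∃ s : Fin 3 → ℤˣ, s ≠ 1 ∧ s ≠ -1 ∧ IsTFlag (typeOne 0 n) s l) := by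
  decide +kernel

lemma isCellFace_zero_iff {a b c : Z3} :
    IsCellFace 0 (toVec a) (toVec b) (toVec c) ↔ ∃ l : Flag, corners l = (a, b, c) := by
  constructor
  · intro h; generalize ha : toVec a = a', hb : toVec b = b', hc : toVec c = c' at h; cases h with
    | typeTwo_even s _ _ _ hs h => subst ha hb hc; exact (typeTwo_even_listed s hs).exists_flag h
    | typeTwo_odd s _ _ _ hs h => subst ha hb hc; exact (typeTwo_odd_listed s hs).exists_flag h
    | typeOne n s _ _ _ hn hs hs' h =>
      subst ha hb hc; exact (typeOne_listed n hn s hs hs').exists_flag h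
  · rintro ⟨l, hl⟩; have h := exists_face l; unfold IsTFlag at h; rw [hl] at h
    rcases h with ⟨s, hs, h⟩ | ⟨s, hs, h⟩ | ⟨n, hn, s, hs, hs', h⟩
    · exact .typeTwo_even s _ _ _ hs ((isFace_iff _ _ _ _ _).2 h)
    · exact .typeTwo_odd s _ _ _ hs ((isFace_iff _ _ _ _ _).2 h)
    · exact .typeOne n s _ _ _ hn hs hs' ((isFace_iff _ _ _ _ _).2 h)

def dot3 (f p : Z3) : ℤ := f.1 * p.1 + f.2.1 * p.2.1 + f.2.2 * p.2.2

/-- The functional `f` separates the face `F` from the translate by `g` of the face `G`, up to common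
corners. -/
def separates (F G : Z3 × Z3 × Z3) (g f : Z3) : Bool :=
  let m := max (dot3 f G.1) (max (dot3 f G.2.1) (dot3 f G.2.2)) + dot3 f g
  let ok := fun p : Z3 => decide (m < dot3 f p) ||
    (decide (m = dot3 f p) && (p == G.1 + g || p == G.2.1 + g || p == G.2.2 + g))
  ok F.1 && ok F.2.1 && ok F.2.2

def separators : List Z3 :=
  [(2, 1, 0), (-2, -1, 0), (1, -2, 0), (-1, 2, 0), (0, 0, -1), (0, 0, 1), (-2, 1, 2), (-1, -2, -2),
    (1, 2, -2), (2, -1, 2), (-1, -2, 2), (2, -1, -2), (1, 2, 2), (-2, 1, -2), (-2, 2, -1), (2, 1, 2),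
    (2, -2, -1), (1, -2, -2), (2, -2, 1), (2, 1, -2), (-2, -1, -2), (-2, 2, 1), (-1, 2, 2),
    (2, 2, -1), (-2, -1, 2), (-2, -2, 1), (1, -2, 2), (-2, -2, -1), (2, 2, 1), (-1, 2, -2)]

def shifts : List Z3 :=
  [(0, 0, 0), (8, 8, 0), (8, -8, 0), (-8, 8, 0), (-8, -8, 0), (8, 0, 8), (8, 0, -8), (-8, 0, 8),
    (-8, 0, -8), (0, 8, 8), (0, 8, -8), (0, -8, 8), (0, -8, -8)]

lemma faces_separated : (faceTable.all fun F => faceTable.all fun G => shifts.all fun g =>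
    (F == G && g == (0, 0, 0)) || separators.any fun f => separates F G g f) = true := by
  decide +kernel

/-- The translations of the lattice, in coordinates. -/
def InLat (p : Z3) : Prop := p.1 % 8 = 0 ∧ p.2.1 % 8 = 0 ∧ p.2.2 % 8 = 0 ∧ (p.1 + p.2.1 + p.2.2) % 16 = 0

instance (p : Z3) : Decidable (InLat p) := by unfold InLat; infer_instance

def crn (k : Flag) : Fin 3 → Z3 := ![(corners k).1, (corners k).2.1, (corners k).2.2]

lemma crn_mem : ∀ k : Flag, ∃ F ∈ faceTable, (∀ i, crn k i = F.1 ∨ crn k i = F.2.1 ∨ crn k i = F.2.2) ∧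
    (∃ i, crn k i = F.1) ∧ (∃ i, crn k i = F.2.1) ∧ (∃ i, crn k i = F.2.2) := by
  decide +kernel

lemma crn_bounds : ∀ (k : Flag) (i : Fin 3), (-4 ≤ (crn k i).1 ∧ (crn k i).1 ≤ 7) ∧
    (-4 ≤ (crn k i).2.1 ∧ (crn k i).2.1 ≤ 7) ∧ (-4 ≤ (crn k i).2.2 ∧ (crn k i).2.2 ≤ 7) := by
  decide +kernel

lemma dot3_add (f p q : Z3) : dot3 f (p + q) = dot3 f p + dot3 f q := by
  simp only [dot3, Prod.fst_add, Prod.snd_add]; ring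

lemma exists_separator (k l : Flag) {g : Z3} (hg : InLat g) :
    (∀ i, ∃ j, crn k i = crn l j + g) ∨ ∃ (f : Z3) (m : ℤ), (∀ j, dot3 f (crn l j + g) ≤ m) ∧
      ∀ i, m ≤ dot3 f (crn k i) ∧ (m = dot3 f (crn k i) → ∃ j, crn k i = crn l j + g) := by
  obtain ⟨h1, h2, h3, h4⟩ := hg
  have hk := crn_bounds k
  have hl := crn_bounds l
  by_cases hx : g.1 < -8 ∨ 8 < g.1
  · rcases hx with hx | hx
    · refine Or.inr ⟨(1, 0, 0), -9, fun j => ?_, fun i => ?_⟩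
      · simp only [dot3, Prod.fst_add]; have := (hl j).1; omega
      · simp only [dot3]; have := (hk i).1; omega
    · refine Or.inr ⟨(-1, 0, 0), -12, fun j => ?_, fun i => ?_⟩
      · simp only [dot3, Prod.fst_add]; have := (hl j).1; omega
      · simp only [dot3]; have := (hk i).1; omega
  by_cases hy : g.2.1 < -8 ∨ 8 < g.2.1
  · rcases hy with hx | hx
    · refine Or.inr ⟨(0, 1, 0), -9, fun j => ?_, fun i => ?_⟩
      · simp only [dot3, Prod.fst_add, Prod.snd_add]; have := (hl j).2.1; omega
      · simp only [dot3]; have := (hk i).2.1; omega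
    · refine Or.inr ⟨(0, -1, 0), -12, fun j => ?_, fun i => ?_⟩
      · simp only [dot3, Prod.fst_add, Prod.snd_add]; have := (hl j).2.1; omega
      · simp only [dot3]; have := (hk i).2.1; omega
  by_cases hz : g.2.2 < -8 ∨ 8 < g.2.2
  · rcases hz with hx | hx
    · refine Or.inr ⟨(0, 0, 1), -9, fun j => ?_, fun i => ?_⟩
      · simp only [dot3, Prod.snd_add]; have := (hl j).2.2; omega
      · simp only [dot3]; have := (hk i).2.2; omega
    · refine Or.inr ⟨(0, 0, -1), -12, fun j => ?_, fun i => ?_⟩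
      · simp only [dot3, Prod.snd_add]; have := (hl j).2.2; omega
      · simp only [dot3]; have := (hk i).2.2; omega
  have hgs : g ∈ shifts := by
    obtain ⟨x, y, z⟩ := g; simp only [not_or, not_lt] at h1 h2 h3 h4 hx hy hz
    have hx' : x = -8 ∨ x = 0 ∨ x = 8 := by omega
    have hy' : y = -8 ∨ y = 0 ∨ y = 8 := by omega
    have hz' : z = -8 ∨ z = 0 ∨ z = 8 := by omega
    rcases hx' with rfl | rfl | rfl <;> rcases hy' with rfl | rfl | rfl <;>
      rcases hz' with rfl | rfl | rfl <;> first | (exfalso; omega) | decide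
  obtain ⟨F, hF, hFk, -, -, -⟩ := crn_mem k
  obtain ⟨G, hG, hGl, ⟨j1, hj1⟩, ⟨j2, hj2⟩, ⟨j3, hj3⟩⟩ := crn_mem l
  have h := faces_separated
  rw [List.all_eq_true] at h
  have h := h F hF
  rw [List.all_eq_true] at h
  have h := h G hG
  rw [List.all_eq_true] at h
  have h := h g hgs
  rw [Bool.or_eq_true] at h
  rcases h with h | h
  · rw [Bool.and_eq_true, beq_iff_eq, beq_iff_eq] at h; obtain ⟨rfl, rfl⟩ := h
    refine Or.inl fun i => ?_
    rcases hFk i with e | e | e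
    · exact ⟨j1, by rw [e, hj1]; simp⟩
    · exact ⟨j2, by rw [e, hj2]; simp⟩
    · exact ⟨j3, by rw [e, hj3]; simp⟩
  · rw [List.any_eq_true] at h; obtain ⟨f, -, h⟩ := h; right
    refine ⟨f, max (dot3 f G.1) (max (dot3 f G.2.1) (dot3 f G.2.2)) + dot3 f g, fun j => ?_, fun i => ?_⟩
    · rw [dot3_add]
      rcases hGl j with e | e | e <;> rw [e] <;> omega
    · simp only [separates, Bool.and_eq_true, Bool.or_eq_true, decide_eq_true_eq, beq_iff_eq] at h
      obtain ⟨⟨a1, a2⟩, a3⟩ := h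
      have key : ∀ p : Z3, (max (dot3 f G.1) (max (dot3 f G.2.1) (dot3 f G.2.2)) + dot3 f g < dot3 f p ∨
          max (dot3 f G.1) (max (dot3 f G.2.1) (dot3 f G.2.2)) + dot3 f g = dot3 f p ∧
            ((p = G.1 + g ∨ p = G.2.1 + g) ∨ p = G.2.2 + g)) →
          max (dot3 f G.1) (max (dot3 f G.2.1) (dot3 f G.2.2)) + dot3 f g ≤ dot3 f p ∧
          (max (dot3 f G.1) (max (dot3 f G.2.1) (dot3 f G.2.2)) + dot3 f g = dot3 f p → ∃ j, p = crn l j + g) := by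
        rintro p (h | ⟨h, h'⟩)
        · exact ⟨h.le, fun h' => absurd h' h.ne⟩
        · refine ⟨h.le, fun _ => ?_⟩
          rcases h' with (e | e) | e
          · exact ⟨j1, by rw [e, hj1]⟩
          · exact ⟨j2, by rw [e, hj2]⟩
          · exact ⟨j3, by rw [e, hj3]⟩
      rcases hFk i with e | e | e <;> rw [e] <;> exact key _ ‹_›

/-- The faces are equilateral triangles of side `√18`. -/
lemma crn_gram : ∀ k : Flag,
    dot3 (crn k 1 - crn k 0) (crn k 1 - crn k 0) = 18 ∧ dot3 (crn k 2 - crn k 0) (crn k 2 - crn k 0) = 18 ∧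
    dot3 (crn k 1 - crn k 0) (crn k 2 - crn k 0) = 9 ∧ dot3 (crn k 2 - crn k 0) (crn k 1 - crn k 0) = 9 := by
  decide +kernel

lemma crn_injective (k : Flag) : Injective (crn k) := by
  revert k; decide +kernel

lemma eq_of_weighted_sum_eq {l : Flag} {x y : Fin 3 → ℝ} (hxy : ∑ j, x j = ∑ j, y j)
    (h : ∀ f : Z3, ∑ j, x j * dot3 f (crn l j) = ∑ j, y j * dot3 f (crn l j)) : x = y := by
  obtain ⟨g1, g2, g3, g4⟩ := crn_gram l
  have h1 := h (crn l 1 - crn l 0)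
  have h2 := h (crn l 2 - crn l 0)
  simp only [sum_univ_three] at h1 h2 hxy
  set e := crn l 1 - crn l 0
  set e' := crn l 2 - crn l 0
  have c1 : dot3 e (crn l 1) = dot3 e (crn l 0) + 18 := by rw [← g1, ← dot3_add]; simp [e]
  have c2 : dot3 e (crn l 2) = dot3 e (crn l 0) + 9 := by rw [← g3, ← dot3_add]; simp [e']
  have c3 : dot3 e' (crn l 1) = dot3 e' (crn l 0) + 9 := by rw [← g4, ← dot3_add]; simp [e]
  have c4 : dot3 e' (crn l 2) = dot3 e' (crn l 0) + 18 := by rw [← g2, ← dot3_add]; simp [e']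
  rw [c1, c2] at h1
  rw [c3, c4] at h2
  push_cast at h1 h2
  have h3 : 18 * (x 1 - y 1) + 9 * (x 2 - y 2) = 0 := by
    linear_combination h1 - (dot3 e (crn l 0) : ℝ) * hxy
  have h4 : 9 * (x 1 - y 1) + 18 * (x 2 - y 2) = 0 := by
    linear_combination h2 - (dot3 e' (crn l 0) : ℝ) * hxy
  ext j
  fin_cases j <;> simp only [Fin.zero_eta, Fin.mk_one, Fin.reduceFinMk] <;> linarith

/-- Two faces, up to a translation, meet only in common corners and edges. -/
lemma faces_meet {k l : Flag} {g : Z3} (hg : InLat g) {x y : Fin 3 → ℝ} (hx : ∀ i, 0 ≤ x i)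
    (hy : ∀ i, 0 ≤ y i) (hx1 : ∑ i, x i = 1) (hy1 : ∑ i, y i = 1)
    (h : ∀ f : Z3, ∑ i, x i * dot3 f (crn k i) = ∑ j, y j * dot3 f (crn l j + g)) (i : Fin 3) :
    x i = 0 ∨ ∃ j, crn k i = crn l j + g ∧ y j = x i := by
  have hsupp : ∀ i, x i = 0 ∨ ∃ j, crn k i = crn l j + g := by
    rcases exists_separator k l hg with h1 | ⟨f, m, h1, h2⟩
    · exact fun i => Or.inr (h1 i)
    · have hle : ∑ i, x i * (dot3 f (crn k i) - m : ℝ) ≤ 0 := by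
        have e1 : ∑ i, x i * (dot3 f (crn k i) - m : ℝ) = ∑ j, y j * (dot3 f (crn l j + g) - m : ℝ) := by
          simp only [mul_sub, Finset.sum_sub_distrib, h f, ← Finset.sum_mul, hx1, hy1]
        rw [e1]; refine Finset.sum_nonpos fun j _ => mul_nonpos_of_nonneg_of_nonpos (hy j) ?_
        have : (dot3 f (crn l j + g) : ℝ) ≤ m := by exact_mod_cast h1 j
        linarith
      have hnn : ∀ i ∈ Finset.univ, 0 ≤ x i * (dot3 f (crn k i) - m : ℝ) := fun i _ => by
        have : (m : ℝ) ≤ dot3 f (crn k i) := by exact_mod_cast (h2 i).1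
        exact mul_nonneg (hx i) (by linarith)
      have hz := (Finset.sum_eq_zero_iff_of_nonneg hnn).1 (le_antisymm hle (Finset.sum_nonneg hnn))
      intro i
      rcases mul_eq_zero.1 (hz i (Finset.mem_univ i)) with h3 | h3
      · exact Or.inl h3
      · refine Or.inr ((h2 i).2 ?_); have : (m : ℝ) = dot3 f (crn k i) := by linarith
        exact_mod_cast this
  set z : Fin 3 → ℝ := fun j => ∑ i, if crn k i = crn l j + g then x i else 0 with hz
  have hsum : ∀ F : Z3 → ℝ, ∑ j, z j * F (crn l j + g) = ∑ i, x i * F (crn k i) := by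
    intro F; simp only [hz, Finset.sum_mul]; rw [Finset.sum_comm]
    refine Finset.sum_congr rfl fun i _ => ?_
    rcases hsupp i with h0 | ⟨j, hj⟩
    · simp [h0]
    · rw [Finset.sum_eq_single j]
      · rw [if_pos hj, hj]
      · intro j' _ hne; rw [if_neg, zero_mul]; intro h'
        exact hne (crn_injective l (add_right_cancel (h'.symm.trans hj)))
      · simp
  have hz1 : ∑ j, z j = 1 := by have := hsum fun _ => 1; simpa [hx1] using this
  have hzy : z = y := by
    refine eq_of_weighted_sum_eq (l := l) (hz1.trans hy1.symm) fun f => ?_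
    have h1 := (hsum fun p => (dot3 f p : ℝ)).trans (h f)
    simp only [dot3_add, Int.cast_add, mul_add, Finset.sum_add_distrib, ← Finset.sum_mul, hz1, hy1] at h1
    linarith
  rcases hsupp i with h0 | ⟨j, hj⟩
  · exact Or.inl h0
  · refine Or.inr ⟨j, hj, ?_⟩; rw [← hzy, hz]; simp only; rw [Finset.sum_eq_single i]
    · rw [if_pos hj]
    · intro i' _ hne; rw [if_neg]; intro h'; exact hne (crn_injective k (h'.trans hj.symm))
    · simp

/-! ### Faces in space -/

def pz (p : Z3) : E3 := pt (toVec p)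

lemma pz_apply (p : Z3) : pz p 0 = p.1 ∧ pz p 1 = p.2.1 ∧ pz p 2 = p.2.2 := by
  simp [pz, pt, toVec]

lemma pt_add (a b : Fin 3 → ℤ) : pt (a + b) = pt a + pt b := by
  ext i; simp [pt]

lemma toVec_add (p q : Z3) : toVec (p + q) = toVec p + toVec q := by
  ext i; fin_cases i <;> simp [toVec]

lemma pz_add (p q : Z3) : pz (p + q) = pz p + pz q := by
  rw [pz, toVec_add, pt_add]; rfl

lemma pt_injective : Injective pt := fun a b h => by
  ext i
  have := congrArg (fun x : E3 => x i) h
  simpa [pt] using this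

lemma pz_injective : Injective pz := pt_injective.comp toVec_injective

lemma pz_neg (p : Z3) : pz (-p) = -pz p := by
  rw [eq_neg_iff_add_eq_zero, ← pz_add, neg_add_cancel]
  ext i; fin_cases i <;> simp [pz, pt, toVec]

lemma isCellPosition_toVec {p : Z3} : IsCellPosition (toVec p) ↔ InLat p := by
  constructor
  · rintro ⟨w, hw, h⟩; rw [sum_univ_three, even_iff_two_dvd] at hw; have h0 := congrFun h 0
    have h1 := congrFun h 1; have h2 := congrFun h 2
    simp only [toVec, cons_val_zero, cons_val_one, cons_val] at h0 h1 h2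
    refine ⟨?_, ?_, ?_, ?_⟩ <;> omega
  · rintro ⟨h0, h1, h2, h3⟩; refine ⟨![p.1 / 8, p.2.1 / 8, p.2.2 / 8], ?_, ?_⟩
    · rw [sum_univ_three, even_iff_two_dvd]; simp only [cons_val_zero, cons_val_one, cons_val]
      omega
    · ext i
      fin_cases i <;> simp only [toVec, Fin.zero_eta, Fin.mk_one, Fin.reduceFinMk, cons_val_zero, cons_val_one, cons_val] <;> omega

lemma typeTwo_isFace_add (c g : Fin 3 → ℤ) (s : Fin 3 → ℤˣ) (x y z : Fin 3 → ℤ) :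
    (typeTwo c).IsFace s x y z ↔ (typeTwo (c + g)).IsFace s (x + g) (y + g) (z + g) := by
  have e : ∀ i, (typeTwo (c + g)).corner s i = (typeTwo c).corner s i + g := fun i => by
    ext k; simp [Octahedron.corner, typeTwo]; ring
  unfold Octahedron.IsFace
  simp only [e, add_left_inj]
  simp only [typeTwo, add_sub_add_right_eq_sub]

lemma typeOne_isFace_add (c g : Fin 3 → ℤ) (n s : Fin 3 → ℤˣ) (x y z : Fin 3 → ℤ) :
    (typeOne c n).IsFace s x y z ↔ (typeOne (c + g) n).IsFace s (x + g) (y + g) (z + g) := by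
  have e : ∀ i, (typeOne (c + g) n).corner s i = (typeOne c n).corner s i + g := fun i => by
    ext k; simp [Octahedron.corner, typeOne]; ring
  have e2 : (typeOne (c + g) n).center = (typeOne c n).center + g := by ext k; simp [typeOne]; ring
  unfold Octahedron.IsFace
  simp only [e, e2, add_left_inj, add_sub_add_right_eq_sub]

lemma IsCellFace.add {c x y z : Fin 3 → ℤ} (h : IsCellFace c x y z) (g : Fin 3 → ℤ) :
    IsCellFace (c + g) (x + g) (y + g) (z + g) := by
  cases h with
  | typeTwo_even s _ _ _ hs h => exact .typeTwo_even s _ _ _ hs ((typeTwo_isFace_add _ _ _ _ _ _).1 h)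
  | typeTwo_odd s _ _ _ hs h =>
    refine .typeTwo_odd s _ _ _ hs ?_; have := (typeTwo_isFace_add _ g _ _ _ _).1 h
    convert this using 2
    ext k; simp; ring
  | typeOne n s _ _ _ hn hs hs' h => exact .typeOne n s _ _ _ hn hs hs' ((typeOne_isFace_add _ _ _ _ _ _ _).1 h)

lemma isCellFace_iff {g x y z : Z3} : IsCellFace (toVec g) (toVec x) (toVec y) (toVec z) ↔
    ∃ l : Flag, x = crn l 0 + g ∧ y = crn l 1 + g ∧ z = crn l 2 + g := by
  have h : IsCellFace (toVec g) (toVec x) (toVec y) (toVec z) ↔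
      IsCellFace 0 (toVec (x - g)) (toVec (y - g)) (toVec (z - g)) := by
    constructor
    · intro h; have := h.add (toVec (-g))
      rw [← toVec_add, ← toVec_add, ← toVec_add, ← toVec_add, add_neg_cancel] at this
      simp only [sub_eq_add_neg]
      convert this using 1
      ext i; fin_cases i <;> rfl
    · intro h; have := h.add (toVec g)
      rwa [← toVec_add, ← toVec_add, ← toVec_add, sub_add_cancel, sub_add_cancel, sub_add_cancel, zero_add] at this
  rw [h, isCellFace_zero_iff]
  refine exists_congr fun l => ?_
  rw [← sub_eq_iff_eq_add, ← sub_eq_iff_eq_add, ← sub_eq_iff_eq_add]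
  simp only [crn, cons_val_zero, cons_val_one, cons_val]
  constructor
  · intro h; rw [h]; exact ⟨rfl, rfl, rfl⟩
  · rintro ⟨h1, h2, h3⟩; rw [h1, h2, h3]

lemma exists_toVec (a : Fin 3 → ℤ) : ∃ p, toVec p = a := ⟨_, toVec_eq a⟩

lemma mem_polyFaces {a b c : E3} : (a, b, c) ∈ polyFaces ↔ ∃ (l : Flag) (g : Z3), InLat g ∧
    a = pz (crn l 0 + g) ∧ b = pz (crn l 1 + g) ∧ c = pz (crn l 2 + g) := by
  constructor
  · rintro ⟨g, x, y, z, hg, h, e⟩; obtain ⟨g, rfl⟩ := exists_toVec g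
    obtain ⟨x, rfl⟩ := exists_toVec x; obtain ⟨y, rfl⟩ := exists_toVec y
    obtain ⟨z, rfl⟩ := exists_toVec z; obtain ⟨l, rfl, rfl, rfl⟩ := isCellFace_iff.1 h
    simp only [Prod.mk.injEq] at e; exact ⟨l, g, isCellPosition_toVec.1 hg, e⟩
  · rintro ⟨l, g, hg, rfl, rfl, rfl⟩
    exact ⟨toVec g, _, _, _, isCellPosition_toVec.2 hg, isCellFace_iff.2 ⟨l, rfl, rfl, rfl⟩, rfl⟩

lemma mem_pieceFaces_iff {a b c : E3} : (a, b, c) ∈ pieceFaces ↔ ∃ l : Flag,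
    a = pz (crn l 0) ∧ b = pz (crn l 1) ∧ c = pz (crn l 2) := by
  have h0 : toVec 0 = 0 := by ext i; fin_cases i <;> rfl
  constructor
  · rintro ⟨x, y, z, h, e⟩; obtain ⟨x, rfl⟩ := exists_toVec x; obtain ⟨y, rfl⟩ := exists_toVec y
    obtain ⟨z, rfl⟩ := exists_toVec z; rw [← h0] at h
    obtain ⟨l, rfl, rfl, rfl⟩ := isCellFace_iff.1 h; simp only [Prod.mk.injEq, add_zero] at e
    exact ⟨l, e⟩
  · rintro ⟨l, rfl, rfl, rfl⟩
    exact ⟨_, _, _, h0 ▸ isCellFace_iff.2 ⟨l, (add_zero _).symm, (add_zero _).symm, (add_zero _).symm⟩, rfl⟩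

lemma InLat.add {p q : Z3} (hp : InLat p) (hq : InLat q) : InLat (p + q) := by
  obtain ⟨h1, h2, h3, h4⟩ := hp
  obtain ⟨h5, h6, h7, h8⟩ := hq
  refine ⟨?_, ?_, ?_, ?_⟩ <;> simp only [Prod.fst_add, Prod.snd_add] <;> omega

lemma InLat.neg {p : Z3} (hp : InLat p) : InLat (-p) := by
  obtain ⟨h1, h2, h3, h4⟩ := hp
  refine ⟨?_, ?_, ?_, ?_⟩ <;> simp only [Prod.fst_neg, Prod.snd_neg] <;> omega

lemma InLat.sub {p q : Z3} (hp : InLat p) (hq : InLat q) : InLat (p - q) := by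
  rw [sub_eq_add_neg]; exact hp.add hq.neg

lemma inLat_zero : InLat 0 := by decide

/-- No translation carries the first flag to another flag and all flags to flags. -/
lemma eq_zero_of_translate : ∀ l : Flag, crn l 1 - crn l 0 = crn 0 1 - crn 0 0 →
    crn l 2 - crn l 0 = crn 0 2 - crn 0 0 → l = 0 ∨ ∃ k : Flag, ∀ l' : Flag,
      ¬ (InLat (crn k 0 + (crn l 0 - crn 0 0) - crn l' 0) ∧ crn l' 1 - crn l' 0 = crn k 1 - crn k 0 ∧
        crn l' 2 - crn l' 0 = crn k 2 - crn k 0) := by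
  decide +kernel

lemma mem_translations_iff {t : E3} : t ∈ translations ↔ ∃ g, InLat g ∧ t = pz g := by
  constructor
  · intro h; have h : ∀ a b c : E3, (a, b, c) ∈ polyFaces ↔ (a + t, b + t, c + t) ∈ polyFaces := h
    have hface : ∀ k : Flag, ∃ (l : Flag) (g : Z3), InLat g ∧ pz (crn k 0) + t = pz (crn l 0 + g) ∧
        pz (crn k 1) + t = pz (crn l 1 + g) ∧ pz (crn k 2) + t = pz (crn l 2 + g) := fun k =>
      mem_polyFaces.1 ((h _ _ _).1 (mem_polyFaces.2 ⟨k, 0, inLat_zero, by simp⟩))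
    obtain ⟨l, g, hg, h0, h1, h2⟩ := hface 0; have ht : t = pz (crn l 0 + g - crn 0 0) := by
      rw [sub_eq_add_neg, pz_add, ← h0, pz_neg]; abel
    have hk : ∀ (k l' : Flag) (g' : Z3) (i : Fin 3), pz (crn k i) + t = pz (crn l' i + g') →
        crn k i + (crn l 0 + g - crn 0 0) = crn l' i + g' := fun k l' g' i h => by
      rw [ht, ← pz_add] at h; exact pz_injective h
    have e0 := hk _ _ _ _ h0; have e1 := hk _ _ _ _ h1; have e2 := hk _ _ _ _ h2
    rcases eq_zero_of_translate l (by linear_combination -e1) (by linear_combination -e2) with rfl | ⟨k, hk'⟩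
    · refine ⟨g, hg, ?_⟩; rw [ht]; congr 1; abel
    · obtain ⟨l', g', hg', h0, h1, h2⟩ := hface k; have e0 := hk _ _ _ _ h0
      have e1 := hk _ _ _ _ h1; have e2 := hk _ _ _ _ h2; refine absurd ⟨?_, ?_, ?_⟩ (hk' l')
      · have : crn k 0 + (crn l 0 - crn 0 0) - crn l' 0 = g' - g := by linear_combination e0
        rw [this]; exact hg'.sub hg
      · linear_combination e0 - e1
      · linear_combination e0 - e2
  · rintro ⟨g, hg, rfl⟩ a b c; rw [mem_polyFaces, mem_polyFaces]; constructor
    · rintro ⟨l, g', hg', rfl, rfl, rfl⟩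
      exact ⟨l, g' + g, hg'.add hg, by rw [← pz_add, add_assoc], by rw [← pz_add, add_assoc], by rw [← pz_add, add_assoc]⟩
    · rintro ⟨l, g', hg', h0, h1, h2⟩
      have key : ∀ x : E3, ∀ p, x + pz g = pz (p + g') → x = pz (p + (g' - g)) := fun x p h => by
        rw [← eq_sub_iff_add_eq] at h
        rw [h, ← add_sub_assoc, sub_eq_add_neg (p + g'), pz_add _ (-g), pz_neg, sub_eq_add_neg]
      exact ⟨l, g' - g, hg'.sub hg, key _ _ h0, key _ _ h1, key _ _ h2⟩

/-! ### The flat triangle and the quotient surface -/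

/-- The coordinates of a complex number in the basis `1`, `omega`. -/
def tco (ξ : ℂ) : ℝ := 2 / √3 * ξ.im
def sco (ξ : ℂ) : ℝ := ξ.re - tco ξ / 2

/-- The closed triangle with corners `0`, `1`, `omega`. -/
def flatTri : Set ℂ := {ξ | 0 ≤ sco ξ ∧ 0 ≤ tco ξ ∧ sco ξ + tco ξ ≤ 1}

/-- The real affine map with `0, 1, omega ↦ a, b, c`. -/
def aff (a b c : E3) (ξ : ℂ) : E3 := a + sco ξ • (b - a) + tco ξ • (c - a)

lemma omega_eq : omega = ⟨1 / 2, √3 / 2⟩ := by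
  rw [omega, show (Real.pi / 3 * I : ℂ) = ((Real.pi / 3 : ℝ) : ℂ) * I by push_cast; ring]
  apply Complex.ext
  · rw [exp_ofReal_mul_I_re, Real.cos_pi_div_three]
  · rw [exp_ofReal_mul_I_im, Real.sin_pi_div_three]

lemma coords_injective {ξ η : ℂ} (h1 : sco ξ = sco η) (h2 : tco ξ = tco η) : ξ = η := by
  have h3 : (0 : ℝ) < √3 := by positivity
  apply Complex.ext
  · unfold sco at h1; linarith
  · unfold tco at h2; exact mul_left_cancel₀ (by positivity) h2

lemma coords_omega_mul (ξ : ℂ) : sco (omega * ξ) = -tco ξ ∧ tco (omega * ξ) = sco ξ + tco ξ := by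
  have h3 : √3 * √3 = 3 := Real.mul_self_sqrt (by norm_num)
  have h4 : √3 ≠ 0 := by positivity
  have ht : tco (omega * ξ) = sco ξ + tco ξ := by
    unfold sco tco; rw [omega_eq, mul_im]; field_simp; ring
  refine ⟨?_, ht⟩
  unfold sco
  rw [ht]
  unfold sco tco
  rw [omega_eq, mul_re]
  field_simp
  linear_combination -ξ.im * h3

lemma coords_one_sub (ξ : ℂ) : sco (1 - ξ) = 1 - sco ξ ∧ tco (1 - ξ) = -tco ξ := by
  simp only [sco, tco, sub_re, sub_im, one_re, one_im]
  constructor <;> ring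

lemma coords_ofReal (x : ℝ) : sco x = x ∧ tco x = 0 := by simp [sco, tco]

lemma coords_conj (ξ : ℂ) : sco (conj ξ) = sco ξ + tco ξ ∧ tco (conj ξ) = -tco ξ := by
  simp only [sco, tco, conj_re, conj_im]
  constructor <;> ring

lemma coords_combo (x y : ℝ) (ξ η : ℂ) : sco (x • ξ + y • η) = x * sco ξ + y * sco η ∧
    tco (x • ξ + y • η) = x * tco ξ + y * tco η := by
  simp only [sco, tco, real_smul, add_re, add_im, re_ofReal_mul, im_ofReal_mul]
  constructor <;> ring

lemma continuous_tco : Continuous tco := by unfold tco; fun_prop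
lemma continuous_sco : Continuous sco := by unfold sco; exact continuous_re.sub (continuous_tco.div_const 2)

lemma continuous_aff (a b c : E3) : Continuous (aff a b c) := by
  unfold aff
  exact (continuous_const.add (continuous_sco.smul continuous_const)).add (continuous_tco.smul continuous_const)

lemma convex_flatTri : Convex ℝ flatTri := by
  rintro ξ ⟨h1, h2, h3⟩ η ⟨h4, h5, h6⟩ x y hx hy hxy
  obtain ⟨e1, e2⟩ := coords_combo x y ξ η
  refine ⟨?_, ?_, ?_⟩
  · rw [e1]; positivity
  · rw [e2]; positivity
  · rw [e1, e2]; nlinarith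

lemma ofReal_mem_flat {x : ℝ} : (x : ℂ) ∈ flatTri ↔ 0 ≤ x ∧ x ≤ 1 := by
  obtain ⟨e1, e2⟩ := coords_ofReal x
  rw [flatTri, mem_ofPred_eq, e1, e2]
  simp

lemma omega_mul_one_sub_mem {ξ : ℂ} (h : ξ ∈ flatTri) : omega * (1 - ξ) ∈ flatTri := by
  obtain ⟨h1, h2, h3⟩ := h
  obtain ⟨e1, e2⟩ := coords_omega_mul (1 - ξ)
  obtain ⟨e3, e4⟩ := coords_one_sub ξ
  refine ⟨?_, ?_, ?_⟩
  · rw [e1, e4]; linarith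
  · rw [e2, e3, e4]; linarith
  · rw [e1, e2, e3, e4]; linarith

lemma omega_mul_ofReal_mem {x : ℝ} (h : (x : ℂ) ∈ flatTri) : omega * x ∈ flatTri := by
  rw [ofReal_mem_flat] at h
  obtain ⟨e1, e2⟩ := coords_omega_mul x
  obtain ⟨e3, e4⟩ := coords_ofReal x
  refine ⟨?_, ?_, ?_⟩ <;> simp only [e1, e2, e3, e4] <;> linarith

lemma aff_zero (a b c : E3) : aff a b c 0 = a := by simp [aff, sco, tco]
lemma aff_one (a b c : E3) : aff a b c 1 = b := by simp [aff, sco, tco]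
lemma aff_omega (a b c : E3) : aff a b c omega = c := by
  obtain ⟨e1, e2⟩ := coords_omega_mul 1
  rw [mul_one] at e1 e2
  have e3 : sco 1 = 1 := by simp [sco, tco]
  have e4 : tco 1 = 0 := by simp [tco]
  rw [aff, e1, e2, e3, e4]; simp

lemma omega_mem : omega ∈ flatTri := by
  obtain ⟨e1, e2⟩ := coords_omega_mul 1
  rw [mul_one] at e1 e2
  have e3 : sco 1 = 1 := by simp [sco, tco]
  have e4 : tco 1 = 0 := by simp [tco]
  refine ⟨?_, ?_, ?_⟩ <;> simp [e1, e2, e3, e4]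

lemma aff_combo (a b c : E3) (ξ η : ℂ) {x y : ℝ} (h : x + y = 1) :
    aff a b c (x • ξ + y • η) = x • aff a b c ξ + y • aff a b c η := by
  obtain ⟨e1, e2⟩ := coords_combo x y ξ η
  obtain rfl : y = 1 - x := by linarith
  rw [aff, aff, aff, e1, e2]
  module

lemma solidTriangle_eq (a b c : E3) : solidTriangle (a, b, c) = aff a b c '' flatTri := by
  refine subset_antisymm (convexHull_min ?_ ?_) ?_
  · rintro x (rfl | rfl | rfl)
    · exact ⟨0, by simpa using ofReal_mem_flat (x := 0), aff_zero _ _ _⟩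
    · exact ⟨1, by simpa using ofReal_mem_flat (x := 1), aff_one _ _ _⟩
    · exact ⟨omega, omega_mem, aff_omega _ _ _⟩
  · rintro _ ⟨ξ, hξ, rfl⟩ _ ⟨η, hη, rfl⟩ x y hx hy hxy
    exact ⟨_, convex_flatTri hξ hη hx hy hxy, aff_combo _ _ _ _ _ hxy⟩
  · rintro _ ⟨ξ, ⟨h1, h2, h3⟩, rfl⟩; have hc := convex_convexHull ℝ ({a, b, c} : Set E3)
    have ha := subset_convexHull ℝ ({a, b, c} : Set E3) (by simp : a ∈ _)
    have hb := subset_convexHull ℝ ({a, b, c} : Set E3) (by simp : b ∈ _)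
    have hcc := subset_convexHull ℝ ({a, b, c} : Set E3) (by simp : c ∈ _)
    have e : aff a b c ξ = ∑ i : Fin 3, ![1 - sco ξ - tco ξ, sco ξ, tco ξ] i • ![a, b, c] i := by
      rw [sum_univ_three, aff]; simp only [cons_val_zero, cons_val_one, cons_val]
      module
    rw [e]; refine hc.sum_mem (fun i _ => ?_) ?_ fun i _ => ?_
    · fin_cases i <;> simp [h1, h2]; linarith
    · rw [sum_univ_three]; simp; ring
    · fin_cases i
      exacts [ha, hb, hcc]

lemma segment_eq (a b c : E3) : segment ℝ a b = aff a b c '' ((fun x : ℝ => (x : ℂ)) '' Icc 0 1) := by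
  rw [segment_eq_image', image_image]
  refine image_congr fun x _ => ?_
  obtain ⟨e1, e2⟩ := coords_ofReal x
  rw [aff, e1, e2]; simp

/-! ### Parametrized faces -/

def emb (l : Flag) : ℂ → E3 := aff (pz (crn l 0)) (pz (crn l 1)) (pz (crn l 2))

/-- The weights of a point with respect to the corners of its face. -/
def wt (ξ : ℂ) : Fin 3 → ℝ := ![1 - sco ξ - tco ξ, sco ξ, tco ξ]

lemma emb_eq_sum (l : Flag) (ξ : ℂ) : emb l ξ = ∑ j, wt ξ j • pz (crn l j) := by
  rw [sum_univ_three, emb, aff]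
  simp only [wt, cons_val_zero, cons_val_one, cons_val]
  module

lemma wt_nonneg {ξ : ℂ} (h : ξ ∈ flatTri) (j : Fin 3) : 0 ≤ wt ξ j := by
  obtain ⟨h1, h2, h3⟩ := h
  fin_cases j <;> simp [wt, h1, h2]; linarith

lemma sum_wt (ξ : ℂ) : ∑ j, wt ξ j = 1 := by
  rw [sum_univ_three]; simp [wt]; ring

lemma wt_injective {ξ η : ℂ} (h : wt ξ = wt η) : ξ = η := coords_injective (congrFun h 1) (congrFun h 2)

lemma aff_add (a b c v : E3) (ξ : ℂ) : aff (a + v) (b + v) (c + v) ξ = aff a b c ξ + v := by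
  simp only [aff, add_sub_add_right_eq_sub]; abel

lemma aff_pz_add (l : Flag) (g : Z3) (ξ : ℂ) :
    aff (pz (crn l 0 + g)) (pz (crn l 1 + g)) (pz (crn l 2 + g)) ξ = emb l ξ + pz g := by
  rw [pz_add, pz_add, pz_add, aff_add]; rfl

lemma mem_polySurface_iff {x : E3} : x ∈ polySurface ↔
    ∃ (l : Flag) (g : Z3), InLat g ∧ ∃ ξ ∈ flatTri, x = emb l ξ + pz g := by
  simp only [polySurface, mem_iUnion, exists_prop]
  constructor
  · rintro ⟨⟨a, b, c⟩, h, hx⟩; obtain ⟨l, g, hg, rfl, rfl, rfl⟩ := mem_polyFaces.1 h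
    rw [solidTriangle_eq] at hx; obtain ⟨ξ, hξ, rfl⟩ := hx
    exact ⟨l, g, hg, ξ, hξ, aff_pz_add _ _ _⟩
  · rintro ⟨l, g, hg, ξ, hξ, rfl⟩; refine ⟨(_, _, _), mem_polyFaces.2 ⟨l, g, hg, rfl, rfl, rfl⟩, ?_⟩
    rw [solidTriangle_eq]; exact ⟨ξ, hξ, aff_pz_add _ _ _⟩

lemma emb_mem {l : Flag} {ξ : ℂ} (h : ξ ∈ flatTri) : emb l ξ ∈ polySurface := by
  refine mem_polySurface_iff.2 ⟨l, 0, inLat_zero, ξ, h, ?_⟩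
  have : pz 0 = 0 := by ext i; fin_cases i <;> simp [pz, pt, toVec]
  rw [this, add_zero]

def basePoint : X := projX ⟨emb 0 0, emb_mem (by simpa using ofReal_mem_flat (x := 0))⟩

open Classical in
def toX (x : E3) : X := if h : x ∈ polySurface then projX ⟨x, h⟩ else basePoint

lemma toX_of_mem {x : E3} (h : x ∈ polySurface) : toX x = projX ⟨x, h⟩ := dif_pos h

lemma toX_eq_iff {x y : E3} (hx : x ∈ polySurface) (hy : y ∈ polySurface) :
    toX x = toX y ↔ ∃ g, InLat g ∧ x = y + pz g := by
  rw [toX_of_mem hx, toX_of_mem hy, projX, projX, Quotient.eq]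
  change QuotientAddGroup.leftRel translations x y ↔ _
  rw [QuotientAddGroup.leftRel_apply, mem_translations_iff]
  constructor
  · rintro ⟨g, hg, h⟩; refine ⟨-g, hg.neg, ?_⟩; rw [pz_neg, ← h]; abel
  · rintro ⟨g, hg, h⟩; refine ⟨-g, hg.neg, ?_⟩; rw [pz_neg, h]; abel

lemma continuousOn_toX : ContinuousOn toX polySurface := by
  rw [continuousOn_iff_continuous_domRestrict]
  have : polySurface.domRestrict toX = projX := by ext x; exact toX_of_mem x.2
  rw [this]
  exact continuous_quotient_mk'

def XA (l : Flag) (ξ : ℂ) : X := toX (emb l ξ)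

lemma continuousOn_XA (l : Flag) : ContinuousOn (XA l) flatTri :=
  continuousOn_toX.comp (continuous_aff _ _ _).continuousOn fun _ h => emb_mem h

lemma add_mem_polySurface {x : E3} {g : Z3} (hg : InLat g) (hx : x ∈ polySurface) : x + pz g ∈ polySurface := by
  obtain ⟨l, g', hg', ξ, hξ, rfl⟩ := mem_polySurface_iff.1 hx
  exact mem_polySurface_iff.2 ⟨l, g' + g, hg'.add hg, ξ, hξ, by rw [pz_add, add_assoc]⟩

lemma toX_add {x : E3} {g : Z3} (hg : InLat g) (hx : x ∈ polySurface) : toX (x + pz g) = toX x :=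
  (toX_eq_iff (add_mem_polySurface hg hx) hx).2 ⟨g, hg, rfl⟩

lemma exists_XA_eq (x : X) : ∃ (l : Flag) (ξ : ℂ), ξ ∈ flatTri ∧ XA l ξ = x := by
  induction x using Quotient.inductionOn with
  | h p =>
    obtain ⟨x, hx⟩ := p; obtain ⟨l, g, hg, ξ, hξ, rfl⟩ := mem_polySurface_iff.1 hx
    refine ⟨l, ξ, hξ, ?_⟩; rw [XA, ← toX_add hg (emb_mem hξ), toX_of_mem hx]; rfl

/-- Points of two faces with the same image in `X` have the same weights at common corners. -/
lemma exists_shift_of_XA_eq {k l : Flag} {ξ η : ℂ} (hξ : ξ ∈ flatTri) (hη : η ∈ flatTri) (h : XA k ξ = XA l η) :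
    ∃ g, InLat g ∧ ∀ i, wt ξ i = 0 ∨ ∃ j, crn k i = crn l j + g ∧ wt η j = wt ξ i := by
  obtain ⟨g, hg, e⟩ := (toX_eq_iff (emb_mem hξ) (emb_mem hη)).1 h
  refine ⟨g, hg, faces_meet hg (wt_nonneg hξ) (wt_nonneg hη) (sum_wt ξ) (sum_wt η) fun f => ?_⟩
  have key : ∀ (z : Fin 3 → ℝ) (p : Fin 3 → Z3) (f : Z3), ∑ i, z i * (dot3 f (p i) : ℝ) =
      f.1 * (∑ i, z i • pz (p i)) 0 + f.2.1 * (∑ i, z i • pz (p i)) 1 + f.2.2 * (∑ i, z i • pz (p i)) 2 := by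
    intro z p f
    simp only [sum_univ_three, PiLp.add_apply, PiLp.smul_apply, pz_apply, smul_eq_mul, dot3]
    push_cast; ring
  have e2 : ∑ j, wt η j • pz (crn l j + g) = emb l η + pz g := by
    simp only [pz_add, smul_add, Finset.sum_add_distrib, ← Finset.sum_smul, sum_wt, one_smul, emb_eq_sum]
  rw [key, key, e2, ← e, emb_eq_sum]

/-! ### Neighbouring flags -/

/-- The same face, starting from its third corner. -/
def cyc (k : Flag) : Flag := Fin.ofNat 96 (3 * (k.1 / 3) + (k.1 % 3 + 2) % 3)

lemma flip_rot : ∀ k : Flag, flip (rot k) = cyc k := by decide +kernel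

lemma crn_cyc : ∀ k : Flag, crn (cyc k) 0 = crn k 2 ∧ crn (cyc k) 1 = crn k 0 ∧ crn (cyc k) 2 = crn k 1 := by
  decide +kernel

lemma crn_rot : ∀ k : Flag, InLat (crn (rot k) 0 - crn k 0) ∧
    crn (rot k) 1 = crn k 2 + (crn (rot k) 0 - crn k 0) := by
  decide +kernel

lemma crn_flip : ∀ k : Flag, InLat (crn (flip k) 0 - crn k 1) ∧
    crn (flip k) 1 = crn k 0 + (crn (flip k) 0 - crn k 1) := by
  decide +kernel

lemma eq_of_edge : ∀ k l : Flag, crn k 1 - crn k 0 = crn l 1 - crn l 0 → InLat (crn k 0 - crn l 0) → k = l := by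
  decide +kernel

lemma flip_flip : ∀ k : Flag, flip (flip k) = k := by decide +kernel

lemma rot_iterate : ∀ k : Flag, rot^[8] k = k := by decide +kernel

lemma XA_cyc (k : Flag) (ξ : ℂ) : XA (cyc k) ξ = XA k (omega * (1 - ξ)) := by
  have : emb (cyc k) ξ = emb k (omega * (1 - ξ)) := by
    obtain ⟨e1, e2⟩ := coords_omega_mul (1 - ξ); obtain ⟨e3, e4⟩ := coords_one_sub ξ
    obtain ⟨h0, h1, h2⟩ := crn_cyc k; rw [emb, emb, h0, h1, h2, aff, aff, e1, e2, e3, e4]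
    module
  rw [XA, this, XA]

lemma XA_rot (k : Flag) {x : ℝ} (hx : (x : ℂ) ∈ flatTri) : XA (rot k) x = XA k (omega * x) := by
  obtain ⟨g, hg, h0, h1⟩ : ∃ g, InLat g ∧ crn (rot k) 0 = crn k 0 + g ∧ crn (rot k) 1 = crn k 2 + g :=
    ⟨_, (crn_rot k).1, by abel, (crn_rot k).2⟩
  refine (toX_eq_iff (emb_mem hx) (emb_mem (omega_mul_ofReal_mem hx))).2 ⟨g, hg, ?_⟩
  obtain ⟨e1, e2⟩ := coords_omega_mul x
  obtain ⟨e3, e4⟩ := coords_ofReal x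
  rw [emb, emb, h0, h1, aff, aff, e1, e2, e3, e4, pz_add, pz_add]
  module

lemma XA_flip (k : Flag) {x : ℝ} (hx : (x : ℂ) ∈ flatTri) : XA (flip k) x = XA k (1 - x) := by
  obtain ⟨g, hg, h0, h1⟩ : ∃ g, InLat g ∧ crn (flip k) 0 = crn k 1 + g ∧ crn (flip k) 1 = crn k 0 + g :=
    ⟨_, (crn_flip k).1, by abel, (crn_flip k).2⟩
  have hx' : (1 - x : ℂ) ∈ flatTri := by
    have := ofReal_mem_flat.1 hx; have h2 := ofReal_mem_flat (x := 1 - x); push_cast at h2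
    exact h2.2 ⟨by linarith, by linarith⟩
  refine (toX_eq_iff (emb_mem hx) (emb_mem hx')).2 ⟨g, hg, ?_⟩
  obtain ⟨e1, e2⟩ := coords_one_sub x
  obtain ⟨e3, e4⟩ := coords_ofReal x
  rw [emb, emb, h0, h1, aff, aff, e1, e2, e3, e4, pz_add, pz_add]
  module

/-! ### Separation -/

lemma isClosed_translations : IsClosed (translations : Set E3) := by
  have hl : ∀ g : Z3, (g.1 : ℝ) = (pz g) 0 ∧ (g.2.1 : ℝ) = (pz g) 1 ∧ (g.2.2 : ℝ) = (pz g) 2 := by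
    intro g; simp [pz_apply]
  have e2 : (translations : Set E3) = (fun x : E3 => (x 0, x 1, x 2)) ⁻¹'
      ((fun g : Z3 => ((g.1 : ℝ), (g.2.1 : ℝ), (g.2.2 : ℝ))) '' {g | InLat g}) := by
    ext t; constructor
    · intro ht; obtain ⟨g, hg, rfl⟩ := mem_translations_iff.1 ht; obtain ⟨h1, h2, h3⟩ := hl g
      exact ⟨g, hg, by simp only [h1, h2, h3]⟩
    · rintro ⟨g, hg, h⟩; obtain ⟨h1, h2, h3⟩ := hl g; refine mem_translations_iff.2 ⟨g, hg, ?_⟩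
      simp only [Prod.mk.injEq] at h; ext i
      fin_cases i
      · exact h.1.symm.trans h1
      · exact h.2.1.symm.trans h2
      · exact h.2.2.symm.trans h3
  rw [e2]
  refine IsClosed.preimage (by fun_prop) ?_
  have hce : Topology.IsClosedEmbedding (fun g : Z3 => ((g.1 : ℝ), (g.2.1 : ℝ), (g.2.2 : ℝ))) :=
    Int.isClosedEmbedding_coe_real.prodMap
      (Int.isClosedEmbedding_coe_real.prodMap Int.isClosedEmbedding_coe_real)
  exact hce.isClosedMap _ (isClosed_discrete _)

instance : T2Space X := by
  have : IsClosed (translations : Set E3) := isClosed_translations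
  let f : X → E3 ⧸ translations := Quotient.lift (fun p : polySurface => (QuotientAddGroup.mk (p : E3) : E3 ⧸ translations))
    fun a b h => QuotientAddGroup.eq.2 (QuotientAddGroup.leftRel_apply.1 h)
  have hf : Continuous f := Continuous.quotient_lift (continuous_quotient_mk'.comp continuous_subtype_val) _
  refine T2Space.of_injective_continuous (f := f) ?_ hf
  rintro ⟨a⟩ ⟨b⟩ h
  exact Quotient.sound (QuotientAddGroup.leftRel_apply.2 (QuotientAddGroup.eq.1 h))

/-! ### When two points of faces agree in `X` -/

def spin (ξ : ℂ) : ℂ := omega * (1 - ξ)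

lemma wt_spin (ξ : ℂ) : wt (spin ξ) 0 = wt ξ 1 ∧ wt (spin ξ) 1 = wt ξ 2 ∧ wt (spin ξ) 2 = wt ξ 0 := by
  obtain ⟨e1, e2⟩ := coords_omega_mul (1 - ξ)
  obtain ⟨e3, e4⟩ := coords_one_sub ξ
  simp only [wt, spin, e1, e2, e3, e4, cons_val_zero, cons_val_one, cons_val]
  refine ⟨by ring, by ring, by ring⟩

lemma spin_spin_spin (ξ : ℂ) : spin (spin (spin ξ)) = ξ := by
  obtain ⟨a1, a2, a3⟩ := wt_spin ξ
  obtain ⟨b1, b2, b3⟩ := wt_spin (spin ξ)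
  obtain ⟨c1, c2, c3⟩ := wt_spin (spin (spin ξ))
  apply wt_injective
  ext i
  fin_cases i
  · exact c1.trans (b2.trans a3)
  · exact c2.trans (b3.trans a1)
  · exact c3.trans (b1.trans a2)

lemma spin_mem {ξ : ℂ} (h : ξ ∈ flatTri) : spin ξ ∈ flatTri := omega_mul_one_sub_mem h

/-- `(k', ξ')` is obtained from `(k, ξ)` by starting the face from another corner. -/
def SameFacePoint (k : Flag) (ξ : ℂ) (k' : Flag) (ξ' : ℂ) : Prop := ∃ n, k' = cyc^[n] k ∧ ξ = spin^[n] ξ' ∧ ξ' ∈ flatTri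

lemma SameFacePoint.apply {Z : Type*} {θ : Flag → ℂ → Z} (hθ : ∀ k, ∀ ξ ∈ flatTri, θ (cyc k) ξ = θ k (spin ξ))
    {k k' : Flag} {ξ ξ' : ℂ} (h : SameFacePoint k ξ k' ξ') : θ k ξ = θ k' ξ' := by
  obtain ⟨n, rfl, rfl, h⟩ := h
  induction n generalizing ξ' with
  | zero => rfl
  | succ n ih => rw [iterate_succ_apply, iterate_succ_apply', hθ _ _ h, ih (spin_mem h)]

lemma SameFacePoint.div_three {k k' : Flag} {ξ ξ' : ℂ} (h : SameFacePoint k ξ k' ξ') : k'.1 / 3 = k.1 / 3 := by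
  obtain ⟨n, rfl, -, -⟩ := h
  have hc : ∀ k : Flag, (cyc k).1 / 3 = k.1 / 3 := by decide +kernel
  induction n with
  | zero => rfl
  | succ n ih => rw [iterate_succ_apply', hc, ih]

lemma exists_sameFacePoint (k : Flag) {ξ : ℂ} (hξ : ξ ∈ flatTri) (i : Fin 3) : ∃ k' ξ', SameFacePoint k ξ k' ξ' ∧
    ξ' ∈ flatTri ∧ (∀ j, wt ξ' j = wt ξ (i + j)) ∧ ∀ j, crn k' j = crn k (i + j) := by
  have h1 := spin_mem hξ
  have h2 := spin_mem h1
  obtain ⟨a1, a2, a3⟩ := wt_spin ξ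
  obtain ⟨b1, b2, b3⟩ := wt_spin (spin ξ)
  obtain ⟨c1, c2, c3⟩ := crn_cyc k
  obtain ⟨d1, d2, d3⟩ := crn_cyc (cyc k)
  fin_cases i
  · exact ⟨k, ξ, ⟨0, rfl, rfl, hξ⟩, hξ, fun j => by simp, fun j => by simp⟩
  · refine ⟨cyc (cyc k), spin ξ, ⟨2, rfl, (spin_spin_spin ξ).symm, h1⟩, h1, fun j => ?_, fun j => ?_⟩
    · fin_cases j <;> [exact a1; exact a2; exact a3]
    · fin_cases j <;> [exact d1.trans c3; exact d2.trans c1; exact d3.trans c2]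
  · refine ⟨cyc k, spin (spin ξ), ⟨1, rfl, (spin_spin_spin ξ).symm, h2⟩, h2, fun j => ?_, fun j => ?_⟩
    · fin_cases j <;> [exact b1.trans a2; exact b2.trans a3; exact b3.trans a1]
    · fin_cases j <;> [exact c1; exact c2; exact c3]

lemma exists_rot_of_vertex : ∀ k l : Flag, InLat (crn k 0 - crn l 0) → ∃ n : Fin 8, k = rot^[n] l := by
  decide +kernel

lemma crn_flip_two : ∀ l : Flag, ∀ j : Fin 3, crn (flip l) 2 ≠ crn l j + (crn (flip l) 0 - crn l 1) := by
  decide +kernel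

lemma wt_zero_iff {ξ : ℂ} : wt ξ 2 = 0 ↔ ∃ x : ℝ, ξ = x := by
  constructor
  · intro h
    exact ⟨sco ξ, coords_injective (coords_ofReal _).1.symm (by rw [(coords_ofReal _).2]; exact h)⟩
  · rintro ⟨x, rfl⟩; exact (coords_ofReal x).2

lemma XA_eq_cases {k l : Flag} {ξ η : ℂ} (hξ : ξ ∈ flatTri) (hη : η ∈ flatTri) (h : XA k ξ = XA l η) :
    ∃ k' ξ' l' η', SameFacePoint k ξ k' ξ' ∧ SameFacePoint l η l' η' ∧
      ((k' = l' ∧ ξ' = η') ∨ (k' = flip l' ∧ ∃ x : ℝ, (x : ℂ) ∈ flatTri ∧ ξ' = x ∧ η' = 1 - x) ∨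
        (ξ' = 0 ∧ η' = 0 ∧ ∃ n, k' = rot^[n] l')) := by
  obtain ⟨i, hi⟩ : ∃ i, wt ξ i ≠ 0 ∧ (wt ξ (i + 1) ≠ 0 ∨ wt ξ (i + 2) = 0) := by
    have hs := sum_wt ξ; rw [sum_univ_three] at hs
    by_cases h0 : wt ξ 0 = 0
    · by_cases h1 : wt ξ 1 = 0
      · exact ⟨2, fun h2 => by linarith, Or.inr h1⟩
      · by_cases h2 : wt ξ 2 = 0
        · exact ⟨1, h1, Or.inr h0⟩
        · exact ⟨1, h1, Or.inl h2⟩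
    · by_cases h1 : wt ξ 1 = 0
      · by_cases h2 : wt ξ 2 = 0
        · exact ⟨0, h0, Or.inr h2⟩
        · exact ⟨2, h2, Or.inl h0⟩
      · exact ⟨0, h0, Or.inl h1⟩
  obtain ⟨k', ξ', hk, hξ', hw, hc⟩ := exists_sameFacePoint k hξ i
  have hXA : ∀ k, ∀ ξ ∈ flatTri, XA (cyc k) ξ = XA k (spin ξ) := fun k ξ _ => XA_cyc k ξ
  rw [hk.apply hXA] at h
  replace hi : wt ξ' 0 ≠ 0 ∧ (wt ξ' 1 ≠ 0 ∨ wt ξ' 2 = 0) := by rw [hw, hw, hw, add_zero]; exact hi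
  clear hw hc
  obtain ⟨g, hg, hm⟩ := exists_shift_of_XA_eq hξ' hη h
  obtain ⟨i0, ha, hb⟩ := (hm 0).resolve_left hi.1
  obtain ⟨l', η', hl, hη', hw, hc⟩ := exists_sameFacePoint l hη i0
  rw [hl.apply hXA] at h
  refine ⟨k', ξ', ?_⟩
  have h0 : crn k' 0 = crn l' 0 + g := by rw [hc, ha, add_zero]
  have h0' : wt η' 0 = wt ξ' 0 := by rw [hw, add_zero, hb]
  replace hm : ∀ i, wt ξ' i = 0 ∨ ∃ j, crn k' i = crn l' j + g ∧ wt η' j = wt ξ' i := by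
    intro i; refine (hm i).imp_right ?_; rintro ⟨j, hj1, hj2⟩; refine ⟨j - i0, ?_, ?_⟩
    · rw [hc, hj1]; simp
    · rw [hw, ← hj2]; simp
  have hs1 := sum_wt ξ'
  have hs2 := sum_wt η'
  rw [sum_univ_three] at hs1 hs2
  by_cases h1 : wt ξ' 1 = 0
  · have h2 : wt ξ' 2 = 0 := hi.2.resolve_left (not_not_intro h1); have n1 := wt_nonneg hη' 1
    have n2 := wt_nonneg hη' 2; refine ⟨l', η', hk, hl, Or.inr (Or.inr ⟨?_, ?_, ?_⟩)⟩
    · apply wt_injective; ext j; have hz : wt 0 = ![1, 0, 0] := by simp [wt, sco, tco]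
      rw [hz]
      fin_cases j
      · simp; linarith
      · exact h1
      · exact h2
    · apply wt_injective; ext j; have hz : wt 0 = ![1, 0, 0] := by simp [wt, sco, tco]
      rw [hz]
      fin_cases j
      · simp; linarith
      · simp; linarith
      · simp; linarith
    · obtain ⟨n, hn⟩ := exists_rot_of_vertex k' l' (by rw [h0, add_sub_cancel_left]; exact hg)
      exact ⟨n, hn⟩
  · obtain ⟨j1, ha1, hb1⟩ := (hm 1).resolve_left h1; have hne : j1 ≠ 0 := by
      rintro rfl; exact absurd (crn_injective k' (ha1.trans h0.symm)) (by decide)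
    obtain rfl | rfl : j1 = 1 ∨ j1 = 2 := by omega
    · have hkl : k' = l' := eq_of_edge _ _ (by rw [h0, ha1]; abel) (by rw [h0, add_sub_cancel_left]; exact hg)
      refine ⟨l', η', hk, hl, Or.inl ⟨hkl, wt_injective ?_⟩⟩; ext j
      fin_cases j
      · exact h0'.symm
      · exact hb1.symm
      · simp; linarith
    · obtain ⟨m, ζ, hlm, hζ, hw', hc'⟩ := exists_sameFacePoint l' hη' 2
      have hl2 : SameFacePoint l η m ζ := by
        obtain ⟨n, e1, e2, e3⟩ := hl; obtain ⟨n', e1', e2', e3'⟩ := hlm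
        exact ⟨n' + n, by rw [e1', e1, iterate_add_apply],
          by rw [e2, e2', ← iterate_add_apply, add_comm], e3'⟩
      obtain ⟨hf1, hf2⟩ := crn_flip m; have m0 : crn m 0 = crn l' 2 := hc' 0
      have m1 : crn m 1 = crn l' 0 := hc' 1; have hkm : k' = flip m := by
        apply eq_of_edge
        · rw [hf2, h0, ha1, m0, m1]; abel
        · have : crn k' 0 - crn (flip m) 0 = g - (crn (flip m) 0 - crn m 1) := by rw [h0, m1]; abel
          rw [this]; exact hg.sub hf1
      have h2 : wt ξ' 2 = 0 := by
        by_contra h2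
        obtain ⟨j, hj, -⟩ := (hm 2).resolve_left h2; refine crn_flip_two m (j - 2) ?_
        have e : crn m (j - 2) = crn l' j := by rw [hc']; simp
        rw [e, ← hkm, hj, h0, m1]; abel
      obtain ⟨x, hx⟩ := wt_zero_iff.1 h2
      refine ⟨m, ζ, hk, hl2, Or.inr (Or.inl ⟨hkm, x, hx ▸ hξ', hx, ?_⟩)⟩
      obtain ⟨e1, e2⟩ := coords_one_sub x; obtain ⟨e3, e4⟩ := coords_ofReal x
      have w0 : wt ζ 0 = wt η' 2 := hw' 0; have w1 : wt ζ 1 = wt η' 0 := hw' 1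
      have w2 : wt ζ 2 = wt η' 1 := hw' 2
      have x0 : wt ξ' 0 = 1 - x := by rw [hx]; simp [wt, e3, e4]
      have x1 : wt ξ' 1 = x := by rw [hx]; simp [wt, e3]
      apply coords_injective
      · rw [e1, e3]; exact w1.trans (h0'.trans x0)
      · rw [e2, e4, neg_zero]; exact w2.trans (by linarith)

/-- The universal property of `X`: maps on the faces which agree along edges agree wherever the
parametrizations of `X` do. -/
lemma eq_of_XA_eq {Z : Type*} {θ : Flag → ℂ → Z} (hc : ∀ k, ∀ ξ ∈ flatTri, θ (cyc k) ξ = θ k (spin ξ))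
    (hf : ∀ k, ∀ x : ℝ, (x : ℂ) ∈ flatTri → θ (flip k) x = θ k (1 - x))
    {k l : Flag} {ξ η : ℂ} (hξ : ξ ∈ flatTri) (hη : η ∈ flatTri) (h : XA k ξ = XA l η) : θ k ξ = θ l η := by
  obtain ⟨k', ξ', l', η', hk, hl, H⟩ := XA_eq_cases hξ hη h
  rw [hk.apply hc, hl.apply hc]
  have m0 : (0 : ℂ) ∈ flatTri := by simpa using ofReal_mem_flat (x := 0)
  have m1 : (1 : ℂ) ∈ flatTri := by simpa using ofReal_mem_flat (x := 1)
  rcases H with ⟨rfl, rfl⟩ | ⟨rfl, x, hx, rfl, rfl⟩ | ⟨rfl, rfl, n, rfl⟩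
  · rfl
  · exact hf _ _ hx
  · have hr : ∀ k, θ (rot k) 0 = θ k 0 := by
      intro k; have e : rot k = flip (cyc k) := by rw [← flip_rot, flip_flip]
      have h0 := hf (cyc k) 0 (by simpa using m0); simp only [ofReal_zero, sub_zero] at h0
      rw [e, h0, hc _ _ m1]; simp [spin]
    clear hk hl
    induction n with
    | zero => rfl
    | succ n ih => rw [iterate_succ_apply', hr, ih]

/-! ### Faces, edges and vertices of `X` -/

lemma imageX_eq {A : Set E3} (h : A ⊆ polySurface) : imageX A = toX '' A := by
  ext x
  constructor
  · rintro ⟨p, hp, rfl⟩; exact ⟨p, hp, toX_of_mem p.2⟩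
  · rintro ⟨p, hp, rfl⟩; exact ⟨⟨p, h hp⟩, hp, (toX_of_mem _).symm⟩

lemma imageX_aff {l : Flag} {g : Z3} (hg : InLat g) {s : Set ℂ} (hs : s ⊆ flatTri) :
    imageX (aff (pz (crn l 0 + g)) (pz (crn l 1 + g)) (pz (crn l 2 + g)) '' s) = XA l '' s := by
  rw [imageX_eq, image_image]
  · refine image_congr fun ξ hξ => ?_; rw [aff_pz_add, toX_add hg (emb_mem (hs hξ)), XA]
  · rintro _ ⟨ξ, hξ, rfl⟩; rw [aff_pz_add]; exact add_mem_polySurface hg (emb_mem (hs hξ))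

lemma zero_mem_flatTri : (0 : ℂ) ∈ flatTri := by simpa using ofReal_mem_flat (x := 0)

def flatEdge : Set ℂ := (fun x : ℝ => (x : ℂ)) '' Icc 0 1

lemma flatEdge_subset : flatEdge ⊆ flatTri := by
  rintro _ ⟨x, hx, rfl⟩
  exact ofReal_mem_flat.2 hx

lemma facesX_eq : facesX = {F | ∃ l, F = XA l '' flatTri} := by
  ext F
  constructor
  · rintro ⟨⟨a, b, c⟩, h, rfl⟩; obtain ⟨l, g, hg, rfl, rfl, rfl⟩ := mem_polyFaces.1 h
    exact ⟨l, by rw [solidTriangle_eq, imageX_aff hg subset_rfl]⟩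
  · rintro ⟨l, rfl⟩; refine ⟨_, mem_polyFaces.2 ⟨l, 0, inLat_zero, rfl, rfl, rfl⟩, ?_⟩
    rw [solidTriangle_eq, imageX_aff inLat_zero subset_rfl]

lemma edgesX_eq : edgesX = {F | ∃ l, F = XA l '' flatEdge} := by
  ext F
  constructor
  · rintro ⟨a, b, c, h, rfl⟩; obtain ⟨l, g, hg, rfl, rfl, rfl⟩ := mem_polyFaces.1 h
    exact ⟨l, by rw [segment_eq _ _ (pz (crn l 2 + g)), ← flatEdge, imageX_aff hg flatEdge_subset]⟩
  · rintro ⟨l, rfl⟩; refine ⟨_, _, _, mem_polyFaces.2 ⟨l, 0, inLat_zero, rfl, rfl, rfl⟩, ?_⟩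
    rw [segment_eq _ _ (pz (crn l 2 + 0)), ← flatEdge, imageX_aff inLat_zero flatEdge_subset]

lemma verticesX_eq : verticesX = {x | ∃ l, x = XA l 0} := by
  have key : ∀ l g, InLat g → toX (pz (crn l 0 + g)) = XA l 0 ∧ pz (crn l 0 + g) ∈ polySurface := by
    intro l g hg; have e : pz (crn l 0 + g) = emb l 0 + pz g := by rw [pz_add, emb, aff_zero]
    have hm := emb_mem (l := l) zero_mem_flatTri; rw [e]
    exact ⟨toX_add hg hm, add_mem_polySurface hg hm⟩
  rw [verticesX, imageX_eq]
  · ext x; constructor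
    · rintro ⟨a, ⟨b, c, h⟩, rfl⟩; obtain ⟨l, g, hg, rfl, rfl, rfl⟩ := mem_polyFaces.1 h
      exact ⟨l, (key l g hg).1⟩
    · rintro ⟨l, rfl⟩
      exact ⟨_, ⟨_, _, mem_polyFaces.2 ⟨l, 0, inLat_zero, rfl, rfl, rfl⟩⟩, (key l 0 inLat_zero).1⟩
  · rintro a ⟨b, c, h⟩; obtain ⟨l, g, hg, rfl, rfl, rfl⟩ := mem_polyFaces.1 h; exact (key l g hg).2

lemma coords_centre : sco (1 / 3 + omega / 3) = 1 / 3 ∧ tco (1 / 3 + omega / 3) = 1 / 3 := by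
  obtain ⟨e1, e2⟩ := coords_omega_mul 1
  have e3 : sco 1 = 1 := by simp [sco, tco]
  have e4 : tco 1 = 0 := by simp [tco]
  rw [mul_one, e4] at e1
  rw [mul_one, e3, e4] at e2
  obtain ⟨a, b⟩ := coords_combo (1 / 3) (1 / 3) 1 omega
  have e : (1 / 3 + omega / 3 : ℂ) = (1 / 3 : ℝ) • (1 : ℂ) + (1 / 3 : ℝ) • omega := by
    simp only [real_smul]; push_cast; ring
  rw [e, a, b, e1, e2, e3, e4]
  norm_num

lemma SameFacePoint.wt_pos {k k' : Flag} {ξ ξ' : ℂ} (h : SameFacePoint k ξ k' ξ') (hp : ∀ i, wt ξ i ≠ 0) :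
    ∀ i, wt ξ' i ≠ 0 := by
  obtain ⟨n, -, rfl, -⟩ := h
  induction n with
  | zero => exact hp
  | succ n ih =>
    refine ih ?_; rw [iterate_succ_apply'] at hp; generalize spin^[n] ξ' = ξ at hp
    obtain ⟨a1, a2, a3⟩ := wt_spin ξ; intro i
    fin_cases i
    · exact a3 ▸ hp 2
    · exact a1 ▸ hp 0
    · exact a2 ▸ hp 1

lemma div_three_eq_of_XA_eq {k l : Flag} {ξ η : ℂ} (hξ : ξ ∈ flatTri) (hη : η ∈ flatTri) (h : XA k ξ = XA l η)
    (hp : ∀ i, wt ξ i ≠ 0) : k.1 / 3 = l.1 / 3 := by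
  obtain ⟨k', ξ', l', η', hk, hl, H⟩ := XA_eq_cases hξ hη h
  have hw := hk.wt_pos hp
  rcases H with ⟨rfl, rfl⟩ | ⟨rfl, x, hx, rfl, rfl⟩ | ⟨rfl, rfl, n, rfl⟩
  · rw [← hk.div_three, hl.div_three]
  · exact absurd (wt_zero_iff.2 ⟨x, rfl⟩) (hw 2)
  · exact absurd (wt_zero_iff.2 ⟨0, by simp⟩) (hw 2)

lemma div_three_eq_of_image_eq {k l : Flag} (h : XA k '' flatTri = XA l '' flatTri) : k.1 / 3 = l.1 / 3 := by
  obtain ⟨e1, e2⟩ := coords_centre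
  have hm : (1 / 3 + omega / 3 : ℂ) ∈ flatTri := by
    refine ⟨?_, ?_, ?_⟩ <;> simp only [e1, e2] <;> norm_num
  have hk : XA k (1 / 3 + omega / 3) ∈ XA l '' flatTri := h ▸ mem_image_of_mem _ hm
  obtain ⟨η, hη, e⟩ := hk
  refine div_three_eq_of_XA_eq hm hη e.symm fun i => ?_
  simp only [wt, e1, e2]
  fin_cases i <;> norm_num

lemma spin_image : spin '' flatTri = flatTri := by
  refine subset_antisymm (by rintro _ ⟨ξ, h, rfl⟩; exact spin_mem h) fun ξ h =>
    ⟨spin (spin ξ), spin_mem (spin_mem h), spin_spin_spin ξ⟩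

lemma image_cyc (k : Flag) : XA (cyc k) '' flatTri = XA k '' flatTri ∧ emb (cyc k) '' flatTri = emb k '' flatTri := by
  have h2 : ∀ ξ, emb (cyc k) ξ = emb k (spin ξ) := by
    intro ξ; obtain ⟨e1, e2⟩ := coords_omega_mul (1 - ξ); obtain ⟨e3, e4⟩ := coords_one_sub ξ
    obtain ⟨h0, h1, h2⟩ := crn_cyc k; rw [spin, emb, emb, h0, h1, h2, aff, aff, e1, e2, e3, e4]
    module
  have h3 : ∀ ξ, XA (cyc k) ξ = XA k (spin ξ) := XA_cyc k
  constructor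
  · rw [funext h3, ← image_image (XA k) spin, spin_image]
  · rw [funext h2, ← image_image (emb k) spin, spin_image]

lemma exists_cyc_of_div_three : ∀ k l : Flag, k.1 / 3 = l.1 / 3 → k = l ∨ k = cyc l ∨ k = cyc (cyc l) := by
  decide +kernel

lemma image_eq_of_div_three {k l : Flag} (h : k.1 / 3 = l.1 / 3) :
    XA k '' flatTri = XA l '' flatTri ∧ emb k '' flatTri = emb l '' flatTri := by
  obtain rfl | rfl | rfl := exists_cyc_of_div_three k l h
  · exact ⟨rfl, rfl⟩
  · exact image_cyc l
  · obtain ⟨a, b⟩ := image_cyc l; obtain ⟨a', b'⟩ := image_cyc (cyc l)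
    exact ⟨a'.trans a, b'.trans b⟩

lemma ncard_facesX : facesX.ncard = 32 := by
  let f : Fin 32 → Set X := fun i => XA ⟨3 * i.1, by omega⟩ '' flatTri
  have hf : Injective f := by
    intro i j h; have := div_three_eq_of_image_eq h
    simp only [Nat.mul_div_cancel_left _ (by norm_num : 0 < 3)] at this; exact Fin.ext this
  have e : facesX = range f := by
    rw [facesX_eq]; ext F; constructor
    · rintro ⟨l, rfl⟩; refine ⟨⟨l.1 / 3, by omega⟩, (image_eq_of_div_three ?_).1⟩; simp
    · rintro ⟨i, rfl⟩; exact ⟨_, rfl⟩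
  rw [e, ← image_univ, ncard_image_of_injective _ hf]
  simp

lemma mem_pieceTriangles_iff {T : Set E3} : T ∈ solidTriangle '' pieceFaces ↔ ∃ l, T = emb l '' flatTri := by
  constructor
  · rintro ⟨⟨a, b, c⟩, h, rfl⟩; obtain ⟨l, rfl, rfl, rfl⟩ := mem_pieceFaces_iff.1 h
    exact ⟨l, solidTriangle_eq _ _ _⟩
  · rintro ⟨l, rfl⟩; exact ⟨_, mem_pieceFaces_iff.2 ⟨l, rfl, rfl, rfl⟩, solidTriangle_eq _ _ _⟩

lemma imageX_emb (l : Flag) : imageX (emb l '' flatTri) = XA l '' flatTri := by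
  rw [imageX_eq, image_image]
  · rfl
  · rintro _ ⟨ξ, hξ, rfl⟩; exact emb_mem hξ

/-- Every face of `X` is the image of exactly one face of the fundamental piece. -/
lemma existsUnique_pieceTriangle {F : Set X} (h : F ∈ facesX) :
    ∃! T : Set E3, T ∈ solidTriangle '' pieceFaces ∧ F = imageX T := by
  rw [facesX_eq] at h
  obtain ⟨l, rfl⟩ := h
  refine ⟨emb l '' flatTri, ⟨mem_pieceTriangles_iff.2 ⟨l, rfl⟩, (imageX_emb l).symm⟩, ?_⟩
  rintro T ⟨hT, e⟩
  obtain ⟨k, rfl⟩ := mem_pieceTriangles_iff.1 hT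
  rw [imageX_emb] at e
  exact (image_eq_of_div_three (div_three_eq_of_image_eq e.symm)).2

lemma imageX_pieceTriangle_mem {T : Set E3} (h : T ∈ solidTriangle '' pieceFaces) : imageX T ∈ facesX := by
  obtain ⟨l, rfl⟩ := mem_pieceTriangles_iff.1 h
  rw [facesX_eq]
  exact ⟨l, imageX_emb l⟩

/-! ### The flat parametrizations -/

/-- The unfolding of a face and its neighbour. -/
def flatMap (l : Flag) (z : ℂ) : X := if 0 ≤ z.im then XA l z else XA (flip l) (1 - z)

lemma rhombus_subset {z : ℂ} (h : z ∈ rhombus) : (0 ≤ z.im → z ∈ flatTri) ∧ (z.im ≤ 0 → 1 - z ∈ flatTri) := by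
  have hs : (0 : ℝ) < 2 / √3 := by positivity
  have h0 : ∀ ζ ∈ convexHull ℝ {0, 1, omega, conj omega},
      0 ≤ sco ζ ∧ 0 ≤ sco ζ + tco ζ ∧ sco ζ ≤ 1 ∧ sco ζ + tco ζ ≤ 1 := by
    have hc : Convex ℝ {ζ : ℂ | 0 ≤ sco ζ ∧ 0 ≤ sco ζ + tco ζ ∧ sco ζ ≤ 1 ∧ sco ζ + tco ζ ≤ 1} := by
      rintro ξ ⟨a1, a2, a3, a4⟩ η ⟨b1, b2, b3, b4⟩ x y hx hy hxy
      obtain ⟨e1, e2⟩ := coords_combo x y ξ η; rw [mem_ofPred_eq, e1, e2]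
      refine ⟨by positivity, ?_, by nlinarith, by nlinarith⟩; have := mul_nonneg hx a2
      have := mul_nonneg hy b2; linarith
    intro ζ hζ; refine convexHull_min ?_ hc hζ; obtain ⟨e1, e2⟩ := coords_omega_mul 1
    have e3 : sco 1 = 1 := by simp [sco, tco]
    have e4 : tco 1 = 0 := by simp [tco]
    have e5 : sco 0 = 0 := by simp [sco, tco]
    have e6 : tco 0 = 0 := by simp [tco]
    obtain ⟨e7, e8⟩ := coords_conj omega; rw [mul_one, e4] at e1; rw [mul_one, e3, e4] at e2
    rw [e1, e2] at e7; rw [e2] at e8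
    rintro ζ (rfl | rfl | rfl | rfl)
    · simp [e5, e6]
    · simp [e3, e4]
    · simp [e1, e2]
    · simp [e7, e8]
  obtain ⟨h1, h2, h3, h4⟩ := h0 z (interior_subset h)
  obtain ⟨e3, e4⟩ := coords_one_sub z
  constructor
  · intro hz; exact ⟨h1, mul_nonneg hs.le hz, h4⟩
  · intro hz; have ht : tco z ≤ 0 := mul_nonpos_of_nonneg_of_nonpos hs.le hz; refine ⟨?_, ?_, ?_⟩
    · rw [e3]; linarith
    · rw [e4]; linarith
    · rw [e3, e4]; linarith

lemma fold_eq (a b c d : E3) (z : ℂ) : fold a b c d z = if 0 ≤ z.im then aff a b c z else aff b a d (1 - z) := by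
  have hs : (0 : ℝ) < 2 / √3 := by positivity
  obtain ⟨e3, e4⟩ := coords_one_sub z
  have e : 0 ≤ 2 / √3 * z.im ↔ 0 ≤ z.im := mul_nonneg_iff_of_pos_left hs
  have ht : 2 / √3 * z.im = tco z := rfl
  have hsc : z.re - tco z / 2 = sco z := rfl
  simp only [fold]
  by_cases h : 0 ≤ z.im
  · rw [if_pos (e.2 h), if_pos h, ht, hsc]; rfl
  · rw [if_neg (fun h' => h (e.1 h')), if_neg h, ht, hsc, aff, e3, e4]
    module

lemma fold_mem_and_toX {l m : Flag} {g g' : Z3} (hg : InLat g) (hg' : InLat g')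
    (h0 : crn m 0 + g' = crn l 1 + g) (h1 : crn m 1 + g' = crn l 0 + g) {z : ℂ} (hz : z ∈ rhombus) :
    fold (pz (crn l 0 + g)) (pz (crn l 1 + g)) (pz (crn l 2 + g)) (pz (crn m 2 + g')) z ∈ polySurface ∧
    toX (fold (pz (crn l 0 + g)) (pz (crn l 1 + g)) (pz (crn l 2 + g)) (pz (crn m 2 + g')) z) = flatMap l z := by
  obtain rfl : m = flip l := by
    obtain ⟨f1, f2⟩ := crn_flip l; apply eq_of_edge
    · rw [f2]; have : crn m 1 - crn m 0 = (crn m 1 + g') - (crn m 0 + g') := by abel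
      rw [this, h0, h1]; abel
    · have : crn m 0 - crn (flip l) 0 = g - g' - (crn (flip l) 0 - crn l 1) := by
        have : crn m 0 = crn l 1 + g - g' := by rw [← h0]; abel
        rw [this]; abel
      rw [this]; exact (hg.sub hg').sub f1
  obtain ⟨k1, k2⟩ := rhombus_subset hz
  rw [fold_eq, flatMap]
  split_ifs with h
  · rw [aff_pz_add]; exact ⟨add_mem_polySurface hg (emb_mem (k1 h)), toX_add hg (emb_mem (k1 h))⟩
  · rw [← h0, ← h1, aff_pz_add]; have hm := k2 (le_of_not_ge h)
    exact ⟨add_mem_polySurface hg' (emb_mem hm), toX_add hg' (emb_mem hm)⟩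

lemma exists_of_mem_flatParams {P : Set ℂ × (ℂ → X)} (h : P ∈ flatParams) :
    P.1 = rhombus ∧ ∃ l, EqOn P.2 (flatMap l) rhombus := by
  obtain ⟨h1, a, b, c, d, hab, hba, h⟩ := h
  refine ⟨h1, ?_⟩
  obtain ⟨l, g, hg, rfl, rfl, rfl⟩ := mem_polyFaces.1 hab
  obtain ⟨m, g', hg', e1, e2, rfl⟩ := mem_polyFaces.1 hba
  refine ⟨l, fun z hz => ?_⟩
  obtain ⟨hm, e⟩ := h z hz
  rw [e, ← toX_of_mem hm]
  exact (fold_mem_and_toX hg hg' (pz_injective e1.symm) (pz_injective e2.symm) hz).2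

lemma flatMap_mem_flatParams (l : Flag) : (rhombus, flatMap l) ∈ flatParams := by
  obtain ⟨f1, f2⟩ := crn_flip l
  have hg : InLat (-(crn (flip l) 0 - crn l 1)) := f1.neg
  have h0 : crn (flip l) 0 + -(crn (flip l) 0 - crn l 1) = crn l 1 + 0 := by abel
  have h1 : crn (flip l) 1 + -(crn (flip l) 0 - crn l 1) = crn l 0 + 0 := by rw [f2]; abel
  refine ⟨rfl, _, _, _, _, mem_polyFaces.2 ⟨l, 0, inLat_zero, rfl, rfl, rfl⟩,
    mem_polyFaces.2 ⟨flip l, _, hg, congrArg pz h0.symm, congrArg pz h1.symm, rfl⟩, fun z hz => ?_⟩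
  obtain ⟨hm, e⟩ := fold_mem_and_toX inLat_zero hg h0 h1 hz
  exact ⟨hm, by rw [← toX_of_mem hm, e]⟩

lemma continuousOn_flatMap (l : Flag) : ContinuousOn (flatMap l) rhombus := by
  have h1 : IsClosed {z : ℂ | 0 ≤ z.im} := isClosed_le continuous_const continuous_im
  have h2 : IsClosed {z : ℂ | z.im ≤ 0} := isClosed_le continuous_im continuous_const
  have e : rhombus = rhombus ∩ {z | 0 ≤ z.im} ∪ rhombus ∩ {z | z.im ≤ 0} := by
    rw [← inter_union_distrib_left]; refine (inter_eq_left.2 fun z _ => ?_).symm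
    exact le_total 0 z.im
  have a1 : ContinuousOn (flatMap l) (rhombus ∩ {z | 0 ≤ z.im}) := by
    refine ((continuousOn_XA l).mono ?_).congr fun z hz => if_pos hz.2
    exact fun z hz => (rhombus_subset hz.1).1 hz.2
  have a2 : ContinuousOn (flatMap l) (rhombus ∩ {z | z.im ≤ 0}) := by
    have hc : ContinuousOn (fun z => XA (flip l) (1 - z)) (rhombus ∩ {z | z.im ≤ 0}) :=
      (continuousOn_XA (flip l)).comp (by fun_prop) fun z hz => (rhombus_subset hz.1).2 hz.2
    refine hc.congr fun z hz => ?_; rw [flatMap]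
    split_ifs with h
    · have h0 : z.im = 0 := le_antisymm hz.2 h
      obtain ⟨x, rfl⟩ : ∃ x : ℝ, z = x := ⟨z.re, Complex.ext rfl (by simpa using h0)⟩
      have := XA_flip l (x := 1 - x) (by push_cast; exact (rhombus_subset hz.1).2 hz.2)
      push_cast at this; rw [sub_sub_cancel] at this; exact this.symm
    · rfl
  intro z hz
  by_cases h : z.im = 0
  · have b1 := a1 z ⟨hz, h.ge⟩; have b2 := a2 z ⟨hz, h.le⟩; have := b1.union b2; rwa [← e] at this
  · rcases lt_or_gt_of_ne h with h | h
    · refine (a2 z ⟨hz, h.le⟩).mono_of_mem_nhdsWithin ?_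
      refine Filter.inter_mem self_mem_nhdsWithin (mem_nhdsWithin_of_mem_nhds ?_)
      exact (continuous_im.tendsto z).eventually (Iic_mem_nhds h)
    · refine (a1 z ⟨hz, h.le⟩).mono_of_mem_nhdsWithin ?_
      refine Filter.inter_mem self_mem_nhdsWithin (mem_nhdsWithin_of_mem_nhds ?_)
      exact (continuous_im.tendsto z).eventually (Ici_mem_nhds h)

/-! ### The hyperbolic and the flat triangle -/

/-- The Euclidean distance from the centre to its neighbours. -/
def rad : ℝ := √(√2 - 1)

lemma sqrt_two_mul_self : √2 * √2 = 2 := Real.mul_self_sqrt (by norm_num)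

lemma one_lt_sqrt_two : 1 < √2 := by
  rw [Real.lt_sqrt] <;> norm_num

lemma sqrt_two_lt : √2 < 3 / 2 := by
  rw [Real.sqrt_lt'] <;> norm_num

lemma rad_sq : rad ^ 2 = √2 - 1 := Real.sq_sqrt (by linarith [one_lt_sqrt_two])

lemma rad_pos : 0 < rad := Real.sqrt_pos.2 (by linarith [one_lt_sqrt_two])

lemma zeta_eq : zeta = ⟨√2 / 2, √2 / 2⟩ := by
  rw [zeta, show (Real.pi / 4 * I : ℂ) = ((Real.pi / 4 : ℝ) : ℂ) * I by push_cast; ring]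
  apply Complex.ext
  · rw [exp_ofReal_mul_I_re, Real.cos_pi_div_four]
  · rw [exp_ofReal_mul_I_im, Real.sin_pi_div_four]

lemma v_zero : v 0 = (rad : ℂ) := by simp [v, rad]

def hypShape : Shape where
  n := 4
  p := rad
  k := 1
  three_le := by norm_num
  p_pos := rad_pos
  k_nonneg := by norm_num
  rel := by rw [rad_sq]; push_cast; rw [Real.cos_pi_div_four]; ring

def flatShape : Shape where
  n := 3
  p := 1
  k := 0
  three_le := by norm_num
  p_pos := by norm_num
  k_nonneg := le_rfl
  rel := by push_cast; rw [Real.cos_pi_div_three]; ring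

lemma hyp_c : hypShape.c = √2 / 2 := by
  change Real.cos (Real.pi / (4 : ℕ)) = _
  push_cast; exact Real.cos_pi_div_four

lemma hyp_s : hypShape.s = √2 / 2 := by
  change Real.sin (Real.pi / (4 : ℕ)) = _
  push_cast; exact Real.sin_pi_div_four

lemma flat_c : flatShape.c = 1 / 2 := by
  change Real.cos (Real.pi / (3 : ℕ)) = _
  push_cast; exact Real.cos_pi_div_three

lemma flat_s : flatShape.s = √3 / 2 := by
  change Real.sin (Real.pi / (3 : ℕ)) = _
  push_cast; exact Real.sin_pi_div_three

lemma hyp_κ : hypShape.κ = zeta := by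
  rw [Shape.κ, hyp_c, hyp_s, zeta_eq]

lemma flat_κ : flatShape.κ = omega := by
  rw [Shape.κ, flat_c, flat_s, omega_eq]

lemma hyp_turn (z : ℂ) : hypShape.turn z = halfTurn (v 0) z := by
  rw [Shape.turn, halfTurn, v_zero, conj_ofReal]
  change (rad - z : ℂ) / (1 - (1 : ℝ) * rad * z) = _
  push_cast; ring_nf

lemma hyp_ρ (z : ℂ) : hypShape.ρ z = zeta * halfTurn (v 0) z := by
  rw [Shape.ρ, hyp_κ, hyp_turn]

lemma flat_turn (z : ℂ) : flatShape.turn z = 1 - z := by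
  rw [Shape.turn]
  change ((1 : ℝ) - z : ℂ) / (1 - (0 : ℝ) * (1 : ℝ) * z) = _
  simp

lemma flat_ρ (z : ℂ) : flatShape.ρ z = spin z := by
  rw [Shape.ρ, flat_κ, flat_turn, spin]

lemma flat_f2 (z : ℂ) : flatShape.f2 z = √3 / 2 * sco z := by
  have h3 : √3 * √3 = 3 := Real.mul_self_sqrt (by norm_num)
  have h4 : √3 ≠ 0 := by positivity
  rw [Shape.f2, flat_s, flat_c, sco, tco]
  field_simp

lemma flat_f3 (z : ℂ) : flatShape.f3 z = √3 / 2 * (1 - sco z - tco z) := by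
  have h4 : √3 ≠ 0 := by positivity
  rw [Shape.f3, flat_s, flat_c, sco, tco]
  change √3 / 2 * 1 * (1 + 0 * _) - _ - _ = _
  field_simp
  ring

lemma flat_T : flatShape.T = flatTri := by
  have h3 : 0 < √3 / 2 := by positivity
  have h4 : 0 < 2 / √3 := by positivity
  ext z
  change 0 ≤ z.im ∧ 0 ≤ flatShape.f2 z ∧ 0 ≤ flatShape.f3 z ∧ 0 * _ < (1 : ℝ) ↔ 0 ≤ sco z ∧ 0 ≤ 2 / √3 * z.im ∧ _
  rw [flat_f2, flat_f3, mul_nonneg_iff_of_pos_left h3, mul_nonneg_iff_of_pos_left h3, mul_nonneg_iff_of_pos_left h4]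
  constructor
  · rintro ⟨a, b, c, -⟩; exact ⟨b, a, by linarith⟩
  · rintro ⟨b, a, c⟩; exact ⟨a, b, by linarith, by norm_num⟩

lemma mem_flat_kite_iff {z : ℂ} : z ∈ flatShape.kite ↔
    0 < sco z ∧ 0 < sco z + tco z ∧ sco z < 1 ∧ sco z + tco z < 1 := by
  have h3 : 0 < √3 / 2 := by positivity
  have hs : (0 : ℝ) < 2 / √3 := by positivity
  change 0 < flatShape.f2 (Shape.up z) ∧ 0 < flatShape.f3 (Shape.up z) ∧ 0 * _ < (1 : ℝ) ↔ _
  rw [flat_f2, flat_f3, mul_pos_iff_of_pos_left h3, mul_pos_iff_of_pos_left h3]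
  rcases le_total 0 z.im with h | h
  · have ht : 0 ≤ tco z := mul_nonneg hs.le h; rw [Shape.up_of_nonneg h]; constructor
    · rintro ⟨a, b, -⟩; refine ⟨?_, ?_, ?_, ?_⟩ <;> linarith
    · rintro ⟨a, b, c, d⟩; refine ⟨?_, ?_, ?_⟩ <;> linarith
  · have ht : tco z ≤ 0 := mul_nonpos_of_nonneg_of_nonpos hs.le h; obtain ⟨e1, e2⟩ := coords_conj z
    rw [Shape.up_of_nonpos h, e1, e2]; constructor
    · rintro ⟨a, b, -⟩; refine ⟨?_, ?_, ?_, ?_⟩ <;> linarith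
    · rintro ⟨a, b, c, d⟩; refine ⟨?_, ?_, ?_⟩ <;> linarith

lemma flatTri_eq_convexHull : flatTri ⊆ convexHull ℝ {0, 1, omega} := by
  rintro ξ ⟨h1, h2, h3⟩
  have hc := convex_convexHull ℝ ({0, 1, omega} : Set ℂ)
  have ha := subset_convexHull ℝ ({0, 1, omega} : Set ℂ) (by simp : (0 : ℂ) ∈ _)
  have hb := subset_convexHull ℝ ({0, 1, omega} : Set ℂ) (by simp : (1 : ℂ) ∈ _)
  have hcc := subset_convexHull ℝ ({0, 1, omega} : Set ℂ) (by simp : omega ∈ _)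
  have e : ξ = ∑ i : Fin 3, ![1 - sco ξ - tco ξ, sco ξ, tco ξ] i • ![0, 1, omega] i := by
    have h3 : √3 ≠ 0 := by positivity
    rw [sum_univ_three, omega_eq]
    simp only [cons_val_zero, cons_val_one, cons_val, smul_zero, zero_add, real_smul, mul_one]
    apply Complex.ext
    · rw [add_re, re_ofReal_mul, ofReal_re, sco]; ring
    · rw [add_im, im_ofReal_mul, ofReal_im, tco]; field_simp; ring
  rw [e]
  refine hc.sum_mem (fun i _ => ?_) ?_ fun i _ => ?_
  · fin_cases i <;> simp [h1, h2]; linarith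
  · rw [sum_univ_three]; simp; ring
  · fin_cases i
    exacts [ha, hb, hcc]

lemma flat_kite : flatShape.kite = rhombus := by
  set K : Set ℂ := convexHull ℝ {0, 1, omega, conj omega} with hK
  have hsub : ({0, 1, omega} : Set ℂ) ⊆ {0, 1, omega, conj omega} := by
    rintro x (rfl | rfl | rfl) <;> simp
  have hconj : ∀ z ∈ K, conj z ∈ K := by
    intro z hz; have h := mem_image_of_mem conjLIE.toLinearIsometry.toLinearMap hz
    rw [hK, LinearMap.image_convexHull] at h; refine convexHull_mono ?_ h
    rintro _ ⟨y, (rfl | rfl | rfl | rfl), rfl⟩ <;> simp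
  refine subset_antisymm (interior_maximal ?_ flatShape.isOpen_kite) ?_
  · intro z hz; have hT : ∀ w ∈ flatShape.T, w ∈ K := fun w hw => by
      rw [flat_T] at hw; exact convexHull_mono hsub (flatTri_eq_convexHull hw)
    have h := hT _ (Shape.up_mem_T hz)
    rcases le_total 0 z.im with h1 | h1
    · rwa [Shape.up_of_nonneg h1] at h
    · rw [Shape.up_of_nonpos h1] at h; simpa using hconj _ h
  · intro z hz; have hlim : ∀ s : ℝ, ∃ ε > 0, (z + (ε * s : ℝ) : ℂ) ∈ rhombus := by
      intro s
      have hc : Filter.Tendsto (fun ε : ℝ => (z + (ε * s : ℝ) : ℂ)) (nhdsWithin 0 (Ioi 0)) (nhds z) := by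
        have : Continuous (fun ε : ℝ => (z + (ε * s : ℝ) : ℂ)) := by fun_prop
        have h := this.tendsto 0; simp only [zero_mul, ofReal_zero, add_zero] at h
        exact h.mono_left nhdsWithin_le_nhds
      obtain ⟨ε, h1, h2⟩ := ((hc.eventually (isOpen_interior.mem_nhds hz)).and self_mem_nhdsWithin).exists
      exact ⟨ε, h2, h1⟩
    have key : ∀ w ∈ rhombus, 0 ≤ sco w ∧ 0 ≤ sco w + tco w ∧ sco w ≤ 1 ∧ sco w + tco w ≤ 1 := by
      intro w hw; have hs : (0 : ℝ) < 2 / √3 := by positivity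
      obtain ⟨a, b⟩ := rhombus_subset hw
      rcases le_total 0 w.im with h | h
      · obtain ⟨h1, h2, h3⟩ := a h; exact ⟨h1, by linarith, by linarith, h3⟩
      · obtain ⟨h1, h2, h3⟩ := b h; obtain ⟨e1, e2⟩ := coords_one_sub w; rw [e1] at h1 h3
        rw [e2] at h2 h3; exact ⟨by linarith, by linarith, by linarith, by linarith⟩
    have hadd : ∀ x : ℝ, sco (z + x) = sco z + x ∧ tco (z + x) = tco z := by
      intro x; simp [sco, tco]; ring
    rw [mem_flat_kite_iff]; obtain ⟨ε, h1, h2⟩ := hlim 1; obtain ⟨δ, h3, h4⟩ := hlim (-1)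
    have k1 := key _ h2; have k2 := key _ h4; rw [(hadd _).1, (hadd _).2] at k1 k2
    refine ⟨?_, ?_, ?_, ?_⟩ <;> linarith

def tri : Set ℂ := hypShape.T

/-- The conformal equivalence of the hyperbolic and the flat equilateral triangle. -/
lemma exists_flattening : ∃ h : ℂ → ℂ, ContinuousOn h tri ∧ BijOn h tri flatTri ∧
    (∀ z ∈ tri, h (zeta * halfTurn (v 0) z) = spin (h z)) ∧
    (∀ z ∈ tri, h (zeta * conj z) = omega * conj (h z)) ∧ h 0 = 0 ∧
    (∀ z ∈ tri, (h z).im = 0 ↔ z.im = 0) ∧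
    (∀ z ∈ tri, h z ∈ flatShape.Ω ↔ z ∈ hypShape.Ω) ∧
    BijOn (Shape.reflectExt h) hypShape.kite rhombus ∧
    DifferentiableOn ℂ (Shape.reflectExt h) hypShape.kite := by
  obtain ⟨h, h1, h2, h3, h4, h5, h6, h7, h8, h9⟩ := Shape.exists_kite_map hypShape flatShape
  rw [flat_T] at h2
  rw [flat_kite] at h8
  refine ⟨h, h1, h2, fun z hz => ?_, fun z hz => ?_, h6, h7, h3, h8, h9⟩
  · rw [← hyp_ρ, h4 z hz, flat_ρ]
  · have := h5 z hz; rwa [Shape.σ, Shape.σ, hyp_κ, flat_κ] at this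

/-! ### Automorphisms of the disk -/

def Disk : Set ℂ := {z | normSq z < 1}

lemma mem_Disk_iff {z : ℂ} : z ∈ Disk ↔ ‖z‖ < 1 := by
  rw [Disk, mem_ofPred_eq, normSq_eq_norm_sq, sq_lt_one_iff₀ (norm_nonneg z)]

lemma isOpen_Disk : IsOpen Disk := isOpen_lt continuous_normSq continuous_const

lemma zero_mem_Disk : (0 : ℂ) ∈ Disk := by simp [Disk]

/-- Orientation preserving isometries of the hyperbolic plane. -/
def IsMob (f : ℂ → ℂ) : Prop :=
  ∃ A B : ℂ, normSq B < normSq A ∧ ∀ z ∈ Disk, f z = (A * z + B) / (conj B * z + conj A)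

lemma mob_den_ne_zero {A B z : ℂ} (h : normSq B < normSq A) (hz : z ∈ Disk) : conj B * z + conj A ≠ 0 := by
  intro e
  have h1 : normSq (conj B * z) = normSq (conj A) := by rw [eq_neg_of_add_eq_zero_left e, normSq_neg]
  rw [normSq_mul, normSq_conj, normSq_conj] at h1
  have h2 := normSq_nonneg B
  have h3 : normSq z < 1 := hz
  nlinarith

lemma one_sub_normSq_mob {A B z : ℂ} : normSq (conj B * z + conj A) - normSq (A * z + B) =
    (normSq A - normSq B) * (1 - normSq z) := by
  simp only [normSq_apply, add_re, add_im, mul_re, mul_im, conj_re, conj_im]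
  ring

lemma IsMob.mapsTo {f : ℂ → ℂ} (hf : IsMob f) : MapsTo f Disk Disk := by
  obtain ⟨A, B, h, hf⟩ := hf
  intro z hz
  have h0 := normSq_pos.2 (mob_den_ne_zero h hz)
  have h1 : 0 < 1 - normSq z := sub_pos.2 hz
  change normSq (f z) < 1
  rw [hf z hz, normSq_div, div_lt_one h0]
  have := one_sub_normSq_mob (A := A) (B := B) (z := z)
  have := mul_pos (sub_pos.2 h) h1
  linarith

lemma IsMob.comp {f g : ℂ → ℂ} (hf : IsMob f) (hg : IsMob g) : IsMob fun z => f (g z) := by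
  obtain ⟨A, B, h, hf⟩ := hf
  obtain ⟨C, D, h', hg'⟩ := hg.imp fun _ h => h
  refine ⟨A * C + B * conj D, A * D + B * conj C, ?_, fun z hz => ?_⟩
  · have : normSq (A * C + B * conj D) - normSq (A * D + B * conj C) =
        (normSq A - normSq B) * (normSq C - normSq D) := by
      simp only [normSq_apply, add_re, add_im, mul_re, mul_im, conj_re, conj_im]; ring
    have := mul_pos (sub_pos.2 h) (sub_pos.2 h'); linarith
  · have h1 := mob_den_ne_zero h' hz; have h2 := mob_den_ne_zero h (hg.mapsTo hz)
    change f (g z) = _; rw [hf _ (hg.mapsTo hz)]; rw [hg' z hz] at h2 ⊢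
    have e1 : conj B * ((C * z + D) / (conj D * z + conj C)) + conj A =
        (conj (A * D + B * conj C) * z + conj (A * C + B * conj D)) / (conj D * z + conj C) := by
      rw [mul_div_assoc', div_add' _ _ _ h1]; simp only [map_add, map_mul, conj_conj]; congr 1; ring
    have e2 : A * ((C * z + D) / (conj D * z + conj C)) + B =
        ((A * C + B * conj D) * z + (A * D + B * conj C)) / (conj D * z + conj C) := by
      rw [mul_div_assoc', div_add' _ _ _ h1]; congr 1; ring
    rw [e1, e2, div_div_div_cancel_right₀ h1]

lemma IsMob.differentiableOn {f : ℂ → ℂ} (hf : IsMob f) : DifferentiableOn ℂ f Disk := by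
  obtain ⟨A, B, h, hf⟩ := hf
  refine DifferentiableOn.congr (f := fun z => (A * z + B) / (conj B * z + conj A)) ?_ hf
  exact DifferentiableOn.div (by fun_prop) (by fun_prop) fun z hz => mob_den_ne_zero h hz

/-- An isometry changes the normalized difference by a factor of modulus one which depends only on
the first point. -/
lemma IsMob.exists_factor {f : ℂ → ℂ} (hf : IsMob f) {a : ℂ} (ha : a ∈ Disk) : ∃ ε : ℂ, ‖ε‖ = 1 ∧ ∀ b ∈ Disk,
    (f b - f a) / (1 - conj (f a) * f b) = ε * ((b - a) / (1 - conj a * b)) := by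
  obtain ⟨A, B, h, hf⟩ := hf
  have h1 := mob_den_ne_zero h ha
  have h2 : B * conj a + A ≠ 0 := by have := (map_ne_zero conj).2 h1; simpa using this
  refine ⟨(B * conj a + A) / (conj B * a + conj A), ?_, fun b hb => ?_⟩
  · have e : conj B * a + conj A = conj (B * conj a + A) := by simp
    rw [norm_div, e, norm_conj, div_self (norm_ne_zero_iff.2 h2)]
  · have h3 := mob_den_ne_zero h hb; have h4 : (A * conj A - B * conj B : ℂ) ≠ 0 := by
      rw [mul_conj, mul_conj, ← ofReal_sub, ofReal_ne_zero]; exact (sub_pos.2 h).ne'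
    rw [hf a ha, hf b hb]
    have e1 : (A * b + B) / (conj B * b + conj A) - (A * a + B) / (conj B * a + conj A) =
        (A * conj A - B * conj B) * (b - a) / ((conj B * b + conj A) * (conj B * a + conj A)) := by
      rw [div_sub_div _ _ h3 h1]; congr 1; ring
    have e2 : 1 - conj ((A * a + B) / (conj B * a + conj A)) * ((A * b + B) / (conj B * b + conj A)) =
        (A * conj A - B * conj B) * (1 - conj a * b) / ((B * conj a + A) * (conj B * b + conj A)) := by
      simp only [map_div₀, map_add, map_mul, conj_conj]
      rw [show conj A * conj a + conj B = conj A * conj a + conj B from rfl, div_mul_div_comm, one_sub_div (mul_ne_zero h2 h3)]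
      congr 1; ring
    rw [e1, e2]; generalize conj B * b + conj A = P at h3; generalize conj B * a + conj A = Q at h1
    generalize B * conj a + A = R at h2; generalize (A * conj A - B * conj B : ℂ) = N at h4
    field_simp

lemma one_sub_conj_mul_ne_zero {a b : ℂ} (ha : a ∈ Disk) (hb : b ∈ Disk) : 1 - conj a * b ≠ 0 := by
  have := mob_den_ne_zero (A := 1) (B := -a) (by simpa [Disk] using ha) hb
  intro h
  apply this
  simp only [map_neg, map_one]
  linear_combination h

lemma IsMob.injOn {f : ℂ → ℂ} (hf : IsMob f) : InjOn f Disk := by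
  intro a ha b hb hab
  obtain ⟨ε, hε, h⟩ := hf.exists_factor ha
  have := h b hb
  rw [hab, sub_self, zero_div, eq_comm, mul_eq_zero, div_eq_zero_iff] at this
  rcases this with h0 | h0 | h0
  · simp [h0] at hε
  · exact (sub_eq_zero.1 h0).symm
  · exact absurd h0 (one_sub_conj_mul_ne_zero ha hb)

lemma IsMob.pseudoDist_eq {f : ℂ → ℂ} (hf : IsMob f) {a b : ℂ} (ha : a ∈ Disk) (hb : b ∈ Disk) :
    pseudoDist (f a) (f b) = pseudoDist a b := by
  obtain ⟨ε, hε, h⟩ := hf.exists_factor ha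
  have e : ∀ x y : ℂ, pseudoDist x y = ‖(y - x) / (1 - conj x * y)‖ := by
    intro x y; rw [pseudoDist, ← norm_neg, ← neg_div, neg_sub]
  rw [e, e, h b hb, norm_mul, hε, one_mul]

lemma IsMob.hypAngle_eq {f : ℂ → ℂ} (hf : IsMob f) {a b c : ℂ} (ha : a ∈ Disk) (hb : b ∈ Disk) (hc : c ∈ Disk) :
    hypAngle (f a) (f b) (f c) = hypAngle a b c := by
  obtain ⟨ε, hε, h⟩ := hf.exists_factor ha
  have h0 : ε ≠ 0 := by rintro rfl; simp at hε
  rw [hypAngle, hypAngle, h b hb, h c hc, mul_div_mul_left _ _ h0]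

/-! ### The symmetry group of the tessellation -/

/-- The generators: the rotation about the centre and the half-turn about the midpoint of an edge. -/
def gen : Bool → ℂ → ℂ
  | true, z => zeta * z
  | false, z => halfTurn (v 0) z

abbrev Word : Type := List Bool

/-- The action of words in the generators. -/
def act (w : Word) (z : ℂ) : ℂ := w.foldr gen z

lemma act_nil (z : ℂ) : act [] z = z := rfl
lemma act_cons (b : Bool) (w : Word) (z : ℂ) : act (b :: w) z = gen b (act w z) := rfl
lemma act_append (w w' : Word) (z : ℂ) : act (w ++ w') z = act w (act w' z) := by
  simp [act, List.foldr_append]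

lemma zeta_mul_conj : zeta * conj zeta = 1 := by
  rw [← hyp_κ]; exact hypShape.κ_mul_conj

lemma isMob_gen (b : Bool) : IsMob (gen b) := by
  cases b
  · refine ⟨-I, I * rad, ?_, fun z _ => ?_⟩
    · rw [normSq_mul, normSq_neg, normSq_I, one_mul, normSq_ofReal, ← sq, rad_sq]
      linarith [sqrt_two_lt]
    · simp only [gen, halfTurn, v_zero, conj_ofReal, map_neg, map_mul, conj_I, neg_neg]
      rw [show -I * z + I * rad = I * (rad - z) by ring, show -I * rad * z + I = I * (1 - rad * z) by ring,
        mul_div_mul_left _ _ I_ne_zero]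
  · have hne : 1 + zeta ≠ 0 := by
      intro h; have := congrArg re h; rw [zeta_eq] at this; simp at this; have := Real.sqrt_nonneg 2
      linarith
    refine ⟨1 + zeta, 0, by simpa using hne, fun z _ => ?_⟩
    have h2 : 1 + conj zeta ≠ 0 := by simpa using (map_ne_zero conj).2 hne
    simp only [gen, map_zero, zero_mul, zero_add, add_zero, map_add, map_one]; rw [eq_div_iff h2]
    linear_combination z * zeta_mul_conj

lemma isMob_act (w : Word) : IsMob (act w) := by
  induction w with
  | nil => exact ⟨1, 0, by simp, fun z _ => by simp [act_nil]⟩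
  | cons b w ih => exact (isMob_gen b).comp ih

lemma act_mem (w : Word) {z : ℂ} (hz : z ∈ Disk) : act w z ∈ Disk := (isMob_act w).mapsTo hz

lemma act_SS {z : ℂ} (hz : z ∈ Disk) : act [false, false] z = z := by
  have h := hypShape.turn_turn (z := z) (by change 1 * _ < (1 : ℝ); rw [one_mul]; exact hz)
  rw [hyp_turn, hyp_turn] at h
  exact h

lemma act_rr (n : ℕ) (z : ℂ) : act (List.replicate n true) z = zeta ^ n * z := by
  induction n with
  | zero => simp [act_nil]
  | succ n ih => rw [List.replicate_succ, act_cons, ih, gen, pow_succ']; ring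

lemma zeta_sq : zeta ^ 2 = I := by
  have h := sqrt_two_mul_self
  rw [zeta_eq, sq]
  apply Complex.ext
  · simp
  · simp; linear_combination h / 2

lemma zeta_pow_four : zeta ^ 4 = -1 := by
  rw [show zeta ^ 4 = (zeta ^ 2) ^ 2 by ring, zeta_sq, I_sq]

lemma zeta_pow_eight : zeta ^ 8 = 1 := by
  rw [show zeta ^ 8 = (zeta ^ 4) ^ 2 by ring, zeta_pow_four]; norm_num

lemma exists_inverse (w : Word) : ∃ w', ∀ z ∈ Disk, act w' (act w z) = z := by
  induction w with
  | nil => exact ⟨[], fun z _ => rfl⟩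
  | cons b w ih =>
    obtain ⟨w', h⟩ := ih; cases b
    · refine ⟨w' ++ [false], fun z hz => ?_⟩; have h2 := act_SS (act_mem w hz)
      rw [act_append, act_cons]; exact (congrArg (act w') h2).trans (h z hz)
    · refine ⟨w' ++ List.replicate 7 true, fun z hz => ?_⟩
      rw [act_append, act_cons, act_rr, gen, ← mul_assoc, ← pow_succ, zeta_pow_eight, one_mul, h z hz]

/-! ### Coordinates with respect to the corners of the fundamental triangle -/

/-- The coordinates of a point, regarded as a point of the hyperboloid, with respect to the points
`0`, `v 0`, `v 1` of the hyperboloid. -/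
def co (z : ℂ) : Fin 3 → ℝ :=
  ![(1 + normSq z) / (1 - normSq z) - (1 + √2) * (√2 * rad * (z.re - z.im) / (1 - normSq z) +
      2 * rad * z.im / (1 - normSq z)),
    √2 * rad * (z.re - z.im) / (1 - normSq z), 2 * rad * z.im / (1 - normSq z)]

/-- The symmetric bilinear form with diagonal entries `1` and all other entries `c`. -/
def bil {K : Type*} [CommRing K] (c : K) (a b : Fin 3 → K) : K := a 0 * b 0 + a 1 * b 1 + a 2 * b 2 +
    c * (a 0 * b 1 + a 1 * b 0 + a 0 * b 2 + a 2 * b 0 + a 1 * b 2 + a 2 * b 1)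

lemma one_sub_pos {z : ℂ} (hz : z ∈ Disk) : 0 < 1 - normSq z := sub_pos.2 hz

lemma co_time (z : ℂ) : co z 0 + (1 + √2) * (co z 1 + co z 2) = (1 + normSq z) / (1 - normSq z) := by
  simp only [co, cons_val_zero, cons_val_one, cons_val]
  ring

lemma bil_co {z w : ℂ} (hz : z ∈ Disk) (hw : w ∈ Disk) : bil (1 + √2) (co z) (co w) =
    1 + 2 * normSq (z - w) / ((1 - normSq z) * (1 - normSq w)) := by
  have h1 := (one_sub_pos hz).ne'
  have h2 := (one_sub_pos hw).ne'
  have hp := rad_sq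
  have hs := sqrt_two_mul_self
  have e : ∀ a b : Fin 3 → ℝ, bil (1 + √2) a b =
      (a 0 + (1 + √2) * (a 1 + a 2)) * (b 0 + (1 + √2) * (b 1 + b 2)) -
        (2 + √2) * (√2 * (a 1 * b 1 + a 2 * b 2) + (a 1 * b 2 + a 2 * b 1)) := by
    intro a b; unfold bil; linear_combination (-(a 1 * b 2 + a 2 * b 1)) * hs
  have e2 : (2 + √2) * (√2 * (co z 1 * co w 1 + co z 2 * co w 2) + (co z 1 * co w 2 + co z 2 * co w 1)) =
      4 * (z.re * w.re + z.im * w.im) / ((1 - normSq z) * (1 - normSq w)) := by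
    simp only [co, cons_val_zero, cons_val_one, cons_val]; field_simp
    have k1 : (2 + √2) * √2 * rad ^ 2 = 2 := by rw [hp]; linear_combination (√2 + 1) * hs
    linear_combination (√2 ^ 2 * (z.re - z.im) * (w.re - w.im) + 2 ^ 2 * z.im * w.im +
      2 * ((z.re - z.im) * w.im + z.im * (w.re - w.im))) * k1 + 2 * (z.re - z.im) * (w.re - w.im) * hs
  have hzw : normSq (z - w) = normSq z + normSq w - 2 * (z.re * w.re + z.im * w.im) := by
    simp only [normSq_apply, sub_re, sub_im]; ring
  rw [e, co_time, co_time, e2, hzw]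
  field_simp
  ring

lemma co_injOn {z w : ℂ} (hz : z ∈ Disk) (hw : w ∈ Disk) (h : co z = co w) : z = w := by
  have h1 := one_sub_pos hz
  have h2 := one_sub_pos hw
  have e := bil_co hz hw
  rw [h, bil_co hw hw] at e
  simp only [sub_self, map_zero, mul_zero, zero_div, add_zero] at e
  have e2 : 2 * normSq (z - w) / ((1 - normSq z) * (1 - normSq w)) = 0 := by linarith
  rw [div_eq_zero_iff, or_iff_left (mul_pos h1 h2).ne'] at e2
  have : normSq (z - w) = 0 := by linarith
  exact sub_eq_zero.1 (normSq_eq_zero.1 this)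

lemma co_zero : co 0 = ![1, 0, 0] := by simp [co]

lemma normSq_rad : normSq (rad : ℂ) = √2 - 1 := by rw [normSq_ofReal, ← sq, rad_sq]

lemma v_mem (j : ℕ) : v j ∈ Disk := by
  have : normSq (v j) = √2 - 1 := by
    have h : normSq zeta = 1 := by have := zeta_mul_conj; rw [mul_conj] at this; exact_mod_cast this
    rw [v, normSq_mul, map_pow, h, one_pow, mul_one]; exact normSq_rad
  rw [Disk, mem_ofPred_eq, this]
  linarith [sqrt_two_lt]

lemma co_v_zero : co (v 0) = ![0, 1, 0] := by
  have h0 : (2 - √2) ≠ 0 := by linarith [sqrt_two_lt]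
  have hs := sqrt_two_mul_self
  have hp := rad_sq
  rw [v_zero, co, normSq_rad]
  have e : 1 - (√2 - 1) = 2 - √2 := by ring
  rw [e]
  have k : √2 * rad * rad / (2 - √2) = 1 := by
    rw [div_eq_one_iff_eq h0]; linear_combination √2 * hp + hs
  have k2 : √2 / (2 - √2) = 1 + √2 := by rw [div_eq_iff h0]; linear_combination hs
  ext i
  fin_cases i <;> simp [k, k2]

lemma co_gen_true {z : ℂ} : co (gen true z) = ![co z 0 + √2 * co z 2, -co z 2, co z 1 + √2 * co z 2] := by
  have hs := sqrt_two_mul_self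
  have h : normSq (zeta * z) = normSq z := by
    rw [normSq_mul]; have := zeta_mul_conj; rw [mul_conj] at this
    rw [show normSq zeta = 1 by exact_mod_cast this, one_mul]
  have h1 : (zeta * z).re = √2 / 2 * (z.re - z.im) := by rw [zeta_eq, mul_re]; ring
  have h2 : (zeta * z).im = √2 / 2 * (z.re + z.im) := by rw [zeta_eq, mul_im]; ring
  change co (zeta * z) = _
  simp only [co, h, h1, h2, cons_val_zero, cons_val_one, cons_val]
  have e1 : √2 * rad * (√2 / 2 * (z.re - z.im) - √2 / 2 * (z.re + z.im)) / (1 - normSq z) =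
      -(2 * rad * z.im / (1 - normSq z)) := by
    linear_combination (-(rad * z.im) / (1 - normSq z)) * hs
  have e2 : 2 * rad * (√2 / 2 * (z.re + z.im)) / (1 - normSq z) =
      √2 * rad * (z.re - z.im) / (1 - normSq z) + √2 * (2 * rad * z.im / (1 - normSq z)) := by
    ring
  rw [e1, e2]
  ext i
  fin_cases i
  · simp; linear_combination (-(2 * rad * z.im / (1 - normSq z))) * hs
  · rfl
  · rfl

lemma co_gen_false {z : ℂ} (hz : z ∈ Disk) : co (gen false z) =
    ![co z 1 + √2 * co z 2, co z 0 + √2 * co z 2, -co z 2] := by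
  have hs := sqrt_two_mul_self
  have hp := rad_sq
  have hD := one_sub_pos hz
  have hk : hypShape.k * normSq z < 1 := by change 1 * _ < (1 : ℝ); rw [one_mul]; exact hz
  have h0 := hypShape.den_pos hk
  have h1 := hypShape.turn_re_im hk
  have h3 := hypShape.normSq_one_sub (z := z)
  have h4 := div_mul_cancel₀ (normSq (hypShape.p - z)) h0.ne'
  rw [← normSq_div] at h4
  change normSq (hypShape.turn z) * _ = _ at h4
  rw [hyp_turn] at h1 h4
  have hNe : normSq (1 - hypShape.k * hypShape.p * z) = 1 - 2 * rad * z.re + rad ^ 2 * normSq z := by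
    change normSq (1 - ((1 : ℝ) : ℂ) * rad * z) = _
    simp only [normSq_apply, sub_re, sub_im, mul_re, mul_im, ofReal_re, ofReal_im, one_re, one_im]
    ring
  rw [hNe] at h0 h1 h3 h4
  rw [← h4] at h3
  change co (halfTurn (v 0) z) = _
  change _ = (rad - z.re) * (1 - 1 * rad * z.re) + 1 * rad * z.im ^ 2 ∧ _ = -(1 - 1 * rad ^ 2) * z.im at h1
  change _ - 1 * _ = (1 - 1 * rad ^ 2) * (1 - 1 * normSq z) at h3
  generalize halfTurn (v 0) z = w at *
  obtain ⟨h1, h2⟩ := h1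
  have hn : normSq z = z.re ^ 2 + z.im ^ 2 := by rw [normSq_apply]; ring
  have h2s : 2 - √2 ≠ 0 := by linarith [sqrt_two_lt]
  have hw0 : 1 - normSq w ≠ 0 := fun h => by
    have : (2 - √2) * (1 - normSq z) = 0 := by
      linear_combination (1 - 2 * rad * z.re + rad ^ 2 * normSq z) * h - h3 + (1 - normSq z) * hp
    exact (mul_eq_zero.1 this).elim h2s hD.ne'
  have key : ∀ P Q : ℝ, P * (1 - 2 * rad * z.re + rad ^ 2 * normSq z) = (2 - √2) * Q →
      P / (1 - normSq w) = Q / (1 - normSq z) := fun P Q h => by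
    rw [div_eq_div_iff hw0 hD.ne']; refine mul_right_cancel₀ h0.ne' ?_
    linear_combination (1 - normSq z) * h - Q * h3 + Q * (1 - normSq z) * hp
  have e2 := key (2 * rad * w.im) (-(2 * rad * z.im)) (by linear_combination 2 * rad * h2 + 2 * rad * z.im * hp)
  have e1 := key (√2 * rad * (w.re - w.im)) (1 + normSq z - (1 + √2) * (√2 * rad * (z.re - z.im)) - 2 * rad * z.im)
    (by linear_combination √2 * rad * (h1 - h2 - rad * hn - (z.re + z.im) * hp) + √2 * (1 + normSq z) * hp +
      (1 + normSq z - √2 * rad * z.re - (2 - √2) * rad * z.im) * hs)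
  have e0 := key (1 + normSq w) (√2 * rad * (z.re - z.im) + √2 * (2 * rad * z.im) + (1 + √2) *
    (1 + normSq z - (1 + √2) * (√2 * rad * (z.re - z.im)) - 2 * rad * z.im - 2 * rad * z.im))
    (by linear_combination -h3 + (1 + normSq z) * hp + (1 + normSq z - (√2 ^ 2 - 2) * rad * z.re + (√2 ^ 2 - 4) * rad * z.im) * hs)
  simp only [co, e0, e1, e2]
  ext i
  fin_cases i <;> simp <;> ring

/-! ### Integral matrices of the symmetries -/

abbrev ZR : Type := Zsqrtd 2

def toR : ZR →+* ℝ := Zsqrtd.toReal (by norm_num)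

lemma toR_apply (x : ZR) : toR x = x.re + x.im * √2 := by simp [toR, Zsqrtd.toReal]

lemma toR_injective : Injective toR := by
  refine Zsqrtd.toReal_injective _ fun n h => ?_
  have h1 : n < 2 := by nlinarith
  have h2 : -2 < n := by nlinarith
  interval_cases n <;> omega

def gmat : Bool → Matrix (Fin 3) (Fin 3) ZR
  | true => !![1, 0, ⟨0, 1⟩; 0, 0, -1; 0, 1, ⟨0, 1⟩]
  | false => !![0, 1, ⟨0, 1⟩; 1, 0, ⟨0, 1⟩; 0, 0, -1]

def mat (w : Word) : Matrix (Fin 3) (Fin 3) ZR := (w.map gmat).prod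

lemma mat_append (w w' : Word) : mat (w ++ w') = mat w * mat w' := by simp [mat]

lemma co_gen (b : Bool) {z : ℂ} (hz : z ∈ Disk) (i : Fin 3) :
    co (gen b z) i = ∑ j, toR (gmat b i j) * co z j := by
  have hs : toR ⟨0, 1⟩ = √2 := by simp [toR_apply]
  cases b
  · rw [co_gen_false hz, sum_univ_three]
    fin_cases i <;> simp [gmat, hs, map_neg]
  · rw [co_gen_true, sum_univ_three]
    fin_cases i <;> simp [gmat, hs, map_neg]

lemma co_act (w : Word) {z : ℂ} (hz : z ∈ Disk) (i : Fin 3) :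
    co (act w z) i = ∑ j, toR (mat w i j) * co z j := by
  induction w generalizing i with
  | nil => simp [act_nil, mat, Matrix.one_apply]
  | cons b w ih =>
    rw [act_cons, co_gen b (act_mem w hz)]
    simp only [mat, List.map_cons, List.prod_cons, Matrix.mul_apply, sum_univ_three, map_add, map_mul]
    simp only [ih, mat, sum_univ_three]; ring

def base : Fin 3 → ℂ := ![0, v 0, v 1]

lemma base_mem_Disk (j : Fin 3) : base j ∈ Disk := by
  fin_cases j
  · exact zero_mem_Disk
  · exact v_mem 0
  · exact v_mem 1

lemma v_one : v 1 = gen true (v 0) := by simp [v, gen, mul_comm]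

lemma co_base (j i : Fin 3) : co (base j) i = if i = j then 1 else 0 := by
  have h1 : co (v 1) = ![0, 0, 1] := by rw [v_one, co_gen_true, co_v_zero]; simp
  fin_cases j
  · change co 0 i = _; rw [co_zero]; fin_cases i <;> rfl
  · change co (v 0) i = _; rw [co_v_zero]; fin_cases i <;> rfl
  · change co (v 1) i = _; rw [h1]; fin_cases i <;> rfl

lemma co_act_base (w : Word) (i j : Fin 3) : co (act w (base j)) i = toR (mat w i j) := by
  rw [co_act w (base_mem_Disk j)]
  simp [co_base]

lemma mat_eq_of_act_eq {w w' : Word} (h : ∀ z ∈ Disk, act w z = act w' z) : mat w = mat w' := by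
  ext1 i j
  apply toR_injective
  rw [← co_act_base, ← co_act_base, h _ (base_mem_Disk j)]

lemma act_eq_of_mat_eq {w w' : Word} (h : mat w = mat w') {z : ℂ} (hz : z ∈ Disk) : act w z = act w' z := by
  refine co_injOn (act_mem w hz) (act_mem w' hz) ?_
  ext i
  rw [co_act w hz, co_act w' hz, h]

/-! ### The flag of a word -/

/-- The flag of `X` onto which the image of the fundamental triangle is to be mapped. -/
def labFrom (k : Flag) (w : Word) : Flag := w.foldl (fun k b => bif b then rot k else flip k) k

def lab (w : Word) : Flag := labFrom 0 w

lemma lab_append (w w' : Word) : lab (w ++ w') = labFrom (lab w) w' := by simp [lab, labFrom, List.foldl_append]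

lemma lab_S (w : Word) : lab (w ++ [false]) = flip (lab w) := lab_append _ _

/-- The residue class of an element modulo `2 * √2`. -/
def red (x : ZR) : ℕ := (x.re % 4).toNat + 4 * (x.im % 2).toNat

def redRow (a b c : ZR) : ℕ := red a + 8 * red b + 64 * red c

/-- The action of the generators on residue classes of rows. -/
def stepRow (b : Bool) (n : ℕ) : ℕ := let x := n % 8
  let y := n / 8 % 8
  let z := n / 64
  bif b then x + 8 * z + 64 * ((2 * (x / 4) + 4 - y % 4 + 2 * (z / 4)) % 4 + 4 * ((x + y / 4 + z) % 2))
  else y + 8 * x + 64 * ((2 * (x / 4) + 2 * (y / 4) + 4 - z % 4) % 4 + 4 * ((x + y + z / 4) % 2))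

lemma red_lt (x : ZR) : red x < 8 := by unfold red; omega

lemma red_parts (x : ZR) : red x / 4 = (x.im % 2).toNat ∧ red x % 4 = (x.re % 4).toNat ∧ red x % 2 = (x.re % 2).toNat := by
  unfold red; omega

lemma red_eq {x : ZR} {m n : ℕ} (hm : (x.re % 4).toNat = m) (hn : (x.im % 2).toNat = n) : red x = m + 4 * n := by
  rw [red, hm, hn]

lemma redRow_parts (a b c : ZR) : redRow a b c % 8 = red a ∧ redRow a b c / 8 % 8 = red b ∧ redRow a b c / 64 = red c := by
  have := red_lt a
  have := red_lt b
  have := red_lt c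
  unfold redRow
  omega

lemma redRow_step_true (a b c : ZR) : redRow a c (⟨0, 1⟩ * a - b + ⟨0, 1⟩ * c) = stepRow true (redRow a b c) := by
  obtain ⟨h1, h2, h3⟩ := redRow_parts a b c
  have hr : (⟨0, 1⟩ * a - b + ⟨0, 1⟩ * c : ZR).re = 2 * a.im - b.re + 2 * c.im := by simp
  have hi : (⟨0, 1⟩ * a - b + ⟨0, 1⟩ * c : ZR).im = a.re - b.im + c.re := by simp
  simp only [stepRow, h1, h2, h3, cond_true]
  rw [redRow]
  congr 2
  obtain ⟨a1, a2, a3⟩ := red_parts a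
  obtain ⟨b1, b2, b3⟩ := red_parts b
  obtain ⟨c1, c2, c3⟩ := red_parts c
  apply red_eq
  · rw [hr, a1, b2, c1]
    clear a1 a2 a3 b1 b2 b3 c1 c2 c3 h1 h2 h3 hr hi
    omega
  · rw [hi, b1]; generalize red a = ra at *
    generalize red b = rb at *
    generalize red c = rc at *
    clear a1 b1 c1 a2 b2 c2 h1 h2 h3 hr hi
    omega

lemma redRow_step_false (a b c : ZR) : redRow b a (⟨0, 1⟩ * a + ⟨0, 1⟩ * b - c) = stepRow false (redRow a b c) := by
  obtain ⟨h1, h2, h3⟩ := redRow_parts a b c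
  have hr : (⟨0, 1⟩ * a + ⟨0, 1⟩ * b - c : ZR).re = 2 * a.im + 2 * b.im - c.re := by simp
  have hi : (⟨0, 1⟩ * a + ⟨0, 1⟩ * b - c : ZR).im = a.re + b.re - c.im := by simp
  simp only [stepRow, h1, h2, h3, cond_false]
  rw [redRow]
  congr 2
  obtain ⟨a1, a2, a3⟩ := red_parts a
  obtain ⟨b1, b2, b3⟩ := red_parts b
  obtain ⟨c1, c2, c3⟩ := red_parts c
  apply red_eq
  · rw [hr, a1, b1, c2]
    clear a1 a2 a3 b1 b2 b3 c1 c2 c3 h1 h2 h3 hr hi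
    omega
  · rw [hi, c1]; generalize red a = ra at *
    generalize red b = rb at *
    generalize red c = rc at *
    clear a1 b1 c1 a2 b2 c2 h1 h2 h3 hr hi
    omega

lemma redRow_mat_append (w : Word) (b : Bool) (i : Fin 3) :
    redRow (mat (w ++ [b]) i 0) (mat (w ++ [b]) i 1) (mat (w ++ [b]) i 2) =
      stepRow b (redRow (mat w i 0) (mat w i 1) (mat w i 2)) := by
  have e : mat [b] = gmat b := by simp [mat]
  rw [mat_append, e]
  cases b
  · rw [← redRow_step_false]
    congr 1 <;> simp [Matrix.mul_apply, sum_univ_three, gmat]; ring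
  · rw [← redRow_step_true]
    congr 1 <;> simp [Matrix.mul_apply, sum_univ_three, gmat]; ring

/-- Residue classes of the first two rows of a matrix, with the flag of the word. -/
def stepState (b : Bool) (s : ℕ × ℕ × Flag) : ℕ × ℕ × Flag :=
  (stepRow b s.1, stepRow b s.2.1, bif b then rot s.2.2 else flip s.2.2)

def state (w : Word) : ℕ × ℕ × Flag :=
  (redRow (mat w 0 0) (mat w 0 1) (mat w 0 2), redRow (mat w 1 0) (mat w 1 1) (mat w 1 2), lab w)

lemma state_append (w : Word) (b : Bool) : state (w ++ [b]) = stepState b (state w) := by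
  rw [state, redRow_mat_append, redRow_mat_append, lab_append]
  rfl

/-- Words which lead to all vertices of `X`, twice. -/
def vertexWords : List Word := [[], [false], [true, false],
    [true, true, false], [false, true, false], [true, true, true, false],
    [false, true, true, false], [true, true, true, true, false], [true, false, true, true, false],
    [false, true, true, true, false], [true, true, true, true, true, false], [true, true, false, true, true, false],
    [true, false, true, true, true, false], [false, true, true, true, true, false], [false, true, false, true, true, false],
    [true, true, true, false, true, true, false], [true, true, false, true, true, true, false], [true, false, true, true, true, true, false],
    [false, true, true, true, true, true, false], [false, true, true, false, true, true, false], [true, true, true, false, true, true, true, false],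
    [true, false, true, true, true, true, true, false], [false, true, true, false, true, true, true, false], [false, true, true, true, false, true, true, true, false]]

def states : List (ℕ × ℕ × Flag) := vertexWords.flatMap fun w => (List.range 8).map fun n =>
    (stepState true)^[n] (w.foldl (fun s b => stepState b s) (1, 8, 0))

lemma states_closed : ∀ s ∈ states, stepState true s ∈ states ∧ stepState false s ∈ states := by
  decide +kernel

lemma states_functional : ∀ s ∈ states, ∀ t ∈ states, s.1 = t.1 → s.2.1 = t.2.1 → s.2.2 = t.2.2 := by
  decide +kernel

lemma state_mem (w : Word) : state w ∈ states := by
  induction w using List.reverseRecOn with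
  | nil =>
    have : state [] = (1, 8, 0) := by decide +kernel
    rw [this]
    decide +kernel
  | append_singleton w b ih =>
    rw [state_append]; cases b
    · exact (states_closed _ ih).2
    · exact (states_closed _ ih).1

lemma lab_eq_of_mat_eq {w w' : Word} (h : mat w = mat w') : lab w = lab w' :=
  states_functional _ (state_mem w) _ (state_mem w') (by simp only [state, h]) (by simp only [state, h])

/-! ### Distances of vertices -/

lemma bil_ones_nonneg (x : Fin 3 → ℝ) : 0 ≤ bil (1 - √2) x x := by
  have hs := sqrt_two_mul_self
  have h1 := one_lt_sqrt_two
  have h2 := sqrt_two_lt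
  have e : bil (1 - √2) x x = (3 - 2 * √2) * (x 0 ^ 2 + x 1 ^ 2 + x 2 ^ 2) +
      (√2 - 1) * ((x 0 - x 1) ^ 2 + (x 0 - x 2) ^ 2 + (x 1 - x 2) ^ 2) := by
    unfold bil; ring
  rw [e]
  have : 0 ≤ 3 - 2 * √2 := by linarith
  have : 0 ≤ √2 - 1 := by linarith
  positivity

lemma abs_bil_le_one {x y : Fin 3 → ℝ} (hx : bil (1 - √2) x x = 1) (hy : bil (1 - √2) y y = 1) :
    |bil (1 - √2) x y| ≤ 1 := by
  have h1 := bil_ones_nonneg (x + y)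
  have h2 := bil_ones_nonneg (x - y)
  have e1 : bil (1 - √2) (x + y) (x + y) = bil (1 - √2) x x + bil (1 - √2) y y + 2 * bil (1 - √2) x y := by
    simp only [bil, Pi.add_apply]; ring
  have e2 : bil (1 - √2) (x - y) (x - y) = bil (1 - √2) x x + bil (1 - √2) y y -
      2 * bil (1 - √2) x y := by
    simp only [bil, Pi.sub_apply]; ring
  rw [e1] at h1
  rw [e2] at h2
  rw [abs_le]
  constructor <;> linarith

lemma bil_map {K L : Type*} [CommRing K] [CommRing L] (f : K →+* L) (c : K) (a b : Fin 3 → K) :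
    f (bil c a b) = bil (f c) (fun i => f (a i)) fun i => f (b i) := by
  simp only [bil, map_add, map_mul]

lemma bil_re_parity (a b : Fin 3 → ZR) : ∃ t : ℤ, (bil ⟨1, 1⟩ a b).re =
    ((a 0).re + (a 1).re + (a 2).re) * ((b 0).re + (b 1).re + (b 2).re) + 2 * t := by
  refine ⟨((a 0).im + (a 1).im + (a 2).im) * ((b 0).im + (b 1).im + (b 2).im) +
    ((a 0).re * ((b 1).im + (b 2).im) + (a 0).im * ((b 1).re + (b 2).re) +
     (a 1).re * ((b 0).im + (b 2).im) + (a 1).im * ((b 0).re + (b 2).re) +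
     (a 2).re * ((b 0).im + (b 1).im) + (a 2).im * ((b 0).re + (b 1).re)), ?_⟩
  simp [bil]
  ring

lemma one_le_bil_co {z w : ℂ} (hz : z ∈ Disk) (hw : w ∈ Disk) : 1 ≤ bil (1 + √2) (co z) (co w) := by
  rw [bil_co hz hw]
  have h1 := one_sub_pos hz
  have h2 := one_sub_pos hw
  have := normSq_nonneg (z - w)
  have : 0 ≤ 2 * normSq (z - w) / ((1 - normSq z) * (1 - normSq w)) := by positivity
  linarith

lemma eq_of_bil_co_eq_one {z w : ℂ} (hz : z ∈ Disk) (hw : w ∈ Disk) (h : bil (1 + √2) (co z) (co w) = 1) : z = w := by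
  rw [bil_co hz hw] at h
  have h1 := one_sub_pos hz
  have h2 := one_sub_pos hw
  have e2 : 2 * normSq (z - w) / ((1 - normSq z) * (1 - normSq w)) = 0 := by linarith
  rw [div_eq_zero_iff, or_iff_left (mul_pos h1 h2).ne'] at e2
  exact sub_eq_zero.1 (normSq_eq_zero.1 (by linarith))

lemma bil_co_self {z : ℂ} (hz : z ∈ Disk) : bil (1 + √2) (co z) (co z) = 1 := by
  rw [bil_co hz hz]; simp

/-- Different vertices have at least the distance of neighbours. -/
lemma le_bil_of_ne {w w' : Word} (h : act w 0 ≠ act w' 0) :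
    1 + √2 ≤ bil (1 + √2) (co (act w 0)) (co (act w' 0)) := by
  have hm := act_mem w zero_mem_Disk
  have hm' := act_mem w' zero_mem_Disk
  set a : Fin 3 → ZR := fun i => mat w i 0
  set b : Fin 3 → ZR := fun i => mat w' i 0
  have ha : co (act w 0) = fun i => toR (a i) := by ext i; exact co_act_base w i 0
  have hb : co (act w' 0) = fun i => toR (b i) := by ext i; exact co_act_base w' i 0
  have hc : toR ⟨1, 1⟩ = 1 + √2 := by simp [toR_apply]
  have hc' : toR (star ⟨1, 1⟩) = 1 - √2 := by simp [toR_apply, sub_eq_add_neg]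
  have e : ∀ x y : Fin 3 → ZR, bil (1 + √2) (fun i => toR (x i)) (fun i => toR (y i)) = toR (bil ⟨1, 1⟩ x y) := by
    intro x y; rw [bil_map, hc]
  have e' : ∀ x y : Fin 3 → ZR, bil (1 - √2) (fun i => toR (star (x i))) (fun i => toR (star (y i))) =
      toR (star (bil ⟨1, 1⟩ x y)) := by
    intro x y
    rw [← hc', show toR (star (bil ⟨1, 1⟩ x y)) = (toR.comp (starRingEnd ZR)) (bil ⟨1, 1⟩ x y) from rfl, bil_map]
    rfl
  have ha1 : bil ⟨1, 1⟩ a a = 1 := by apply toR_injective; rw [← e, ← ha, bil_co_self hm, map_one]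
  have hb1 : bil ⟨1, 1⟩ b b = 1 := by apply toR_injective; rw [← e, ← hb, bil_co_self hm', map_one]
  have h1 := one_le_bil_co hm hm'
  have hne : bil (1 + √2) (co (act w 0)) (co (act w' 0)) ≠ 1 := fun h' => h (eq_of_bil_co_eq_one hm hm' h')
  have h2 := abs_bil_le_one (x := fun i => toR (star (a i))) (y := fun i => toR (star (b i)))
    (by rw [e', ha1]; simp) (by rw [e', hb1]; simp)
  rw [e'] at h2
  rw [ha, hb, e] at h1 hne ⊢
  obtain ⟨t1, p1⟩ := bil_re_parity a a
  obtain ⟨t2, p2⟩ := bil_re_parity b b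
  obtain ⟨t3, p3⟩ := bil_re_parity a b
  rw [ha1] at p1
  rw [hb1] at p2
  have hodd : Odd (bil ⟨1, 1⟩ a b).re := by
    have o1 : Odd ((a 0).re + (a 1).re + (a 2).re) := by
      by_contra h
      rw [Int.not_odd_iff_even] at h; obtain ⟨r, hr⟩ := h; rw [hr] at p1; simp at p1
      have : (1 : ℤ) = 2 * ((r + r) * r + t1) := by linarith
      omega
    have o2 : Odd ((b 0).re + (b 1).re + (b 2).re) := by
      by_contra h
      rw [Int.not_odd_iff_even] at h; obtain ⟨r, hr⟩ := h; rw [hr] at p2; simp at p2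
      have : (1 : ℤ) = 2 * ((r + r) * r + t2) := by linarith
      omega
    rw [p3]; exact (o1.mul o2).add_even (even_two_mul _)
  generalize bil ⟨1, 1⟩ a b = β at *
  rw [toR_apply] at *
  simp only [Zsqrtd.re_star, Zsqrtd.im_star, Int.cast_neg] at h2
  obtain ⟨h3, h4⟩ := abs_le.1 h2
  have hs := one_lt_sqrt_two
  have hre : 0 ≤ β.re := by
    have : (0 : ℝ) ≤ β.re := by linarith
    exact_mod_cast this
  have him : 0 ≤ β.im := by
    by_contra! hlt
    have : (β.im : ℝ) ≤ -1 := by exact_mod_cast (by omega : β.im ≤ -1)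
    nlinarith
  have hre1 : (1 : ℝ) ≤ β.re := by
    have : 1 ≤ β.re := by obtain ⟨r, hr⟩ := hodd; omega
    exact_mod_cast this
  rcases him.lt_or_eq with h5 | h5
  · have : (1 : ℝ) ≤ β.im := by exact_mod_cast h5
    nlinarith
  · exfalso
    rw [← h5] at h4 hne; simp at h4 hne
    exact hne (le_antisymm (by exact_mod_cast h4) (by exact_mod_cast hre1))

/-! ### Overlaps of triangles -/

lemma tri_subset : tri ⊆ Disk := by
  intro z hz
  have : 1 * normSq z < (1 : ℝ) := hz.2.2.2
  rwa [one_mul] at this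

lemma co_one_nonneg_iff {z : ℂ} (hz : z ∈ Disk) : 0 ≤ co z 1 ↔ z.im ≤ z.re := by
  have h1 := one_sub_pos hz
  have hp := rad_pos
  change 0 ≤ √2 * rad * (z.re - z.im) / (1 - normSq z) ↔ _
  rw [le_div_iff₀ h1, zero_mul, mul_nonneg_iff_of_pos_left (by positivity), sub_nonneg]

lemma co_two_nonneg_iff {z : ℂ} (hz : z ∈ Disk) : 0 ≤ co z 2 ↔ 0 ≤ z.im := by
  have h1 := one_sub_pos hz
  have hp := rad_pos
  change 0 ≤ 2 * rad * z.im / (1 - normSq z) ↔ _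
  rw [le_div_iff₀ h1, zero_mul, mul_nonneg_iff_of_pos_left (by positivity)]

lemma mem_tri_iff {z : ℂ} (hz : z ∈ Disk) : z ∈ tri ↔ ∀ i, 0 ≤ co z i := by
  have h1 := one_sub_pos hz
  have hp := rad_pos
  have hs := sqrt_two_mul_self
  have hs0 : 0 < √2 / 2 := by positivity
  have hr := rad_sq
  have e2 : hypShape.f2 z = √2 / 2 * (z.re - z.im) := by rw [Shape.f2, hyp_c, hyp_s]; ring
  have e3 : hypShape.f3 z = (√2 / 2 * rad * (1 - normSq z)) * co z 0 := by
    rw [Shape.f3, hyp_c, hyp_s]; change √2 / 2 * rad * (1 + 1 * normSq z) - _ - _ = _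
    simp only [co, cons_val_zero]; have h0 := h1.ne'; field_simp; ring_nf
    rw [show rad ^ 2 = √2 - 1 from hr]
    linear_combination ((z.re + z.im) + (√2 - 1) * (z.re - z.im)) * hs
  rw [Fin.forall_fin_succ, Fin.forall_fin_succ, Fin.forall_fin_one]
  change 0 ≤ z.im ∧ 0 ≤ hypShape.f2 z ∧ 0 ≤ hypShape.f3 z ∧ 1 * normSq z < (1 : ℝ) ↔ 0 ≤ co z 0 ∧ 0 ≤ co z 1 ∧ 0 ≤ co z 2
  rw [co_one_nonneg_iff hz, co_two_nonneg_iff hz, e2, e3, mul_nonneg_iff_of_pos_left hs0, sub_nonneg,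
    mul_nonneg_iff_of_pos_left (mul_pos (mul_pos hs0 hp) h1), one_mul]
  have h2 : normSq z < 1 := hz
  tauto

lemma one_lt_mul_sum_sq {x : ℂ} (hx : x ∈ Disk) : 1 < (1 + √2) * (co x 0 + co x 1 + co x 2) ^ 2 := by
  have h := bil_co_self hx
  have hs := one_lt_sqrt_two
  have e : (1 + √2) * (co x 0 + co x 1 + co x 2) ^ 2 =
      bil (1 + √2) (co x) (co x) + √2 * (co x 0 ^ 2 + co x 1 ^ 2 + co x 2 ^ 2) := by
    unfold bil; ring
  have h2 : 0 < co x 0 ^ 2 + co x 1 ^ 2 + co x 2 ^ 2 := by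
    by_contra! h2
    have h0 : co x 0 = 0 := by nlinarith [sq_nonneg (co x 0), sq_nonneg (co x 1), sq_nonneg (co x 2)]
    have h1 : co x 1 = 0 := by nlinarith [sq_nonneg (co x 0), sq_nonneg (co x 1), sq_nonneg (co x 2)]
    have h3 : co x 2 = 0 := by nlinarith [sq_nonneg (co x 0), sq_nonneg (co x 1), sq_nonneg (co x 2)]
    unfold bil at h; rw [h0, h1, h3] at h; simp at h
  rw [e, h]
  have : 0 < √2 * (co x 0 ^ 2 + co x 1 ^ 2 + co x 2 ^ 2) := by positivity
  linarith

lemma bil_sum_left (c : ℝ) (s : Fin 3 → ℝ) (a : Fin 3 → Fin 3 → ℝ) (b : Fin 3 → ℝ) :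
    bil c (fun i => ∑ j, s j * a j i) b = ∑ j, s j * bil c (a j) b := by
  simp only [bil, sum_univ_three]; ring

lemma bil_comm (c : ℝ) (a b : Fin 3 → ℝ) : bil c a b = bil c b a := by unfold bil; ring

lemma co_act_sum (w : Word) {x : ℂ} (hx : x ∈ Disk) :
    co (act w x) = fun i => ∑ j, co x j * co (act w (base j)) i := by
  ext i
  rw [co_act w hx]
  refine Finset.sum_congr rfl fun j _ => ?_
  rw [co_act_base, mul_comm]

/-- Words which move the centre to the corners of the fundamental triangle. -/
def baseWord : Fin 3 → Word := ![[], [false], [true, false]]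

lemma act_baseWord (i : Fin 3) : act (baseWord i) 0 = base i := by
  have h : gen false 0 = v 0 := by simp [gen, halfTurn]
  fin_cases i
  · rfl
  · exact h
  · change gen true (gen false 0) = v 1; rw [h, v_one]

lemma exists_common_vertex {w w' : Word} {x x' : ℂ} (hx : x ∈ tri) (hx' : x' ∈ tri) (h : act w x = act w' x') :
    ∃ i j, act w (base i) = act w' (base j) := by
  by_contra! hne
  have hd := tri_subset hx
  have hd' := tri_subset hx'
  have h0 := (mem_tri_iff hd).1 hx
  have h0' := (mem_tri_iff hd').1 hx'
  have hb : ∀ i j, 1 + √2 ≤ bil (1 + √2) (co (act w (base i))) (co (act w' (base j))) := by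
    intro i j; have := hne i j
    rw [← act_baseWord, ← act_baseWord, ← act_append, ← act_append] at this ⊢
    exact le_bil_of_ne this
  have h1 : bil (1 + √2) (co (act w x)) (co (act w' x')) = 1 := by
    rw [h]; exact bil_co_self (act_mem w' hd')
  have h2 : bil (1 + √2) (co (act w x)) (co (act w' x')) =
      ∑ i, co x i * ∑ j, co x' j * bil (1 + √2) (co (act w (base i))) (co (act w' (base j))) := by
    rw [co_act_sum w hd, bil_sum_left]; refine Finset.sum_congr rfl fun i _ => ?_
    rw [bil_comm, co_act_sum w' hd', bil_sum_left]; simp only [bil_comm _ _ (co (act w (base i)))]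
  have h3 : ∀ i, (1 + √2) * (co x' 0 + co x' 1 + co x' 2) ≤
      ∑ j, co x' j * bil (1 + √2) (co (act w (base i))) (co (act w' (base j))) := by
    intro i; rw [sum_univ_three]; have a0 := mul_le_mul_of_nonneg_left (hb i 0) (h0' 0)
    have a1 := mul_le_mul_of_nonneg_left (hb i 1) (h0' 1)
    have a2 := mul_le_mul_of_nonneg_left (hb i 2) (h0' 2); linarith
  have h4 : (1 + √2) * (co x 0 + co x 1 + co x 2) * (co x' 0 + co x' 1 + co x' 2) ≤ 1 := by
    refine le_trans ?_ h1.le; rw [h2, sum_univ_three]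
    have a0 := mul_le_mul_of_nonneg_left (h3 0) (h0 0)
    have a1 := mul_le_mul_of_nonneg_left (h3 1) (h0 1)
    have a2 := mul_le_mul_of_nonneg_left (h3 2) (h0 2); linarith
  have h5 := one_lt_mul_sum_sq hd
  have h6 := one_lt_mul_sum_sq hd'
  have s1 : 0 ≤ co x 0 + co x 1 + co x 2 := by linarith [h0 0, h0 1, h0 2]
  have s2 : 0 ≤ co x' 0 + co x' 1 + co x' 2 := by linarith [h0' 0, h0' 1, h0' 2]
  generalize co x 0 + co x 1 + co x 2 = S at *
  generalize co x' 0 + co x' 1 + co x' 2 = S' at *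
  have hs := one_lt_sqrt_two
  have h7 : 0 ≤ (1 + √2) * S * S' := by positivity
  have h8 : ((1 + √2) * S * S') ^ 2 ≤ 1 := pow_le_one₀ h7 h4
  have h9 : ((1 + √2) * S * S') ^ 2 = ((1 + √2) * S ^ 2) * ((1 + √2) * S' ^ 2) := by ring
  nlinarith

/-! ### Vertex stabilizers -/

lemma exists_sector (z : ℂ) : ∃ (j : Fin 8) (q : ℂ), z = zeta ^ (j : ℕ) * q ∧ 0 ≤ q.im ∧ q.im ≤ q.re := by
  have hq : ∃ (j : Fin 4) (q : ℂ), z = zeta ^ (2 * (j : ℕ)) * q ∧ 0 ≤ q.im ∧ 0 ≤ q.re := by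
    have h2 := zeta_sq; have h4 := zeta_pow_four
    have h6 : zeta ^ 6 = -I := by rw [show zeta ^ 6 = zeta ^ 4 * zeta ^ 2 by ring, h2, h4]; ring
    rcases le_total 0 z.re with hx | hx <;> rcases le_total 0 z.im with hy | hy
    · exact ⟨0, z, by simp, hy, hx⟩
    · refine ⟨3, I * z, ?_, by simpa using hx, by simpa using hy⟩; change z = zeta ^ 6 * (I * z)
      rw [h6]; linear_combination z * I_sq
    · refine ⟨1, -I * z, ?_, by simpa using hx, by simpa using hy⟩; change z = zeta ^ 2 * (-I * z)
      rw [h2]; linear_combination z * I_sq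
    · refine ⟨2, -z, ?_, by simpa using hy, by simpa using hx⟩; change z = zeta ^ 4 * (-z)
      rw [h4]; ring
  obtain ⟨j, q, h, h1, h2⟩ := hq
  rcases le_total q.im q.re with h3 | h3
  · exact ⟨⟨2 * j, by omega⟩, q, h, h1, h3⟩
  · refine ⟨⟨2 * j + 1, by omega⟩, conj zeta * q, ?_, ?_, ?_⟩
    · rw [h]; simp only [pow_succ]; linear_combination (-zeta ^ (2 * (j : ℕ)) * q) * zeta_mul_conj
    · rw [zeta_eq]; simp; have := Real.sqrt_nonneg 2; nlinarith
    · rw [zeta_eq]; simp; have := Real.sqrt_nonneg 2; nlinarith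

lemma normSq_v_zero : normSq (v 0) = √2 - 1 := by rw [v_zero, normSq_rad]

/-- A symmetry which fixes the centre is a rotation of the tessellation. -/
lemma exists_rotation {w : Word} (h : act w 0 = 0) : ∃ l : Fin 8, ∀ z ∈ Disk, act w z = zeta ^ (l : ℕ) * z := by
  obtain ⟨j, q, hq, him, hre⟩ := exists_sector (act w (v 0))
  have hmob : ∀ w, act w 0 = 0 → ∃ ε : ℂ, ‖ε‖ = 1 ∧ ∀ z ∈ Disk, act w z = ε * z := by
    intro w h; obtain ⟨ε, hε, he⟩ := (isMob_act w).exists_factor zero_mem_Disk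
    refine ⟨ε, hε, fun z hz => ?_⟩; have := he z hz; rw [h] at this; simpa using this
  set w1 := List.replicate (8 - (j : ℕ)) true ++ w with hw1
  have hinv : zeta ^ (8 - (j : ℕ)) * zeta ^ (j : ℕ) = 1 := by
    rw [← pow_add, Nat.sub_add_cancel (by omega), zeta_pow_eight]
  have ha : ∀ z, act w1 z = zeta ^ (8 - (j : ℕ)) * act w z := fun z => by rw [hw1, act_append, act_rr]
  have h0 : act w1 0 = 0 := by rw [ha, h, mul_zero]
  have hq1 : act w1 (v 0) = q := by rw [ha, hq, ← mul_assoc, hinv, one_mul]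
  have hv := v_mem 0
  have hqD : q ∈ Disk := hq1 ▸ act_mem w1 hv
  obtain ⟨ε, hε, he⟩ := hmob w1 h0
  have hs := one_lt_sqrt_two
  have hn : normSq q = √2 - 1 := by
    rw [← hq1, he _ hv, normSq_mul, normSq_v_zero, normSq_eq_norm_sq, hε]; ring
  have hb0 : bil (1 + √2) (co q) (co 0) = 1 + √2 := by
    rw [bil_co hqD zero_mem_Disk, sub_zero, map_zero, sub_zero, mul_one, hn]
    have : 1 - (√2 - 1) ≠ 0 := by linarith [sqrt_two_lt]
    field_simp; linear_combination sqrt_two_mul_self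
  have hcase : q = v 0 ∨ q = v 1 := by
    by_contra! hne
    have hb : ∀ i : Fin 3, 1 + √2 ≤ bil (1 + √2) (co q) (co (base i)) := by
      intro i; have hqe : act (w1 ++ [false]) 0 = q := by
        rw [act_append, ← hq1]; have := act_baseWord 1; exact congrArg (act w1) this
      by_cases hi : i = 0
      · subst hi; exact hb0.ge
      · rw [← act_baseWord, ← hqe]; refine le_bil_of_ne ?_; rw [hqe, act_baseWord]
        fin_cases i
        · exact absurd rfl hi
        · exact hne.1
        · exact hne.2
    have e : ∀ (x : Fin 3 → ℝ) (i : Fin 3), bil (1 + √2) x (co (base i)) =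
        (1 + √2) * (x 0 + x 1 + x 2) - √2 * x i := by
      intro x i
      fin_cases i <;> simp [bil, co_base] <;> ring
    have c1 := (co_one_nonneg_iff hqD).2 hre; have c2 := (co_two_nonneg_iff hqD).2 him
    have b0 := hb 0; have b1 := hb 1; have b2 := hb 2
    have hb0' : bil (1 + √2) (co q) (co (base 0)) = 1 + √2 := hb0; rw [e] at b0 b1 b2 hb0'
    have c0 : 0 ≤ co q 0 := by
      have : √2 * co q 1 ≤ √2 * co q 0 := by linarith
      have := le_of_mul_le_mul_left this (by linarith); linarith
    have hself := bil_co_self hqD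
    have e2 : bil (1 + √2) (co q) (co q) = co q 0 * ((1 + √2) * (co q 0 + co q 1 + co q 2) - √2 * co q 0) +
        co q 1 * ((1 + √2) * (co q 0 + co q 1 + co q 2) - √2 * co q 1) +
        co q 2 * ((1 + √2) * (co q 0 + co q 1 + co q 2) - √2 * co q 2) := by
      unfold bil; ring
    have m0 := mul_le_mul_of_nonneg_left b0 c0; have m1 := mul_le_mul_of_nonneg_left b1 c1
    have m2 := mul_le_mul_of_nonneg_left b2 c2; have h5 := one_lt_mul_sum_sq hqD
    have hle : (1 + √2) * (co q 0 + co q 1 + co q 2) ≤ 1 := by rw [e2] at hself; linarith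
    have hS : 0 ≤ co q 0 + co q 1 + co q 2 := by linarith
    generalize co q 0 + co q 1 + co q 2 = S at *
    nlinarith
  have hv0 : (v 0 : ℂ) ≠ 0 := by rw [v_zero, ofReal_ne_zero]; exact rad_pos.ne'
  have hεq : ε * v 0 = q := by rw [← he _ hv, hq1]
  have hw : ∀ z ∈ Disk, act w z = zeta ^ (j : ℕ) * (ε * z) := by
    intro z hz; rw [← he z hz, ha, ← mul_assoc, mul_comm (zeta ^ (j : ℕ)), hinv, one_mul]
  rcases hcase with h1 | h1
  · have : ε = 1 := mul_right_cancel₀ hv0 (by rw [hεq, h1, one_mul])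
    exact ⟨j, fun z hz => by rw [hw z hz, this, one_mul]⟩
  · have : ε = zeta := mul_right_cancel₀ hv0 (by rw [hεq, h1, v_one]; rfl)
    refine ⟨j + 1, fun z hz => ?_⟩; rw [hw z hz, this, ← mul_assoc, ← pow_succ]
    congr 1
    rw [Fin.val_add_eq_ite]
    split_ifs with h8
    · have : (j : ℕ) = 7 := by have h9 : ((1 : Fin 8) : ℕ) = 1 := rfl; omega
      rw [this, zeta_pow_eight]; simp
    · rfl

/-! ### The developing map -/

def flatten : ℂ → ℂ := Classical.choose exists_flattening

lemma flatten_spec : ContinuousOn flatten tri ∧ BijOn flatten tri flatTri ∧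
    (∀ z ∈ tri, flatten (zeta * halfTurn (v 0) z) = spin (flatten z)) ∧
    (∀ z ∈ tri, flatten (zeta * conj z) = omega * conj (flatten z)) ∧ flatten 0 = 0 ∧
    (∀ z ∈ tri, (flatten z).im = 0 ↔ z.im = 0) ∧
    (∀ z ∈ tri, flatten z ∈ flatShape.Ω ↔ z ∈ hypShape.Ω) ∧
    BijOn (Shape.reflectExt flatten) hypShape.kite rhombus ∧
    DifferentiableOn ℂ (Shape.reflectExt flatten) hypShape.kite := Classical.choose_spec exists_flattening

def tspin (z : ℂ) : ℂ := act [true, false] z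

lemma tspin_eq (z : ℂ) : tspin z = hypShape.ρ z := (hyp_ρ z).symm

lemma hyp_k_normSq {z : ℂ} (hz : z ∈ Disk) : hypShape.k * normSq z < 1 := by
  change 1 * _ < (1 : ℝ); rw [one_mul]; exact hz

lemma tspin_mem {z : ℂ} (hz : z ∈ tri) : tspin z ∈ tri := by
  rw [tspin_eq]; exact hypShape.ρ_mem_T hz

lemma tspin_tspin_tspin {z : ℂ} (hz : z ∈ Disk) : tspin (tspin (tspin z)) = z := by
  have hk := hyp_k_normSq hz
  simp only [tspin_eq]
  rw [hypShape.ρ_ρ (hypShape.k_normSq_ρ hk), hypShape.ρ'_ρ hk]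

lemma tspin_base : tspin 0 = v 1 ∧ tspin (v 0) = 0 ∧ tspin (v 1) = v 0 := by
  have h0 : tspin 0 = v 1 := by
    change gen true (gen false 0) = v 1; rw [show gen false 0 = v 0 by simp [gen, halfTurn], v_one]
  have h1 : tspin (v 0) = 0 := by change gen true (gen false (v 0)) = 0; simp [gen, halfTurn]
  refine ⟨h0, h1, ?_⟩
  rw [← h0]
  have := tspin_tspin_tspin (v_mem 0)
  rwa [h1] at this

/-- The point of `X` which is represented by a point of the image of the fundamental triangle. -/
def face (w : Word) (x : ℂ) : X := XA (lab w) (flatten x)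

lemma flatten_mem {x : ℂ} (hx : x ∈ tri) : flatten x ∈ flatTri := flatten_spec.2.1.mapsTo hx

lemma face_tspin (w : Word) {x : ℂ} (hx : x ∈ tri) : face (w ++ [true, false]) x = face w (tspin x) := by
  have e : lab (w ++ [true, false]) = cyc (lab w) := by rw [lab_append, ← flip_rot]; rfl
  rw [face, face, e, XA_cyc]
  congr 1
  exact (flatten_spec.2.2.1 x hx).symm

lemma exists_frame_at (w : Word) {x : ℂ} (hx : x ∈ tri) (i : Fin 3) : ∃ w' y, y ∈ tri ∧ act w' y = act w x ∧
    act w' 0 = act w (base i) ∧ face w' y = face w x := by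
  obtain ⟨h0, h1, h2⟩ := tspin_base
  have h3 := tspin_tspin_tspin (tri_subset hx)
  have ha : ∀ w z, act (w ++ [true, false]) z = act w (tspin z) := fun w z => act_append _ _ _
  fin_cases i
  · exact ⟨w, x, hx, rfl, rfl, rfl⟩
  · refine ⟨w ++ [true, false] ++ [true, false], tspin x, tspin_mem hx, ?_, ?_, ?_⟩
    · rw [ha, ha, h3]
    · rw [ha, ha, h0, h2]; rfl
    · rw [face_tspin _ (tspin_mem hx), face_tspin _ (tspin_mem (tspin_mem hx)), h3]
  · refine ⟨w ++ [true, false], tspin (tspin x), tspin_mem (tspin_mem hx), ?_, ?_, ?_⟩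
    · rw [ha, h3]
    · rw [ha, h0]; rfl
    · rw [face_tspin _ (tspin_mem (tspin_mem hx)), h3]

lemma XA_rot_of_zeta {k : Flag} {x x' : ℂ} (hx : x ∈ tri) (hx' : x' ∈ tri) (h : x = zeta * x') :
    XA k (flatten x) = XA (rot k) (flatten x') := by
  have him : x'.im = 0 := by
    have h1 := (co_one_nonneg_iff (tri_subset hx)).1 ((mem_tri_iff (tri_subset hx)).1 hx 1)
    have h2 : 0 ≤ x'.im := hx'.1; rw [h, zeta_eq] at h1; simp at h1; have := one_lt_sqrt_two
    nlinarith
  have hc : conj x' = x' := conj_eq_iff_im.2 him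
  have h4 := flatten_spec.2.2.2.1 x' hx'
  have h5 := (flatten_spec.2.2.2.2.2.1 x' hx').2 him
  rw [hc, ← h, conj_eq_iff_im.2 h5] at h4
  obtain ⟨t, ht⟩ : ∃ t : ℝ, flatten x' = t := ⟨(flatten x').re, Complex.ext rfl (by simpa using h5)⟩
  have hm := flatten_mem hx'
  rw [ht] at hm h4 ⊢
  rw [h4, XA_rot k hm]

lemma XA_rot_zero (k : Flag) (n : ℕ) : XA (rot^[n] k) 0 = XA k 0 := by
  induction n with
  | zero => rfl
  | succ n ih =>
    have := XA_rot (rot^[n] k) (x := 0) (by simpa using zero_mem_flatTri)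
    rw [ofReal_zero, mul_zero, ih] at this; rw [iterate_succ_apply', this]

lemma XA_rot_iterate {k : Flag} {l : Fin 8} {x x' : ℂ} (hx : x ∈ tri) (hx' : x' ∈ tri) (h : x = zeta ^ (l : ℕ) * x') :
    XA k (flatten x) = XA (rot^[l] k) (flatten x') := by
  have h1 : 0 ≤ x.im := hx.1
  have h2 : 0 ≤ x'.im := hx'.1
  have h3 := (co_one_nonneg_iff (tri_subset hx)).1 ((mem_tri_iff (tri_subset hx)).1 hx 1)
  have h4 := (co_one_nonneg_iff (tri_subset hx')).1 ((mem_tri_iff (tri_subset hx')).1 hx' 1)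
  have hs := one_lt_sqrt_two
  have e2 := zeta_sq
  have e4 := zeta_pow_four
  have e3 : zeta ^ 3 = I * zeta := by rw [pow_succ, e2]
  have e5 : zeta ^ 5 = -zeta := by rw [pow_succ, e4]; ring
  have e6 : zeta ^ 6 = -I := by rw [show zeta ^ 6 = zeta ^ 4 * zeta ^ 2 by ring, e2, e4]; ring
  have key : x' = 0 → XA k (flatten x) = XA (rot^[l] k) (flatten x') := by
    rintro rfl; rw [mul_zero] at h; rw [h, flatten_spec.2.2.2.2.1, XA_rot_zero]
  have hz : x'.re ≤ 0 → x' = 0 := fun hr => by apply Complex.ext <;> simp <;> linarith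
  fin_cases l
  · simp at h; rw [h]; rfl
  · simp at h; exact XA_rot_of_zeta hx hx' h
  · refine key (hz ?_); change x = zeta ^ 2 * x' at h; rw [h, e2] at h1 h3; simp at h1 h3; linarith
  · refine key (hz ?_); change x = zeta ^ 3 * x' at h; rw [h, e3, zeta_eq] at h1 h3; simp at h1 h3
    nlinarith
  · refine key (hz ?_); change x = zeta ^ 4 * x' at h; rw [h, e4] at h1 h3; simp at h1 h3; linarith
  · refine key (hz ?_); change x = zeta ^ 5 * x' at h; rw [h, e5, zeta_eq] at h1 h3; simp at h1 h3
    nlinarith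
  · refine key (hz ?_); change x = zeta ^ 6 * x' at h; rw [h, e6] at h1 h3; simp at h1 h3; linarith
  · change x = zeta ^ 7 * x' at h
    have h' : x' = zeta * x := by rw [h, ← mul_assoc, ← pow_succ', zeta_pow_eight, one_mul]
    have := XA_rot_of_zeta (k := rot^[7] k) hx' hx h'
    rw [show rot (rot^[7] k) = rot^[8] k from (iterate_succ_apply' rot 7 k).symm, rot_iterate] at this
    exact this.symm

lemma labFrom_replicate (k : Flag) (n : ℕ) : labFrom k (List.replicate n true) = rot^[n] k := by
  induction n generalizing k with
  | zero => rfl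
  | succ n ih => rw [List.replicate_succ, iterate_succ_apply, ← ih]; rfl

/-- Points of the images of the fundamental triangle determine points of `X`. -/
lemma face_eq_of_act_eq {w w' : Word} {x x' : ℂ} (hx : x ∈ tri) (hx' : x' ∈ tri) (h : act w x = act w' x') :
    face w x = face w' x' := by
  obtain ⟨i, j, hij⟩ := exists_common_vertex hx hx' h
  obtain ⟨w1, y, hy, a1, a2, a3⟩ := exists_frame_at w hx i
  obtain ⟨w2, y', hy', b1, b2, b3⟩ := exists_frame_at w' hx' j
  rw [← a3, ← b3]
  rw [← a1, ← b1] at h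
  rw [← a2, ← b2] at hij
  clear a1 a2 a3 b1 b2 b3 hx hx'
  obtain ⟨w0, hw0⟩ := exists_inverse w1
  have h0 : act (w0 ++ w2) 0 = 0 := by rw [act_append, ← hij, hw0 _ zero_mem_Disk]
  obtain ⟨l, hl⟩ := exists_rotation h0
  have hyD := tri_subset hy
  have hyD' := tri_subset hy'
  have e1 : y = zeta ^ (l : ℕ) * y' := by rw [← hl y' hyD', act_append, ← h, hw0 y hyD]
  obtain ⟨w1', hw1'⟩ := exists_inverse w0
  have e2 : lab w2 = rot^[l] (lab w1) := by
    rw [← labFrom_replicate, ← lab_append]; apply lab_eq_of_mat_eq; apply mat_eq_of_act_eq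
    intro z hz; have hz2 := act_mem w2 hz
    have hz3 : zeta ^ (l : ℕ) * z ∈ Disk := by rw [← hl z hz]; exact act_mem _ hz
    have c := hl z hz; rw [act_append] at c; rw [act_append, act_rr]
    apply (isMob_act w0).injOn hz2 (act_mem w1 hz3); rw [c, hw0 _ hz3]
  rw [face, face, e2]
  exact XA_rot_iterate hy hy' e1

open Classical in
/-- The developing map: the map from the disk to `X` which maps the triangles of the tessellation to
faces. -/
def dev (z : ℂ) : X :=
  if h : ∃ w, ∃ x ∈ tri, act w x = z then face h.choose h.choose_spec.choose else basePoint

lemma dev_act (w : Word) {x : ℂ} (hx : x ∈ tri) : dev (act w x) = face w x := by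
  have h : ∃ w', ∃ x' ∈ tri, act w' x' = act w x := ⟨w, x, hx, rfl⟩
  rw [dev, dif_pos h]
  exact face_eq_of_act_eq h.choose_spec.choose_spec.1 hx h.choose_spec.choose_spec.2

/-! ### Hyperbolic convex hulls in coordinates -/

/-- The coordinates of a point of the Klein disk. -/
def kc (K : ℂ) : Fin 3 → ℝ :=
  ![1 - (1 + √2) * (√2 * rad / 2 * (K.re - K.im) + rad * K.im), √2 * rad / 2 * (K.re - K.im), rad * K.im]

/-- The height of a point on the hyperboloid. -/
def height (z : ℂ) : ℝ := (1 + normSq z) / (1 - normSq z)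

lemma height_pos {z : ℂ} (hz : z ∈ Disk) : 0 < height z :=
  div_pos (by have := normSq_nonneg z; linarith) (one_sub_pos hz)

lemma height_eq (z : ℂ) : height z = co z 0 + (1 + √2) * (co z 1 + co z 2) := (co_time z).symm

lemma co_eq_kc {z : ℂ} (hz : z ∈ Disk) (i : Fin 3) : co z i = height z * kc (toKlein z) i := by
  have h1 := (one_sub_pos hz).ne'
  have h2 : 1 + normSq z ≠ 0 := by have := normSq_nonneg z; linarith
  have hr : (toKlein z).re = 2 / (1 + normSq z) * z.re := by rw [toKlein, normSq_eq_norm_sq]; exact re_ofReal_mul _ _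
  have hi : (toKlein z).im = 2 / (1 + normSq z) * z.im := by rw [toKlein, normSq_eq_norm_sq]; exact im_ofReal_mul _ _
  fin_cases i <;> simp [kc, co, height, hr, hi] <;> field_simp

lemma kc_sum {ι : Type*} {s : Finset ι} {m : ι → ℝ} {K : ι → ℂ} (h : ∑ i ∈ s, m i = 1) (j : Fin 3) :
    kc (∑ i ∈ s, m i • K i) j = ∑ i ∈ s, m i * kc (K i) j := by
  have hr : (∑ i ∈ s, m i • K i).re = ∑ i ∈ s, m i * (K i).re := by simp
  have hi : (∑ i ∈ s, m i • K i).im = ∑ i ∈ s, m i * (K i).im := by simp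
  fin_cases j
  · change 1 - (1 + √2) * (√2 * rad / 2 * (_ - _) + rad * _) =
      ∑ i ∈ s, m i * (1 - (1 + √2) * (√2 * rad / 2 * ((K i).re - (K i).im) + rad * (K i).im))
    rw [hr, hi]
    simp only [mul_sub, mul_add, Finset.sum_sub_distrib, Finset.sum_add_distrib, Finset.mul_sum, mul_one, h]
    congr 1
    simp only [← Finset.sum_sub_distrib, ← Finset.sum_add_distrib]
    exact Finset.sum_congr rfl fun i _ => by ring
  · change √2 * rad / 2 * (_ - _) = ∑ i ∈ s, m i * (√2 * rad / 2 * ((K i).re - (K i).im))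
    rw [hr, hi, ← Finset.sum_sub_distrib, Finset.mul_sum]
    exact Finset.sum_congr rfl fun i _ => by ring
  · change rad * _ = ∑ i ∈ s, m i * (rad * (K i).im); rw [hi, Finset.mul_sum]
    exact Finset.sum_congr rfl fun i _ => by ring

lemma kc_injective {K L : ℂ} (h : kc K = kc L) : K = L := by
  have hp := rad_pos
  have h2 : K.im = L.im := mul_left_cancel₀ hp.ne' (congrFun h 2)
  have h1 : K.re - K.im = L.re - L.im := mul_left_cancel₀ (by positivity : √2 * rad / 2 ≠ 0) (congrFun h 1)
  exact Complex.ext (by linarith) h2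

lemma subset_hypHull {A : Set ℂ} {z : ℂ} (hz : z ∈ Disk) (h : z ∈ A) : z ∈ hypHull A :=
  ⟨mem_Disk_iff.1 hz, subset_convexHull ℝ _ (mem_image_of_mem _ h)⟩

lemma hypHull_subset {A : Set ℂ} {z : ℂ} (h : z ∈ hypHull A) : z ∈ Disk := mem_Disk_iff.2 h.1

lemma nonneg_of_mem_hypHull {A : Set ℂ} (a : Fin 3 → ℝ) (hA : ∀ p ∈ A, p ∈ Disk ∧ 0 ≤ ∑ i, a i * co p i)
    {z : ℂ} (hz : z ∈ hypHull A) : 0 ≤ ∑ i, a i * co z i := by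
  have hc : Convex ℝ {K : ℂ | 0 ≤ ∑ i, a i * kc K i} := by
    intro K hK L hL x y hx hy hxy
    have e : ∀ j, kc (x • K + y • L) j = x * kc K j + y * kc L j := by
      intro j
      have := kc_sum (s := Finset.univ) (m := ![x, y]) (K := ![K, L]) (by simpa using hxy) j
      simpa using this
    have e2 : ∑ i, a i * kc (x • K + y • L) i = x * ∑ i, a i * kc K i + y * ∑ i, a i * kc L i := by
      simp only [e, sum_univ_three]; ring
    rw [mem_ofPred_eq, e2]; exact add_nonneg (mul_nonneg hx hK) (mul_nonneg hy hL)
  have hT : ∀ p ∈ Disk, ∑ i, a i * co p i = height p * ∑ i, a i * kc (toKlein p) i := by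
    intro p hp; simp only [co_eq_kc hp, sum_univ_three]; ring
  have hzD := hypHull_subset hz
  have h := convexHull_min (s := toKlein '' A) ?_ hc hz.2
  · rw [hT z hzD]; exact mul_nonneg (height_pos hzD).le h
  · rintro _ ⟨p, hp, rfl⟩; obtain ⟨h1, h2⟩ := hA p hp; rw [hT p h1] at h2
    exact nonneg_of_mul_nonneg_right h2 (height_pos h1)

/-- Nonnegative combinations of points of a hull belong to the hull. -/
lemma mem_hypHull_of_sum {A : Set ℂ} {z : ℂ} (hz : z ∈ Disk) (p : Fin 3 → ℂ) (hp : ∀ j, p j ∈ hypHull A) (s : Fin 3 → ℝ)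
    (hs : ∀ j, 0 ≤ s j) (h : ∀ i, co z i = ∑ j, s j * co (p j) i) : z ∈ hypHull A := by
  have hT := height_pos hz
  have hpD := fun j => hypHull_subset (hp j)
  have hsum : ∑ j, s j * height (p j) / height z = 1 := by
    rw [← Finset.sum_div, div_eq_one_iff_eq hT.ne']; simp only [height_eq, h, sum_univ_three]; ring
  refine ⟨mem_Disk_iff.1 hz, ?_⟩
  have e : toKlein z = ∑ j, (s j * height (p j) / height z) • toKlein (p j) := by
    apply kc_injective; ext i; rw [kc_sum hsum]; refine mul_left_cancel₀ hT.ne' ?_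
    rw [← co_eq_kc hz, h, Finset.mul_sum]; refine Finset.sum_congr rfl fun j _ => ?_
    rw [co_eq_kc (hpD j)]; field_simp
  rw [e]
  exact (convex_convexHull ℝ _).sum_mem (fun j _ => div_nonneg (mul_nonneg (hs j) (height_pos (hpD j)).le) hT.le)
    hsum fun j _ => (hp j).2

lemma mem_hypSegment {a b z : ℂ} (ha : a ∈ Disk) (hb : b ∈ Disk) (hz : z ∈ Disk) :
    z ∈ hypSegment a b ↔ ∃ s t : ℝ, 0 ≤ s ∧ 0 ≤ t ∧ ∀ i, co z i = s * co a i + t * co b i := by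
  constructor
  · intro h; have h2 := h.2; rw [image_pair, convexHull_pair] at h2
    obtain ⟨x, y, hx, hy, hxy, e⟩ := h2; have hT := (height_pos hz).le
    refine ⟨height z * x / height a, height z * y / height b, div_nonneg (mul_nonneg hT hx) (height_pos ha).le,
      div_nonneg (mul_nonneg hT hy) (height_pos hb).le, fun i => ?_⟩
    have := kc_sum (s := Finset.univ) (m := ![x, y]) (K := ![toKlein a, toKlein b]) (by simpa using hxy) i
    simp only [Fin.sum_univ_two, cons_val_zero, cons_val_one] at this
    rw [co_eq_kc hz, ← e, this, co_eq_kc ha, co_eq_kc hb]; have h1 := (height_pos ha).ne'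
    have h3 := (height_pos hb).ne'; field_simp
  · rintro ⟨s, t, hs, ht, h⟩; refine mem_hypHull_of_sum hz ![a, b, a] ?_ ![s, t, 0] ?_ fun i => ?_
    · intro j
      fin_cases j
      exacts [subset_hypHull ha (by simp), subset_hypHull hb (by simp), subset_hypHull ha (by simp)]
    · intro j
      fin_cases j
      exacts [hs, ht, le_rfl]
    · rw [h, sum_univ_three]; simp

lemma act_image_hypSegment (w : Word) {a b : ℂ} (ha : a ∈ Disk) (hb : b ∈ Disk) :
    act w '' hypSegment a b = hypSegment (act w a) (act w b) := by
  have key : ∀ w {a b : ℂ}, a ∈ Disk → b ∈ Disk → act w '' hypSegment a b ⊆ hypSegment (act w a) (act w b) := by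
    rintro w a b ha hb _ ⟨z, hz, rfl⟩; have hzD := hypHull_subset hz
    obtain ⟨s, t, hs, ht, h⟩ := (mem_hypSegment ha hb hzD).1 hz
    refine (mem_hypSegment (act_mem w ha) (act_mem w hb) (act_mem w hzD)).2 ⟨s, t, hs, ht, fun i => ?_⟩
    simp only [co_act w hzD, co_act w ha, co_act w hb, h, sum_univ_three]; ring
  refine subset_antisymm (key w ha hb) fun z hz => ?_
  obtain ⟨w', hw'⟩ := exists_inverse w
  have hzD := hypHull_subset hz
  have h := key w' (act_mem w ha) (act_mem w hb) (mem_image_of_mem _ hz)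
  rw [hw' a ha, hw' b hb] at h
  refine ⟨_, h, (isMob_act w').injOn (act_mem _ (act_mem _ hzD)) hzD (hw' _ (act_mem _ hzD))⟩

lemma hypHull_tile (w : Word) : hypHull {act w 0, act w (v 0), act w (v 1)} = act w '' tri := by
  have hb : ∀ j, act w (base j) ∈ ({act w 0, act w (v 0), act w (v 1)} : Set ℂ) := by
    intro j; fin_cases j <;> simp [base]
  have hb' : ∀ p ∈ ({act w 0, act w (v 0), act w (v 1)} : Set ℂ), ∃ j, p = act w (base j) := by
    rintro p (rfl | rfl | rfl)
    exacts [⟨0, rfl⟩, ⟨1, rfl⟩, ⟨2, rfl⟩]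
  have hD := fun j => act_mem w (base_mem_Disk j)
  refine subset_antisymm (fun z hz => ?_) ?_
  · obtain ⟨w', hw'⟩ := exists_inverse w; have hzD := hypHull_subset hz
    refine ⟨act w' z, (mem_tri_iff (act_mem _ hzD)).2 fun i => ?_,
      (isMob_act w').injOn (act_mem _ (act_mem _ hzD)) hzD (hw' _ (act_mem _ hzD))⟩
    rw [co_act w' hzD]; refine nonneg_of_mem_hypHull _ (fun p hp => ?_) hz
    obtain ⟨j, rfl⟩ := hb' p hp; refine ⟨hD j, ?_⟩
    rw [← co_act w' (hD j), hw' _ (base_mem_Disk j), co_base]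
    split_ifs <;> norm_num
  · rintro _ ⟨x, hx, rfl⟩; have hxD := tri_subset hx
    exact mem_hypHull_of_sum (act_mem w hxD) (fun j => act w (base j)) (fun j => subset_hypHull (hD j) (hb j)) (co x)
      ((mem_tri_iff hxD).1 hx) fun i => congrFun (co_act_sum w hxD) i

lemma hypSegment_tile (w : Word) : hypSegment (act w 0) (act w (v 0)) = act w '' (tri ∩ {x | x.im = 0}) := by
  rw [← act_image_hypSegment w zero_mem_Disk (v_mem 0)]
  congr 1
  ext x
  have h2 : ∀ {x}, x ∈ Disk → (co x 2 = 0 ↔ x.im = 0) := fun {x} hx => by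
    have h := (one_sub_pos hx).ne'; change 2 * rad * x.im / (1 - normSq x) = 0 ↔ _
    simp [rad_pos.ne', h]
  constructor
  · intro hx; have hxD := hypHull_subset hx
    obtain ⟨s, t, hs, ht, h⟩ := (mem_hypSegment zero_mem_Disk (v_mem 0) hxD).1 hx
    rw [co_zero, co_v_zero] at h
    refine ⟨(mem_tri_iff hxD).2 fun i => ?_, (h2 hxD).1 (by rw [h]; simp)⟩
    rw [h]; fin_cases i <;> simp [hs, ht]
  · rintro ⟨hx, h⟩; have hxD := tri_subset hx; have h0 := (mem_tri_iff hxD).1 hx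
    refine (mem_hypSegment zero_mem_Disk (v_mem 0) hxD).2 ⟨co x 0, co x 1, h0 0, h0 1, fun i => ?_⟩
    rw [co_zero, co_v_zero]; have := (h2 hxD).2 h
    fin_cases i <;> simp [this]

lemma isClosed_hypHull {A : Set ℂ} (hA : A.Finite) (hD : A ⊆ Disk) : IsClosed (hypHull A) := by
  have hcont : Continuous toKlein := by
    have h : ∀ z : ℂ, (1 + ‖z‖ ^ 2) ≠ 0 := fun z => by positivity
    unfold toKlein
    fun_prop (disch := exact h _)
  have hn : ∀ z, ‖toKlein z‖ = 2 * ‖z‖ / (1 + ‖z‖ ^ 2) := fun z => by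
    rw [toKlein, norm_smul, Real.norm_of_nonneg (by positivity)]; ring
  have hb : convexHull ℝ (toKlein '' A) ⊆ Metric.ball 0 1 := by
    refine convexHull_min ?_ (convex_ball _ _); rintro _ ⟨p, hp, rfl⟩
    have := mem_Disk_iff.1 (hD hp); rw [mem_ball_zero_iff, hn, div_lt_one (by positivity)]
    nlinarith
  have e : hypHull A = Metric.closedBall 0 1 ∩ toKlein ⁻¹' convexHull ℝ (toKlein '' A) := by
    ext z; refine ⟨fun h => ⟨mem_closedBall_zero_iff.2 h.1.le, h.2⟩, fun h => ⟨?_, h.2⟩⟩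
    refine lt_of_le_of_ne (mem_closedBall_zero_iff.1 h.1) fun h1 => ?_; have := hb h.2
    rw [mem_ball_zero_iff, hn, h1] at this; norm_num at this
  rw [e]
  exact Metric.isClosed_closedBall.inter ((hA.image _).isCompact_convexHull (𝕜 := ℝ) |>.isClosed.preimage hcont)

/-! ### A decidable criterion for signs -/

def nonnegZR (x : ZR) : Prop := (0 ≤ x.re ∧ 0 ≤ x.im) ∨ (0 ≤ x.re ∧ 2 * x.im ^ 2 ≤ x.re ^ 2) ∨ (0 ≤ x.im ∧ x.re ^ 2 ≤ 2 * x.im ^ 2)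

instance (x : ZR) : Decidable (nonnegZR x) := by unfold nonnegZR; infer_instance

lemma toR_nonneg {x : ZR} (h : nonnegZR x) : 0 ≤ toR x := by
  have hs := sqrt_two_mul_self
  have hs0 := Real.sqrt_nonneg 2
  rw [toR_apply]
  rcases h with ⟨h1, h2⟩ | ⟨h1, h2⟩ | ⟨h1, h2⟩
  · have : (0 : ℝ) ≤ x.re := by exact_mod_cast h1
    have : (0 : ℝ) ≤ x.im := by exact_mod_cast h2
    positivity
  · have h3 : (0 : ℝ) ≤ x.re := by exact_mod_cast h1
    have h4 : 2 * (x.im : ℝ) ^ 2 ≤ x.re ^ 2 := by exact_mod_cast h2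
    have := abs_le_of_sq_le_sq' (a := (x.im : ℝ) * √2) (b := x.re) (by nlinarith) h3
    linarith [this.1]
  · have h3 : (0 : ℝ) ≤ x.im := by exact_mod_cast h1
    have h4 : (x.re : ℝ) ^ 2 ≤ 2 * x.im ^ 2 := by exact_mod_cast h2
    have := abs_le_of_sq_le_sq' (a := (x.re : ℝ)) (b := x.im * √2) (by nlinarith) (by positivity)
    linarith [this.1]

/-! ### The polygon -/

abbrev rr (n : ℕ) : Word := List.replicate n true

lemma zeta_pow_mod (n : ℕ) : zeta ^ n = zeta ^ (n % 8) := by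
  conv_lhs => rw [← Nat.div_add_mod n 8, pow_add, pow_mul, zeta_pow_eight, one_pow, one_mul]

lemma zeta_cancel (j : ℕ) : zeta ^ j * zeta ^ (7 * j) = 1 := by
  rw [← pow_add, show j + 7 * j = 8 * j by ring, pow_mul, zeta_pow_eight, one_pow]

lemma zeta_mul_mem {z : ℂ} (n : ℕ) (hz : z ∈ Disk) : zeta ^ n * z ∈ Disk := act_rr n z ▸ act_mem _ hz

lemma halfTurn_v (j : ℕ) (z : ℂ) : halfTurn (v j) z = zeta ^ j * halfTurn (v 0) (zeta ^ (7 * j) * z) := by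
  have h := zeta_cancel j
  have hc : conj zeta ^ j = zeta ^ (7 * j) := by
    have h2 : conj zeta ^ j * zeta ^ j = 1 := by rw [← mul_pow, mul_comm, zeta_mul_conj, one_pow]
    linear_combination zeta ^ (7 * j) * h2 - conj zeta ^ j * h
  have e : v j = rad * zeta ^ j := rfl
  simp only [halfTurn, v_zero, e, map_mul, map_pow, conj_ofReal, hc]
  rw [mul_div_assoc', ← mul_assoc]
  congr 1
  linear_combination z * h

def uWord : Word := [false, true, true, true, true, false]
def wWord : Word := [false, true, true, true, true, true, true, false]
/-- The word of the side pairing with index zero. -/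
def tauZero : Word := (rr 2 ++ [false] ++ rr 7 ++ [false] ++ rr 7) ++ (rr 2 ++ [false] ++ rr 7 ++ [false] ++ rr 7) ++
  (rr 2 ++ [false] ++ rr 7 ++ [false] ++ rr 7)
def tauWord (j : ℕ) : Word := rr j ++ tauZero ++ rr (7 * j)

lemma halfTurn_v_v (j k : ℕ) : halfTurn (v j) (v (j + k)) = zeta ^ j * halfTurn (v 0) (v k) := by
  have e : ∀ j, v j = rad * zeta ^ j := fun _ => rfl
  rw [halfTurn_v, e (j + k), e k, pow_add]
  congr 2
  linear_combination (rad * zeta ^ k) * zeta_cancel j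

lemma act_v (k : ℕ) : act ([false] ++ rr k ++ [false]) 0 = halfTurn (v 0) (v k) := by
  rw [act_append, act_append, act_rr]
  change halfTurn (v 0) (zeta ^ k * act (baseWord 1) 0) = _
  rw [act_baseWord]
  simp [v, base, mul_comm]

lemma u_eq (j : ℕ) : u j = act (rr j ++ uWord) 0 := by
  rw [act_append, act_rr, show uWord = [false] ++ rr 4 ++ [false] from rfl, act_v, u, halfTurn_v_v]

lemma w_eq (j : ℕ) : w j = act (rr j ++ wWord) 0 := by
  rw [act_append, act_rr, show wWord = [false] ++ rr 6 ++ [false] from rfl, act_v, w, halfTurn_v_v]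

lemma u_add (n j : ℕ) : u (n + j) = zeta ^ n * u j := by
  rw [u_eq, u_eq, act_append, act_append, act_rr, act_rr, pow_add, mul_assoc]

lemma w_add (n j : ℕ) : w (n + j) = zeta ^ n * w j := by
  rw [w_eq, w_eq, act_append, act_append, act_rr, act_rr, pow_add, mul_assoc]

lemma u_mem_Disk (j : ℕ) : u j ∈ Disk := u_eq j ▸ act_mem _ zero_mem_Disk
lemma w_mem_Disk (j : ℕ) : w j ∈ Disk := w_eq j ▸ act_mem _ zero_mem_Disk

lemma sidePairing_eq (j : ℕ) (z : ℂ) : sidePairing j z = act (tauWord j) z := by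
  have h : ∀ z, halfTurn (v (j + 2)) (halfTurn (v (j + 1)) z) =
      zeta ^ j * act (rr 2 ++ [false] ++ rr 7 ++ [false] ++ rr 7) (zeta ^ (7 * j) * z) := by
    intro z; rw [halfTurn_v, halfTurn_v (j + 1)]; simp only [act_append, act_rr]
    change _ = zeta ^ j * (zeta ^ 2 * halfTurn (v 0) (zeta ^ 7 * halfTurn (v 0) (zeta ^ 7 * (zeta ^ (7 * j) * z))))
    rw [← mul_assoc, ← mul_assoc, ← pow_add, ← pow_add, ← mul_assoc (zeta ^ 7), ← pow_add,
      show 7 + 7 * j = 7 * (j + 1) by ring, zeta_pow_mod (7 * (j + 2) + (j + 1)),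
      show (7 * (j + 2) + (j + 1)) % 8 = 7 by omega]
  have h2 : ∀ z, zeta ^ (7 * j) * (zeta ^ j * z) = z := fun z => by rw [← mul_assoc, mul_comm (zeta ^ (7 * j)), zeta_cancel, one_mul]
  simp only [sidePairing, iterate_succ_apply, iterate_zero_apply, h, h2, tauWord, tauZero, act_append, act_rr]

lemma act_zero_eq {w w' : Word} (h : ∀ i, mat w i 0 = mat w' i 0) : act w 0 = act w' 0 := by
  refine co_injOn (act_mem _ zero_mem_Disk) (act_mem _ zero_mem_Disk) ?_
  ext i
  have := co_act_base w i 0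
  have h2 := co_act_base w' i 0
  rw [h i, ← h2] at this
  exact this

lemma act_tauWord (j : ℕ) (z : ℂ) : act (tauWord j) z = zeta ^ j * act tauZero (zeta ^ (7 * j) * z) := by
  rw [tauWord, act_append, act_append, act_rr, act_rr]

lemma zeta_cancel' (j : ℕ) (z : ℂ) : zeta ^ (7 * j) * (zeta ^ j * z) = z := by
  rw [← mul_assoc, mul_comm (zeta ^ (7 * j)), zeta_cancel, one_mul]

lemma zeta_cancel'' (j : ℕ) (z : ℂ) : zeta ^ j * (zeta ^ (7 * j) * z) = z := by rw [← mul_assoc, zeta_cancel, one_mul]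

lemma sidePairing_corners (j : ℕ) : sidePairing j (u j) = u (j + 3) ∧ sidePairing j (w j) = w (j + 2) := by
  rw [sidePairing_eq, sidePairing_eq, act_tauWord, act_tauWord, u_add, w_add, ← add_zero j, u_add, w_add, add_zero, zeta_cancel',
    zeta_cancel', u_eq, u_eq, w_eq, w_eq, ← act_append, ← act_append]
  exact ⟨congrArg _ (act_zero_eq (by decide +kernel)), congrArg _ (act_zero_eq (by decide +kernel))⟩

/-- The linear forms which define the sides. -/
def lA (c : Fin 3 → ℝ) : ℝ := 2 * c 0 + (√2 - 1) * c 1 + c 2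
def lB (c : Fin 3 → ℝ) : ℝ := 2 * c 0 + c 1 + (√2 - 1) * c 2

lemma nonneg_act_of_mem_hypHull {A : Set ℂ} (a : Fin 3 → ℝ) (w : Word) (hA : ∀ p ∈ A, p ∈ Disk ∧ 0 ≤ ∑ i, a i * co (act w p) i)
    {z : ℂ} (hz : z ∈ hypHull A) : 0 ≤ ∑ i, a i * co (act w z) i := by
  have e : ∀ p ∈ Disk, ∑ i, a i * co (act w p) i = ∑ k, (∑ i, a i * toR (mat w i k)) * co p k := by
    intro p hp; simp only [co_act w hp, sum_univ_three]; ring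
  rw [e z (hypHull_subset hz)]
  exact nonneg_of_mem_hypHull _ (fun p hp => ⟨(hA p hp).1, e p (hA p hp).1 ▸ (hA p hp).2⟩) hz

lemma lA_eq (c : Fin 3 → ℝ) : lA c = ∑ i, ![2, √2 - 1, 1] i * c i := by simp [sum_univ_three, lA]
lemma lB_eq (c : Fin 3 → ℝ) : lB c = ∑ i, ![2, 1, √2 - 1] i * c i := by simp [sum_univ_three, lB]

lemma toR_lA (w : Word) : lA (co (act w 0)) = toR (2 * mat w 0 0 + ⟨-1, 1⟩ * mat w 1 0 + mat w 2 0) := by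
  have h : ∀ i, co (act w 0) i = toR (mat w i 0) := fun i => co_act_base w i 0
  rw [lA, h, h, h, map_add, map_add, map_mul, map_mul, toR_apply ⟨-1, 1⟩, map_ofNat]
  push_cast; ring

lemma toR_lB (w : Word) : lB (co (act w 0)) = toR (2 * mat w 0 0 + mat w 1 0 + ⟨-1, 1⟩ * mat w 2 0) := by
  have h : ∀ i, co (act w 0) i = toR (mat w i 0) := fun i => co_act_base w i 0
  rw [lB, h, h, h, map_add, map_add, map_mul, map_mul, toR_apply ⟨-1, 1⟩, map_ofNat]
  push_cast; ring

lemma polygon_subset : polygon ⊆ Disk := fun _ h => hypHull_subset h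

lemma ineq_of_mem {z : ℂ} (hz : z ∈ polygon) (n : ℕ) : 0 ≤ lA (co (zeta ^ n * z)) ∧ 0 ≤ lB (co (zeta ^ n * z)) := by
  have hmod : ∀ (n j : ℕ), ∃ i : Fin 8, zeta ^ n * u j = act (rr i ++ uWord) 0 ∧ zeta ^ n * w j = act (rr i ++ wWord) 0 := by
    intro n j; refine ⟨⟨(n + j) % 8, by omega⟩, ?_, ?_⟩
    · rw [u_eq, act_append, act_append, act_rr, act_rr, ← mul_assoc, ← pow_add, zeta_pow_mod]
    · rw [w_eq, act_append, act_append, act_rr, act_rr, ← mul_assoc, ← pow_add, zeta_pow_mod]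
  have hu : ∀ i : Fin 8, nonnegZR (2 * mat (rr i ++ uWord) 0 0 + ⟨-1, 1⟩ * mat (rr i ++ uWord) 1 0 + mat (rr i ++ uWord) 2 0) ∧
      nonnegZR (2 * mat (rr i ++ wWord) 0 0 + ⟨-1, 1⟩ * mat (rr i ++ wWord) 1 0 + mat (rr i ++ wWord) 2 0) ∧
      nonnegZR (2 * mat (rr i ++ uWord) 0 0 + mat (rr i ++ uWord) 1 0 + ⟨-1, 1⟩ * mat (rr i ++ uWord) 2 0) ∧
      nonnegZR (2 * mat (rr i ++ wWord) 0 0 + mat (rr i ++ wWord) 1 0 + ⟨-1, 1⟩ * mat (rr i ++ wWord) 2 0) := by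
    decide +kernel
  rw [← act_rr, lA_eq, lB_eq]
  constructor <;> refine nonneg_act_of_mem_hypHull _ _ ?_ hz
  · rintro _ (⟨j, rfl⟩ | ⟨j, rfl⟩) <;> obtain ⟨i, h1, h2⟩ := hmod n j <;> rw [← lA_eq, act_rr]
    · exact ⟨u_mem_Disk j, by rw [h1, toR_lA]; exact toR_nonneg (hu i).1⟩
    · exact ⟨w_mem_Disk j, by rw [h2, toR_lA]; exact toR_nonneg (hu i).2.1⟩
  · rintro _ (⟨j, rfl⟩ | ⟨j, rfl⟩) <;> obtain ⟨i, h1, h2⟩ := hmod n j <;> rw [← lB_eq, act_rr]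
    · exact ⟨u_mem_Disk j, by rw [h1, toR_lB]; exact toR_nonneg (hu i).2.2.1⟩
    · exact ⟨w_mem_Disk j, by rw [h2, toR_lB]; exact toR_nonneg (hu i).2.2.2⟩

lemma co_comb (w : Word) {z : ℂ} (hz : z ∈ Disk) {p : Fin 3 → ℂ} (hp : ∀ j, p j ∈ Disk) {s : Fin 3 → ℝ}
    (h : ∀ i, co z i = ∑ j, s j * co (p j) i) (i : Fin 3) : co (act w z) i = ∑ j, s j * co (act w (p j)) i := by
  simp only [co_act w hz, co_act w (hp _), h, sum_univ_three]; ring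

lemma co_corners : co (u 0) = ![-1, 2 + 2 * √2, 0] ∧ co (w 0) = ![-1, √2, √2] ∧ co (u 1) = ![-1, 0, 2 + 2 * √2] := by
  have e : ∀ w, co (act w 0) = fun i => toR (mat w i 0) := fun w => funext fun i => co_act_base w i 0
  have m1 : (fun i => mat (rr 0 ++ uWord) i 0) = ![-1, ⟨2, 2⟩, 0] := by decide +kernel
  have m2 : (fun i => mat (rr 0 ++ wWord) i 0) = ![-1, ⟨0, 1⟩, ⟨0, 1⟩] := by decide +kernel
  have m3 : (fun i => mat (rr 1 ++ uWord) i 0) = ![-1, 0, ⟨2, 2⟩] := by decide +kernel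
  rw [u_eq, w_eq, u_eq, e, e, e]
  refine ⟨?_, ?_, ?_⟩ <;> ext i
  · rw [congrFun m1 i]; fin_cases i <;> simp [toR_apply]
  · rw [congrFun m2 i]; fin_cases i <;> simp [toR_apply]
  · rw [congrFun m3 i]; fin_cases i <;> simp [toR_apply]

lemma corner_mem (j : ℕ) : u j ∈ polygon ∧ w j ∈ polygon :=
  ⟨subset_hypHull (u_mem_Disk j) (Or.inl ⟨j, rfl⟩), subset_hypHull (w_mem_Disk j) (Or.inr ⟨j, rfl⟩)⟩

lemma zero_mem_polygon : (0 : ℂ) ∈ polygon := by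
  have m4 : (fun i => mat (rr 4 ++ uWord) i 0) = ![⟨11, 8⟩, ⟨-2, -2⟩, 0] := by decide +kernel
  have h4 : co (u 4) = ![11 + 8 * √2, -2 - 2 * √2, 0] := by
    have e : ∀ w, co (act w 0) = fun i => toR (mat w i 0) := fun w => funext fun i => co_act_base w i 0
    rw [u_eq, e]; ext i; rw [congrFun m4 i]; fin_cases i <;> simp [toR_apply]; ring
  have hs := Real.sqrt_nonneg 2
  refine mem_hypHull_of_sum zero_mem_Disk ![u 0, u 4, u 0] ?_ ![1 / (10 + 8 * √2), 1 / (10 + 8 * √2), 0] ?_ fun i => ?_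
  · intro j
    fin_cases j
    exacts [(corner_mem 0).1, (corner_mem 4).1, (corner_mem 0).1]
  · intro j
    fin_cases j <;> simp <;> positivity
  · have h0 : (10 + 8 * √2) ≠ 0 := by positivity
    rw [co_zero, sum_univ_three]
    fin_cases i <;> simp [h4, co_corners.1] <;> field_simp <;> ring

/-- The fan triangles of the polygon. -/
lemma mem_polygon_of_lower {q : ℂ} (j : ℕ) (hq : q ∈ Disk) (h2 : 0 ≤ co q 2) (h1 : co q 2 ≤ co q 1) (h : 0 ≤ lA (co q)) :
    zeta ^ j * q ∈ polygon := by
  obtain ⟨c1, c2, -⟩ := co_corners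
  have hs := one_lt_sqrt_two
  have hs2 := sqrt_two_mul_self
  rw [← act_rr]
  refine mem_hypHull_of_sum (act_mem _ hq) (fun k => act (rr j) (![0, u 0, w 0] k)) ?_
    ![lA (co q) / 2, (co q 1 - co q 2) * (√2 - 1) / 2, co q 2 * √2 / 2] ?_
    (co_comb _ hq (p := ![0, u 0, w 0]) ?_ fun i => ?_)
  · intro k
    fin_cases k
    · change act (rr j) 0 ∈ polygon; rw [act_rr, mul_zero]; exact zero_mem_polygon
    · change act (rr j) (u 0) ∈ polygon; rw [act_rr, ← u_add]; exact (corner_mem _).1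
    · change act (rr j) (w 0) ∈ polygon; rw [act_rr, ← w_add]; exact (corner_mem _).2
  · have a1 : 0 ≤ (co q 1 - co q 2) * (√2 - 1) / 2 := div_nonneg (mul_nonneg (by linarith) (by linarith)) (by norm_num)
    intro k
    fin_cases k
    exacts [div_nonneg h (by norm_num), a1, by simp; positivity]
  · intro k
    fin_cases k
    exacts [zero_mem_Disk, u_mem_Disk 0, w_mem_Disk 0]
  · rw [sum_univ_three]
    fin_cases i <;> simp [c1, c2, co_zero, lA]
    · ring
    · linear_combination (-(co q 1)) * hs2 + co q 2 / 2 * hs2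
    · linear_combination (-(co q 2) / 2) * hs2

lemma mem_polygon_of_upper {q : ℂ} (j : ℕ) (hq : q ∈ Disk) (h2 : 0 ≤ co q 1) (h1 : co q 1 ≤ co q 2) (h : 0 ≤ lB (co q)) :
    zeta ^ j * q ∈ polygon := by
  obtain ⟨-, c2, c1⟩ := co_corners
  have hs := one_lt_sqrt_two
  have hs2 := sqrt_two_mul_self
  rw [← act_rr]
  refine mem_hypHull_of_sum (act_mem _ hq) (fun k => act (rr j) (![0, u 1, w 0] k)) ?_
    ![lB (co q) / 2, (co q 2 - co q 1) * (√2 - 1) / 2, co q 1 * √2 / 2] ?_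
    (co_comb _ hq (p := ![0, u 1, w 0]) ?_ fun i => ?_)
  · intro k
    fin_cases k
    · change act (rr j) 0 ∈ polygon; rw [act_rr, mul_zero]; exact zero_mem_polygon
    · change act (rr j) (u 1) ∈ polygon; rw [act_rr, ← u_add]; exact (corner_mem _).1
    · change act (rr j) (w 0) ∈ polygon; rw [act_rr, ← w_add]; exact (corner_mem _).2
  · have a1 : 0 ≤ (co q 2 - co q 1) * (√2 - 1) / 2 := div_nonneg (mul_nonneg (by linarith) (by linarith)) (by norm_num)
    intro k
    fin_cases k
    exacts [div_nonneg h (by norm_num), a1, by simp; positivity]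
  · intro k
    fin_cases k
    exacts [zero_mem_Disk, u_mem_Disk 1, w_mem_Disk 0]
  · rw [sum_univ_three]
    fin_cases i <;> simp [c1, c2, co_zero, lB]
    · ring
    · linear_combination (-(co q 1) / 2) * hs2
    · linear_combination (-(co q 2)) * hs2 + co q 1 / 2 * hs2

lemma mem_polygon_iff {z : ℂ} (hz : z ∈ Disk) :
    z ∈ polygon ↔ ∀ n : Fin 8, 0 ≤ lA (co (zeta ^ (n : ℕ) * z)) ∧ 0 ≤ lB (co (zeta ^ (n : ℕ) * z)) := by
  refine ⟨fun h n => ineq_of_mem h n, fun h => ?_⟩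
  obtain ⟨j, q, rfl, him, hre⟩ := exists_sector z
  have hqD : q ∈ Disk := by have := zeta_mul_mem (7 * j) hz; rwa [zeta_cancel'] at this
  have hq := h ⟨7 * j % 8, by omega⟩
  simp only [← zeta_pow_mod, zeta_cancel'] at hq
  have c1 := (co_one_nonneg_iff hqD).2 hre
  have c2 := (co_two_nonneg_iff hqD).2 him
  rcases le_total (co q 2) (co q 1) with h3 | h3
  · exact mem_polygon_of_lower j hqD c2 h3 hq.1
  · exact mem_polygon_of_upper j hqD c1 h3 hq.2

lemma zeta_mul_mem_polygon (n : ℕ) {z : ℂ} (hz : z ∈ polygon) : zeta ^ n * z ∈ polygon := by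
  refine (mem_polygon_iff (zeta_mul_mem n (polygon_subset hz))).2 fun m => ?_
  rw [← mul_assoc, ← pow_add]
  exact ineq_of_mem hz _

/-! ### The sides of the polygon -/

def row (a : Fin 3 → ZR) (z : ℂ) : ℝ := ∑ i, toR (a i) * co z i

lemma row_act {a b : Fin 3 → ZR} {w : Word} (h : ∀ j, ∑ i, a i * mat w i j = b j) {z : ℂ} (hz : z ∈ Disk) :
    row a (act w z) = row b z := by
  simp only [row, co_act w hz, ← h, sum_univ_three, map_add, map_mul]; ring

def rowA : Fin 3 → ZR := ![2, ⟨-1, 1⟩, 1]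
def rowB : Fin 3 → ZR := ![2, 1, ⟨-1, 1⟩]

lemma row_rowA (z : ℂ) : row rowA z = lA (co z) := by
  have e : ∀ i, toR (rowA i) = ![2, √2 - 1, 1] i := by intro i; fin_cases i <;> simp [rowA, toR_apply, neg_add_eq_sub]
  simp [row, e, sum_univ_three, lA]
lemma row_rowB (z : ℂ) : row rowB z = lB (co z) := by
  have e : ∀ i, toR (rowB i) = ![2, 1, √2 - 1] i := by intro i; fin_cases i <;> simp [rowB, toR_apply, neg_add_eq_sub]
  simp [row, e, sum_univ_three, lB]

lemma row_vec (a b c : ZR) (z : ℂ) : row ![a, b, c] z = toR a * co z 0 + toR b * co z 1 + toR c * co z 2 := by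
  simp [row, sum_univ_three]

lemma co_rows {w : Word} {z : ℂ} (hz : z ∈ Disk) (a b c : Fin 3 → ZR) (h : ∀ j, mat w 0 j = a j ∧ mat w 1 j = b j ∧ mat w 2 j = c j) :
    co (act w z) 0 = row a z ∧ co (act w z) 1 = row b z ∧ co (act w z) 2 = row c z := by
  simp only [co_act w hz, row]
  refine ⟨?_, ?_, ?_⟩ <;> refine Finset.sum_congr rfl fun j _ => ?_
  exacts [by rw [(h j).1], by rw [(h j).2.1], by rw [(h j).2.2]]

lemma isClosed_polygon : IsClosed polygon := by
  have h : ∀ (f : ℕ → ℂ), (∀ n j, f (n + j) = zeta ^ n * f j) → (range f).Finite := fun f hf => by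
    refine (Set.finite_range fun i : Fin 8 => f i).subset ?_; rintro _ ⟨j, rfl⟩
    refine ⟨⟨j % 8, by omega⟩, ?_⟩; rw [← add_zero j, hf, zeta_pow_mod, ← hf]
    rfl
  refine isClosed_hypHull ((h u u_add).union (h w w_add)) ?_
  rintro _ (⟨j, rfl⟩ | ⟨j, rfl⟩)
  exacts [u_mem_Disk j, w_mem_Disk j]

lemma row_zeta {q : ℂ} (hq : q ∈ Disk) : lB (co (zeta ^ 1 * q)) = lA (co q) + √2 * co q 2 ∧
    lA (co (zeta ^ 7 * q)) = lB (co q) + √2 * co q 1 := by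
  rw [← act_rr, ← act_rr, ← row_rowB (act _ _), ← row_rowA (act _ _),
    row_act (b := ![2, ⟨-1, 1⟩, ⟨1, 1⟩]) (by decide +kernel) hq, row_act (b := ![2, ⟨1, 1⟩, ⟨-1, 1⟩]) (by decide +kernel) hq]
  constructor <;> simp [row, sum_univ_three, lA, lB, toR_apply] <;> ring

lemma mem_sideA_zero_iff {q : ℂ} (hq : q ∈ Disk) : q ∈ sideA 0 ↔ q ∈ polygon ∧ lA (co q) = 0 := by
  obtain ⟨c1, c2, -⟩ := co_corners
  have hs := one_lt_sqrt_two
  have hs2 := sqrt_two_mul_self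
  rw [sideA, mem_hypSegment (u_mem_Disk 0) (w_mem_Disk 0) hq, c1, c2]
  constructor
  · rintro ⟨s, t, h1, h2, h⟩
    refine ⟨mem_hypHull_of_sum hq ![u 0, w 0, w 0] ?_ ![s, t, 0] ?_ fun i => by rw [h i, ← c1, ← c2]; simp [sum_univ_three], ?_⟩
    · intro j
      fin_cases j
      exacts [(corner_mem 0).1, (corner_mem 0).2, (corner_mem 0).2]
    · intro j; fin_cases j <;> simp [h1, h2]
    · simp only [lA, h]; simp; linear_combination (2 * s + t) * hs2
  · rintro ⟨hP, h⟩; have h1 := (ineq_of_mem hP 0).2; have h2 := (ineq_of_mem hP 1).2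
    rw [(row_zeta hq).1, h] at h2; rw [pow_zero, one_mul] at h1; unfold lA at h; unfold lB at h1
    have h3 : 0 ≤ co q 2 := nonneg_of_mul_nonneg_right (by linarith) (by linarith : 0 < √2)
    have h4 : 0 ≤ co q 1 - co q 2 :=
      nonneg_of_mul_nonneg_right (by linarith : 0 ≤ (2 - √2) * (co q 1 - co q 2)) (by linarith [sqrt_two_lt])
    refine ⟨(co q 1 - co q 2) * (√2 - 1) / 2, co q 2 * √2 / 2,
      div_nonneg (mul_nonneg h4 (by linarith)) (by norm_num), by positivity, fun i => ?_⟩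
    fin_cases i <;> simp
    · linarith
    · linear_combination (-(co q 1)) * hs2 + co q 2 / 2 * hs2
    · linear_combination (-(co q 2) / 2) * hs2

lemma mem_sideB_zero_iff {q : ℂ} (hq : q ∈ Disk) : q ∈ sideB 0 ↔ q ∈ polygon ∧ lB (co q) = 0 := by
  obtain ⟨-, c2, c1⟩ := co_corners
  have hs := one_lt_sqrt_two
  have hs2 := sqrt_two_mul_self
  rw [sideB, mem_hypSegment (u_mem_Disk _) (w_mem_Disk 0) hq, c1, c2]
  constructor
  · rintro ⟨s, t, h1, h2, h⟩
    refine ⟨mem_hypHull_of_sum hq ![u 1, w 0, w 0] ?_ ![s, t, 0] ?_ fun i => by rw [h i, ← c1, ← c2]; simp [sum_univ_three], ?_⟩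
    · intro j
      fin_cases j
      exacts [(corner_mem 1).1, (corner_mem 0).2, (corner_mem 0).2]
    · intro j; fin_cases j <;> simp [h1, h2]
    · simp only [lB, h]; simp; linear_combination (2 * s + t) * hs2
  · rintro ⟨hP, h⟩; have h1 := (ineq_of_mem hP 0).1; have h2 := (ineq_of_mem hP 7).1
    rw [(row_zeta hq).2, h] at h2; rw [pow_zero, one_mul] at h1; unfold lB at h; unfold lA at h1
    have h3 : 0 ≤ co q 1 := nonneg_of_mul_nonneg_right (by linarith) (by linarith : 0 < √2)
    have h4 : 0 ≤ co q 2 - co q 1 :=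
      nonneg_of_mul_nonneg_right (by linarith : 0 ≤ (2 - √2) * (co q 2 - co q 1)) (by linarith [sqrt_two_lt])
    refine ⟨(co q 2 - co q 1) * (√2 - 1) / 2, co q 1 * √2 / 2,
      div_nonneg (mul_nonneg h4 (by linarith)) (by norm_num), by positivity, fun i => ?_⟩
    fin_cases i <;> simp
    · linarith
    · linear_combination (-(co q 1) / 2) * hs2
    · linear_combination (-(co q 2)) * hs2 + co q 1 / 2 * hs2

lemma sides_rotate (n j : ℕ) : sideA (n + j) = (zeta ^ n * ·) '' sideA j ∧ sideB (n + j) = (zeta ^ n * ·) '' sideB j := by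
  have e : (zeta ^ n * ·) = act (rr n) := by ext z; rw [act_rr]
  rw [sideA, sideA, sideB, sideB, e, act_image_hypSegment _ (u_mem_Disk _) (w_mem_Disk _),
    act_image_hypSegment _ (u_mem_Disk _) (w_mem_Disk _), ← e, u_add, w_add, add_assoc n j 1, u_add]
  exact ⟨rfl, rfl⟩

lemma mem_polygon_rotate (n : ℕ) (z : ℂ) : zeta ^ (7 * n) * z ∈ polygon ↔ z ∈ polygon :=
  ⟨fun h => zeta_cancel'' n z ▸ zeta_mul_mem_polygon n h, zeta_mul_mem_polygon _⟩

lemma mem_image_rotate (n : ℕ) (z : ℂ) (A : Set ℂ) : z ∈ (zeta ^ n * ·) '' A ↔ zeta ^ (7 * n) * z ∈ A := by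
  constructor
  · rintro ⟨q, hq, rfl⟩; change zeta ^ (7 * n) * (zeta ^ n * q) ∈ A; rwa [zeta_cancel']
  · exact fun h => ⟨_, h, zeta_cancel'' n z⟩

lemma mem_sideA_iff {j : ℕ} {z : ℂ} (hz : z ∈ Disk) : z ∈ sideA j ↔ z ∈ polygon ∧ lA (co (zeta ^ (7 * j) * z)) = 0 := by
  rw [← add_zero j, (sides_rotate j 0).1, mem_image_rotate, mem_sideA_zero_iff (zeta_mul_mem _ hz), mem_polygon_rotate, add_zero]

lemma mem_sideB_iff {j : ℕ} {z : ℂ} (hz : z ∈ Disk) : z ∈ sideB j ↔ z ∈ polygon ∧ lB (co (zeta ^ (7 * j) * z)) = 0 := by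
  rw [← add_zero j, (sides_rotate j 0).2, mem_image_rotate, mem_sideB_zero_iff (zeta_mul_mem _ hz), mem_polygon_rotate, add_zero]

lemma continuousOn_co (i : Fin 3) : ContinuousOn (fun z => co z i) Disk := by
  have h : ∀ z ∈ Disk, 1 - normSq z ≠ 0 := fun z hz => (one_sub_pos hz).ne'
  fin_cases i <;> simp [co] <;> fun_prop (disch := assumption)

/-- Moving outwards along a ray leaves the polygon at a side. -/
lemma neg_of_ray {q : ℂ} {b c t : ℝ} (hq : q ∈ Disk) (h : 2 * co q 0 + b * co q 1 + c * co q 2 = 0) (ht : 1 < t)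
    (htq : (t : ℂ) * q ∈ Disk) : 2 * co (t * q) 0 + b * co (t * q) 1 + c * co (t * q) 2 < 0 := by
  have key : ∀ z ∈ Disk, (2 * co z 0 + b * co z 1 + c * co z 2) * (1 - normSq z) =
      2 * (1 + normSq z) - rad * (√2 * (z.re - z.im) * (2 * (1 + √2) - b) + 2 * z.im * (2 * (1 + √2) - c)) := fun z hz => by
    have := (one_sub_pos hz).ne'; simp only [co, cons_val_zero, cons_val_one, cons_val]; field_simp
    ring
  have h1 := key q hq
  have h2 := key _ htq
  have h3 := one_sub_pos htq
  have hN : normSq (t * q) = t * t * normSq q := by rw [normSq_mul, normSq_ofReal]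
  rw [h, zero_mul] at h1
  rw [re_ofReal_mul, im_ofReal_mul] at h2
  have h4 : 0 < (t - 1) * (1 - t * normSq q) := by
    have := normSq_nonneg q; rw [hN] at h3; exact mul_pos (by linarith) (by nlinarith)
  refine neg_of_mul_neg_left (b := 1 - normSq (t * q)) ?_ h3.le
  rw [h2, hN]
  linear_combination 2 * h4 - t * h1

lemma frontier_polygon : frontier polygon = ⋃ j : ℕ, (sideA j ∪ sideB j) := by
  rw [isClosed_polygon.frontier_eq]
  ext z
  simp only [mem_sdiff, mem_iUnion, mem_union]
  constructor
  · rintro ⟨hz, hi⟩; have hD := polygon_subset hz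
    by_contra! hne
    refine hi (mem_interior_iff_mem_nhds.2 ?_)
    have hc : ∀ (n : ℕ) (i : Fin 3), ContinuousAt (fun z => co (zeta ^ n * z) i) z := fun n i => by
      have h1 := (continuousOn_co i).continuousAt (isOpen_Disk.mem_nhds (zeta_mul_mem n hD))
      exact ContinuousAt.comp (f := fun z => zeta ^ n * z) h1 (by fun_prop)
    have key : ∀ n : Fin 8, ∀ᶠ z in 𝓝 z, 0 < lA (co (zeta ^ (n : ℕ) * z)) ∧ 0 < lB (co (zeta ^ (n : ℕ) * z)) := by
      intro n; have h7 : zeta ^ (7 * (7 * (n : ℕ))) * z = zeta ^ (n : ℕ) * z := by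
        rw [zeta_pow_mod, show 7 * (7 * (n : ℕ)) % 8 = n by omega]
      have hA := mt (mem_sideA_iff hD).2 (hne (7 * n)).1
      have hB := mt (mem_sideB_iff hD).2 (hne (7 * n)).2; rw [h7] at hA hB
      have h0 := ineq_of_mem hz n
      have p1 : 0 < lA (co (zeta ^ (n : ℕ) * z)) := lt_of_le_of_ne h0.1 fun e => hA ⟨hz, e.symm⟩
      have p2 : 0 < lB (co (zeta ^ (n : ℕ) * z)) := lt_of_le_of_ne h0.2 fun e => hB ⟨hz, e.symm⟩
      have c1 : ContinuousAt (fun z => lA (co (zeta ^ (n : ℕ) * z))) z := by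
        unfold lA; exact (((hc n 0).const_mul 2).add ((hc n 1).const_mul _)).add (hc n 2)
      have c2 : ContinuousAt (fun z => lB (co (zeta ^ (n : ℕ) * z))) z := by
        unfold lB; exact (((hc n 0).const_mul 2).add (hc n 1)).add ((hc n 2).const_mul _)
      exact (c1.eventually (lt_mem_nhds p1)).and (c2.eventually (lt_mem_nhds p2))
    filter_upwards [Filter.eventually_all.2 key, isOpen_Disk.mem_nhds hD] with y hy hyD
    exact (mem_polygon_iff hyD).2 fun n => ⟨(hy n).1.le, (hy n).2.le⟩
  · rintro ⟨j, hj⟩; have hD : z ∈ Disk := hj.elim hypHull_subset hypHull_subset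
    rw [mem_sideA_iff hD, mem_sideB_iff hD, ← and_or_left] at hj; refine ⟨hj.1, fun hi => ?_⟩
    have hc : ContinuousAt (fun t : ℝ => (t : ℂ) * z) 1 := by fun_prop
    have h1 : ∀ᶠ t : ℝ in 𝓝[>] 1, (t : ℂ) * z ∈ polygon :=
      (hc.eventually (by simpa using mem_interior_iff_mem_nhds.1 hi)).filter_mono nhdsWithin_le_nhds
    obtain ⟨t, ht, ht1⟩ := (h1.and self_mem_nhdsWithin).exists
    have e : zeta ^ (7 * j) * ((t : ℂ) * z) = t * (zeta ^ (7 * j) * z) := by ring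
    have h2 := ineq_of_mem ht (7 * j); have h3 := zeta_mul_mem (7 * j) (polygon_subset ht)
    have hq := zeta_mul_mem (7 * j) hD; rw [e] at h2 h3
    rcases hj.2 with h | h
    · have := neg_of_ray (b := √2 - 1) (c := 1) hq (by rw [one_mul]; exact h) ht1 h3
      rw [one_mul] at this; exact absurd h2.1 (not_le.2 this)
    · have := neg_of_ray (b := 1) (c := √2 - 1) hq (by rw [one_mul]; exact h) ht1 h3
      rw [one_mul] at this; exact absurd h2.2 (not_le.2 this)

lemma sidePairing_image (j : ℕ) : sidePairing j '' sideA j = sideB (j + 2) := by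
  have e : sidePairing j = act (tauWord j) := funext (sidePairing_eq j)
  rw [sideA, sideB, e, act_image_hypSegment _ (u_mem_Disk _) (w_mem_Disk _), ← e, (sidePairing_corners j).1, (sidePairing_corners j).2]

lemma mem_sideA_of_mem {j : ℕ} {z : ℂ} (hz : z ∈ polygon) (h : sidePairing j z ∈ polygon) : z ∈ sideA j := by
  have hD := polygon_subset hz
  have hq := zeta_mul_mem (7 * j) hD
  have h1 := (ineq_of_mem h (7 * j + 6)).2
  have h0 := (ineq_of_mem hz (7 * j)).1
  rw [sidePairing_eq, act_tauWord, ← mul_assoc, ← pow_add, zeta_pow_mod, show (7 * j + 6 + j) % 8 = 6 by omega, ← act_rr,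
    ← act_append, ← row_rowB, row_act (b := -rowA) (by decide +kernel) hq,
    show ∀ z, row (-rowA) z = -row rowA z from fun z => by simp [row, Finset.sum_neg_distrib], row_rowA] at h1
  exact (mem_sideA_iff hD).2 ⟨hz, by linarith⟩

/-! ### The tiles of the polygon -/

def kindWord : Fin 4 → Word
  | 0 => []
  | 1 => [true, false, true, true, false]
  | 2 => [false, true, true, true, true, true, false, true, false]
  | 3 => [true, false, true, true, false, true]

def frameWord (n : Fin 96) : Word :=
  rr (n / 12 : ℕ) ++ kindWord ⟨n / 3 % 4, by omega⟩ ++ (List.replicate (n % 3 : ℕ) [true, false]).flatten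

def frameIndex (l : Flag) : Fin 96 := ((List.finRange 96).find? fun n => lab (frameWord n) = l).getD 0

lemma frameIndex_lab : ∀ n : Fin 96, frameIndex (lab (frameWord n)) = n := by decide +kernel
lemma lab_frameIndex : ∀ l, lab (frameWord (frameIndex l)) = l := by decide +kernel
lemma frameIndex_cyc : ∀ l, (frameIndex (cyc l) : ℕ) = 3 * (frameIndex l / 3) + (frameIndex l + 1) % 3 := by decide +kernel

/-- The first edge of the frame lies in the polygon. -/
def EdgeInside (n : Fin 96) : Prop := n / 3 % 4 < (2 : ℕ) ∨ n / 3 % 4 = (2 : ℕ) ∧ n % 3 = (1 : ℕ)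
instance (n : Fin 96) : Decidable (EdgeInside n) := by unfold EdgeInside; infer_instance

/-- Two frames with opposite first edges. -/
def Glued (n n' : Fin 96) : Prop :=
  mat (frameWord n ++ [false]) = mat (frameWord n') ∧ (n / 12 = (n' / 12 : ℕ) ∨ EdgeInside n) ∨
  EdgeInside n ∧ mat (frameWord n ++ [false]) = mat (tauWord (n' / 12) ++ frameWord n') ∨
  EdgeInside n' ∧ mat (tauWord (n / 12) ++ (frameWord n ++ [false])) = mat (frameWord n')
instance (n n' : Fin 96) : Decidable (Glued n n') := by unfold Glued; infer_instance

lemma glued_flip : ∀ l : Flag, Glued (frameIndex l) (frameIndex (flip l)) := by decide +kernel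

lemma act_frameWord (n : Fin 96) (x : ℂ) :
    act (frameWord n) x = zeta ^ (n / 12 : ℕ) * act (kindWord ⟨n / 3 % 4, by omega⟩) (tspin^[n % 3] x) := by
  have h : ∀ m x, act (List.replicate m [true, false]).flatten x = tspin^[m] x := by
    intro m
    induction m with
    | zero => exact fun x => rfl
    | succ m ih => exact fun x => by rw [List.replicate_succ', List.flatten_append, act_append, ih, iterate_succ_apply]; rfl
  rw [frameWord, act_append, act_append, act_rr, h]

lemma tspin_iterate_mem (m : ℕ) {x : ℂ} (hx : x ∈ tri) : tspin^[m] x ∈ tri := by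
  induction m generalizing x with
  | zero => exact hx
  | succ m ih => exact ih (tspin_mem hx)

lemma sidePairing_rotate (j : ℕ) {w : Word} (x : ℂ) :
    sidePairing j (zeta ^ j * act w x) = zeta ^ (j + 2) * act (rr 6 ++ tauZero ++ w) x := by
  rw [sidePairing_eq, act_tauWord, zeta_cancel', act_append, act_append, act_rr, ← mul_assoc, ← pow_add,
    zeta_pow_mod (j + 2 + 6), zeta_pow_mod j, show (j + 2 + 6) % 8 = j % 8 by omega]

lemma mem_polygon_of_inner (j : ℕ) (k : Fin 4) (hk : (k : ℕ) < 2) {x : ℂ} (hx : x ∈ tri) : zeta ^ j * act (kindWord k) x ∈ polygon := by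
  have hD := tri_subset hx
  have h := (mem_tri_iff hD).1 hx
  have hs := one_lt_sqrt_two
  have a0 := h 0
  have a1 := h 1
  have a2 := h 2
  have hq := act_mem (kindWord k) hD
  have hh : 0 ≤ co (act (kindWord k) x) 1 ∧ 0 ≤ co (act (kindWord k) x) 2 ∧ 0 ≤ lA (co (act (kindWord k) x)) ∧
      0 ≤ lB (co (act (kindWord k) x)) := by
    obtain rfl | rfl : k = 0 ∨ k = 1 := by omega
    · have : 0 ≤ √2 - 1 := by linarith
      refine ⟨a1, a2, ?_, ?_⟩ <;> [change 0 ≤ 2 * co x 0 + (√2 - 1) * co x 1 + co x 2; change 0 ≤ 2 * co x 0 + co x 1 + (√2 - 1) * co x 2] <;> positivity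
    · obtain ⟨e0, e1, e2⟩ := co_rows (w := kindWord 1) hD ![-1, 0, 0] ![⟨0, 1⟩, 0, 1] ![⟨0, 1⟩, 1, 0] (by decide +kernel)
      simp [row_vec, toR_apply] at e0 e1 e2; have hs2 := sqrt_two_mul_self
      have b1 : 0 ≤ (√2 - 1) * co x 1 := mul_nonneg (by linarith) a1
      have b2 : 0 ≤ (√2 - 1) * co x 2 := mul_nonneg (by linarith) a2; rw [lA, lB, e0, e1, e2]
      refine ⟨by positivity, by positivity, ?_, ?_⟩
      · linear_combination a1 + b2 - co x 0 * hs2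
      · linear_combination a2 + b1 - co x 0 * hs2
  rcases le_total (co (act (kindWord k) x) 2) (co (act (kindWord k) x) 1) with h3 | h3
  · exact mem_polygon_of_lower j hq hh.2.1 h3 hh.2.2.1
  · exact mem_polygon_of_upper j hq hh.1 h3 hh.2.2.2

/-- The position of the points of the tiles which are cut by sides. -/
lemma outer_mem (j : ℕ) {x : ℂ} (hx : x ∈ tri) : (co x 1 ≤ co x 2 → zeta ^ j * act (kindWord 2) x ∈ polygon) ∧
    (co x 2 ≤ co x 1 → sidePairing j (zeta ^ j * act (kindWord 2) x) ∈ polygon) ∧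
    (co x 2 ≤ co x 1 → zeta ^ j * act (kindWord 3) x ∈ polygon) ∧
    (co x 1 ≤ co x 2 → sidePairing j (zeta ^ j * act (kindWord 3) x) ∈ polygon) := by
  have hD := tri_subset hx
  have h := (mem_tri_iff hD).1 hx
  have hs := one_lt_sqrt_two
  have hs2 := sqrt_two_mul_self
  have a0 := h 0
  have a1 := h 1
  have a2 := h 2
  have m1 : 0 ≤ √2 * co x 0 := by positivity
  have m2 : 0 ≤ √2 * co x 1 := by positivity
  have m3 : 0 ≤ √2 * co x 2 := by positivity
  have pos : ∀ {t : ℝ}, 0 ≤ t → 0 ≤ (√2 - 1) * t := fun ht => mul_nonneg (by linarith) ht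
  rw [sidePairing_rotate, sidePairing_rotate]
  refine ⟨fun hl => ?_, fun hl => ?_, fun hl => ?_, fun hl => ?_⟩
  · obtain ⟨e0, e1, e2⟩ := co_rows (w := kindWord 2) hD ![-1, ⟨0, -1⟩, 0] ![⟨2, 2⟩, ⟨2, 1⟩, 1] ![0, 1, 0] (by decide +kernel)
    simp [row_vec, toR_apply, -List.append_assoc] at e0 e1 e2
    refine mem_polygon_of_lower j (act_mem _ hD) (by rw [e2]; exact a1) (by rw [e1, e2]; linarith) ?_
    rw [lA, e0, e1, e2]; linear_combination pos (sub_nonneg.2 hl) - (2 * co x 0 + co x 1) * hs2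
  · obtain ⟨e0, e1, e2⟩ := co_rows (w := rr 6 ++ tauZero ++ kindWord 2) hD ![-1, 0, ⟨0, -1⟩] ![0, 0, 1] ![⟨2, 2⟩, 1, ⟨2, 1⟩] (by decide +kernel)
    simp [row_vec, toR_apply, -List.append_assoc] at e0 e1 e2
    refine mem_polygon_of_upper _ (act_mem _ hD) (by rw [e1]; exact a2) (by rw [e1, e2]; linarith) ?_
    rw [lB, e0, e1, e2]; linear_combination pos (sub_nonneg.2 hl) - (2 * co x 0 + co x 2) * hs2
  · obtain ⟨e0, e1, e2⟩ := co_rows (w := kindWord 3) hD ![-1, 0, ⟨0, -1⟩] ![⟨0, 1⟩, 1, ⟨2, 1⟩] ![⟨0, 1⟩, 0, 1] (by decide +kernel)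
    simp [row_vec, toR_apply, -List.append_assoc] at e0 e1 e2
    refine mem_polygon_of_lower j (act_mem _ hD) (by rw [e2]; linarith) (by rw [e1, e2]; linarith) ?_
    rw [lA, e0, e1, e2]; linear_combination pos (sub_nonneg.2 hl) - (co x 0 + co x 2) * hs2
  · obtain ⟨e0, e1, e2⟩ := co_rows (w := rr 6 ++ tauZero ++ kindWord 3) hD ![-1, ⟨0, -1⟩, 0] ![⟨0, 1⟩, 1, 0] ![⟨0, 1⟩, ⟨2, 1⟩, 1] (by decide +kernel)
    simp [row_vec, toR_apply, -List.append_assoc] at e0 e1 e2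
    refine mem_polygon_of_upper _ (act_mem _ hD) (by rw [e1]; linarith) (by rw [e1, e2]; linarith) ?_
    rw [lB, e0, e1, e2]; linear_combination pos (sub_nonneg.2 hl) - (co x 0 + co x 1) * hs2

lemma act_frameWord_mem (n : Fin 96) {x : ℂ} (hx : x ∈ tri) : act (frameWord n) x ∈ doublePolygon (n / 12 : ℕ) := by
  have hy := tspin_iterate_mem (n % 3) hx
  have hD : act (frameWord n) x ∈ Disk := act_mem _ (tri_subset hx)
  rw [act_frameWord] at hD ⊢
  set y := tspin^[n % 3] x
  set k : Fin 4 := ⟨n / 3 % 4, by omega⟩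
  obtain ⟨h1, h2, h3, h4⟩ := outer_mem (n / 12 : ℕ) hy
  have key : zeta ^ (n / 12 : ℕ) * act (kindWord k) y ∈ polygon ∨ sidePairing (n / 12) (zeta ^ (n / 12 : ℕ) * act (kindWord k) y) ∈ polygon := by
    by_cases hk : (k : ℕ) < 2
    · exact Or.inl (mem_polygon_of_inner _ _ hk hy)
    obtain hk | hk : k = 2 ∨ k = 3 := by omega
    · rw [hk]; exact (le_total (co y 1) (co y 2)).imp h1 h2
    · rw [hk]; exact (le_total (co y 2) (co y 1)).imp h3 h4
  exact key.imp_right fun h => ⟨mem_Disk_iff.1 hD, h⟩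

lemma edgeInside_mem {n : Fin 96} (hn : EdgeInside n) {x : ℂ} (hx : x ∈ tri) (hi : x.im = 0) : act (frameWord n) x ∈ polygon := by
  have hy := tspin_iterate_mem (n % 3) hx
  rw [act_frameWord]
  rcases hn with h | ⟨h, h'⟩
  · exact mem_polygon_of_inner _ _ h hy
  · rw [h', show (⟨n / 3 % 4, by omega⟩ : Fin 4) = 2 from Fin.ext h]; have hD := tri_subset hx
    refine (outer_mem _ (tspin_mem hx)).1 ?_
    obtain ⟨-, e1, e2⟩ := co_rows (w := [true, false]) hD ![0, 1, 0] ![0, 0, 1] ![1, 0, 0] (by decide +kernel)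
    simp [row_vec, toR_apply] at e1 e2; rw [tspin, e1, e2]; have h2 : co x 2 = 0 := by simp [co, hi]
    rw [h2]; exact (mem_tri_iff hD).1 hx 0

/-! ### The polygon is covered by its tiles -/

def invWord (w : Word) : Word := w.reverse.flatMap fun b => bif b then rr 7 else [false]

def kindFrame (j : Fin 8) (k : Fin 4) : Fin 96 := ⟨12 * j + 3 * k, by omega⟩

lemma act_kindFrame (j : Fin 8) (k : Fin 4) (x : ℂ) : act (frameWord (kindFrame j k)) x = zeta ^ (j : ℕ) * act (kindWord k) x := by
  have h : ∀ (j : Fin 8) (k : Fin 4), frameWord (kindFrame j k) = rr j ++ kindWord k := by decide +kernel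
  rw [h, act_append, act_rr]

lemma exists_preimage {q : ℂ} (hq : q ∈ Disk) (w : Word) (a b c : Fin 3 → ZR)
    (h : ∀ j, mat (invWord w) 0 j = a j ∧ mat (invWord w) 1 j = b j ∧ mat (invWord w) 2 j = c j)
    (h1 : mat (w ++ invWord w) = mat []) (h2 : 0 ≤ row a q ∧ 0 ≤ row b q ∧ 0 ≤ row c q) : ∃ x ∈ tri, act w x = q := by
  obtain ⟨e0, e1, e2⟩ := co_rows hq a b c h
  refine ⟨act (invWord w) q, (mem_tri_iff (act_mem _ hq)).2 fun i => ?_, ?_⟩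
  · fin_cases i
    exacts [e0 ▸ h2.1, e1 ▸ h2.2.1, e2 ▸ h2.2.2]
  · rw [← act_append, act_eq_of_mat_eq h1 hq, act_nil]

lemma exists_frame_of_mem_polygon (p : polygon) : ∃ n : Fin 96, ∃ x ∈ tri, Represents (n / 12 : ℕ) (act (frameWord n) x) p := by
  obtain ⟨z, hz⟩ := p
  obtain ⟨j, q, rfl, him, hre⟩ := exists_sector z
  have hq : q ∈ Disk := by
    have := zeta_mul_mem (7 * j) (polygon_subset hz); rwa [zeta_cancel'] at this
  have hl := ineq_of_mem hz (7 * j)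
  rw [zeta_cancel'] at hl
  have c1 := (co_one_nonneg_iff hq).2 hre
  have c2 := (co_two_nonneg_iff hq).2 him
  have hs := one_lt_sqrt_two
  have hs2 := sqrt_two_mul_self
  have inner : ∀ k : Fin 4, (∃ x ∈ tri, act (kindWord k) x = q) →
      ∃ n : Fin 96, ∃ x ∈ tri, Represents (n / 12 : ℕ) (act (frameWord n) x) ⟨zeta ^ (j : ℕ) * q, hz⟩ := by
    rintro k ⟨x, hx, e⟩; exact ⟨kindFrame j k, x, hx, Or.inl (by rw [act_kindFrame, e])⟩
  have outer : ∀ k : Fin 4, (∃ x ∈ tri, act (rr 6 ++ tauZero ++ kindWord k) x = q) →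
      ∃ n : Fin 96, ∃ x ∈ tri, Represents (n / 12 : ℕ) (act (frameWord n) x) ⟨zeta ^ (j : ℕ) * q, hz⟩ := by
    rintro k ⟨x, hx, e⟩; refine ⟨kindFrame ⟨(j + 6) % 8, by omega⟩ k, x, hx, Or.inr ?_⟩
    rw [act_kindFrame, show ((kindFrame ⟨(j + 6) % 8, by omega⟩ k : Fin 96) / 12 : ℕ) = (j + 6) % 8 by simp only [kindFrame]; omega,
      sidePairing_rotate, e, zeta_pow_mod (_ + 2)]
    rw [show ((j + 6) % 8 + 2) % 8 = (j : ℕ) by omega]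
  have hA := mul_nonneg (by linarith : 0 ≤ √2 + 1) hl.1
  have hB := mul_nonneg (by linarith : 0 ≤ √2 + 1) hl.2
  unfold lA at hA
  unfold lB at hB
  by_cases h0 : 0 ≤ co q 0
  · refine inner 0 ⟨q, (mem_tri_iff hq).2 fun i => ?_, rfl⟩
    fin_cases i
    exacts [h0, c1, c2]
  push Not at h0
  rcases le_total (co q 2) (co q 1) with h3 | h3
  · by_cases h4 : 0 ≤ √2 * co q 0 + co q 2
    · refine inner 1 (exists_preimage hq _ ![-1, 0, 0] ![⟨0, 1⟩, 0, 1] ![⟨0, 1⟩, 1, 0] (by decide +kernel) (by decide +kernel) ?_)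
      simp only [row_vec, toR_apply]; refine ⟨?_, ?_, ?_⟩ <;> simp <;> linarith
    push Not at h4
    by_cases h5 : 0 ≤ co q 0 + √2 * co q 2
    · refine inner 3 (exists_preimage hq _ ![1, 0, ⟨0, 1⟩] ![⟨2, 1⟩, 1, ⟨0, 1⟩] ![⟨0, -1⟩, 0, -1] (by decide +kernel)
        (by decide +kernel) ?_)
      simp only [row_vec, toR_apply]; refine ⟨?_, ?_, ?_⟩ <;> simp <;> [linarith; skip; linarith]
      linear_combination hA + h4 + co q 1 * hs2
    · refine inner 2 (exists_preimage hq _ ![-1, 0, ⟨0, -1⟩] ![0, 0, 1] ![⟨2, 2⟩, 1, ⟨2, 1⟩] (by decide +kernel) (by decide +kernel) ?_)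
      simp only [row_vec, toR_apply]; refine ⟨?_, ?_, ?_⟩ <;> simp <;> [linarith; linarith; skip]
      linear_combination hA + c2 + co q 1 * hs2
  · by_cases h4 : 0 ≤ √2 * co q 0 + co q 1
    · refine inner 1 (exists_preimage hq _ ![-1, 0, 0] ![⟨0, 1⟩, 0, 1] ![⟨0, 1⟩, 1, 0] (by decide +kernel) (by decide +kernel) ?_)
      simp only [row_vec, toR_apply]; refine ⟨?_, ?_, ?_⟩ <;> simp <;> linarith
    push Not at h4
    by_cases h5 : 0 ≤ co q 0 + √2 * co q 1
    · refine outer 3 (exists_preimage hq _ ![1, ⟨0, 1⟩, 0] ![⟨0, -1⟩, -1, 0] ![⟨2, 1⟩, ⟨0, 1⟩, 1] (by decide +kernel)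
        (by decide +kernel) ?_)
      simp only [row_vec, toR_apply]; refine ⟨?_, ?_, ?_⟩ <;> simp <;> [linarith; linarith; skip]
      linear_combination hB + h4 + co q 2 * hs2
    · refine outer 2 (exists_preimage hq _ ![-1, ⟨0, -1⟩, 0] ![⟨2, 2⟩, ⟨2, 1⟩, 1] ![0, 1, 0] (by decide +kernel) (by decide +kernel) ?_)
      simp only [row_vec, toR_apply]; refine ⟨?_, ?_, ?_⟩ <;> simp <;> [linarith; skip; linarith]
      linear_combination hB + c1 + co q 2 * hs2

/-! ### Gluing the tiles -/

lemma projY_sidePairing {j : ℕ} {z : ℂ} (hz : z ∈ polygon) (h : sidePairing j z ∈ polygon) : projY ⟨z, hz⟩ = projY ⟨_, h⟩ :=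
  Quotient.sound (Relation.EqvGen.rel _ _ ⟨j, mem_sideA_of_mem hz h, rfl⟩)

lemma projY_eq {j : ℕ} {z : ℂ} {p q : polygon} (hp : Represents j z p) (hq : Represents j z q) : projY p = projY q := by
  obtain ⟨p, hp'⟩ := p
  obtain ⟨q, hq'⟩ := q
  rcases hp with rfl | rfl <;> rcases hq with rfl | rfl
  exacts [rfl, projY_sidePairing _ _, (projY_sidePairing _ _).symm, rfl]

lemma exists_represents {j : ℕ} {z : ℂ} (h : z ∈ doublePolygon j) : ∃ p, Represents j z p :=
  h.elim (fun h => ⟨⟨z, h⟩, Or.inl rfl⟩) fun h => ⟨⟨_, h.2⟩, Or.inr rfl⟩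

open scoped Classical in
/-- The point of `Y` which is represented by a point of the double polygon. -/
def cl (j : ℕ) (z : ℂ) : Y :=
  if h : ∃ p, Represents j z p then projY h.choose else projY ⟨0, zero_mem_polygon⟩

lemma cl_eq {j : ℕ} {z : ℂ} {p : polygon} (h : Represents j z p) : cl j z = projY p := by
  have h' : ∃ p, Represents j z p := ⟨p, h⟩
  rw [cl, dif_pos h']
  exact projY_eq h'.choose_spec h

def unflatten (ξ : ℂ) : ℂ := invFunOn flatten tri ξ

lemma unflatten_mem {ξ : ℂ} (h : ξ ∈ flatTri) : unflatten ξ ∈ tri := invFunOn_mem (flatten_spec.2.1.surjOn h)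

lemma flatten_unflatten {ξ : ℂ} (h : ξ ∈ flatTri) : flatten (unflatten ξ) = ξ :=
  invFunOn_eq (flatten_spec.2.1.surjOn h)

lemma unflatten_eq {x : ℂ} (h : x ∈ tri) : unflatten (flatten x) = x :=
  flatten_spec.2.1.injOn (unflatten_mem (flatten_mem h)) h (flatten_unflatten (flatten_mem h))

lemma flatten_tspin {x : ℂ} (h : x ∈ tri) : flatten (tspin x) = spin (flatten x) := flatten_spec.2.2.1 x h

lemma gen_false_mem {x : ℂ} (hx : x ∈ tri) (hi : x.im = 0) : act [false] x ∈ tri ∧ (act [false] x).im = 0 ∧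
    flatten (act [false] x) = 1 - flatten x := by
  have hD := tri_subset hx
  have h := (mem_tri_iff hD).1 hx
  have h2 : co x 2 = 0 := by simp [co, hi]
  obtain ⟨e0, e1, e2⟩ := co_rows (w := [false]) hD ![0, 1, ⟨0, 1⟩] ![1, 0, ⟨0, 1⟩] ![0, 0, -1] (by decide +kernel)
  simp [row_vec, toR_apply, h2] at e0 e1 e2
  have hm : act [false] x ∈ tri := (mem_tri_iff (act_mem _ hD)).2 fun i => by
    fin_cases i
    exacts [e0 ▸ h 1, e1 ▸ h 0, e2.ge]
  have him : (act [false] x).im = 0 := by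
    have h0 := (one_sub_pos (act_mem [false] hD)).ne'; have hp := rad_pos.ne'
    simpa [co, h0, hp] using e2
  refine ⟨hm, him, ?_⟩
  have h3 := flatten_spec.2.2.1 x hx
  have h4 := flatten_spec.2.2.2.1 _ hm
  rw [conj_eq_iff_im.2 him] at h4
  have h5 : omega * (1 - flatten x) = omega * conj (flatten (act [false] x)) := by rw [← h4]; exact h3.symm
  have h6 := mul_left_cancel₀ (exp_ne_zero _) h5
  rw [conj_eq_iff_im.2 ((flatten_spec.2.2.2.2.2.1 _ hm).2 him)] at h6
  exact h6.symm

def cellMap (l : Flag) (ξ : ℂ) : Y := cl (frameIndex l / 12 : ℕ) (act (frameWord (frameIndex l)) (unflatten ξ))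

lemma cellMap_cyc (k : Flag) {ξ : ℂ} (hξ : ξ ∈ flatTri) : cellMap (cyc k) ξ = cellMap k (spin ξ) := by
  have h := frameIndex_cyc k
  have hx := unflatten_mem hξ
  have e : unflatten (spin ξ) = tspin (unflatten ξ) := by
    rw [← unflatten_eq (tspin_mem hx), flatten_tspin hx, flatten_unflatten hξ]
  rw [cellMap, cellMap, act_frameWord, act_frameWord, e, ← iterate_succ_apply]
  generalize hm : frameIndex (cyc k) = m at *
  generalize frameIndex k = n at *
  have h1 : (m : ℕ) / 12 = n / 12 := by omega
  have h2 : (⟨m / 3 % 4, by omega⟩ : Fin 4) = ⟨n / 3 % 4, by omega⟩ := Fin.ext (by simp only; omega)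
  have h3 : tspin^[m % 3] (unflatten ξ) = tspin^[n % 3 + 1] (unflatten ξ) := by
    by_cases hn : (n : ℕ) % 3 = 2
    · rw [hn, show (m : ℕ) % 3 = 0 by omega]; exact (tspin_tspin_tspin (tri_subset hx)).symm
    · rw [show (m : ℕ) % 3 = n % 3 + 1 by omega]
  rw [h1, h2, h3]

lemma cellMap_flip (k : Flag) {t : ℝ} (ht : (t : ℂ) ∈ flatTri) : cellMap (flip k) t = cellMap k (1 - t) := by
  have hx := unflatten_mem ht
  have hi : (unflatten t).im = 0 := (flatten_spec.2.2.2.2.2.1 _ hx).1 (by rw [flatten_unflatten ht, ofReal_im])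
  obtain ⟨hm, him, hf⟩ := gen_false_mem hx hi
  rw [flatten_unflatten ht] at hf
  have hD := tri_subset hx
  rw [cellMap, cellMap, ← hf, unflatten_eq hm, ← act_append]
  have h1 := fun h : EdgeInside (frameIndex k) => edgeInside_mem h hm him
  have h2 := fun h : EdgeInside (frameIndex (flip k)) => edgeInside_mem h hx hi
  rw [← act_append] at h1
  rcases glued_flip k with ⟨h, hj | he⟩ | ⟨he, h⟩ | ⟨he, h⟩
  · rw [act_eq_of_mat_eq h hD, hj]
  · have h1 := h1 he; rw [act_eq_of_mat_eq h hD] at h1 ⊢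
    rw [cl_eq (p := ⟨_, h1⟩) (Or.inl rfl), cl_eq (p := ⟨_, h1⟩) (Or.inl rfl)]
  · have h1 := h1 he; have e := act_eq_of_mat_eq h hD
    rw [act_append (tauWord _), ← sidePairing_eq] at e
    rw [cl_eq (p := ⟨_, h1⟩) (Or.inl rfl), cl_eq (p := ⟨_, h1⟩) (Or.inr e)]
  · have h2 := h2 he; have e := act_eq_of_mat_eq h hD
    rw [act_append (tauWord _), ← sidePairing_eq] at e
    rw [cl_eq (p := ⟨_, h2⟩) (Or.inl rfl), cl_eq (p := ⟨_, h2⟩) (Or.inr e.symm)]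

lemma cellMap_eq {k l : Flag} {ξ η : ℂ} (hξ : ξ ∈ flatTri) (hη : η ∈ flatTri) (h : XA k ξ = XA l η) : cellMap k ξ = cellMap l η :=
  eq_of_XA_eq (fun k _ hξ => cellMap_cyc k hξ) (fun k _ hx => cellMap_flip k hx) hξ hη h

/-! ### The map from the polygon to `X` -/

lemma lab_tauWord (j : ℕ) : lab (tauWord j) = 0 := by
  have h : ∀ j : Fin 8, lab (tauWord j) = 0 := by decide +kernel
  rw [← h ⟨j % 8, by omega⟩]
  refine lab_eq_of_mat_eq (mat_eq_of_act_eq fun z _ => ?_)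
  rw [act_tauWord, act_tauWord, zeta_pow_mod, zeta_pow_mod (7 * j), zeta_pow_mod (7 * _), show 7 * j % 8 = 7 * (j % 8) % 8 by omega]

lemma dev_sidePairing (j : ℕ) (w : Word) {x : ℂ} (hx : x ∈ tri) : dev (sidePairing j (act w x)) = dev (act w x) := by
  rw [sidePairing_eq, ← act_append, dev_act _ hx, dev_act _ hx, face, face, lab_append, lab_tauWord]
  rfl

lemma exists_tile_of_mem_polygon {z : ℂ} (hz : z ∈ polygon) : ∃ w, ∃ x ∈ tri, z = act w x := by
  obtain ⟨n, x, hx, h⟩ := exists_frame_of_mem_polygon ⟨z, hz⟩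
  rcases h with h | h
  · exact ⟨_, x, hx, h⟩
  · exact ⟨_, x, hx, by rw [act_append, ← sidePairing_eq]; exact h⟩

lemma dev_represents {j : ℕ} {z : ℂ} {p : polygon} (hz : z ∈ Disk) (h : Represents j z p) : dev p = dev z := by
  obtain ⟨w, x, hx, e⟩ := exists_tile_of_mem_polygon p.2
  rcases h with h | h
  · rw [h]
  · obtain ⟨w', hw'⟩ := exists_inverse (tauWord j)
    have e2 : z = act (w' ++ w) x := by rw [act_append, ← e, h, sidePairing_eq, hw' z hz]
    rw [h, e2, dev_sidePairing j _ hx]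

lemma dev_eq_of_proj {p q : polygon} (h : projY p = projY q) : dev p = dev q := by
  have h2 := Quotient.exact h
  change Relation.EqvGen _ p q at h2
  induction h2 with
  | rel p q hr => exact (dev_represents (polygon_subset p.2) (Or.inr hr.choose_spec.2)).symm
  | refl p => rfl
  | symm p q _ ih => exact (ih (Quotient.sound ‹_›)).symm
  | trans p q r _ _ ih1 ih2 => exact (ih1 (Quotient.sound ‹_›)).trans (ih2 (Quotient.sound ‹_›))

lemma projY_eq_cellMap (p : polygon) : ∃ l, ∃ ξ ∈ flatTri, projY p = cellMap l ξ ∧ dev p = XA l ξ := by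
  obtain ⟨n, x, hx, h⟩ := exists_frame_of_mem_polygon p
  refine ⟨lab (frameWord n), flatten x, flatten_mem hx, ?_, ?_⟩
  · rw [cellMap, unflatten_eq hx, frameIndex_lab, cl_eq h]
  · rw [dev_represents (act_mem _ (tri_subset hx)) h, dev_act _ hx, face]

lemma proj_eq_of_dev {p q : polygon} (h : dev p = dev q) : projY p = projY q := by
  obtain ⟨k, ξ, hξ, h1, h2⟩ := projY_eq_cellMap p
  obtain ⟨l, η, hη, h3, h4⟩ := projY_eq_cellMap q
  rw [h1, h3]
  exact cellMap_eq hξ hη (by rw [← h2, ← h4, h])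

lemma exists_dev_eq (y : X) : ∃ p : polygon, dev p = y := by
  obtain ⟨l, ξ, hξ, rfl⟩ := exists_XA_eq y
  have hx := unflatten_mem hξ
  obtain ⟨p, hp⟩ := exists_represents (act_frameWord_mem (frameIndex l) hx)
  refine ⟨p, ?_⟩
  rw [dev_represents (act_mem _ (tri_subset hx)) hp, dev_act _ hx, face, lab_frameIndex, flatten_unflatten hξ]

/-! ### The developing map in conformal coordinates -/

open TriangleMap.Shape (reflectExt up_of_nonneg up_of_nonpos up_mem_T isOpen_kite mem_kite_iff)

lemma mem_tri_of_kite {y : ℂ} (hy : y ∈ hypShape.kite) : (0 ≤ y.im → y ∈ tri) ∧ (y.im ≤ 0 → conj y ∈ tri) := by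
  have h := up_mem_T hy
  exact ⟨fun hi => by rwa [up_of_nonneg hi] at h, fun hi => by rwa [up_of_nonpos hi] at h⟩

lemma im_flatten_nonneg {x : ℂ} (hx : x ∈ tri) : 0 ≤ (flatten x).im := by
  have h : flatten x ∈ flatShape.T := by rw [flat_T]; exact flatten_mem hx
  exact h.1

lemma kite_subset_Disk : hypShape.kite ⊆ Disk := by
  intro y hy
  rcases le_total 0 y.im with hi | hi
  · exact tri_subset ((mem_tri_of_kite hy).1 hi)
  · have := tri_subset ((mem_tri_of_kite hy).2 hi)
    rwa [mem_Disk_iff, norm_conj, ← mem_Disk_iff] at this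

/-- On the kite around an edge, the developing map is a flat parametrization. -/
lemma dev_kite (w : Word) {y : ℂ} (hy : y ∈ hypShape.kite) : dev (act w y) = flatMap (lab w) (reflectExt flatten y) := by
  obtain ⟨h1, h2⟩ := mem_tri_of_kite hy
  by_cases hi : 0 ≤ y.im
  · have hx := h1 hi
    rw [dev_act w hx, face, flatMap, reflectExt, if_pos hi, if_pos (im_flatten_nonneg hx)]
  · have hx := h2 (not_le.1 hi).le; have hD := tri_subset hx; have hyD := kite_subset_Disk hy
    have e : act [false] y = zeta * conj (tspin (conj y)) := by
      change halfTurn (v 0) y = zeta * conj (zeta * halfTurn (v 0) (conj y))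
      rw [map_mul, ← mul_assoc, zeta_mul_conj, one_mul, halfTurn, halfTurn, v_zero]; simp
    have hm : act [false] y ∈ tri := by rw [e, ← hyp_κ]; exact hypShape.σ_mem_T (tspin_mem hx)
    have hf : flatten (act [false] y) = 1 - conj (flatten (conj y)) := by
      rw [e, flatten_spec.2.2.2.1 _ (tspin_mem hx), flatten_tspin hx, spin, map_mul, ← mul_assoc, ← flat_κ,
        flatShape.κ_mul_conj, one_mul, map_sub, map_one]
    have hn : ¬ 0 ≤ (conj (flatten (conj y))).im := by
      have h3 := im_flatten_nonneg hx
      have h4 := mt (flatten_spec.2.2.2.2.2.1 _ hx).1 (by rw [conj_im]; intro h; exact hi (by linarith))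
      rw [conj_im, not_le]; exact neg_lt_zero.2 (lt_of_le_of_ne h3 (Ne.symm h4))
    have e2 : act w y = act (w ++ [false]) (act [false] y) := by
      rw [act_append, ← act_append [false]]; exact congrArg _ (act_SS hyD).symm
    rw [e2, dev_act _ hm, face, lab_S, hf, flatMap, reflectExt, if_neg hi, if_neg hn]

lemma co_tspin {x : ℂ} (hx : x ∈ Disk) : co (tspin x) 0 = co x 1 ∧ co (tspin x) 1 = co x 2 ∧ co (tspin x) 2 = co x 0 := by
  obtain ⟨e0, e1, e2⟩ := co_rows (w := [true, false]) hx ![0, 1, 0] ![0, 0, 1] ![1, 0, 0] (by decide +kernel)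
  simp only [row_vec, map_zero, map_one, zero_mul, one_mul, zero_add, add_zero] at e0 e1 e2
  exact ⟨e0, e1, e2⟩

lemma co_two_eq_zero_iff {x : ℂ} (hx : x ∈ Disk) : co x 2 = 0 ↔ x.im = 0 := by
  have h0 := (one_sub_pos hx).ne'
  have hp := rad_pos.ne'
  simp [co, h0, hp]

lemma mem_kite_of_co {x : ℂ} (hx : x ∈ tri) (h0 : co x 0 ≠ 0) (h1 : co x 1 ≠ 0) : x ∈ hypShape.kite := by
  have hD := tri_subset hx
  have hD' := act_mem [true, false] hD
  have hk := hyp_k_normSq hD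
  rw [mem_kite_iff hx, ← hypShape.ρ_ρ hk, ← tspin_eq, ← tspin_eq]
  have e : co (tspin x) 2 = _ := (co_tspin hD).2.2
  have e' : co (tspin (tspin x)) 2 = _ := (co_tspin hD').2.2
  refine ⟨fun h => h0 ?_, fun h => h1 ?_⟩
  · rw [← e]; exact (co_two_eq_zero_iff hD').2 h
  · rw [← (co_tspin hD).1]; exact e'.symm.trans ((co_two_eq_zero_iff (act_mem _ hD')).2 h)

lemma act_tspin (w : Word) {x : ℂ} (hx : x ∈ Disk) : act (w ++ [true, false, true, false]) (tspin x) = act w x := by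
  rw [show [true, false, true, false] = [true, false] ++ [true, false] from rfl, act_append, act_append [true, false]]
  have h := tspin_tspin_tspin hx
  unfold tspin at h ⊢
  rw [h]

/-- Every point of a tile which is not a vertex lies in the kite around an edge. -/
lemma exists_kite (w : Word) {x : ℂ} (hx : x ∈ tri) (hb : ∀ i, x ≠ base i) : ∃ w', ∃ y ∈ hypShape.kite, act w' y = act w x := by
  have hD := tri_subset hx
  have hx' := tspin_mem hx
  have hD' := tri_subset hx'
  obtain ⟨a0, a1, a2⟩ := co_tspin hD
  obtain ⟨b0, b1, b2⟩ := co_tspin hD'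
  have hne : ∀ i, (∀ m, m ≠ i → co x m = 0) → False := by
    intro i hz; refine hb i (co_injOn hD (base_mem_Disk i) ?_); have h3 := bil_co_self hD
    have h4 := (mem_tri_iff hD).1 hx; have h6 : co x i * co x i = 1 := by
      rw [bil] at h3
      fin_cases i
      · change co x 0 * co x 0 = 1
        rw [hz 1 (by decide), hz 2 (by decide)] at h3; linear_combination h3
      · change co x 1 * co x 1 = 1
        rw [hz 0 (by decide), hz 2 (by decide)] at h3; linear_combination h3
      · change co x 2 * co x 2 = 1
        rw [hz 0 (by decide), hz 1 (by decide)] at h3; linear_combination h3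
    have h5 : co x i = 1 := by nlinarith [h4 i]
    ext m; rw [co_base]
    split_ifs with hm
    · rw [hm, h5]
    · exact hz m hm
  by_cases h0 : co x 0 = 0
  · have h1 : co x 1 ≠ 0 := fun h => hne 2 fun m hm => by fin_cases m <;> first | assumption | exact absurd rfl hm
    have h2 : co x 2 ≠ 0 := fun h => hne 1 fun m hm => by fin_cases m <;> first | assumption | exact absurd rfl hm
    exact ⟨_, _, mem_kite_of_co hx' (by rw [a0]; exact h1) (by rw [a1]; exact h2), act_tspin w hD⟩
  by_cases h1 : co x 1 = 0
  · have h2 : co x 2 ≠ 0 := fun h => hne 0 fun m hm => by fin_cases m <;> first | assumption | exact absurd rfl hm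
    exact ⟨_, _, mem_kite_of_co (tspin_mem hx') (by rw [b0, a1]; exact h2) (by rw [b1, a2]; exact h0), (act_tspin _ hD').trans (act_tspin w hD)⟩
  · exact ⟨_, _, mem_kite_of_co hx h0 h1, rfl⟩

lemma exists_inverse' (w : Word) : ∃ w', (∀ z ∈ Disk, act w' (act w z) = z) ∧ ∀ z ∈ Disk, act w (act w' z) = z := by
  obtain ⟨w', h⟩ := exists_inverse w
  obtain ⟨w'', h'⟩ := exists_inverse w'
  refine ⟨w', h, fun z hz => ?_⟩
  have h1 := h' (act w (act w' z)) (act_mem _ (act_mem _ hz))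
  rw [h _ (act_mem _ hz), h' z hz] at h1
  exact h1.symm

lemma differentiableAt_act (w : Word) {z : ℂ} (hz : z ∈ Disk) : DifferentiableAt ℂ (act w) z :=
  (isMob_act w).differentiableOn.differentiableAt (isOpen_Disk.mem_nhds hz)

/-- Near a point of a kite, the developing map is a flat parametrization in a conformal coordinate. -/
lemma exists_local_form (w : Word) {y : ℂ} (hy : y ∈ hypShape.kite) : ∃ g : ℂ → ℂ, DifferentiableAt ℂ g (act w y) ∧
    g (act w y) ∈ rhombus ∧ (fun z => dev z) =ᶠ[𝓝 (act w y)] fun z => flatMap (lab w) (g z) := by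
  obtain ⟨w', h1, h2⟩ := exists_inverse' w
  obtain ⟨-, -, -, -, -, -, -, hb, hd⟩ := flatten_spec
  have hyD := kite_subset_Disk hy
  have hD := act_mem w hyD
  have hy' : act w' (act w y) ∈ hypShape.kite := by rwa [h1 y hyD]
  have hg := differentiableAt_act w' hD
  refine ⟨fun z => reflectExt flatten (act w' z), ?_, hb.mapsTo hy', ?_⟩
  · exact DifferentiableAt.comp (act w y) (hd.differentiableAt ((isOpen_kite hypShape).mem_nhds hy')) hg
  · filter_upwards [hg.continuousAt.preimage_mem_nhds ((isOpen_kite hypShape).mem_nhds hy'), isOpen_Disk.mem_nhds hD] with z hz hzD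
    rw [← dev_kite w hz, h2 z hzD]

/-- A neighbourhood of a vertex is covered by eight tiles. -/
lemma eventually_zero_sector : ∀ᶠ z in 𝓝 (0 : ℂ), ∃ (j : Fin 8) (q : ℂ), z = zeta ^ (j : ℕ) * q ∧ q ∈ tri ∧ ‖q‖ < rad := by
  have hc : ContinuousAt (fun z => co z 0) 0 := (continuousOn_co 0).continuousAt (isOpen_Disk.mem_nhds zero_mem_Disk)
  have h1 : ∀ᶠ z in 𝓝 (0 : ℂ), 0 < co z 0 := hc.eventually (lt_mem_nhds (by simp [co_zero]))
  obtain ⟨ε, hε, h2⟩ := Metric.eventually_nhds_iff.1 (h1.and (isOpen_Disk.mem_nhds zero_mem_Disk))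
  filter_upwards [Metric.ball_mem_nhds (0 : ℂ) hε, Metric.ball_mem_nhds (0 : ℂ) rad_pos] with z hz hz'
  obtain ⟨j, q, rfl, him, hre⟩ := exists_sector z
  have hn : ‖zeta ^ (j : ℕ) * q‖ = ‖q‖ := by
    have : ‖zeta‖ = 1 := by rw [zeta, ← ofReal_ofNat, ← ofReal_div, norm_exp_ofReal_mul_I]
    rw [norm_mul, norm_pow, this, one_pow, one_mul]
  rw [mem_ball_zero_iff, hn] at hz hz'
  obtain ⟨h3, h4⟩ := h2 (y := q) (by rwa [dist_zero_right])
  refine ⟨j, q, rfl, (mem_tri_iff h4).2 fun i => ?_, hz'⟩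
  fin_cases i
  exacts [h3.le, (co_one_nonneg_iff h4).2 hre, (co_two_nonneg_iff h4).2 him]

lemma continuousAt_dev_zero (w : Word) : ContinuousAt (fun z => dev (act w z)) 0 := by
  have h0 : (0 : ℂ) ∈ tri := (mem_tri_iff zero_mem_Disk).2 fun i => by rw [co_zero]; fin_cases i <;> simp
  have key : ∀ (w : Word), Filter.Tendsto (fun q => dev (act w q)) (𝓝[tri] 0) (𝓝 (dev (act w 0))) := fun w => by
    have hc : ContinuousOn (fun q => face w q) tri := (continuousOn_XA _).comp flatten_spec.1 fun x hx => flatten_mem hx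
    have := hc 0 h0; rw [ContinuousWithinAt, ← dev_act w h0] at this
    exact this.congr' (by filter_upwards [self_mem_nhdsWithin] with q hq using (dev_act w hq).symm)
  intro V hV
  have hj : ∀ j : Fin 8, ∀ᶠ z in 𝓝 (0 : ℂ), zeta ^ (7 * (j : ℕ)) * z ∈ tri → dev (act (w ++ rr j) (zeta ^ (7 * (j : ℕ)) * z)) ∈ V := by
    intro j; have e : act (w ++ rr j) 0 = act w 0 := by rw [act_append, act_rr, mul_zero]
    have h1 := eventually_nhdsWithin_iff.1 ((key (w ++ rr j)).eventually (by rw [e]; exact hV))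
    have hm : Filter.Tendsto (fun z : ℂ => zeta ^ (7 * (j : ℕ)) * z) (𝓝 0) (𝓝 0) := by
      have : Continuous fun z : ℂ => zeta ^ (7 * (j : ℕ)) * z := by fun_prop
      simpa using this.tendsto 0
    exact hm.eventually h1
  rw [Filter.mem_map]
  filter_upwards [Filter.eventually_all.2 hj, eventually_zero_sector] with z hz ⟨j, q, e, hq, _⟩
  have h1 := hz j
  rw [e, zeta_cancel'] at h1
  have h2 := h1 hq
  rw [act_append, act_rr, ← e] at h2
  exact h2

lemma continuousAt_dev (w : Word) {x : ℂ} (hx : x ∈ tri) : ContinuousAt dev (act w x) := by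
  by_cases hb : ∀ i, x ≠ base i
  · obtain ⟨w', y, hy, e⟩ := exists_kite w hx hb; obtain ⟨g, h1, h2, h3⟩ := exists_local_form w' hy
    rw [← e]; refine ContinuousAt.congr ?_ h3.symm; have hr : IsOpen rhombus := isOpen_interior
    exact ContinuousAt.comp (f := g) ((continuousOn_flatMap _).continuousAt (hr.mem_nhds h2)) h1.continuousAt
  · push Not at hb
    obtain ⟨i, rfl⟩ := hb; obtain ⟨w', h1, h2⟩ := exists_inverse' (w ++ baseWord i)
    have hD := act_mem w (base_mem_Disk i); have e : act w' (act w (base i)) = 0 := by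
      rw [← act_baseWord, ← act_append w, h1 0 zero_mem_Disk]
    have hc := continuousAt_dev_zero (w ++ baseWord i); rw [← e] at hc
    refine ContinuousAt.congr (ContinuousAt.comp hc (differentiableAt_act w' hD).continuousAt) ?_
    filter_upwards [isOpen_Disk.mem_nhds hD] with z hz; exact congrArg dev (h2 z hz)

/-- A holomorphic chart of `X` is holomorphic in the disk. -/
lemma differentiableAt_chart {e : OpenPartialHomeomorph X ℂ} (he : e ∈ holomorphicCharts flatParams) (w : Word) {x : ℂ}
    (hx : x ∈ tri) (hs : dev (act w x) ∈ e.source) : DifferentiableAt ℂ (fun z => e (dev z)) (act w x) := by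
  have hr : IsOpen rhombus := isOpen_interior
  have key : ∀ (w : Word) {x : ℂ}, x ∈ tri → (∀ i, x ≠ base i) → dev (act w x) ∈ e.source →
      DifferentiableAt ℂ (fun z => e (dev z)) (act w x) := by
    intro w x hx hb hs; obtain ⟨w', y, hy, h⟩ := exists_kite w hx hb; rw [← h] at hs ⊢
    obtain ⟨g, h1, h2, h3⟩ := exists_local_form w' hy
    have hd := he _ (flatMap_mem_flatParams (lab w'))
    have ho : IsOpen (rhombus ∩ flatMap (lab w') ⁻¹' e.source) := (continuousOn_flatMap _).isOpen_inter_preimage hr e.open_source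
    have h4 : flatMap (lab w') (g (act w' y)) ∈ e.source := by rw [← h3.eq_of_nhds]; exact hs
    refine DifferentiableAt.congr_of_eventuallyEq ?_ (h3.mono fun z hz => congrArg e hz)
    exact DifferentiableAt.comp (g := fun z => e (flatMap (lab w') z)) (act w' y) (hd.differentiableAt (ho.mem_nhds ⟨h2, h4⟩)) h1
  by_cases hb : ∀ i, x ≠ base i
  · exact key w hx hb hs
  push Not at hb
  obtain ⟨i, rfl⟩ := hb
  have hD := act_mem w (base_mem_Disk i)
  have hc := continuousAt_dev w hx
  have hE : ContinuousAt (fun z => e (dev z)) (act w (base i)) := ContinuousAt.comp (e.continuousAt hs) hc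
  refine (analyticAt_of_differentiable_on_punctured_nhds_of_continuousAt ?_ hE).differentiableAt
  obtain ⟨w', h1, h2⟩ := exists_inverse' (w ++ baseWord i)
  have e0 : act w' (act w (base i)) = 0 := by rw [← act_baseWord, ← act_append w, h1 0 zero_mem_Disk]
  have h3 := (differentiableAt_act w' hD).continuousAt.tendsto
  rw [e0] at h3
  filter_upwards [nhdsWithin_le_nhds (h3.eventually eventually_zero_sector), nhdsWithin_le_nhds (isOpen_Disk.mem_nhds hD),
    nhdsWithin_le_nhds (hc.preimage_mem_nhds (e.open_source.mem_nhds hs)), self_mem_nhdsWithin] with z ⟨j, q, h4, hq, hn⟩ hz hzs hne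
  have h5 : act (w ++ baseWord i ++ rr j) q = z := by rw [act_append, act_rr, ← h4, h2 z hz]
  rw [← h5] at hzs ⊢
  refine key _ hq (fun k hk => ?_) hzs
  have hv : ∀ k, k ≠ 0 → ‖base k‖ = rad := by
    have hz1 : ‖zeta‖ = 1 := by rw [zeta, ← ofReal_ofNat, ← ofReal_div, norm_exp_ofReal_mul_I]
    have h0 : ‖v 0‖ = rad := by rw [v_zero, norm_real, Real.norm_of_nonneg rad_pos.le]
    intro k hk
    fin_cases k
    · exact absurd rfl hk
    · exact h0
    · change ‖v 1‖ = rad; rw [v_one, gen, norm_mul, hz1, h0, one_mul]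
  by_cases hk0 : k = 0
  · rw [hk, hk0] at h5; refine hne ?_; rw [mem_singleton_iff, ← h5]
    change act (w ++ baseWord i ++ rr j) 0 = _
    rw [act_append, act_rr, mul_zero, act_append, act_baseWord]
  · rw [hk, hv k hk0] at hn; exact lt_irrefl _ hn

/-! ### The homeomorphism -/

lemma exists_tile_of_mem_doublePolygon {j : ℕ} {z : ℂ} (h : z ∈ doublePolygon j) : ∃ w, ∃ x ∈ tri, z = act w x := by
  rcases h with h | ⟨h, h'⟩
  · exact exists_tile_of_mem_polygon h
  · obtain ⟨w, x, hx, e⟩ := exists_tile_of_mem_polygon h'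
    obtain ⟨w', hw'⟩ := exists_inverse (tauWord j)
    exact ⟨w' ++ w, x, hx, by rw [act_append, ← e, sidePairing_eq, hw' z (mem_Disk_iff.2 h)]⟩

lemma doublePolygon_subset (j : ℕ) : doublePolygon j ⊆ Disk := fun _ h =>
  h.elim (fun h => polygon_subset h) fun h => mem_Disk_iff.2 h.1

instance : CompactSpace polygon := isCompact_iff_compactSpace.1 <|
  (isCompact_closedBall (0 : ℂ) 1).of_isClosed_subset isClosed_polygon fun z hz => by
    rw [mem_closedBall_zero_iff]; exact (mem_Disk_iff.1 (polygon_subset hz)).le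

def surfaceEquiv : Y ≃ X :=
  Equiv.ofBijective (Quotient.lift (fun p : polygon => dev p) fun _ _ h => dev_eq_of_proj (Quotient.sound h)) <| by
    constructor
    · intro a b
      induction a using Quotient.inductionOn
      induction b using Quotient.inductionOn
      exact proj_eq_of_dev
    · exact fun y => (exists_dev_eq y).imp' projY fun p hp => hp

lemma continuous_surfaceEquiv : Continuous surfaceEquiv := by
  refine Continuous.quotient_lift ?_ _
  have h : ContinuousOn dev polygon := fun z hz => by
    obtain ⟨w, x, hx, rfl⟩ := exists_tile_of_mem_polygon hz
    exact (continuousAt_dev w hx).continuousWithinAt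
  exact continuousOn_iff_continuous_domRestrict.1 h

def surfaceHomeo : Y ≃ₜ X := continuous_surfaceEquiv.homeoOfEquivCompactToT2

lemma surfaceHomeo_projY (p : polygon) : surfaceHomeo (projY p) = dev p := rfl

lemma surfaceHomeo_represents {j : ℕ} {z : ℂ} {p : polygon} (hz : z ∈ Disk) (h : Represents j z p) : surfaceHomeo (projY p) = dev z := by
  rw [surfaceHomeo_projY, dev_represents hz h]

lemma surfaceHomeo_imageY {j : ℕ} {A : Set ℂ} (hA : A ⊆ doublePolygon j) : surfaceHomeo '' imageY j A = dev '' A := by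
  ext y
  constructor
  · rintro ⟨_, ⟨z, hz, p, hp, rfl⟩, rfl⟩
    exact ⟨z, hz, (surfaceHomeo_represents (doublePolygon_subset j (hA hz)) hp).symm⟩
  · rintro ⟨z, hz, rfl⟩; obtain ⟨p, hp⟩ := exists_represents (hA hz)
    exact ⟨_, ⟨z, hz, p, hp, rfl⟩, surfaceHomeo_represents (doublePolygon_subset j (hA hz)) hp⟩

lemma isTile_iff {a b c : ℂ} : IsTile a b c ↔ ∃ w, a = act w 0 ∧ b = act w (v 0) ∧ c = act w (v 1) := by
  constructor
  · intro h
    induction h with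
    | base => exact ⟨[], rfl, rfl, rfl⟩
    | rotate _ ih => obtain ⟨w, rfl, rfl, rfl⟩ := ih; exact ⟨true :: w, rfl, rfl, rfl⟩
    | turn _ ih => obtain ⟨w, rfl, rfl, rfl⟩ := ih; exact ⟨false :: w, rfl, rfl, rfl⟩
  · rintro ⟨w, rfl, rfl, rfl⟩
    induction w with
    | nil => exact IsTile.base
    | cons b w ih =>
      cases b
      · exact ih.turn
      · exact ih.rotate

lemma dev_image_tile (w : Word) : dev '' (act w '' tri) = XA (lab w) '' flatTri := by
  rw [← flatten_spec.2.1.image_eq, image_image, image_image]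
  exact image_congr fun x hx => dev_act w hx

lemma dev_image_edge (w : Word) : dev '' (act w '' (tri ∩ {x | x.im = 0})) = XA (lab w) '' flatEdge := by
  have e : flatten '' (tri ∩ {x | x.im = 0}) = flatEdge := by
    ext ξ; constructor
    · rintro ⟨x, ⟨hx, hi⟩, rfl⟩
      have h : ((flatten x).re : ℂ) = flatten x := Complex.ext (ofReal_re _) (((flatten_spec.2.2.2.2.2.1 x hx).2 hi).symm ▸ ofReal_im _)
      exact ⟨(flatten x).re, ofReal_mem_flat.1 (h.symm ▸ flatten_mem hx), h⟩
    · rintro ⟨t, ht, rfl⟩; have h := ofReal_mem_flat.2 ht; have hf := flatten_unflatten h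
      exact ⟨_, ⟨unflatten_mem h, (flatten_spec.2.2.2.2.2.1 _ (unflatten_mem h)).1 (by rw [hf, ofReal_im])⟩, hf⟩
  rw [← e, image_image, image_image]
  exact image_congr fun x hx => dev_act w hx.1

lemma tile_subset_doublePolygon (n : Fin 96) : act (frameWord n) '' tri ⊆ doublePolygon (n / 12 : ℕ) := by
  rintro _ ⟨x, hx, rfl⟩
  exact act_frameWord_mem n hx

lemma surfaceHomeo_faces : (Set.image surfaceHomeo) '' facesY = facesX := by
  rw [facesX_eq]
  ext F
  constructor
  · rintro ⟨_, ⟨j, a, b, c, h, hs, rfl⟩, rfl⟩; obtain ⟨w, rfl, rfl, rfl⟩ := isTile_iff.1 h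
    exact ⟨lab w, by rw [surfaceHomeo_imageY hs, hypHull_tile, dev_image_tile]⟩
  · rintro ⟨l, rfl⟩; have hs := tile_subset_doublePolygon (frameIndex l); rw [← hypHull_tile] at hs
    exact ⟨_, ⟨_, _, _, _, isTile_iff.2 ⟨_, rfl, rfl, rfl⟩, hs, rfl⟩, by
      rw [surfaceHomeo_imageY hs, hypHull_tile, dev_image_tile, lab_frameIndex]⟩

lemma surfaceHomeo_edges : (Set.image surfaceHomeo) '' edgesY = edgesX := by
  rw [edgesX_eq]
  ext F
  constructor
  · rintro ⟨_, ⟨j, a, b, c, h, hs, rfl⟩, rfl⟩; obtain ⟨w, rfl, rfl, rfl⟩ := isTile_iff.1 h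
    exact ⟨lab w, by rw [surfaceHomeo_imageY hs, hypSegment_tile, dev_image_edge]⟩
  · rintro ⟨l, rfl⟩
    have hs := (image_mono (inter_subset_left (t := {x | x.im = 0}))).trans (tile_subset_doublePolygon (frameIndex l))
    rw [← hypSegment_tile] at hs
    exact ⟨_, ⟨_, _, _, _, isTile_iff.2 ⟨_, rfl, rfl, rfl⟩, hs, rfl⟩, by
      rw [surfaceHomeo_imageY hs, hypSegment_tile, dev_image_edge, lab_frameIndex]⟩

lemma zero_mem_tri : (0 : ℂ) ∈ tri := (mem_tri_iff zero_mem_Disk).2 fun i => by rw [co_zero]; fin_cases i <;> simp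

lemma dev_vertex (w : Word) : dev (act w 0) = XA (lab w) 0 := by
  rw [dev_act w zero_mem_tri, face, flatten_spec.2.2.2.2.1]

lemma surfaceHomeo_vertices : surfaceHomeo '' verticesY = verticesX := by
  rw [verticesX_eq]
  ext y
  constructor
  · rintro ⟨_, ⟨p, b, c, h, rfl⟩, rfl⟩; obtain ⟨w, hp, rfl, rfl⟩ := isTile_iff.1 h
    exact ⟨lab w, by rw [surfaceHomeo_projY, hp, dev_vertex]⟩
  · rintro ⟨l, rfl⟩
    obtain ⟨p, hp⟩ := exists_represents (act_frameWord_mem (frameIndex l) zero_mem_tri)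
    have ht : ∃ w, (p : ℂ) = act w 0 := by
      rcases hp with h | h
      · exact ⟨_, h⟩
      · exact ⟨tauWord _ ++ _, by rw [h, sidePairing_eq, ← act_append]⟩
    obtain ⟨w, hw⟩ := ht; refine ⟨projY p, ⟨p, _, _, isTile_iff.2 ⟨w, hw, rfl, rfl⟩, rfl⟩, ?_⟩
    rw [surfaceHomeo_represents (act_mem _ zero_mem_Disk) hp, dev_vertex, lab_frameIndex]

lemma ncard_facesY : facesY.ncard = 32 := by
  rw [← ncard_facesX, ← surfaceHomeo_faces, ncard_image_of_injective _ (image_injective.2 surfaceHomeo.injective)]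

/-! ### Conformality -/

lemma cl_mem_hypParams (j : ℕ) : (interior (doublePolygon j), cl j) ∈ hypParams :=
  ⟨j, rfl, fun _ hz => (exists_represents (interior_subset hz)).imp fun _ hp => ⟨hp, cl_eq hp⟩⟩

lemma surfaceHomeo_cl {j : ℕ} {z : ℂ} (hz : z ∈ doublePolygon j) : surfaceHomeo (cl j z) = dev z := by
  obtain ⟨p, hp⟩ := exists_represents hz
  rw [cl_eq hp, surfaceHomeo_represents (doublePolygon_subset j hz) hp]

lemma chart_of_chart {e : OpenPartialHomeomorph X ℂ} (he : e ∈ holomorphicCharts flatParams) :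
    surfaceHomeo.toOpenPartialHomeomorph.trans e ∈ holomorphicCharts hypParams := by
  rintro ⟨U, φ⟩ ⟨j, rfl, hφ⟩ z ⟨hz, hs⟩
  have key : ∀ z ∈ interior (doublePolygon j), surfaceHomeo (φ z) = dev z := fun z hz => by
    obtain ⟨p, hp, h⟩ := hφ z hz; change φ z = _ at h
    rw [h, surfaceHomeo_represents (doublePolygon_subset j (interior_subset hz)) hp]
  have hs' : dev z ∈ e.source := by rw [← key z hz]; exact hs.2
  obtain ⟨w, x, hx, e1⟩ := exists_tile_of_mem_doublePolygon (interior_subset hz)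
  have hd := differentiableAt_chart he w hx (e1 ▸ hs')
  rw [← e1] at hd
  refine (hd.congr_of_eventuallyEq ?_).differentiableWithinAt
  filter_upwards [isOpen_interior.mem_nhds hz] with y hy
  exact congrArg e (key y hy)

/-- The upper half of the rhombus is mapped holomorphically to the disk. -/
lemma unflatten_upper {z : ℂ} (hz : z ∈ rhombus) (hi : 0 < z.im) : DifferentiableAt ℂ unflatten z ∧
    unflatten z ∈ hypShape.kite ∩ {y | 0 < y.im} := by
  obtain ⟨-, -, -, -, -, him, -, hb, hd⟩ := flatten_spec
  obtain ⟨h1, h2, -⟩ := injOn_holomorphic (isOpen_kite hypShape) hd hb.injOn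
  rw [hb.image_eq] at h1 h2
  have key : ∀ z ∈ rhombus, 0 < z.im → invFunOn (reflectExt flatten) hypShape.kite z = unflatten z ∧
      unflatten z ∈ hypShape.kite ∩ {y | 0 < y.im} := by
    intro z hz hi; have hm := invFunOn_mem (hb.surjOn hz); have hv := invFunOn_eq (hb.surjOn hz)
    set y := invFunOn (reflectExt flatten) hypShape.kite z; obtain ⟨t1, t2⟩ := mem_tri_of_kite hm
    rw [reflectExt] at hv
    split_ifs at hv with h
    · have e : unflatten z = y := by rw [← hv, unflatten_eq (t1 h)]
      refine ⟨e.symm, e ▸ hm, ?_⟩; rw [mem_ofPred_eq, e]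
      refine lt_of_le_of_ne h fun h0 => hi.ne' ?_; rw [← hv]; exact (him y (t1 h)).2 h0.symm
    · have := im_flatten_nonneg (t2 (not_le.1 h).le); rw [← hv, conj_im] at hi; linarith
  refine ⟨(h2.differentiableAt (h1.mem_nhds hz)).congr_of_eventuallyEq ?_, (key z hz hi).2⟩
  filter_upwards [h1.mem_nhds hz, continuous_im.continuousAt.eventually (lt_mem_nhds hi)] with y hy hyi
  exact (key y hy hyi).1.symm

lemma chart_of_chart' {e : OpenPartialHomeomorph X ℂ}
    (he : surfaceHomeo.toOpenPartialHomeomorph.trans e ∈ holomorphicCharts hypParams) : e ∈ holomorphicCharts flatParams := by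
  have hr : IsOpen rhombus := isOpen_interior
  have upper : ∀ l, ∀ z ∈ rhombus, 0 < z.im → XA l z ∈ e.source → DifferentiableAt ℂ (fun z => e (XA l z)) z := by
    intro l z hz hi hs; obtain ⟨hd, hm, hm'⟩ := unflatten_upper hz hi
    have hO : IsOpen (hypShape.kite ∩ {y | 0 < y.im}) := (isOpen_kite _).inter (isOpen_lt continuous_const continuous_im)
    have hOt : hypShape.kite ∩ {y | 0 < y.im} ⊆ tri := fun y hy => (mem_tri_of_kite hy.1).1 hy.2.le
    set n := frameIndex l
    have hI : IsOpen (act (frameWord n) '' (hypShape.kite ∩ {y | 0 < y.im})) :=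
      (injOn_holomorphic hO ((isMob_act _).differentiableOn.mono (hOt.trans tri_subset))
        ((isMob_act _).injOn.mono (hOt.trans tri_subset))).1
    have hsub := interior_maximal ((image_mono hOt).trans (tile_subset_doublePolygon n)) hI
    have key : ∀ z ∈ rhombus, 0 < z.im → act (frameWord n) (unflatten z) ∈ interior (doublePolygon (n / 12 : ℕ)) ∧
        surfaceHomeo (cl (n / 12 : ℕ) (act (frameWord n) (unflatten z))) = XA l z := by
      intro z hz hi; have hm := (unflatten_upper hz hi).2; have h1 := hsub (mem_image_of_mem _ hm)
      refine ⟨h1, ?_⟩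
      rw [surfaceHomeo_cl (interior_subset h1), dev_act _ (hOt hm), face, flatten_unflatten ((rhombus_subset hz).1 hi.le), lab_frameIndex]
    have hc : IsOpen (interior (doublePolygon (n / 12 : ℕ)) ∩ dev ⁻¹' e.source) := by
      refine ContinuousOn.isOpen_inter_preimage (fun y hy => ?_) isOpen_interior e.open_source
      obtain ⟨w, x, hx, rfl⟩ := exists_tile_of_mem_doublePolygon (interior_subset hy)
      exact (continuousAt_dev w hx).continuousWithinAt
    have hd2 : DifferentiableOn ℂ (fun y => e (surfaceHomeo (cl (n / 12 : ℕ) y))) (interior (doublePolygon (n / 12 : ℕ)) ∩ dev ⁻¹' e.source) := by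
      refine (he _ (cl_mem_hypParams (n / 12))).mono fun y hy => ⟨hy.1, mem_univ _, ?_⟩
      change surfaceHomeo (cl _ y) ∈ e.source; rw [surfaceHomeo_cl (interior_subset hy.1)]
      exact hy.2
    obtain ⟨h1, h2⟩ := key z hz hi
    have h3 : dev (act (frameWord n) (unflatten z)) ∈ e.source := by rwa [← surfaceHomeo_cl (interior_subset h1), h2]
    have hD := tri_subset (hOt ⟨hm, hm'⟩)
    have h4 := DifferentiableAt.comp (g := act (frameWord n)) z (differentiableAt_act _ hD) hd
    refine (DifferentiableAt.comp (g := fun y => e (surfaceHomeo (cl (n / 12 : ℕ) y))) z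
      (hd2.differentiableAt (hc.mem_nhds ⟨h1, h3⟩)) h4).congr_of_eventuallyEq ?_
    filter_upwards [hr.mem_nhds hz, continuous_im.continuousAt.eventually (lt_mem_nhds hi)] with y hy hyi
    exact congrArg e (key y hy hyi).2.symm
  rintro P hP
  obtain ⟨h1, l, hl⟩ := exists_of_mem_flatParams hP
  have ho : IsOpen (rhombus ∩ flatMap l ⁻¹' e.source) := (continuousOn_flatMap l).isOpen_inter_preimage hr e.open_source
  have hset : P.1 ∩ P.2 ⁻¹' e.source = rhombus ∩ flatMap l ⁻¹' e.source := by
    rw [h1]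
    exact Set.ext fun z => and_congr_right fun hz => by rw [mem_preimage, mem_preimage, hl hz]
  rw [hset]
  refine DifferentiableOn.congr (f := fun z => e (flatMap l z)) ?_ fun z hz => congrArg e (hl hz.1)
  refine differentiableOn_of_off_real ho
    (e.continuousOn.comp ((continuousOn_flatMap l).mono inter_subset_left) fun z hz => hz.2) fun z ⟨hz, hs⟩ hi => ?_
  rw [mem_preimage] at hs
  rcases lt_or_gt_of_ne hi with hi | hi
  · have h2 : flatMap l z = XA (flip l) (1 - z) := if_neg (not_le.2 hi)
    have hz' : 1 - z ∈ rhombus := by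
      rw [← flat_kite, mem_flat_kite_iff] at hz ⊢; obtain ⟨a, b⟩ := coords_one_sub z; rw [a, b]
      refine ⟨?_, ?_, ?_, ?_⟩ <;> linarith
    have h3 := upper (flip l) (1 - z) hz' (by simpa using hi) (h2 ▸ hs)
    refine (DifferentiableAt.comp (g := fun z => e (XA (flip l) z)) z h3 (by fun_prop)).congr_of_eventuallyEq ?_
    filter_upwards [continuous_im.continuousAt.eventually (gt_mem_nhds hi)] with y hy
    exact congrArg e (if_neg (not_le.2 hy))
  · have h2 : flatMap l z = XA l z := if_pos hi.le
    refine (upper l z hz hi (h2 ▸ hs)).congr_of_eventuallyEq ?_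
    filter_upwards [continuous_im.continuousAt.eventually (lt_mem_nhds hi)] with y hy
    exact congrArg e (if_pos hy.le)

lemma isConformal_surfaceHomeo : IsConformal hypParams flatParams surfaceHomeo := fun _ => ⟨chart_of_chart, chart_of_chart'⟩

/-! ### Angles -/

lemma hypAngle_base : hypAngle 0 (v 0) (v 1) = Real.pi / 4 := by
  have hr : (rad : ℂ) ≠ 0 := ofReal_ne_zero.2 rad_pos.ne'
  have e : v 1 / v 0 = zeta := by rw [v_one, v_zero, gen, mul_div_assoc, div_self hr, mul_one]
  have hp := Real.pi_pos
  rw [hypAngle, map_zero]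
  simp only [zero_mul, sub_zero, div_one]
  rw [e, zeta, exp_mul_I]
  have h := arg_cos_add_sin_mul_I (θ := Real.pi / 4) ⟨by linarith, by linarith⟩
  push_cast at h
  exact h

lemma hypAngle_of_isTile {a b c : ℂ} (h : IsTile a b c) : hypAngle a b c = Real.pi / 4 ∧ hypAngle b c a = Real.pi / 4 ∧
    hypAngle c a b = Real.pi / 4 := by
  obtain ⟨w, rfl, rfl, rfl⟩ := isTile_iff.1 h
  have h0 := zero_mem_Disk
  have h1 := v_mem 0
  have h2 := v_mem 1
  have hm := isMob_act w
  have ht : IsMob tspin := isMob_act _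
  obtain ⟨t0, t1, t2⟩ := tspin_base
  have e1 : hypAngle (v 0) (v 1) 0 = Real.pi / 4 := by
    rw [← ht.hypAngle_eq h1 h2 h0, t0, t1, t2, hypAngle_base]
  rw [hm.hypAngle_eq h0 h1 h2, hm.hypAngle_eq h1 h2 h0, hm.hypAngle_eq h2 h0 h1]
  refine ⟨hypAngle_base, e1, ?_⟩
  rw [← ht.hypAngle_eq h2 h0 h1, t0, t1, t2, e1]

/-! ### Petrie polygons -/

lemma exists_co {c : Fin 3 → ℝ} (hc : ∀ i, 0 ≤ c i) (h1 : 0 < c 1) : ∃ z ∈ Disk, ∃ r : ℝ, 0 < r ∧ ∀ i, co z i = r * c i := by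
  have hs := sqrt_two_mul_self
  have hs1 := one_lt_sqrt_two
  have hrad := rad_sq
  have hp := rad_pos
  have hB : 0 < bil (1 + √2) c c := by have := hc 0; have := hc 2; unfold bil; positivity
  set r := (√(bil (1 + √2) c c))⁻¹
  have hr : 0 < r := inv_pos.2 (Real.sqrt_pos.2 hB)
  have hr2 : r ^ 2 * bil (1 + √2) c c = 1 := by rw [inv_pow, Real.sq_sqrt hB.le, inv_mul_cancel₀ hB.ne']
  set T := r * c 0 + (1 + √2) * (r * c 1 + r * c 2) with hT
  have hT0 : 0 < T + 1 := by have := hc 0; have := hc 2; positivity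
  let z : ℂ := ⟨(r * c 2 + √2 * (r * c 1)) / (rad * (T + 1)), r * c 2 / (rad * (T + 1))⟩
  have hN : normSq z = (T - 1) / (T + 1) := by
    have h2 : (√2 - 1) * (T ^ 2 - 1) = 2 * ((r * c 1) ^ 2 + (r * c 2) ^ 2 + √2 * (r * c 1) * (r * c 2)) := by
      rw [bil] at hr2; rw [hT]
      linear_combination (√2 - 1) * hr2 + ((√2 + 1) * ((r * c 1) ^ 2 + (r * c 2) ^ 2) + 2 * √2 * (r * c 1) * (r * c 2)) * hs
    rw [normSq_apply]
    change (r * c 2 + √2 * (r * c 1)) / (rad * (T + 1)) * ((r * c 2 + √2 * (r * c 1)) / (rad * (T + 1))) +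
      r * c 2 / (rad * (T + 1)) * (r * c 2 / (rad * (T + 1))) = _
    rw [div_mul_div_comm, div_mul_div_comm, ← add_div, div_eq_div_iff (by positivity) hT0.ne']
    linear_combination (r * c 1) ^ 2 * (T + 1) * hs - (T + 1) * h2 - (T - 1) * (T + 1) ^ 2 * hrad
  have h1N : 1 - normSq z = 2 / (T + 1) := by rw [hN]; field_simp; ring
  have hz : z ∈ Disk := by
    have : 0 < 1 - normSq z := h1N ▸ by positivity
    exact sub_pos.1 this
  have c1 : co z 1 = r * c 1 := by
    change √2 * rad * ((r * c 2 + √2 * (r * c 1)) / (rad * (T + 1)) - r * c 2 / (rad * (T + 1))) / (1 - normSq z) = _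
    rw [h1N]; field_simp; linear_combination c 1 * hs
  have c2 : co z 2 = r * c 2 := by
    change 2 * rad * (r * c 2 / (rad * (T + 1))) / (1 - normSq z) = _; rw [h1N]; field_simp
  have c0 : co z 0 = r * c 0 := by
    have h3 := co_time z
    have h4 : (1 + normSq z) / (1 - normSq z) = T := by rw [h1N, hN]; field_simp; ring
    rw [h4, c1, c2] at h3; linarith
  refine ⟨z, hz, r, hr, fun i => ?_⟩
  fin_cases i
  exacts [c0, c1, c2]

lemma pseudoDist_comm (a b : ℂ) : pseudoDist a b = pseudoDist b a := by
  rw [pseudoDist, pseudoDist, norm_div, norm_div, norm_sub_rev, ← norm_conj (1 - conj a * b)]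
  congr 2
  simp [mul_comm]

lemma IsHypMidpoint.act (w : Word) {m a b : ℂ} (ha : a ∈ Disk) (hb : b ∈ Disk) (h : IsHypMidpoint m a b) :
    IsHypMidpoint (act w m) (act w a) (act w b) := by
  have hm := hypHull_subset h.1
  refine ⟨act_image_hypSegment w ha hb ▸ mem_image_of_mem _ h.1, ?_⟩
  rw [(isMob_act w).pseudoDist_eq ha hm, (isMob_act w).pseudoDist_eq hm hb, h.2]

lemma exists_midpoint : ∃ m ∈ Disk, IsHypMidpoint m 0 (v 0) ∧ ∃ r : ℝ, 0 < r ∧ co m 0 = r ∧ co m 1 = r ∧ co m 2 = 0 := by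
  obtain ⟨m, hm, r, hr, h⟩ := exists_co (c := ![1, 1, 0]) (by intro i; fin_cases i <;> simp) (by simp)
  have h0 : co m 0 = r := by simp [h]
  have h1 : co m 1 = r := by simp [h]
  have h2 : co m 2 = 0 := by simp [h]
  refine ⟨m, hm, ⟨(mem_hypSegment zero_mem_Disk (v_mem 0) hm).2 ⟨r, r, hr.le, hr.le, fun i => ?_⟩, ?_⟩, r, hr, h0, h1, h2⟩
  · rw [h, co_zero, co_v_zero]
    fin_cases i <;> simp
  · obtain ⟨e0, e1, e2⟩ := co_rows (w := [false]) hm ![0, 1, ⟨0, 1⟩] ![1, 0, ⟨0, 1⟩] ![0, 0, -1] (by decide +kernel)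
    simp [row_vec, h0, h1, h2] at e0 e1 e2
    have hS : act [false] m = m := co_injOn (act_mem _ hm) hm <| by
      ext i
      fin_cases i
      exacts [e0.trans h0.symm, e1.trans h1.symm, e2.trans h2.symm]
    have e : act [false] 0 = v 0 := act_baseWord 1
    rw [← (isMob_act [false]).pseudoDist_eq zero_mem_Disk hm, hS, e, pseudoDist_comm]

/-- The translation by two steps along a Petrie polygon and its inverse. -/
def stepWord : Word := rr 2 ++ [false] ++ rr 7 ++ [false] ++ rr 7
def stepInv : Word := rr 1 ++ [false] ++ rr 1 ++ [false] ++ rr 6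

def step : Equiv.Perm Disk where
  toFun z := ⟨act stepWord z, act_mem _ z.2⟩
  invFun z := ⟨act stepInv z, act_mem _ z.2⟩
  left_inv z := Subtype.ext <| by
    have h : mat (stepInv ++ stepWord) = mat [] := by decide +kernel
    exact (act_append _ _ _).symm.trans (act_eq_of_mat_eq h z.2)
  right_inv z := Subtype.ext <| by
    have h : mat (stepWord ++ stepInv) = mat [] := by decide +kernel
    exact (act_append _ _ _).symm.trans (act_eq_of_mat_eq h z.2)

lemma exists_step_word (n : ℤ) : ∃ w, ∀ z : Disk, ((step ^ n) z : ℂ) = act w z := by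
  induction n using Int.induction_on with
  | zero => exact ⟨[], fun z => rfl⟩
  | succ n ih =>
    obtain ⟨w, hw⟩ := ih
    exact ⟨w ++ stepWord, fun z => by rw [zpow_add_one, Equiv.Perm.mul_apply, hw, act_append]; rfl⟩
  | pred n ih =>
    obtain ⟨w, hw⟩ := ih
    exact ⟨w ++ stepInv, fun z => by rw [zpow_sub_one, Equiv.Perm.mul_apply, hw, act_append]; rfl⟩

def strip (j : ℕ) (k : ℤ) : ℂ := zeta ^ j * ((step ^ (k / 2)) ⟨v (k % 2).toNat, v_mem _⟩ : ℂ)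

lemma act_stepWord_v : act stepWord (v 0) = 0 ∧ act stepWord (v 1) = v 2 := by
  have h2 : act (rr 2 ++ [false]) 0 = v 2 := by
    rw [act_append, act_rr, show act [false] 0 = v 0 from act_baseWord 1, v, v, pow_zero, mul_one, mul_comm]
  rw [← h2, show v 0 = act [false] 0 from (act_baseWord 1).symm, show v 1 = act [true, false] 0 from (act_baseWord 2).symm,
    ← act_append, ← act_append]
  exact ⟨act_zero_eq (w' := []) (by decide +kernel), act_zero_eq (by decide +kernel)⟩

lemma strip_eq (j : ℕ) (k : ℤ) : strip j (2 * k) = zeta ^ j * ((step ^ k) ⟨v 0, v_mem _⟩ : ℂ) ∧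
    strip j (2 * k + 1) = zeta ^ j * ((step ^ k) ⟨v 1, v_mem _⟩ : ℂ) ∧
    strip j (2 * k + 2) = zeta ^ j * ((step ^ k) ⟨0, zero_mem_Disk⟩ : ℂ) ∧
    strip j (2 * k + 3) = zeta ^ j * ((step ^ k) ⟨v 2, v_mem _⟩ : ℂ) := by
  have h0 : step ⟨v 0, v_mem _⟩ = ⟨0, zero_mem_Disk⟩ := Subtype.ext act_stepWord_v.1
  have h1 : step ⟨v 1, v_mem _⟩ = ⟨v 2, v_mem _⟩ := Subtype.ext act_stepWord_v.2
  have even : ∀ k, strip j (2 * k) = zeta ^ j * ((step ^ k) ⟨v 0, v_mem _⟩ : ℂ) := fun k => by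
    rw [strip, show 2 * k / 2 = k by omega]; simp only [show 2 * k % 2 = 0 by omega, Int.toNat_zero]
  have odd : ∀ k, strip j (2 * k + 1) = zeta ^ j * ((step ^ k) ⟨v 1, v_mem _⟩ : ℂ) := fun k => by
    rw [strip, show (2 * k + 1) / 2 = k by omega]
    simp only [show (2 * k + 1) % 2 = 1 by omega, Int.toNat_one]
  refine ⟨even k, odd k, ?_, ?_⟩
  · rw [show 2 * k + 2 = 2 * (k + 1) by ring, even, zpow_add_one, Equiv.Perm.mul_apply, h0]
  · rw [show 2 * k + 3 = 2 * (k + 1) + 1 by ring, odd, zpow_add_one, Equiv.Perm.mul_apply, h1]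

lemma tspin_tspin_base : tspin (tspin 0) = v 0 ∧ tspin (tspin (v 0)) = v 1 ∧ tspin (tspin (v 1)) = 0 := by
  obtain ⟨t0, t1, t2⟩ := tspin_base
  simp [t0, t1, t2]

lemma isPetrieStrip_strip (j : ℕ) : IsPetrieStrip (strip j) := by
  intro k
  obtain ⟨e0, e1, e2, e3⟩ := strip_eq j k
  obtain ⟨w, hw⟩ := exists_step_word k
  obtain ⟨t0, t1, t2⟩ := tspin_tspin_base
  have ht : ∀ z, act [true, false, true, false] z = tspin (tspin z) := fun z => act_append [true, false] [true, false] z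
  rw [e0, e1, e2, e3, hw, hw, hw, hw, ← act_rr, ← act_rr, ← act_rr, ← act_rr]
  constructor
  · refine isTile_iff.2 ⟨rr j ++ (w ++ [true, false, true, false]), ?_⟩
    simp only [act_append (rr j), act_append w, ht, t0, t1, t2, and_self]
  · refine isTile_iff.2 ⟨rr j ++ (w ++ rr 1), ?_⟩
    have hv : zeta ^ 1 * v 0 = v 1 ∧ zeta ^ 1 * v 1 = v 2 := by constructor <;> simp only [v] <;> ring
    simp only [act_append (rr j), act_append w, act_rr, hv.1, hv.2, mul_zero, and_self]

lemma sidePairing_strip (j : ℕ) (k : ℤ) : sidePairing j (strip j k) = strip j (k + 6) := by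
  have h3 : ∀ z : Disk, ((step ^ (3 : ℤ)) z : ℂ) = act tauZero z := fun z => by
    rw [show tauZero = (stepWord ++ stepWord) ++ stepWord from rfl, act_append, act_append]
    rfl
  rw [sidePairing_eq, act_tauWord, strip, zeta_cancel', strip, show (k + 6) / 2 = 3 + k / 2 by omega, zpow_add, Equiv.Perm.mul_apply, h3]
  simp only [show (k + 6) % 2 = k % 2 by omega]

lemma exists_crossing (j : ℕ) : ∃ z ∈ sideA j, ∃ m m' : ℂ, IsHypMidpoint m (strip j (-2)) (strip j (-1)) ∧
    IsHypMidpoint m' (strip j (-1)) (strip j 0) ∧ z ∈ hypSegment m m' := by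
  obtain ⟨e0, e1, e2, -⟩ := strip_eq j (-1)
  obtain ⟨m, hm, hmid, μ, hμ, c0, c1, c2⟩ := exists_midpoint
  obtain ⟨z, hz, r, hr, hc⟩ := exists_co (c := ![1, 1, 2]) (by intro i; fin_cases i <;> simp) (by simp)
  have hinv : ∀ z : Disk, ((step ^ (-1 : ℤ)) z : ℂ) = act stepInv z := fun z => rfl
  have hT : ∀ z, zeta ^ j * act stepInv z = act (rr j ++ stepInv) z := fun z => by rw [act_append, act_rr]
  rw [hinv, hT] at e0 e1 e2
  obtain ⟨t0, t1, t2⟩ := tspin_base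
  obtain ⟨s0, s1, -⟩ := tspin_tspin_base
  have hD := act_mem [true, false] hm
  have hD2 := act_mem [true, false] hD
  have m2 := IsHypMidpoint.act [true, false] zero_mem_Disk (v_mem 0) hmid
  have m1 := IsHypMidpoint.act [true, false] (act_mem _ zero_mem_Disk) (act_mem _ (v_mem 0)) m2
  have n2 := m2.act (rr j ++ stepInv) (act_mem _ zero_mem_Disk) (act_mem _ (v_mem 0))
  have n1 := m1.act (rr j ++ stepInv) (act_mem _ (act_mem _ zero_mem_Disk)) (act_mem _ (act_mem _ (v_mem 0)))
  change IsHypMidpoint _ (act _ (tspin (tspin 0))) (act _ (tspin (tspin (v 0)))) at n1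
  change IsHypMidpoint _ (act _ (tspin 0)) (act _ (tspin (v 0))) at n2
  rw [s0, s1] at n1
  rw [t0, t1] at n2
  rw [show (2 : ℤ) * -1 = -2 by norm_num] at e0
  rw [show (2 : ℤ) * -1 + 1 = -1 by norm_num] at e1
  rw [show (2 : ℤ) * -1 + 2 = 0 by norm_num] at e2
  refine ⟨act (rr j ++ stepInv) z, ?_, _, _, by rw [e0, e1]; exact n1, by rw [e1, e2]; exact n2, ?_⟩
  · rw [← add_zero j, (sides_rotate j 0).1, add_zero, ← hT]
    refine mem_image_of_mem _ ((mem_hypSegment (u_mem_Disk 0) (w_mem_Disk 0) (act_mem _ hz)).2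
      ⟨r * √2 / 2, r * (2 + √2 / 2), by positivity, by positivity, ?_⟩)
    obtain ⟨a0, a1, a2⟩ := co_rows (w := stepInv) hz ![0, ⟨0, -1⟩, -1] ![1, ⟨2, 1⟩, ⟨0, 1⟩] ![0, 1, ⟨0, 1⟩] (by decide +kernel)
    simp only [row_vec, hc] at a0 a1 a2; simp [toR_apply] at a0 a1 a2
    obtain ⟨b1, b2, -⟩ := co_corners; have hs := sqrt_two_mul_self; intro i; rw [b1, b2]
    fin_cases i <;> simp [a0, a1, a2]
    · ring
    · linear_combination (-3 * r / 2) * hs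
    · linear_combination (-r / 2) * hs
  · rw [← act_image_hypSegment _ hD2 hD]
    refine mem_image_of_mem _ ((mem_hypSegment hD2 hD hz).2 ⟨r / μ, r / μ, by positivity, by positivity, ?_⟩)
    obtain ⟨a0, a1, a2⟩ := co_tspin hm; obtain ⟨b0, b1, b2⟩ := co_tspin hD; have h0 := hμ.ne'
    intro i; change co z i = r / μ * co (tspin (tspin m)) i + r / μ * co (tspin m) i
    have B0 : co (tspin (tspin m)) 0 = co m 2 := b0.trans a1
    have B1 : co (tspin (tspin m)) 1 = co m 0 := b1.trans a2
    have B2 : co (tspin (tspin m)) 2 = co m 1 := b2.trans a0; rw [hc]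
    fin_cases i
    · change r * 1 = r / μ * co (tspin (tspin m)) 0 + r / μ * co (tspin m) 0
      rw [B0, a0, c1, c2]; field_simp; ring
    · change r * 1 = r / μ * co (tspin (tspin m)) 1 + r / μ * co (tspin m) 1
      rw [B1, a1, c0, c2]; field_simp; ring
    · change r * 2 = r / μ * co (tspin (tspin m)) 2 + r / μ * co (tspin m) 2
      rw [B2, a2, c0, c1]; field_simp; ring

lemma petrie_sidePairing (j : ℕ) : sidePairing j '' sideA j = sideB (j + 2) ∧ ∃ p : ℤ → ℂ, IsPetrieStrip p ∧
    (∀ k : ℤ, sidePairing j (p k) = p (k + 6)) ∧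
    ∃ z ∈ sideA j ∩ petriePolygon p, sidePairing j z ∈ sideB (j + 2) ∩ petriePolygon p := by
  obtain ⟨z, hz, m, m', h1, h2, h3⟩ := exists_crossing j
  have hD : ∀ k, strip j k ∈ Disk := fun k => zeta_mul_mem j (Subtype.coe_prop _)
  refine ⟨sidePairing_image j, strip j, isPetrieStrip_strip j, sidePairing_strip j, z, ⟨hz, -2, m, m', h1, h2, h3⟩,
    sidePairing_image j ▸ mem_image_of_mem _ hz, 4, act (tauWord j) m, act (tauWord j) m', ?_, ?_, ?_⟩
  · have := h1.act (tauWord j) (hD _) (hD _)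
    rwa [← sidePairing_eq, ← sidePairing_eq j (strip j _), ← sidePairing_eq j (strip j _), sidePairing_strip, sidePairing_strip, sidePairing_eq] at this
  · have := h2.act (tauWord j) (hD _) (hD _)
    rwa [← sidePairing_eq, ← sidePairing_eq j (strip j _), ← sidePairing_eq j (strip j _), sidePairing_strip, sidePairing_strip, sidePairing_eq] at this
  · rw [sidePairing_eq, ← act_image_hypSegment _ (hypHull_subset h1.1) (hypHull_subset h2.1)]
    exact mem_image_of_mem _ h3

end OctaSurface
end

theorem mainTheorem8 :
    -- the triangles of the tessellation have angles `π / 4`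
    (∀ a b c : ℂ, OctaSurface.IsTile a b c → OctaSurface.hypAngle a b c = Real.pi / 4 ∧
      OctaSurface.hypAngle b c a = Real.pi / 4 ∧ OctaSurface.hypAngle c a b = Real.pi / 4) ∧
    -- the `16`-gon is bounded by its sixteen sides, which are paired by translations by six steps
    -- along Petrie polygons that meet the paired sides in corresponding points
    (frontier OctaSurface.polygon = ⋃ j : ℕ, (OctaSurface.sideA j ∪ OctaSurface.sideB j)) ∧
    (∀ j : ℕ, OctaSurface.sidePairing j '' OctaSurface.sideA j = OctaSurface.sideB (j + 2) ∧
      ∃ p : ℤ → ℂ, OctaSurface.IsPetrieStrip p ∧ (∀ k : ℤ, OctaSurface.sidePairing j (p k) = p (k + 6)) ∧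
        ∃ z ∈ OctaSurface.sideA j ∩ OctaSurface.petriePolygon p, OctaSurface.sidePairing j z ∈
            OctaSurface.sideB (j + 2) ∩ OctaSurface.petriePolygon p) ∧
    -- the surface obtained from the `16`-gon is tiled by `32` triangles
    OctaSurface.facesY.ncard = 32 ∧
    -- it is combinatorially and conformally the same as `X`
    ∃ Φ : OctaSurface.Y ≃ₜ OctaSurface.X, Φ '' OctaSurface.verticesY = OctaSurface.verticesX ∧
      (Set.image Φ) '' OctaSurface.edgesY = OctaSurface.edgesX ∧
      (Set.image Φ) '' OctaSurface.facesY = OctaSurface.facesX ∧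
      OctaSurface.IsConformal OctaSurface.hypParams OctaSurface.flatParams Φ ∧
      -- and the triangles correspond to those of the fundamental piece
      (∀ F ∈ OctaSurface.facesY, ∃! T : Set OctaSurface.E3,
        T ∈ OctaSurface.solidTriangle '' OctaSurface.pieceFaces ∧ Φ '' F = OctaSurface.imageX T) ∧
      (∀ T ∈ OctaSurface.solidTriangle '' OctaSurface.pieceFaces,
        ∃! F : Set OctaSurface.Y, F ∈ OctaSurface.facesY ∧ Φ '' F = OctaSurface.imageX T) := by
  refine ⟨fun a b c h => OctaSurface.hypAngle_of_isTile h, OctaSurface.frontier_polygon, OctaSurface.petrie_sidePairing,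
    OctaSurface.ncard_facesY, OctaSurface.surfaceHomeo, OctaSurface.surfaceHomeo_vertices, OctaSurface.surfaceHomeo_edges,
    OctaSurface.surfaceHomeo_faces, OctaSurface.isConformal_surfaceHomeo, fun F hF => ?_, fun T hT => ?_⟩
  · exact OctaSurface.existsUnique_pieceTriangle (OctaSurface.surfaceHomeo_faces ▸ Set.mem_image_of_mem _ hF)
  · have h := OctaSurface.imageX_pieceTriangle_mem hT; rw [← OctaSurface.surfaceHomeo_faces] at h
    obtain ⟨F, hF, e⟩ := h
    exact ⟨F, ⟨hF, e⟩, fun G hG => Set.image_injective.2 OctaSurface.surfaceHomeo.injective (hG.2.trans e.symm)⟩
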